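/- **Notation.** $|E|$ is Lebesgue measure, $0<\delta<1$ is a scale. $X\lesssim Y$ means $X\le cY$ for a constant $c>0$. $X\lessapprox Y$ means that for every $\epsilon>0$ there is $C_\epsilon>0$ with $X\le C_\epsilon\delta^{-\epsilon}Y$; $X\approx Y$ means $X\lessapprox Y\lessapprox X$. The constants $C_\epsilon$ in the hypotheses are fixed in advance and do not depend on $\delta$ or on the sets; the constants in the conclusions depend only on $\sigma$ and on the family $(C_\epsilon)_{\epsilon>0}$. A $(\delta,\sigma)$-set is a union $A\subset\mathbb R$ of $\delta$-intervals (open balls of radius $\delta$) such that $|A\cap B(a,r)|\lessapprox \delta\,(r/\delta)^\sigma$ for all $a\in\mathbb R$ and $\delta<r<1$. For a line $l\subset\mathbb R^2$, $T(l,r)$ (a tube of radius $r$) is the $r$-neighbourhood of $l$. A pencil of $\delta$-tubes with tip $p\in\mathbb R^2$ is a union $P$ of tubes $T(l,\delta)$ over a set of lines $l$ through $p$. Identify $S^1$ with $[0,1)$; $P$ is a $(\delta,\sigma)$-pencil if its set of directions at resolution $\delta$, i.e. the union of the $\delta$-arcs around the directions of its central lines, is a $(\delta,\sigma)$-set. For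 $p\ne q$ let $l_{p,q}$ be the line through $p$ and $q$. **Theorem.** The following three statements are equivalent. (i) (Discretized sum-product.) For every $0<\sigma<1$ there exists $\epsilon_0=\epsilon_0(\sigma)>0$ such that for every $(\delta,\sigma)$-set $A\subset[0,1]$ with $|A|\approx\delta^{1-\sigma}$, $$\max\{|A+A|,\,|AA|\}\gtrsim\delta^{-\epsilon_0}|A|.$$ (ii) (Four pencils.) For every $0<\sigma<1$ there exists $\epsilon_0=\epsilon_0(\sigma)>0$ such that the following holds. Let $P_1,\dots,P_4$ be $(\delta,\sigma)$-pencils with tips $p_1,\dots,p_4\in\mathbb R^2$ such that $\operatorname{dist}(p_i,p_j)\approx\operatorname{dist}(p_i,[0,1]^2)\approx\operatorname{dist}(l_{p_i,p_j},[0,1]^2)\approx1$ for all $i\neq j$, and such that $p_1,\dots,p_4$ are not contained in a tube of radius $\approx1$ (that is, $r\gtrapprox1$ for every tube of radius $r$ containing the four tips). Then $$\Bigl|\bigcap_{i=1}^4P_i\cap[0,1]^2\Bigr|\lesssim\delta^{2-2\sigma+\epsilon_0}.$$ (iii) For every $0<\sigma<1$ there exists $\epsilon_0=\epsilon_0(\sigma)>0$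 such that for every $(\delta,\sigma)$-set $A\subset[1/4,1/2]$ with $|A|\approx\delta^{1-\sigma}$, $$\max\{|AA|,\,|(1-A)(1-A)|\}\gtrsim\delta^{-\epsilon_0}|A|.$$ -/

import Mathlib

open MeasureTheory Set
open scoped Pointwise

/-- The relation `X ⪅ Y` at scale `δ`, with the implicit constants `C ε` made explicit:
`X ≤ C ε * δ ^ (-ε) * Y` for every `ε > 0`.  A family of objects satisfies `X ⪅ Y` when this holds
with one function `C` for the whole family. -/
def ApproxLE (C : ℝ → ℝ) (δ X Y : ℝ) : Prop :=
  ∀ ε : ℝ, 0 < ε → X ≤ C ε * δ ^ (-ε) * Y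

/-- The relation `X ≈ Y`, that is `X ⪅ Y ⪅ X`. -/
def ApproxEq (C : ℝ → ℝ) (δ X Y : ℝ) : Prop :=
  ApproxLE C δ X Y ∧ ApproxLE C δ Y X

/-- `A` is `δ`-discretized: a union of (open) `δ`-balls of the line. -/
def IsDiscretized (δ : ℝ) (A : Set ℝ) : Prop :=
  ∃ S : Set ℝ, A = ⋃ x ∈ S, Metric.ball x δ

/-- `(δ, σ)`-sets on the line: `δ`-discretized sets with
`|A ∩ B(a, r)| ⪅ δ (r / δ) ^ σ` for all `a` and all `δ < r < 1`. -/
def IsDeltaSet (C : ℝ → ℝ) (δ σ : ℝ) (A : Set ℝ) : Prop :=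
  IsDiscretized δ A ∧
    ∀ a r : ℝ, δ < r → r < 1 →
      ApproxLE C δ (volume.real (A ∩ Metric.ball a r)) (δ * (r / δ) ^ σ)

/-- The Euclidean plane. -/
abbrev Plane : Type := EuclideanSpace ℝ (Fin 2)

/-- The unit square `[0,1]²`. -/
def unitSquare : Set Plane := {x | ∀ i, x i ∈ Icc (0 : ℝ) 1}

/-- The identification of `[0, 1)` with the unit circle. -/
noncomputable def direction (θ : ℝ) : Plane :=
  !₂[Real.cos (2 * Real.pi * θ), Real.sin (2 * Real.pi * θ)]

/-- The line through `p` with direction vector `v` (a line when `v ≠ 0`). -/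
def lineAt (p v : Plane) : Set Plane := {x | ∃ t : ℝ, x = p + t • v}

/-- The tube `T(l, r)`: the `r`-neighbourhood of `l`. -/
def tube (l : Set Plane) (r : ℝ) : Set Plane := Metric.thickening r l

/-- The distance between two sets in the plane. -/
noncomputable def setDist (S T : Set Plane) : ℝ := ⨅ z : S × T, dist (z.1 : Plane) (z.2 : Plane)

/-- The pencil of `δ`-tubes with tip `p` whose central lines are the lines through `p` with
directions in `Θ`. -/
def pencil (δ : ℝ) (p : Plane) (Θ : Set ℝ) : Set Plane :=
  ⋃ θ ∈ Θ, tube (lineAt p (direction θ)) δ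

/-- `P` is a `(δ, σ)`-pencil with tip `p`: it is a pencil of `δ`-tubes whose direction set is a
`(δ, σ)`-set.  A `δ`-tube through `p` stands for the `δ`-arc around the direction of its central
line, so the direction set is the union of these arcs.  (The radial projection of the whole tube
would be the full circle, since the tube contains a neighbourhood of the tip.) -/
def IsDeltaPencil (C : ℝ → ℝ) (δ σ : ℝ) (p : Plane) (P : Set Plane) : Prop :=
  ∃ Θ : Set ℝ, Θ ⊆ Ico 0 1 ∧ P = pencil δ p Θ ∧
    IsDeltaSet C δ σ (⋃ θ ∈ Θ, Metric.ball θ δ)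

/-- The position of the four tips:
`dist(pᵢ, pⱼ) ≈ dist(pᵢ, [0,1]²) ≈ dist(l_{pᵢ, pⱼ}, [0,1]²) ≈ 1` for `i ≠ j`,
and any tube containing all four tips has radius `⪆ 1`. -/
def TipsInGeneralPosition (C : ℝ → ℝ) (δ : ℝ) (p : Fin 4 → Plane) : Prop :=
  (∀ i j : Fin 4, i ≠ j →
    ApproxEq C δ (dist (p i) (p j)) 1 ∧
    ApproxEq C δ (Metric.infDist (p i) unitSquare) 1 ∧
    ApproxEq C δ (setDist (lineAt (p i) (p j - p i)) unitSquare) 1) ∧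
  (∀ (q v : Plane) (r : ℝ), v ≠ 0 → (∀ i, p i ∈ tube (lineAt q v) r) → ApproxLE C δ 1 r)

/-- Bourgain's discretized sum-product theorem.  The gain `ε₀` depends only on `σ`; the constant in
the conclusion depends only on `σ` and on the constants `C` in the hypotheses. -/
def DiscretizedSumProduct : Prop :=
  ∀ σ : ℝ, 0 < σ → σ < 1 → ∃ ε₀ : ℝ, 0 < ε₀ ∧
    ∀ C : ℝ → ℝ, ∃ c : ℝ, 0 < c ∧
      ∀ (δ : ℝ) (A : Set ℝ), 0 < δ → δ < 1 → A ⊆ Icc 0 1 →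
        IsDeltaSet C δ σ A → ApproxEq C δ (volume.real A) (δ ^ (1 - σ)) →
        c * (δ ^ (-ε₀) * volume.real A) ≤ max (volume.real (A + A)) (volume.real (A * A))

/-- The estimate for the intersection of four pencils of tubes. -/
def FourPencilEstimate : Prop :=
  ∀ σ : ℝ, 0 < σ → σ < 1 → ∃ ε₀ : ℝ, 0 < ε₀ ∧
    ∀ C : ℝ → ℝ, ∃ K : ℝ, 0 < K ∧
      ∀ (δ : ℝ) (p : Fin 4 → Plane) (P : Fin 4 → Set Plane), 0 < δ → δ < 1 →
        (∀ i, IsDeltaPencil C δ σ (p i) (P i)) → TipsInGeneralPosition C δ p →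
        volume.real ((⋂ i, P i) ∩ unitSquare) ≤ K * δ ^ (2 - 2 * σ + ε₀)

/-- The sum-product estimate for the pair `AA`, `(1 - A)(1 - A)`. -/
def ProductShiftedProduct : Prop :=
  ∀ σ : ℝ, 0 < σ → σ < 1 → ∃ ε₀ : ℝ, 0 < ε₀ ∧
    ∀ C : ℝ → ℝ, ∃ c : ℝ, 0 < c ∧
      ∀ (δ : ℝ) (A : Set ℝ), 0 < δ → δ < 1 → A ⊆ Icc (1 / 4) (1 / 2) →
        IsDeltaSet C δ σ A → ApproxEq C δ (volume.real A) (δ ^ (1 - σ)) →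
        c * (δ ^ (-ε₀) * volume.real A) ≤
          max (volume.real (A * A)) (volume.real (({1} - A) * ({1} - A)))

/-! Each estimate asserts a gain of a fixed power of `δ`, uniformly over all families of constants.
Call a configuration bad at scale `δ` with constant `K` if it satisfies the hypotheses and violates
the gain, both up to factors `K`. `Gap.of_uniform` and `Gap.uniform` show that the estimate amounts
to `Gap`: for some `η > 0` and all small `δ` nothing is bad with constant `δ ^ (-η)`. By
`Gap.transfer`, an implication between two estimates then only needs a construction that turns a bad
object of one kind, with constant `K`, into a bad object of the other kind, with constant `K ^ c`.
Losses of any fixed power of `K` are harmless. All sets are replaced by finite sets and measured by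
the number `cov` of `δ`-cells that they meet, so that sumset inequalities for finite sets of
integers apply to cell labels.

The direction from sum-product to the other two statements rests on
`FourPencilRich.exists_small_sum_and_product`. Let about `N ^ 2` points `(x, y)` have about `N`
values of each of `x`, `y`, `x / y` and lie on about `N` lines `y = l x + m`. Balog–Szemerédi–Gowers
applied to `log x` and `-log y` gives a dense part on which the abscissae have few products and
quotients. Fix one line that carries about `N` points of this part. For `q₁` in the part and `q₂` on
the line, `l x₁ + m (x₁ / x₂)` is close to `(x₁ / x₂) y₂`, and the latter takes few values because
its logarithm comes from an iterated sumset. This is a dense graph with few sums, so a second use of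
Balog–Szemerédi–Gowers makes many of the `x₁` have few sums while they keep few products.

Four pencils take this form in projective coordinates that send two tips to infinity and a third to
the origin; the fourth tip supplies the lines (`FourPencilBad.exists_fourPencilRich`). If `AA` and
`(1 - A)(1 - A)` are both small, then the points of `A × A` lie in four small pencils: two with tips
at infinity, one at the origin (few `x / y`), one at `(1, 1)` (few `(1 - y) / (1 - x)`).

Conversely, let `S` have few sums and products. A projective map sends `S × S` into the square so
that `y / x`, `y`, `x`, `x + y` become directions from four fixed tips; all four direction sets are
small and not concentrated, and the pencils contain the image of `S × S`
(`gap_sumProductBad_of_gap_fourPencilBad`). For the shifted products, few products give many `a` for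
which `a S` is nearly parallel to `b S` for one fixed `b`; with `α = a / b`, the triangle inequality
of Ruzsa makes `x S - S` small for every `x = (3 - α)(3 - α')`. Since `S` is not concentrated, such
dilates `x` are few (`cov_dilates_le`). Hence `B = {α / 3}` has few products and few shifted
products (`gap_sumProductBad_of_gap_prodShift`). -/

section Graphs

/-! ### Dense bipartite graphs and paths of length three. -/

set_option maxHeartbeats 1000000 in
open Classical in
/-- Two-sided dense-graph lemma behind the Balog–Szemerédi–Gowers theorem: a dense bipartite graph
contains a dense subgraph on `A' × B'` all of whose pairs are joined by many paths of length
three. -/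
theorem exists_dense_subgraph_many_paths {α β : Type*} [DecidableEq α] [DecidableEq β]
    (A : Finset α) (B : Finset β)
    (G : Finset (α × β)) (hG : G ⊆ A ×ˢ B) {K : ℝ} (hK : 1 ≤ K)
    (h : (A.card * B.card : ℝ) ≤ K * G.card) :
    ∃ A' ⊆ A, ∃ B' ⊆ B,
      (A.card * B.card : ℝ) ≤ 24 * K ^ 2 * (G.filter (fun p => p.1 ∈ A' ∧ p.2 ∈ B')).card ∧
      ∀ a ∈ A', ∀ b ∈ B', (A.card * B.card : ℝ) ≤ 2 ^ 14 * K ^ 5 *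
        ((A ×ˢ B).filter (fun p => (a, p.2) ∈ G ∧ (p.1, p.2) ∈ G ∧ (p.1, b) ∈ G)).card := by
  have hK0 : 0 < K := by linarith
  rcases B.eq_empty_or_nonempty with rfl | hB
  · exact ⟨∅, by simp, ∅, by simp, by simp, by simp⟩
  have hBc : (0 : ℝ) < B.card := by exact_mod_cast hB.card_pos
  set g : α → β → Prop := fun a b => (a, b) ∈ G with hg
  set nb : α → Finset β := fun a => B.filter (g a) with hnb
  -- Vertices of degree below `|B| / (2K)` carry at most half of the edges and are dropped.
  set A0 := A.filter (fun a => (B.card : ℝ) ≤ 2 * K * (nb a).card) with hA0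
  have hdouble : ∀ X : Finset α, ∑ a ∈ X, ((nb a).card : ℝ) =
      ∑ b ∈ B, ((X.filter (fun a => g a b)).card : ℝ) := by
    intro X
    have := Finset.sum_card_bipartiteAbove_eq_sum_card_bipartiteBelow (s := X) (t := B) g
    exact_mod_cast this
  have hGsum : (G.card : ℝ) = ∑ a ∈ A, ((nb a).card : ℝ) := by
    have h1 : G.card = ∑ a ∈ A, (G.filter (fun p => p.1 = a)).card :=
      Finset.card_eq_sum_card_fiberwise (fun p hp => (Finset.mem_product.1 (hG hp)).1)
    rw [h1]; push_cast
    refine Finset.sum_congr rfl fun a _ => ?_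
    congr 1
    refine Finset.card_bij' (fun p _ => p.2) (fun b _ => (a, b)) ?_ ?_ ?_ ?_
    · rintro ⟨x, y⟩ hp
      simp only [Finset.mem_filter] at hp
      obtain ⟨hp, rfl⟩ := hp
      exact Finset.mem_filter.2 ⟨(Finset.mem_product.1 (hG hp)).2, hp⟩
    · intro b hb
      simp only [hnb, Finset.mem_filter] at hb ⊢
      exact ⟨hb.2, trivial⟩
    · rintro ⟨x, y⟩ hp
      simp only [Finset.mem_filter] at hp
      obtain ⟨hp, rfl⟩ := hp
      rfl
    · intro b hb; rfl
  set N0 : β → Finset α := fun b => A0.filter (fun a => g a b) with hN0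
  have s1 : (A.card * B.card : ℝ) ≤ 2 * K * ∑ b ∈ B, ((N0 b).card : ℝ) := by
    rw [← hdouble A0]
    have h1 := Finset.sum_filter_add_sum_filter_not A
      (fun a => (B.card : ℝ) ≤ 2 * K * (nb a).card) (fun a => ((nb a).card : ℝ))
    rw [← hGsum] at h1
    have h2 : 2 * K * ∑ a ∈ A.filter (fun a => ¬ (B.card : ℝ) ≤ 2 * K * (nb a).card),
        ((nb a).card : ℝ) ≤ A.card * B.card := by
      rw [Finset.mul_sum]
      calc _ ≤ ∑ a ∈ A.filter (fun a => ¬ (B.card : ℝ) ≤ 2 * K * (nb a).card), (B.card : ℝ) := by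
            refine Finset.sum_le_sum fun a ha => ?_
            exact (not_le.1 (Finset.mem_filter.1 ha).2).le
        _ ≤ ∑ a ∈ A, (B.card : ℝ) :=
            Finset.sum_le_sum_of_subset_of_nonneg (Finset.filter_subset _ _)
              (fun _ _ _ => Nat.cast_nonneg _)
        _ = _ := by simp
    nlinarith
  have s2 : (A.card : ℝ) ^ 2 * B.card ≤ 4 * K ^ 2 * ∑ b ∈ B, ((N0 b).card : ℝ) ^ 2 := by
    have hcs := sq_sum_le_card_mul_sum_sq (s := B) (f := fun b => ((N0 b).card : ℝ))
    have h0 : (0 : ℝ) ≤ A.card * B.card := by positivity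
    have h1 : (A.card * B.card : ℝ) ^ 2 ≤ (2 * K * ∑ b ∈ B, ((N0 b).card : ℝ)) ^ 2 :=
      pow_le_pow_left₀ h0 s1 2
    have h2 : ((A.card : ℝ) ^ 2 * B.card) * B.card ≤
        (4 * K ^ 2 * ∑ b ∈ B, ((N0 b).card : ℝ) ^ 2) * B.card := by
      calc ((A.card : ℝ) ^ 2 * B.card) * B.card = (A.card * B.card : ℝ) ^ 2 := by ring
        _ ≤ _ := h1
        _ = 4 * K ^ 2 * (∑ b ∈ B, ((N0 b).card : ℝ)) ^ 2 := by ring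
        _ ≤ 4 * K ^ 2 * (B.card * ∑ b ∈ B, ((N0 b).card : ℝ) ^ 2) := by gcongr
        _ = _ := by ring
    exact le_of_mul_le_mul_right h2 hBc
  -- A pair is bad if it has fewer than `|B| / (256 K ^ 3)` common neighbours; such a pair lies in
  -- the neighbourhood of few `b`, which is what `s3` sums up.
  set bad : α → α → Prop := fun a a' =>
    ((B.filter (fun b => g a b ∧ g a' b)).card : ℝ) * (256 * K ^ 3) < B.card with hbad
  set bd : β → Finset (α × α) := fun b =>
    (N0 b ×ˢ N0 b).filter (fun p => bad p.1 p.2) with hbd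
  have s3 : 256 * K ^ 3 * ∑ b ∈ B, ((bd b).card : ℝ) ≤ (A.card : ℝ) ^ 2 * B.card := by
    have h1 := Finset.sum_card_bipartiteAbove_eq_sum_card_bipartiteBelow
      (s := (A0 ×ˢ A0).filter (fun p => bad p.1 p.2)) (t := B)
      (fun p b => g p.1 b ∧ g p.2 b)
    have h2 : ∀ b, Finset.bipartiteBelow (fun (p : α × α) b => g p.1 b ∧ g p.2 b)
        ((A0 ×ˢ A0).filter (fun p => bad p.1 p.2)) b = bd b := by
      intro b
      ext p
      simp only [Finset.bipartiteBelow, hbd, hN0, Finset.mem_filter, Finset.mem_product]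
      tauto
    simp only [h2] at h1
    have h3 : (∑ b ∈ B, ((bd b).card : ℝ)) =
        ∑ p ∈ (A0 ×ˢ A0).filter (fun p => bad p.1 p.2),
          ((B.filter (fun b => g p.1 b ∧ g p.2 b)).card : ℝ) := by
      exact_mod_cast h1.symm
    rw [h3, Finset.mul_sum]
    calc _ ≤ ∑ p ∈ (A0 ×ˢ A0).filter (fun p => bad p.1 p.2), (B.card : ℝ) := by
          refine Finset.sum_le_sum fun p hp => ?_
          have := (Finset.mem_filter.1 hp).2
          simp only [hbad] at this
          linarith
      _ ≤ ∑ p ∈ A ×ˢ A, (B.card : ℝ) :=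
          Finset.sum_le_sum_of_subset_of_nonneg
            ((Finset.filter_subset _ _).trans
              (Finset.product_subset_product (Finset.filter_subset _ _) (Finset.filter_subset _ _)))
            (fun _ _ _ => Nat.cast_nonneg _)
      _ = _ := by
          rw [Finset.sum_const, nsmul_eq_mul, Finset.card_product]; push_cast; ring
  -- Averaging over `b`: the second moment of the neighbourhoods is at least `|A| ^ 2 |B| / (4 K ^
  -- 2)` by `s2`, and `32 K` times the bad pairs cost at most half of it by `s3`. The weight `32 K`
  -- makes the bad pairs at most a `1 / (32 K)` fraction of all pairs in the neighbourhood of `b0`.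
  obtain ⟨b0, hb0, hb0'⟩ : ∃ b ∈ B, (A.card : ℝ) ^ 2 / (8 * K ^ 2) ≤
      ((N0 b).card : ℝ) ^ 2 - 32 * K * (bd b).card := by
    refine Finset.exists_le_of_sum_le hB ?_
    rw [Finset.sum_sub_distrib, ← Finset.mul_sum, Finset.sum_const, nsmul_eq_mul]
    have e1 : 32 * K * ∑ b ∈ B, ((bd b).card : ℝ) ≤ (A.card : ℝ) ^ 2 * B.card / (8 * K ^ 2) := by
      rw [le_div_iff₀ (by positivity)]
      calc _ = 256 * K ^ 3 * ∑ b ∈ B, ((bd b).card : ℝ) := by ring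
        _ ≤ _ := s3
    have e2 : (A.card : ℝ) ^ 2 * B.card / (4 * K ^ 2) ≤ ∑ b ∈ B, ((N0 b).card : ℝ) ^ 2 := by
      rw [div_le_iff₀ (by positivity)]
      linarith
    have e3 : (A.card : ℝ) ^ 2 * B.card / (4 * K ^ 2) - (A.card : ℝ) ^ 2 * B.card / (8 * K ^ 2) =
      B.card * ((A.card : ℝ) ^ 2 / (8 * K ^ 2)) := by field_simp; ring
    linarith
  set A1 := N0 b0 with hA1
  have hA1A0 : A1 ⊆ A0 := Finset.filter_subset _ _
  have hA0A : A0 ⊆ A := Finset.filter_subset _ _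
  have f1 : (A.card : ℝ) ≤ 3 * K * A1.card := by
    have h1 : (A.card : ℝ) ^ 2 / (8 * K ^ 2) ≤ (A1.card : ℝ) ^ 2 := by
      have : (0 : ℝ) ≤ 32 * K * (bd b0).card := by positivity
      linarith
    rw [div_le_iff₀ (by positivity)] at h1
    refine le_of_sq_le_sq ?_ (by positivity)
    nlinarith [sq_nonneg (K * A1.card)]
  have f2 : 32 * K * ((bd b0).card : ℝ) ≤ (A1.card : ℝ) ^ 2 := by
    have : (0 : ℝ) ≤ (A.card : ℝ) ^ 2 / (8 * K ^ 2) := by positivity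
    linarith
  -- By Markov's inequality at least half of `A1` has at most `|A1| / (16 K)` bad partners.
  set A' := A1.filter (fun a => 16 * K * ((A1.filter (bad a)).card : ℝ) ≤ A1.card) with hA'
  have hA'A1 : A' ⊆ A1 := Finset.filter_subset _ _
  have f3 : (A1.card : ℝ) ≤ 2 * A'.card := by
    set X := A1.filter (fun a => ¬ 16 * K * ((A1.filter (bad a)).card : ℝ) ≤ A1.card) with hX
    have hsplit : (A'.card : ℝ) + X.card = A1.card := by
      exact_mod_cast Finset.card_filter_add_card_filter_not (s := A1)
        (fun a => 16 * K * ((A1.filter (bad a)).card : ℝ) ≤ A1.card)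
    have hsum : ((bd b0).card : ℝ) = ∑ a ∈ A1, ((A1.filter (bad a)).card : ℝ) := by
      have : (bd b0).card = ∑ a ∈ A1, (A1.filter (bad a)).card := by
        simp only [hbd, Finset.card_filter, Finset.sum_product, hA1]
      exact_mod_cast this
    have hX1 : (X.card : ℝ) * A1.card ≤ 16 * K * (bd b0).card := by
      rw [hsum, Finset.mul_sum]
      calc (X.card : ℝ) * A1.card = ∑ a ∈ X, (A1.card : ℝ) := by simp
        _ ≤ ∑ a ∈ X, 16 * K * ((A1.filter (bad a)).card : ℝ) := by
            refine Finset.sum_le_sum fun a ha => ?_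
            exact (not_le.1 (Finset.mem_filter.1 ha).2).le
        _ ≤ _ := Finset.sum_le_sum_of_subset_of_nonneg (Finset.filter_subset _ _)
            (fun _ _ _ => by positivity)
    rcases Nat.eq_zero_or_pos A1.card with h0 | h0
    · rw [h0]; simp
    · have h0' : (0 : ℝ) < A1.card := by exact_mod_cast h0
      have : (X.card : ℝ) * 2 ≤ A1.card := by
        refine le_of_mul_le_mul_right ?_ h0'
        nlinarith
      linarith
  set B' := B.filter (fun b => (A'.card : ℝ) ≤ 4 * K * (A'.filter (fun a => g a b)).card) with hB'
  refine ⟨A', (hA'A1.trans hA1A0).trans hA0A, B', Finset.filter_subset _ _, ?_, ?_⟩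
  · have e0 : ((G.filter (fun p => p.1 ∈ A' ∧ p.2 ∈ B')).card : ℝ) =
        ∑ b ∈ B', ((A'.filter (fun a => g a b)).card : ℝ) := by
      have h1 : (G.filter (fun p => p.1 ∈ A' ∧ p.2 ∈ B')).card =
          ∑ b ∈ B', ((G.filter (fun p => p.1 ∈ A' ∧ p.2 ∈ B')).filter (fun p => p.2 = b)).card :=
        Finset.card_eq_sum_card_fiberwise (fun p hp => by
          simpa using (Finset.mem_filter.1 hp).2.2)
      rw [h1]; push_cast
      refine Finset.sum_congr rfl fun b hb => ?_
      congr 1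
      refine Finset.card_bij' (fun p _ => p.1) (fun a _ => (a, b)) ?_ ?_ ?_ ?_
      · rintro ⟨x, y⟩ hp
        simp only [Finset.mem_filter] at hp
        obtain ⟨⟨hp, hx, hy⟩, rfl⟩ := hp
        exact Finset.mem_filter.2 ⟨hx, hp⟩
      · intro a ha
        simp only [Finset.mem_filter] at ha ⊢
        exact ⟨⟨ha.2, ha.1, hb⟩, trivial⟩
      · rintro ⟨x, y⟩ hp
        simp only [Finset.mem_filter] at hp
        obtain ⟨hp, rfl⟩ := hp
        rfl
      · intro b hb; rfl
    rw [e0]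
    have e1 : (A'.card * B.card : ℝ) ≤ 2 * K * ∑ b ∈ B, ((A'.filter (fun a => g a b)).card : ℝ) := by
      rw [← hdouble A', Finset.mul_sum]
      calc (A'.card * B.card : ℝ) = ∑ a ∈ A', (B.card : ℝ) := by simp
        _ ≤ _ := Finset.sum_le_sum fun a ha =>
          (Finset.mem_filter.1 (hA1A0 (hA'A1 ha))).2
    have e2 := Finset.sum_filter_add_sum_filter_not B
      (fun b => (A'.card : ℝ) ≤ 4 * K * (A'.filter (fun a => g a b)).card)
      (fun b => ((A'.filter (fun a => g a b)).card : ℝ))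
    have e3 : 4 * K * ∑ b ∈ B.filter (fun b => ¬ (A'.card : ℝ) ≤
        4 * K * (A'.filter (fun a => g a b)).card),
        ((A'.filter (fun a => g a b)).card : ℝ) ≤ A'.card * B.card := by
      rw [Finset.mul_sum]
      calc _ ≤ ∑ b ∈ B.filter (fun b => ¬ (A'.card : ℝ) ≤
            4 * K * (A'.filter (fun a => g a b)).card), (A'.card : ℝ) := by
            refine Finset.sum_le_sum fun a ha => ?_
            exact (not_le.1 (Finset.mem_filter.1 ha).2).le
        _ ≤ ∑ b ∈ B, (A'.card : ℝ) :=
            Finset.sum_le_sum_of_subset_of_nonneg (Finset.filter_subset _ _)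
              (fun _ _ _ => Nat.cast_nonneg _)
        _ = _ := by simp; ring
    set E := ∑ b ∈ B', ((A'.filter (fun a => g a b)).card : ℝ) with hE
    have e4 : (A'.card * B.card : ℝ) ≤ 4 * K * E := by nlinarith
    calc (A.card * B.card : ℝ) ≤ (3 * K * (2 * A'.card)) * B.card := by
          gcongr
          exact f1.trans (by gcongr)
      _ = 6 * K * (A'.card * B.card) := by ring
      _ ≤ 6 * K * (4 * K * E) := by gcongr
      _ = _ := by ring
  · intro a ha b hb
    -- A vertex `b` of `B'` has at least `|A'| / (4K) ≥ |A1| / (8K)` neighbours in `A'`, and at most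
    -- half that many are bad for `a`. Each remaining `a1` gives a path for every common neighbour
    -- of `a` and `a1`.
    set good := A'.filter (fun a1 => g a1 b ∧ ¬ bad a a1) with hgood
    have g1 : (A'.card : ℝ) ≤ 4 * K * (A'.filter (fun a => g a b)).card :=
      (Finset.mem_filter.1 hb).2
    have g2 : 16 * K * ((A1.filter (bad a)).card : ℝ) ≤ A1.card := (Finset.mem_filter.1 ha).2
    have g3 : ((A'.filter (fun a => g a b)).card : ℝ) ≤ good.card + (A1.filter (bad a)).card := by
      have : A'.filter (fun a => g a b) ⊆ good ∪ A1.filter (bad a) := by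
        intro x hx
        simp only [Finset.mem_filter, Finset.mem_union, hgood] at hx ⊢
        by_cases hbx : bad a x
        · exact Or.inr ⟨hA'A1 hx.1, hbx⟩
        · exact Or.inl ⟨hx.1, hx.2, hbx⟩
      exact_mod_cast (Finset.card_le_card this).trans (Finset.card_union_le _ _)
    have g4 : (A1.card : ℝ) ≤ 16 * K * good.card := by nlinarith
    have g5 : (good.card : ℝ) * B.card ≤ 256 * K ^ 3 *
        ((A ×ˢ B).filter (fun p => (a, p.2) ∈ G ∧ (p.1, p.2) ∈ G ∧ (p.1, b) ∈ G)).card := by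
      have hle : ∑ a1 ∈ good, (B.filter (fun b1 => g a b1 ∧ g a1 b1)).card ≤
          ((A ×ˢ B).filter (fun p => (a, p.2) ∈ G ∧ (p.1, p.2) ∈ G ∧ (p.1, b) ∈ G)).card := by
        rw [← Finset.card_sigma]
        refine Finset.card_le_card_of_injOn (fun q => (q.1, q.2)) ?_ ?_
        · rintro ⟨x, y⟩ hq
          simp only [Finset.coe_sigma, Set.mem_sigma_iff, Finset.mem_coe, Finset.mem_filter,
            hgood] at hq
          simp only [Finset.mem_coe, Finset.mem_filter, Finset.mem_product]
          exact ⟨⟨hA0A (hA1A0 (hA'A1 hq.1.1)), hq.2.1⟩, hq.2.2.1, hq.2.2.2, hq.1.2.1⟩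
        · rintro ⟨x, y⟩ _ ⟨x', y'⟩ _ hxy
          simp only [Prod.mk.injEq] at hxy
          obtain ⟨rfl, rfl⟩ := hxy
          rfl
      calc (good.card : ℝ) * B.card = ∑ a1 ∈ good, (B.card : ℝ) := by simp
        _ ≤ ∑ a1 ∈ good, 256 * K ^ 3 * ((B.filter (fun b1 => g a b1 ∧ g a1 b1)).card : ℝ) := by
            refine Finset.sum_le_sum fun a1 h1 => ?_
            have := (Finset.mem_filter.1 h1).2.2
            simp only [hbad, not_lt] at this
            linarith
        _ = 256 * K ^ 3 * ((∑ a1 ∈ good, (B.filter (fun b1 => g a b1 ∧ g a1 b1)).card : ℕ) : ℝ) := by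
            rw [← Finset.mul_sum]; push_cast; rfl
        _ ≤ _ := by gcongr
    set Pn := (((A ×ˢ B).filter
      (fun p => (a, p.2) ∈ G ∧ (p.1, p.2) ∈ G ∧ (p.1, b) ∈ G)).card : ℝ) with hPn
    have hP0 : 0 ≤ Pn := Nat.cast_nonneg _
    calc (A.card * B.card : ℝ) ≤ (3 * K * (16 * K * good.card)) * B.card := by
          gcongr
          exact f1.trans (by gcongr)
      _ = 48 * K ^ 2 * (good.card * B.card) := by ring
      _ ≤ 48 * K ^ 2 * (256 * K ^ 3 * Pn) := by gcongr
      _ = 12288 * (K ^ 5 * Pn) := by ring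
      _ ≤ 2 ^ 14 * (K ^ 5 * Pn) := by
          have : 0 ≤ K ^ 5 * Pn := by positivity
          nlinarith
      _ = _ := by ring

end Graphs

/-! ### Counting cells of side `δ`, and maps that nearly respect them. -/

section Cells

/-- The index of the cell of side `δ` that contains `x`. -/
noncomputable def cell (δ x : ℝ) : ℤ := ⌊x / δ⌋

/-- The number of cells of side `δ` that meet the finite set `S`. -/
noncomputable def cov (δ : ℝ) (S : Finset ℝ) : ℕ := (S.image (cell δ)).card

theorem cell_bounds {δ : ℝ} (hδ : 0 < δ) (x : ℝ) :
    (cell δ x : ℝ) * δ ≤ x ∧ x < ((cell δ x : ℝ) + 1) * δ := by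
  unfold cell
  constructor
  · rw [← le_div_iff₀ hδ]; exact Int.floor_le _
  · rw [← div_lt_iff₀ hδ]; exact Int.lt_floor_add_one _

theorem abs_sub_lt_of_cell_eq {δ x y : ℝ} (hδ : 0 < δ) (h : cell δ x = cell δ y) :
    |x - y| < δ := by
  have h1 := cell_bounds hδ x
  have h2 := cell_bounds hδ y
  rw [h] at h1
  rw [abs_lt]
  constructor <;> nlinarith

theorem abs_cell_sub_le {δ x y M : ℝ} (hδ : 0 < δ) (h : |x - y| ≤ M * δ) :
    |(cell δ x : ℝ) - cell δ y| ≤ M + 1 := by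
  have h1 := cell_bounds hδ x
  have h2 := cell_bounds hδ y
  rw [abs_le] at h ⊢
  constructor
  · refine le_of_mul_le_mul_right ?_ hδ
    nlinarith
  · refine le_of_mul_le_mul_right ?_ hδ
    nlinarith

/-- Counts `F` fibre by fibre over `g`. All later changes of coordinates compare two families of
labels in this way, the bound `k` coming from a Lipschitz estimate. -/
theorem card_image_le_mul_card_image {ι β γ : Type*} [DecidableEq β] [DecidableEq γ]
    (T : Finset ι) (F : ι → γ) (g : ι → β)
    {k : ℝ} (h : ∀ i ∈ T, (((T.filter (fun j => g j = g i)).image F).card : ℝ) ≤ k) :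
    ((T.image F).card : ℝ) ≤ k * (T.image g).card := by
  have hsub : T.image F ⊆ (T.image g).biUnion (fun b => (T.filter (fun j => g j = b)).image F) := by
    intro y hy
    obtain ⟨i, hi, rfl⟩ := Finset.mem_image.1 hy
    exact Finset.mem_biUnion.2 ⟨g i, Finset.mem_image_of_mem _ hi,
      Finset.mem_image_of_mem _ (Finset.mem_filter.2 ⟨hi, rfl⟩)⟩
  calc ((T.image F).card : ℝ) ≤
        ∑ b ∈ T.image g, (((T.filter (fun j => g j = b)).image F).card : ℝ) := by
        exact_mod_cast (Finset.card_le_card hsub).trans Finset.card_biUnion_le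
    _ ≤ ∑ b ∈ T.image g, k := by
        refine Finset.sum_le_sum fun b hb => ?_
        obtain ⟨i, hi, rfl⟩ := Finset.mem_image.1 hb
        exact h i hi
    _ = _ := by simp [mul_comm]

theorem card_le_of_abs_sub_le {S : Finset ℤ} {a M : ℝ} (hM : 0 ≤ M)
    (h : ∀ i ∈ S, |(i : ℝ) - a| ≤ M) : (S.card : ℝ) ≤ 2 * M + 1 := by
  have hsub : S ⊆ Finset.Icc ⌈a - M⌉ ⌊a + M⌋ := by
    intro i hi
    have := abs_le.1 (h i hi)
    rw [Finset.mem_Icc, Int.ceil_le, Int.le_floor]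
    constructor <;> linarith
  have h1 : (S.card : ℝ) ≤ ((Finset.Icc ⌈a - M⌉ ⌊a + M⌋).card : ℝ) := by
    exact_mod_cast Finset.card_le_card hsub
  rw [Int.card_Icc] at h1
  refine h1.trans ?_
  have h2 := Int.floor_le (a + M)
  have h3 := Int.le_ceil (a - M)
  rcases le_total 0 (⌊a + M⌋ + 1 - ⌈a - M⌉) with h0 | h0
  · have : (((⌊a + M⌋ + 1 - ⌈a - M⌉).toNat : ℤ) : ℝ) = ((⌊a + M⌋ + 1 - ⌈a - M⌉ : ℤ) : ℝ) := by
      rw [Int.toNat_of_nonneg h0]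
    rw [Int.cast_natCast] at this
    rw [this]; push_cast; linarith
  · rw [Int.toNat_of_nonpos h0]; simp; linarith

theorem card_image_int_le {ι β : Type*} [DecidableEq β] (T : Finset ι) (F : ι → ℤ) (g : ι → β) {M : ℝ}
    (hM : 0 ≤ M) (h : ∀ i ∈ T, ∀ j ∈ T, g i = g j → |(F i : ℝ) - F j| ≤ M) :
    ((T.image F).card : ℝ) ≤ (2 * M + 1) * (T.image g).card := by
  refine card_image_le_mul_card_image T F g fun i hi => ?_
  refine card_le_of_abs_sub_le (a := F i) hM ?_
  intro y hy
  obtain ⟨j, hj, rfl⟩ := Finset.mem_image.1 hy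
  rw [Finset.mem_filter] at hj
  exact h j hj.1 i hi hj.2

theorem card_image_int_prod_le {ι β : Type*} [DecidableEq β] (T : Finset ι) (F F' : ι → ℤ) (g : ι → β) {M : ℝ}
    (hM : 0 ≤ M) (h : ∀ i ∈ T, ∀ j ∈ T, g i = g j → |(F i : ℝ) - F j| ≤ M)
    (h' : ∀ i ∈ T, ∀ j ∈ T, g i = g j → |(F' i : ℝ) - F' j| ≤ M) :
    ((T.image (fun i => (F i, F' i))).card : ℝ) ≤ (2 * M + 1) ^ 2 * (T.image g).card := by
  refine card_image_le_mul_card_image T _ g fun i hi => ?_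
  set T' := T.filter (fun j => g j = g i) with hT'
  have hsub : T'.image (fun i => (F i, F' i)) ⊆ T'.image F ×ˢ T'.image F' := by
    intro y hy
    obtain ⟨j, hj, rfl⟩ := Finset.mem_image.1 hy
    exact Finset.mem_product.2 ⟨Finset.mem_image_of_mem _ hj, Finset.mem_image_of_mem _ hj⟩
  have h1 : ((T'.image F).card : ℝ) ≤ 2 * M + 1 := by
    refine card_le_of_abs_sub_le (a := F i) hM ?_
    intro y hy
    obtain ⟨j, hj, rfl⟩ := Finset.mem_image.1 hy
    rw [Finset.mem_filter] at hj
    exact h j hj.1 i hi hj.2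
  have h2 : ((T'.image F').card : ℝ) ≤ 2 * M + 1 := by
    refine card_le_of_abs_sub_le (a := F' i) hM ?_
    intro y hy
    obtain ⟨j, hj, rfl⟩ := Finset.mem_image.1 hy
    rw [Finset.mem_filter] at hj
    exact h' j hj.1 i hi hj.2
  calc ((T'.image (fun i => (F i, F' i))).card : ℝ)
      ≤ ((T'.image F ×ˢ T'.image F').card : ℝ) := by exact_mod_cast Finset.card_le_card hsub
    _ = (T'.image F).card * (T'.image F').card := by rw [Finset.card_product]; push_cast; rfl
    _ ≤ (2 * M + 1) * (2 * M + 1) := by gcongr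
    _ = _ := by ring

/-- If the label `g` determines the real number `f` up to `M * δ`, then the number of cells met by
the values of `f` is controlled by the number of labels. -/
theorem card_image_cell_le {ι β : Type*} [DecidableEq β] (T : Finset ι) (f : ι → ℝ) (g : ι → β) {δ M : ℝ}
    (hδ : 0 < δ) (hM : 0 ≤ M) (h : ∀ i ∈ T, ∀ j ∈ T, g i = g j → |f i - f j| ≤ M * δ) :
    ((T.image (fun i => cell δ (f i))).card : ℝ) ≤ (2 * M + 3) * (T.image g).card := by
  have := card_image_int_le T (fun i => cell δ (f i)) g (M := M + 1) (by linarith)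
    (fun i hi j hj hij => abs_cell_sub_le hδ (h i hi j hj hij))
  convert this using 2
  ring

theorem card_image_cell_prod_le {ι β : Type*} [DecidableEq β] (T : Finset ι) (f f' : ι → ℝ) (g : ι → β) {δ M : ℝ}
    (hδ : 0 < δ) (hM : 0 ≤ M) (h : ∀ i ∈ T, ∀ j ∈ T, g i = g j → |f i - f j| ≤ M * δ)
    (h' : ∀ i ∈ T, ∀ j ∈ T, g i = g j → |f' i - f' j| ≤ M * δ) :
    ((T.image (fun i => (cell δ (f i), cell δ (f' i)))).card : ℝ) ≤
      (2 * M + 3) ^ 2 * (T.image g).card := by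
  have := card_image_int_prod_le T (fun i => cell δ (f i)) (fun i => cell δ (f' i)) g (M := M + 1)
    (by linarith) (fun i hi j hj hij => abs_cell_sub_le hδ (h i hi j hj hij))
    (fun i hi j hj hij => abs_cell_sub_le hδ (h' i hi j hj hij))
  convert this using 2
  ring

theorem cov_image {ι : Type*} (δ : ℝ) (T : Finset ι) (f : ι → ℝ) :
    cov δ (T.image f) = (T.image (fun i => cell δ (f i))).card := by
  unfold cov
  rw [Finset.image_image]
  rfl

theorem cov_mono {δ : ℝ} {S T : Finset ℝ} (h : S ⊆ T) : cov δ S ≤ cov δ T :=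
  Finset.card_le_card (Finset.image_subset_image h)

theorem exists_injOn_image_eq {ι β : Type*} [DecidableEq β] (T : Finset ι) (g : ι → β) :
    ∃ T' ⊆ T, Set.InjOn g T' ∧ T'.image g = T.image g := by
  obtain ⟨T', h1, h2, h3⟩ := Finset.exists_subset_injOn_image_eq_of_surjOn (f := g) T (T.image g)
    (by rw [Finset.coe_image]; exact Set.surjOn_image _ _)
  exact ⟨T', by exact_mod_cast h1, h2, h3⟩

/-- With the reverse inequality `abs_sub_le_mul_abs_log_sub`, the logarithm is bi-Lipschitz on
compact subsets of the positive reals, so products of numbers become sums of integer labels with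
bounded loss. -/
theorem abs_log_sub_log_le {a b m : ℝ} (hm : 0 < m) (ha : m ≤ a) (hb : m ≤ b) :
    |Real.log a - Real.log b| ≤ |a - b| / m := by
  have key : ∀ a b : ℝ, m ≤ a → m ≤ b → Real.log a - Real.log b ≤ |a - b| / m := by
    intro a b ha hb
    have ha0 := hm.trans_le ha
    have hb0 := hm.trans_le hb
    rw [← Real.log_div ha0.ne' hb0.ne']
    calc Real.log (a / b) ≤ a / b - 1 := Real.log_le_sub_one_of_pos (by positivity)
      _ = (a - b) / b := by field_simp
      _ ≤ |a - b| / b := by gcongr; exact le_abs_self _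
      _ ≤ |a - b| / m := by gcongr
  rw [abs_le]
  have h1 := key a b ha hb
  have h2 := key b a hb ha
  rw [abs_sub_comm] at h2
  constructor <;> linarith

theorem abs_sub_le_mul_abs_log_sub {a b M : ℝ} (ha : 0 < a) (hb : 0 < b) (haM : a ≤ M)
    (hbM : b ≤ M) : |a - b| ≤ M * |Real.log a - Real.log b| := by
  have key : ∀ a b : ℝ, 0 < a → 0 < b → a ≤ M → a - b ≤ M * |Real.log a - Real.log b| := by
    intro a b ha hb haM
    have h1 : 1 - b / a ≤ Real.log a - Real.log b := by
      have := Real.log_le_sub_one_of_pos (show 0 < b / a by positivity)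
      rw [Real.log_div hb.ne' ha.ne'] at this
      linarith
    calc a - b = a * (1 - b / a) := by field_simp
      _ ≤ a * |Real.log a - Real.log b| := by
          gcongr; exact h1.trans (le_abs_self _)
      _ ≤ _ := by gcongr
  rw [abs_le]
  have h1 := key a b ha hb haM
  have h2 := key b a hb ha hbM
  rw [abs_sub_comm (Real.log b)] at h2
  constructor <;> linarith

end Cells

/-! ### Balog–Szemerédi–Gowers and Plünnecke–Ruzsa for integer labels. -/

section AdditiveCombinatorics

/-- A form of the Balog–Szemerédi–Gowers theorem for integers. -/
theorem exists_dense_subgraph_small_sumset (A B : Finset ℤ) (G : Finset (ℤ × ℤ))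
    (hG : G ⊆ A ×ˢ B) {K N : ℝ} (hK : 100 ≤ K) (hN : 0 < N) (hA : (A.card : ℝ) ≤ K * N)
    (hB : (B.card : ℝ) ≤ K * N) (hGN : N ^ 2 ≤ K * G.card)
    (hC : ((G.image (fun p => p.1 + p.2)).card : ℝ) ≤ K * N) :
    ∃ A' ⊆ A, ∃ B' ⊆ B,
      N ^ 2 ≤ K ^ 8 * (G.filter (fun p => p.1 ∈ A' ∧ p.2 ∈ B')).card ∧
      ((A' + B').card : ℝ) ≤ K ^ 22 * N := by
  have hK0 : 0 < K := by linarith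
  have hK1 : 1 ≤ K := by linarith
  have hAB : (A.card * B.card : ℝ) ≤ K ^ 3 * G.card := by
    calc (A.card * B.card : ℝ) ≤ (K * N) * (K * N) := by gcongr
      _ = K ^ 2 * N ^ 2 := by ring
      _ ≤ K ^ 2 * (K * G.card) := by gcongr
      _ = _ := by ring
  obtain ⟨A', hA', B', hB', h1, h2⟩ :=
    exists_dense_subgraph_many_paths A B G hG (one_le_pow₀ hK1) hAB
  have hGle : (G.card : ℝ) ≤ A.card * B.card := by
    exact_mod_cast (Finset.card_le_card hG).trans_eq (Finset.card_product _ _)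
  refine ⟨A', hA', B', hB', ?_, ?_⟩
  · set E := ((G.filter (fun p => p.1 ∈ A' ∧ p.2 ∈ B')).card : ℝ) with hE
    have hE0 : 0 ≤ E := Nat.cast_nonneg _
    calc N ^ 2 ≤ K * (A.card * B.card) := hGN.trans (by gcongr)
      _ ≤ K * (24 * (K ^ 3) ^ 2 * E) := mul_le_mul_of_nonneg_left h1 hK0.le
      _ = 24 * (K ^ 7 * E) := by ring
      _ ≤ K * (K ^ 7 * E) := by gcongr; linarith
      _ = _ := by ring
  · set C := G.image (fun p => p.1 + p.2) with hCdef
    have hpos : (0 : ℝ) < A.card * B.card := by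
      have : 0 < K * (G.card : ℝ) := lt_of_lt_of_le (by positivity) hGN
      have : 0 < (G.card : ℝ) := pos_of_mul_pos_right this hK0.le
      linarith
    have key : ((A' + B').card : ℝ) * (A.card * B.card) ≤ 2 ^ 14 * (K ^ 3) ^ 5 * C.card ^ 3 := by
      -- One representation per sum is fixed, so that the counting map below can recover `s` from
      -- its value.
      have hrep : ∀ s ∈ A' + B', ∃ p : ℤ × ℤ, p.1 ∈ A' ∧ p.2 ∈ B' ∧ p.1 + p.2 = s := by
        intro s hs
        obtain ⟨a, ha, b, hb, rfl⟩ := Finset.mem_add.1 hs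
        exact ⟨(a, b), ha, hb, rfl⟩
      choose! r hr1 hr2 hr3 using hrep
      set P : ℤ → Finset (ℤ × ℤ) := fun s => (A ×ˢ B).filter
        (fun p => ((r s).1, p.2) ∈ G ∧ (p.1, p.2) ∈ G ∧ (p.1, (r s).2) ∈ G) with hP
      -- A path of length three writes `a + b = (a + b₁) - (a₁ + b₁) + (a₁ + b)` with all three sums
      -- taken along edges. The triple of sums determines `s`, hence `(a, b)`, and then `a₁` and
      -- `b₁`, so the paths inject into `C ^ 3`.
      have hcount : ∑ s ∈ A' + B', (P s).card ≤ C.card ^ 3 := by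
        have : C.card ^ 3 = (C ×ˢ (C ×ˢ C)).card := by
          rw [Finset.card_product, Finset.card_product]; ring
        rw [this, ← Finset.card_sigma]
        refine Finset.card_le_card_of_injOn
          (fun q => ((r q.1).1 + q.2.2, (q.2.1 + q.2.2, q.2.1 + (r q.1).2))) ?_ ?_
        · rintro ⟨s, p⟩ hq
          simp only [Finset.coe_sigma, Set.mem_sigma_iff, Finset.mem_coe, hP,
            Finset.mem_filter] at hq
          simp only [Finset.mem_coe, Finset.mem_product, hCdef]
          exact ⟨Finset.mem_image.2 ⟨_, hq.2.2.1, rfl⟩, Finset.mem_image.2 ⟨_, hq.2.2.2.1, rfl⟩,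
            Finset.mem_image.2 ⟨_, hq.2.2.2.2, rfl⟩⟩
        · rintro ⟨s, p⟩ hq ⟨s', p'⟩ hq' he
          simp only [Finset.coe_sigma, Set.mem_sigma_iff, Finset.mem_coe] at hq hq'
          simp only [Prod.mk.injEq] at he
          have e1 := hr3 s hq.1
          have e2 := hr3 s' hq'.1
          have hs : s = s' := by
            rw [← e1, ← e2]
            linarith [he.1, he.2.1, he.2.2]
          subst hs
          have h5 : p.2 = p'.2 := by linarith [he.1]
          have h6 : p.1 = p'.1 := by linarith [he.2.2]
          rw [Prod.ext h6 h5]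
      calc ((A' + B').card : ℝ) * (A.card * B.card)
          = ∑ s ∈ A' + B', (A.card * B.card : ℝ) := by simp
        _ ≤ ∑ s ∈ A' + B', 2 ^ 14 * (K ^ 3) ^ 5 * ((P s).card : ℝ) :=
            Finset.sum_le_sum fun s hs => h2 _ (hr1 s hs) _ (hr2 s hs)
        _ = 2 ^ 14 * (K ^ 3) ^ 5 * ((∑ s ∈ A' + B', (P s).card : ℕ) : ℝ) := by
            rw [← Finset.mul_sum]; push_cast; rfl
        _ ≤ 2 ^ 14 * (K ^ 3) ^ 5 * ((C.card ^ 3 : ℕ) : ℝ) := by gcongr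
        _ = _ := by push_cast; rfl
    have hlow : N ^ 2 ≤ K * (A.card * B.card) := hGN.trans (by gcongr)
    refine le_of_mul_le_mul_right ?_ (show 0 < N ^ 2 by positivity)
    calc ((A' + B').card : ℝ) * N ^ 2 ≤ (A' + B').card * (K * (A.card * B.card)) := by gcongr
      _ = K * ((A' + B').card * (A.card * B.card)) := by ring
      _ ≤ K * (2 ^ 14 * (K ^ 3) ^ 5 * C.card ^ 3) := by gcongr
      _ ≤ K * (2 ^ 14 * (K ^ 3) ^ 5 * (K * N) ^ 3) := by gcongr
      _ = 2 ^ 14 * (K ^ 19 * N ^ 3) := by ring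
      _ ≤ K ^ 3 * (K ^ 19 * N ^ 3) := by
          gcongr
          calc (2 : ℝ) ^ 14 ≤ 100 ^ 3 := by norm_num
            _ ≤ K ^ 3 := by gcongr
      _ = _ := by ring

/-- The Plünnecke–Ruzsa inequality, with the doubling constant bounded by `K ^ 2` because `A.card`
and `N` agree up to a factor `K`. -/
theorem card_two_nsmul_sub_le {A : Finset ℤ} {K N : ℝ} (hK : 1 ≤ K) (hN : 0 < N)
    (hA : N ≤ K * A.card) (hA' : (A.card : ℝ) ≤ K * N)
    (hAA : ((A + A).card : ℝ) ≤ K * N) (m k : ℕ) :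
    ((m • A - k • A).card : ℝ) ≤ K ^ (2 * (m + k) + 1) * N := by
  have hK0 : 0 < K := by linarith
  have hAne : A.Nonempty := by
    rw [← Finset.card_pos]
    have : 0 < K * (A.card : ℝ) := hN.trans_le hA
    have := pos_of_mul_pos_right this hK0.le
    exact_mod_cast this
  have hc : (0 : ℝ) < A.card := by exact_mod_cast hAne.card_pos
  have h := NNRat.cast_mono (K := ℝ)
    (Finset.pluennecke_ruzsa_inequality_nsmul_sub_nsmul_add hAne A m k)
  have h' : ((m • A - k • A).card : ℝ) ≤ (((A + A).card : ℝ) / A.card) ^ (m + k) * A.card := by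
    push_cast at h
    exact h
  have h2 : ((A + A).card : ℝ) / A.card ≤ K ^ 2 := by
    rw [div_le_iff₀ hc]
    calc ((A + A).card : ℝ) ≤ K * N := hAA
      _ ≤ K * (K * A.card) := by gcongr
      _ = _ := by ring
  calc _ ≤ _ := h'
    _ ≤ (K ^ 2) ^ (m + k) * (K * N) := by gcongr
    _ = _ := by rw [← pow_mul]; ring

/-- A form of the Balog–Szemerédi–Gowers theorem for integers, with the further sumset bounds that
follow from the Plünnecke–Ruzsa inequalities. -/
theorem exists_dense_subgraph_small_doubling (A B : Finset ℤ) (G : Finset (ℤ × ℤ))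
    (hG : G ⊆ A ×ˢ B) {K N : ℝ} (hK : 100 ≤ K) (hN : 0 < N) (hA : (A.card : ℝ) ≤ K * N)
    (hB : (B.card : ℝ) ≤ K * N) (hGN : N ^ 2 ≤ K * G.card)
    (hC : ((G.image (fun p => p.1 + p.2)).card : ℝ) ≤ K * N) :
    ∃ A' ⊆ A, ∃ B' ⊆ B,
      N ^ 2 ≤ K ^ 8 * (G.filter (fun p => p.1 ∈ A' ∧ p.2 ∈ B')).card ∧
      N ≤ K ^ 9 * A'.card ∧
      ((A' + A').card : ℝ) ≤ K ^ 53 * N ∧ ((A' - A').card : ℝ) ≤ K ^ 53 * N ∧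
      ((A' - A' - B').card : ℝ) ≤ K ^ 402 * N := by
  have hK0 : 0 < K := by linarith
  have hK1 : 1 ≤ K := by linarith
  obtain ⟨A', hA', B', hB', h1, h2⟩ :=
    exists_dense_subgraph_small_sumset A B G hG hK hN hA hB hGN hC
  have hprod : ((G.filter (fun p => p.1 ∈ A' ∧ p.2 ∈ B')).card : ℝ) ≤ A'.card * B'.card := by
    have : G.filter (fun p => p.1 ∈ A' ∧ p.2 ∈ B') ⊆ A' ×ˢ B' := by
      intro p hp
      exact Finset.mem_product.2 (Finset.mem_filter.1 hp).2
    exact_mod_cast (Finset.card_le_card this).trans_eq (Finset.card_product _ _)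
  have hAc : (A'.card : ℝ) ≤ K * N := le_trans (by exact_mod_cast Finset.card_le_card hA') hA
  have hBc : (B'.card : ℝ) ≤ K * N := le_trans (by exact_mod_cast Finset.card_le_card hB') hB
  have hAl : N ≤ K ^ 9 * A'.card := by
    refine le_of_mul_le_mul_right ?_ hN
    calc N * N = N ^ 2 := by ring
      _ ≤ K ^ 8 * (A'.card * B'.card) := h1.trans (by gcongr)
      _ ≤ K ^ 8 * (A'.card * (K * N)) := by gcongr
      _ = _ := by ring
  have hBl : N ≤ K ^ 9 * B'.card := by
    refine le_of_mul_le_mul_right ?_ hN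
    calc N * N = N ^ 2 := by ring
      _ ≤ K ^ 8 * (A'.card * B'.card) := h1.trans (by gcongr)
      _ ≤ K ^ 8 * ((K * N) * B'.card) := by gcongr
      _ = _ := by ring
  have hBA : ((B' + A').card : ℝ) ≤ K ^ 22 * N := by rwa [add_comm]
  have h3 : ((A' + A').card : ℝ) ≤ K ^ 53 * N := by
    have h := Finset.ruzsa_triangle_inequality_add_add_add A' B' A'
    have h' : ((A' + A').card : ℝ) * B'.card ≤ (A' + B').card * (B' + A').card := by
      exact_mod_cast h
    refine le_of_mul_le_mul_right ?_ hN
    calc ((A' + A').card : ℝ) * N ≤ (A' + A').card * (K ^ 9 * B'.card) := by gcongr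
      _ = K ^ 9 * ((A' + A').card * B'.card) := by ring
      _ ≤ K ^ 9 * ((K ^ 22 * N) * (K ^ 22 * N)) := by
          exact mul_le_mul_of_nonneg_left (h'.trans (mul_le_mul h2 hBA (Nat.cast_nonneg _) (by positivity)))
            (by positivity)
      _ = _ := by ring
  have h4 : ((A' - A').card : ℝ) ≤ K ^ 53 * N := by
    have h := Finset.ruzsa_triangle_inequality_sub_add_add A' B' A'
    have h' : ((A' - A').card : ℝ) * B'.card ≤ (A' + B').card * (B' + A').card := by
      rw [add_comm B' A']; exact_mod_cast h
    refine le_of_mul_le_mul_right ?_ hN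
    calc ((A' - A').card : ℝ) * N ≤ (A' - A').card * (K ^ 9 * B'.card) := by gcongr
      _ = K ^ 9 * ((A' - A').card * B'.card) := by ring
      _ ≤ K ^ 9 * ((K ^ 22 * N) * (K ^ 22 * N)) := by
          exact mul_le_mul_of_nonneg_left (h'.trans (mul_le_mul h2 hBA (Nat.cast_nonneg _) (by positivity)))
            (by positivity)
      _ = _ := by ring
  refine ⟨A', hA', B', hB', h1, hAl, h3, h4, ?_⟩
  have h5 : ((2 • A' - 1 • A').card : ℝ) ≤ (K ^ 53) ^ (2 * (2 + 1) + 1) * N :=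
    card_two_nsmul_sub_le (one_le_pow₀ hK1) hN
      (hAl.trans (by gcongr; norm_num))
      (hAc.trans (by gcongr; exact le_self_pow₀ hK1 (by norm_num))) h3 2 1
  -- The triangle inequality through `A'` reduces `A' - A' - B'` to `2A' - A'`, which Plünnecke
  -- bounds, and to `A' + B'`.
  have h6 := Finset.ruzsa_triangle_inequality_sub_add_add (A' - A') A' B'
  have h7 : A' - A' + A' = 2 • A' - 1 • A' := by
    rw [two_nsmul, one_nsmul, sub_add_eq_add_sub]
  rw [h7] at h6
  have h8 : ((A' - A' - B').card : ℝ) * A'.card ≤ (2 • A' - 1 • A').card * (A' + B').card := by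
    rw [add_comm A' B']
    exact_mod_cast h6
  refine le_of_mul_le_mul_right ?_ hN
  calc ((A' - A' - B').card : ℝ) * N ≤ (A' - A' - B').card * (K ^ 9 * A'.card) := by gcongr
    _ = K ^ 9 * ((A' - A' - B').card * A'.card) := by ring
    _ ≤ K ^ 9 * (((K ^ 53) ^ (2 * (2 + 1) + 1) * N) * (K ^ 22 * N)) := by
        exact mul_le_mul_of_nonneg_left (h8.trans (mul_le_mul h5 h2 (Nat.cast_nonneg _) (by positivity)))
          (by positivity)
    _ = K ^ 402 * N * N := by ring

end AdditiveCombinatorics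

/-! ### From a point set rich in four pencils to a set with few sums and few products. -/

section Core

/-- A point set that is rich with respect to four pencils (two of them with tips at infinity, one
with its tip at the origin, and one arbitrary), in coordinates. -/
structure FourPencilRich {ι κ : Type*} [DecidableEq κ] (K δ N : ℝ) (Q : Finset ι) (x y : ι → ℝ)
    (τ : ι → κ) (lam mu : κ → ℝ) : Prop where
  x_mem : ∀ q ∈ Q, K⁻¹ ≤ x q ∧ x q ≤ K
  y_mem : ∀ q ∈ Q, K⁻¹ ≤ y q ∧ y q ≤ K
  lam_mem : ∀ q ∈ Q, K⁻¹ ≤ |lam (τ q)| ∧ |lam (τ q)| ≤ K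
  mu_mem : ∀ q ∈ Q, K⁻¹ ≤ |mu (τ q)| ∧ |mu (τ q)| ≤ K
  line : ∀ q ∈ Q, |y q - (lam (τ q) * x q + mu (τ q))| ≤ K * δ
  inj : Set.InjOn (fun q => (cell δ (x q), cell δ (y q))) Q
  card_ge : N ^ 2 ≤ K * Q.card
  card_x : ((Q.image (fun q => cell δ (x q))).card : ℝ) ≤ K * N
  card_y : ((Q.image (fun q => cell δ (y q))).card : ℝ) ≤ K * N
  card_div : ((Q.image (fun q => cell δ (x q / y q))).card : ℝ) ≤ K * N
  card_tau : ((Q.image τ).card : ℝ) ≤ K * N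

/-- Since `K ≥ 100`, numerical constants are absorbed into powers of `K`; this is the only
bookkeeping of constants from here on. -/
theorem numeral_mul_pow_le {K c : ℝ} {m k l : ℕ} (hK : 100 ≤ K) (hc : c ≤ 100 ^ m) (hl : m + k ≤ l) :
    c * K ^ k ≤ K ^ l := by
  have hK0 : 0 < K := by linarith
  calc c * K ^ k ≤ K ^ m * K ^ k := by
        gcongr
        exact hc.trans (by gcongr)
    _ = K ^ (m + k) := by rw [pow_add]
    _ ≤ K ^ l := pow_le_pow_right₀ (by linarith) hl

theorem abs_div_sub_div_le {a w a' w' e m M : ℝ} (hm : 0 < m) (hw : m ≤ w) (hw' : m ≤ w')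
    (hM : 0 ≤ M) (hx' : |a' / w'| ≤ M) (ha : |a - a'| ≤ e) (hww : |w - w'| ≤ e) :
    |a / w - a' / w'| ≤ (1 + M) * e / m := by
  have hw0 := hm.trans_le hw
  have hw0' := hm.trans_le hw'
  have he : 0 ≤ e := (abs_nonneg _).trans ha
  have : a / w - a' / w' = ((a - a') - (a' / w') * (w - w')) / w := by
    field_simp; ring
  rw [this, abs_div, abs_of_pos hw0]
  have h1 : |(a - a') - (a' / w') * (w - w')| ≤ (1 + M) * e := by
    calc _ ≤ |a - a'| + |(a' / w') * (w - w')| := abs_sub _ _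
      _ ≤ e + M * e := by rw [abs_mul]; gcongr
      _ = _ := by ring
  gcongr

-- The first use of Balog–Szemerédi–Gowers exploits the three pencils `x`, `y`, `x / y` and is
-- multiplicative; the second exploits a single line of the fourth pencil and turns the
-- multiplicative structure into additive structure.
set_option maxHeartbeats 4000000 in
theorem FourPencilRich.exists_small_sum_and_product {ι κ : Type*} [DecidableEq ι] [DecidableEq κ]
    {K δ N : ℝ} {Q : Finset ι} {x y : ι → ℝ} {τ : ι → κ} {lam mu : κ → ℝ} (hK : 100 ≤ K)
    (hδ : 0 < δ) (hN : 0 < N) (h : FourPencilRich K δ N Q x y τ lam mu) :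
    ∃ S ⊆ Q.image x, N ≤ K ^ 200000 * cov δ S ∧ (cov δ (S + S) : ℝ) ≤ K ^ 200000 * N ∧
      (cov δ (S * S) : ℝ) ≤ K ^ 200000 * N := by
  have hK0 : 0 < K := by linarith
  have hK1 : 1 ≤ K := by linarith
  have hKi : 0 < K⁻¹ := by positivity
  have hx0 : ∀ q ∈ Q, 0 < x q := fun q hq => hKi.trans_le (h.x_mem q hq).1
  have hy0 : ∀ q ∈ Q, 0 < y q := fun q hq => hKi.trans_le (h.y_mem q hq).1
  -- The sign in `v` makes `u + v` a label of `log (x / y)`, so the third pencil bounds the sums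
  -- along the graph `G`.
  set u : ι → ℤ := fun q => cell δ (Real.log (x q)) with hu
  set v : ι → ℤ := fun q => cell δ (-Real.log (y q)) with hv
  have hux : ∀ q ∈ Q, ∀ q' ∈ Q, u q = u q' → |x q - x q'| ≤ K * δ := by
    intro q hq q' hq' he
    refine (abs_sub_le_mul_abs_log_sub (hx0 q hq) (hx0 q' hq') (h.x_mem q hq).2
      (h.x_mem q' hq').2).trans ?_
    gcongr
    exact (abs_sub_lt_of_cell_eq hδ he).le
  have hvy : ∀ q ∈ Q, ∀ q' ∈ Q, v q = v q' → |y q - y q'| ≤ K * δ := by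
    intro q hq q' hq' he
    refine (abs_sub_le_mul_abs_log_sub (hy0 q hq) (hy0 q' hq') (h.y_mem q hq).2
      (h.y_mem q' hq').2).trans ?_
    have := (abs_sub_lt_of_cell_eq hδ he).le
    rw [neg_sub_neg, abs_sub_comm] at this
    gcongr
  set G := Q.image (fun q => (u q, v q)) with hG
  have hGsub : G ⊆ Q.image u ×ˢ Q.image v := by
    intro p hp
    obtain ⟨q, hq, rfl⟩ := Finset.mem_image.1 hp
    exact Finset.mem_product.2 ⟨Finset.mem_image_of_mem _ hq, Finset.mem_image_of_mem _ hq⟩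
  have hUc : ((Q.image u).card : ℝ) ≤ K ^ 4 * N := by
    have := card_image_cell_le Q (fun q => Real.log (x q)) (fun q => cell δ (x q)) (M := K) hδ
      hK0.le (fun q hq q' hq' he => by
        refine (abs_log_sub_log_le hKi (h.x_mem q hq).1 (h.x_mem q' hq').1).trans ?_
        rw [div_inv_eq_mul, mul_comm]
        gcongr
        exact (abs_sub_lt_of_cell_eq hδ he).le)
    calc _ ≤ _ := this
      _ ≤ (3 * K) * (K * N) := mul_le_mul (by linarith) h.card_x (Nat.cast_nonneg _) (by positivity)
      _ = 3 * K ^ 2 * N := by ring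
      _ ≤ _ := by gcongr; exact numeral_mul_pow_le (m := 1) hK (by norm_num) (by norm_num)
  have hVc : ((Q.image v).card : ℝ) ≤ K ^ 4 * N := by
    have := card_image_cell_le Q (fun q => -Real.log (y q)) (fun q => cell δ (y q)) (M := K) hδ
      hK0.le (fun q hq q' hq' he => by
        rw [neg_sub_neg, abs_sub_comm]
        refine (abs_log_sub_log_le hKi (h.y_mem q hq).1 (h.y_mem q' hq').1).trans ?_
        rw [div_inv_eq_mul, mul_comm]
        gcongr
        exact (abs_sub_lt_of_cell_eq hδ he).le)
    calc _ ≤ _ := this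
      _ ≤ (3 * K) * (K * N) := mul_le_mul (by linarith) h.card_y (Nat.cast_nonneg _) (by positivity)
      _ = 3 * K ^ 2 * N := by ring
      _ ≤ _ := by gcongr; exact numeral_mul_pow_le (m := 1) hK (by norm_num) (by norm_num)
  have hGc : N ^ 2 ≤ K ^ 4 * G.card := by
    have h1 := card_image_cell_prod_le Q x y (fun q => (u q, v q)) (M := K) hδ hK0.le
      (fun q hq q' hq' he => hux q hq q' hq' (Prod.ext_iff.1 he).1)
      (fun q hq q' hq' he => hvy q hq q' hq' (Prod.ext_iff.1 he).2)
    rw [Finset.card_image_of_injOn h.inj] at h1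
    calc N ^ 2 ≤ K * Q.card := h.card_ge
      _ ≤ K * ((3 * K) ^ 2 * G.card) := by
          gcongr
          exact h1.trans (by gcongr; linarith)
      _ = 9 * K ^ 3 * G.card := by ring
      _ ≤ _ := by gcongr; exact numeral_mul_pow_le (m := 1) hK (by norm_num) (by norm_num)
  have hCc : ((G.image (fun p => p.1 + p.2)).card : ℝ) ≤ K ^ 4 * N := by
    rw [hG, Finset.image_image]
    have := card_image_int_le Q ((fun p : ℤ × ℤ => p.1 + p.2) ∘ fun q => (u q, v q))
      (fun q => cell δ (x q / y q)) (M := K ^ 2 + 2) (by positivity)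
      (fun q hq q' hq' he => by
        have h1 := (abs_sub_lt_of_cell_eq hδ he).le
        have hlow : ∀ q ∈ Q, (K ^ 2)⁻¹ ≤ x q / y q := by
          intro q hq
          rw [le_div_iff₀ (hy0 q hq)]
          calc (K ^ 2)⁻¹ * y q ≤ (K ^ 2)⁻¹ * K := by gcongr; exact (h.y_mem q hq).2
            _ = K⁻¹ := by field_simp
            _ ≤ _ := (h.x_mem q hq).1
        have h2 := abs_log_sub_log_le (by positivity) (hlow q hq) (hlow q' hq')
        rw [div_inv_eq_mul, Real.log_div (hx0 q hq).ne' (hy0 q hq).ne',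
          Real.log_div (hx0 q' hq').ne' (hy0 q' hq').ne'] at h2
        have h3 := cell_bounds hδ (Real.log (x q))
        have h4 := cell_bounds hδ (Real.log (x q'))
        have h5 := cell_bounds hδ (-Real.log (y q))
        have h6 := cell_bounds hδ (-Real.log (y q'))
        have h7 : |x q / y q - x q' / y q'| * K ^ 2 ≤ δ * K ^ 2 := by gcongr
        have h8 := abs_le.1 (h2.trans h7)
        simp only [Function.comp_apply, hu, hv]
        push_cast
        rw [abs_le]
        constructor
        · refine le_of_mul_le_mul_right ?_ hδ
          nlinarith
        · refine le_of_mul_le_mul_right ?_ hδ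
          nlinarith)
    calc _ ≤ _ := this
      _ ≤ (3 * K ^ 2) * (K * N) :=
          mul_le_mul (by nlinarith) h.card_div (Nat.cast_nonneg _) (by positivity)
      _ = 3 * K ^ 3 * N := by ring
      _ ≤ _ := by gcongr; exact numeral_mul_pow_le (m := 1) hK (by norm_num) (by norm_num)
  have hK4 : 100 ≤ K ^ 4 := hK.trans (le_self_pow₀ hK1 (by norm_num))
  obtain ⟨U, hU, V, hV, hE, -, hUU, hUmU, hUUV⟩ :=
    exists_dense_subgraph_small_doubling _ _ G hGsub hK4 hN hUc hVc hGc hCc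
  set Q' := Q.filter (fun q => u q ∈ U ∧ v q ∈ V) with hQ'
  have hQ'Q : Q' ⊆ Q := Finset.filter_subset _ _
  have hQ'c : N ^ 2 ≤ K ^ 32 * Q'.card := by
    have h1 : G.filter (fun p => p.1 ∈ U ∧ p.2 ∈ V) ⊆ Q'.image (fun q => (u q, v q)) := by
      intro p hp
      obtain ⟨hp, hp'⟩ := Finset.mem_filter.1 hp
      obtain ⟨q, hq, rfl⟩ := Finset.mem_image.1 hp
      exact Finset.mem_image.2 ⟨q, Finset.mem_filter.2 ⟨hq, hp'⟩, rfl⟩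
    have h2 := (Finset.card_le_card h1).trans Finset.card_image_le
    calc N ^ 2 ≤ _ := hE
      _ ≤ (K ^ 4) ^ 8 * Q'.card := by gcongr
      _ = _ := by ring
  -- Pigeonhole: at least about `N ^ 2` points lie on at most about `N` lines, so one line carries
  -- about `N` of them.
  obtain ⟨t, ht⟩ : ∃ t, N ≤ K ^ 33 * (Q'.filter (fun q => τ q = t)).card := by
    by_contra! hcon
    have h1 : Q'.card = ∑ t ∈ Q.image τ, (Q'.filter (fun q => τ q = t)).card :=
      Finset.card_eq_sum_card_fiberwise (fun q hq => Finset.mem_coe.2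
        (Finset.mem_image_of_mem _ (hQ'Q hq)))
    have hQne : (Q.image τ).Nonempty := by
      rw [Finset.image_nonempty, Finset.nonempty_iff_ne_empty]
      rintro rfl
      have := h.card_ge
      simp at this
      nlinarith [sq_nonneg N]
    have h2 : K ^ 33 * (Q'.card : ℝ) < (Q.image τ).card * N := by
      rw [h1]; push_cast
      rw [Finset.mul_sum]
      calc _ < ∑ t ∈ Q.image τ, N := Finset.sum_lt_sum_of_nonempty hQne (fun t _ => hcon t)
        _ = _ := by simp
    have h3 : K * N ^ 2 ≤ K ^ 33 * (Q'.card : ℝ) := by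
      calc K * N ^ 2 ≤ K * (K ^ 32 * Q'.card) := by gcongr
        _ = _ := by ring
    have h4 : ((Q.image τ).card : ℝ) * N ≤ K * N * N := by gcongr; exact h.card_tau
    nlinarith
  set Qt := Q'.filter (fun q => τ q = t) with hQt
  have hQtQ' : Qt ⊆ Q' := Finset.filter_subset _ _
  have hQtQ : Qt ⊆ Q := hQtQ'.trans hQ'Q
  have hQtne : Qt.Nonempty := by
    rw [← Finset.card_pos]
    have : 0 < K ^ 33 * (Qt.card : ℝ) := hN.trans_le ht
    have := pos_of_mul_pos_right this (by positivity)
    exact_mod_cast this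
  set l := lam t with hl
  set m := mu t with hm
  have hτ : ∀ q ∈ Qt, τ q = t := fun q hq => (Finset.mem_filter.1 hq).2
  have hlm : (K⁻¹ ≤ |l| ∧ |l| ≤ K) ∧ (K⁻¹ ≤ |m| ∧ |m| ≤ K) := by
    obtain ⟨q, hq⟩ := hQtne
    have h1 := h.lam_mem q (hQtQ hq)
    have h2 := h.mu_mem q (hQtQ hq)
    rw [hτ q hq] at h1 h2
    exact ⟨h1, h2⟩
  obtain ⟨⟨hl1, hl2⟩, hm1, hm2⟩ := hlm
  have hl0 : 0 < |l| := hKi.trans_le hl1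
  have hm0 : 0 < |m| := hKi.trans_le hm1
  have hline : ∀ q ∈ Qt, |y q - (l * x q + m)| ≤ K * δ := by
    intro q hq
    have := h.line q (hQtQ hq)
    rwa [hτ q hq] at this
  -- the chosen line carries many abscissae
  have hXt : N ≤ K ^ 36 * (Qt.image (fun q => cell δ (x q))).card := by
    have h1 := card_image_cell_prod_le Qt x y (fun q => cell δ (x q)) (M := 3 * K) hδ
      (by positivity)
      (fun q hq q' hq' he => by
        have := (abs_sub_lt_of_cell_eq hδ he).le
        nlinarith)
      (fun q hq q' hq' he => by
        have h1 := (abs_sub_lt_of_cell_eq hδ he).le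
        have h2 := abs_le.1 (hline q hq)
        have h3 := abs_le.1 (hline q' hq')
        have h4 : |l * (x q - x q')| ≤ K * δ := by
          rw [abs_mul]; gcongr
        have h5 := abs_le.1 h4
        rw [abs_le]
        constructor <;> linarith)
    rw [Finset.card_image_of_injOn (h.inj.mono (by exact_mod_cast hQtQ))] at h1
    calc N ≤ K ^ 33 * Qt.card := ht
      _ ≤ K ^ 33 * ((7 * K) ^ 2 * (Qt.image (fun q => cell δ (x q))).card) := by
          refine mul_le_mul_of_nonneg_left (h1.trans ?_) (by positivity)
          gcongr
          linarith
      _ = 49 * K ^ 35 * (Qt.image (fun q => cell δ (x q))).card := by ring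
      _ ≤ _ := by gcongr; exact numeral_mul_pow_le (m := 1) hK (by norm_num) (by norm_num)
  -- For `p = (q₁, q₂)` with `q₂` on the chosen line, `l x₁ + m (x₁ / x₂) = (x₁ / x₂)(l x₂ + m)`,
  -- which is close to `x₁ y₂ / x₂`. The second graph joins the label of `l x₁` to that of `m (x₁ /
  -- x₂)`.
  set P := Q' ×ˢ Qt with hP
  have hP1 : ∀ p ∈ P, p.1 ∈ Q ∧ p.2 ∈ Q := fun p hp =>
    ⟨hQ'Q (Finset.mem_product.1 hp).1, hQtQ (Finset.mem_product.1 hp).2⟩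
  set i : ι → ℤ := fun q => cell δ (l * x q) with hi
  set w : ι × ι → ℝ := fun p => x p.1 / x p.2 with hw
  set j : ι × ι → ℤ := fun p => cell δ (m * w p) with hj
  have hxi : ∀ q ∈ Q, ∀ q' ∈ Q, i q = i q' → |x q - x q'| ≤ K * δ := by
    intro q hq q' hq' he
    have h1 := (abs_sub_lt_of_cell_eq hδ he).le
    rw [← mul_sub, abs_mul] at h1
    calc |x q - x q'| = K * (K⁻¹ * |x q - x q'|) := by field_simp
      _ ≤ K * (|l| * |x q - x q'|) := by gcongr
      _ ≤ K * δ := by gcongr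
  have hwlow : ∀ p ∈ P, (K ^ 2)⁻¹ ≤ w p := by
    intro p hp
    simp only [hw]
    rw [le_div_iff₀ (hx0 _ (hP1 p hp).2)]
    calc (K ^ 2)⁻¹ * x p.2 ≤ (K ^ 2)⁻¹ * K := by gcongr; exact (h.x_mem _ (hP1 p hp).2).2
      _ = K⁻¹ := by field_simp
      _ ≤ _ := (h.x_mem _ (hP1 p hp).1).1
  have hwup : ∀ p ∈ P, w p ≤ K ^ 2 := by
    intro p hp
    simp only [hw]
    rw [div_le_iff₀ (hx0 _ (hP1 p hp).2)]
    calc x p.1 ≤ K := (h.x_mem _ (hP1 p hp).1).2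
      _ = K ^ 2 * K⁻¹ := by field_simp
      _ ≤ _ := by gcongr; exact (h.x_mem _ (hP1 p hp).2).1
  have hw0 : ∀ p ∈ P, 0 < w p := fun p hp => lt_of_lt_of_le (by positivity) (hwlow p hp)
  have hwlog : ∀ p ∈ P, Real.log (w p) = Real.log (x p.1) - Real.log (x p.2) := fun p hp =>
    Real.log_div (hx0 _ (hP1 p hp).1).ne' (hx0 _ (hP1 p hp).2).ne'
  set G2 := P.image (fun p => (i p.1, j p)) with hG2
  have hG2sub : G2 ⊆ Q'.image i ×ˢ P.image j := by
    intro p hp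
    obtain ⟨q, hq, rfl⟩ := Finset.mem_image.1 hp
    exact Finset.mem_product.2 ⟨Finset.mem_image_of_mem _ (Finset.mem_product.1 hq).1,
      Finset.mem_image_of_mem _ hq⟩
  have hIc : ((Q'.image i).card : ℝ) ≤ K ^ 4 * N := by
    have h1 := card_image_cell_le Q' (fun q => l * x q) (fun q => cell δ (x q)) (M := K) hδ
      hK0.le (fun q hq q' hq' he => by
        rw [← mul_sub, abs_mul]
        gcongr
        exact (abs_sub_lt_of_cell_eq hδ he).le)
    have h2 : ((Q'.image (fun q => cell δ (x q))).card : ℝ) ≤ K * N :=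
      le_trans (by exact_mod_cast Finset.card_le_card (Finset.image_subset_image hQ'Q)) h.card_x
    calc _ ≤ _ := h1
      _ ≤ (3 * K) * (K * N) := mul_le_mul (by linarith) h2 (Nat.cast_nonneg _) (by positivity)
      _ = 3 * K ^ 2 * N := by ring
      _ ≤ _ := by gcongr; exact numeral_mul_pow_le (m := 1) hK (by norm_num) (by norm_num)
  -- The logarithm of `x₁ / x₂` has its label close to `U - U`.
  have hJc : ((P.image j).card : ℝ) ≤ K ^ 216 * N := by
    have h1 := card_image_cell_le P (fun p => m * w p) (fun p => u p.1 - u p.2) (M := 2 * K ^ 3) hδ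
      (by positivity) (fun p hp p' hp' he => by
        have hd : |Real.log (w p) - Real.log (w p')| ≤ 2 * δ := by
          rw [hwlog p hp, hwlog p' hp']
          have e1 := cell_bounds hδ (Real.log (x p.1))
          have e2 := cell_bounds hδ (Real.log (x p.2))
          have e3 := cell_bounds hδ (Real.log (x p'.1))
          have e4 := cell_bounds hδ (Real.log (x p'.2))
          have he' : (cell δ (Real.log (x p.1)) : ℝ) - cell δ (Real.log (x p.2)) =
            cell δ (Real.log (x p'.1)) - cell δ (Real.log (x p'.2)) := by exact_mod_cast he
          have he'' := congrArg (· * δ) he'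
          simp only [sub_mul] at he''
          rw [abs_le]
          constructor <;> linarith
        have h2 := abs_sub_le_mul_abs_log_sub (hw0 p hp) (hw0 p' hp') (hwup p hp) (hwup p' hp')
        rw [← mul_sub, abs_mul]
        calc |m| * |w p - w p'| ≤ K * (K ^ 2 * (2 * δ)) := by
              gcongr
              exact h2.trans (by gcongr)
          _ = _ := by ring)
    have h2 : P.image (fun p => u p.1 - u p.2) ⊆ U - U := by
      intro z hz
      obtain ⟨p, hp, rfl⟩ := Finset.mem_image.1 hz
      obtain ⟨hp1, hp2⟩ := Finset.mem_product.1 hp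
      exact Finset.sub_mem_sub (Finset.mem_filter.1 hp1).2.1
        (Finset.mem_filter.1 (hQtQ' hp2)).2.1
    have h3 : ((P.image (fun p => u p.1 - u p.2)).card : ℝ) ≤ (K ^ 4) ^ 53 * N :=
      le_trans (by exact_mod_cast Finset.card_le_card h2) hUmU
    have h4 : 1 ≤ K ^ 3 := one_le_pow₀ hK1
    calc _ ≤ _ := h1
      _ ≤ (7 * K ^ 3) * ((K ^ 4) ^ 53 * N) :=
          mul_le_mul (by linarith) h3 (Nat.cast_nonneg _) (by positivity)
      _ = 7 * K ^ 215 * N := by ring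
      _ ≤ _ := by gcongr; exact numeral_mul_pow_le (m := 1) hK (by norm_num) (by norm_num)
  -- An edge determines `x₁` and `w = x₁ / x₂`, hence also `x₂ = x₁ / w`, up to `O(δ)` with powers
  -- of `K`; so there are about as many edges as pairs of abscissae.
  have hG2c : N ^ 2 ≤ K ^ 90 * G2.card := by
    have h1 := card_image_cell_prod_le P (fun p => x p.1) (fun p => x p.2)
      (fun p => (i p.1, j p)) (M := 2 * K ^ 4 * 2 * K) hδ (by positivity)
      (fun p hp p' hp' he => by
        have := hxi _ (hP1 p hp).1 _ (hP1 p' hp').1 (Prod.ext_iff.1 he).1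
        refine this.trans ?_
        gcongr
        have : 1 ≤ K ^ 4 := one_le_pow₀ hK1
        nlinarith)
      (fun p hp p' hp' he => by
        have e1 := hxi _ (hP1 p hp).1 _ (hP1 p' hp').1 (Prod.ext_iff.1 he).1
        have e2 : |w p - w p'| ≤ K * δ := by
          have h1 := (abs_sub_lt_of_cell_eq hδ (Prod.ext_iff.1 he).2).le
          rw [← mul_sub, abs_mul] at h1
          calc |w p - w p'| = K * (K⁻¹ * |w p - w p'|) := by field_simp
            _ ≤ K * (|m| * |w p - w p'|) := by gcongr
            _ ≤ K * δ := by gcongr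
        have e3 : ∀ p ∈ P, x p.1 / w p = x p.2 := by
          intro p hp
          have := (hx0 _ (hP1 p hp).1).ne'
          have := (hx0 _ (hP1 p hp).2).ne'
          simp only [hw]
          field_simp
        have e4 := abs_div_sub_div_le (a := x p.1) (a' := x p'.1) (M := K)
          (by positivity) (hwlow p hp) (hwlow p' hp')
          hK0.le (by
            rw [e3 p' hp', abs_of_pos (hx0 _ (hP1 p' hp').2)]
            exact (h.x_mem _ (hP1 p' hp').2).2) e1 e2
        rw [e3 p hp, e3 p' hp'] at e4
        refine e4.trans ?_
        rw [div_inv_eq_mul]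
        have : 0 ≤ K ^ 3 * δ := by positivity
        have h5 : 1 ≤ K ^ 2 := one_le_pow₀ hK1
        calc (1 + K) * (K * δ) * K ^ 2 = (1 + K) * (K ^ 3 * δ) := by ring
          _ ≤ (4 * K ^ 2) * (K ^ 3 * δ) := by gcongr; nlinarith
          _ = _ := by ring)
    have h2 : P.image (fun p => (cell δ (x p.1), cell δ (x p.2))) =
        Q'.image (fun q => cell δ (x q)) ×ˢ Qt.image (fun q => cell δ (x q)) := by
      rw [hP, ← Finset.prodMap_image_product]
      rfl
    rw [h2, Finset.card_product] at h1
    push_cast at h1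
    set c := ((Qt.image (fun q => cell δ (x q))).card : ℝ) with hc
    have h3 : c ≤ (Q'.image (fun q => cell δ (x q))).card := by
      rw [hc]
      exact_mod_cast Finset.card_le_card (Finset.image_subset_image hQtQ')
    have h4 : 1 ≤ K ^ 5 := one_le_pow₀ hK1
    calc N ^ 2 ≤ (K ^ 36 * c) ^ 2 := by gcongr
      _ = K ^ 72 * (c * c) := by ring
      _ ≤ K ^ 72 * ((11 * K ^ 5) ^ 2 * G2.card) := by
          refine mul_le_mul_of_nonneg_left ?_ (by positivity)
          calc c * c ≤ (Q'.image (fun q => cell δ (x q))).card * c := by gcongr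
            _ ≤ _ := h1
            _ ≤ _ := by gcongr; nlinarith
      _ = 121 * K ^ 82 * G2.card := by ring
      _ ≤ _ := by gcongr; exact numeral_mul_pow_le (m := 2) hK (by norm_num) (by norm_num)
  -- The sums along the edges are close to `z = x₁ y₂ / x₂`, whose logarithm is labelled by an
  -- element of `U - U - V`.
  have hSc : ((G2.image (fun p => p.1 + p.2)).card : ℝ) ≤ K ^ 1613 * N := by
    rw [hG2, Finset.image_image]
    have h1 := card_image_int_le P ((fun p : ℤ × ℤ => p.1 + p.2) ∘ fun p => (i p.1, j p))
      (fun p => u p.1 - u p.2 - v p.2) (M := 5 * K ^ 3 + 2) (by positivity)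
      (fun p hp p' hp' he => by
        set z : ι × ι → ℝ := fun p => w p * y p.2 with hz
        have hz0 : ∀ p ∈ P, 0 < z p := fun p hp => mul_pos (hw0 p hp) (hy0 _ (hP1 p hp).2)
        have hzup : ∀ p ∈ P, z p ≤ K ^ 3 := by
          intro p hp
          calc z p ≤ K ^ 2 * K :=
                mul_le_mul (hwup p hp) (h.y_mem _ (hP1 p hp).2).2 (hy0 _ (hP1 p hp).2).le
                  (by positivity)
            _ = _ := by ring
        have hzl : ∀ p ∈ P, Real.log (z p) =
            Real.log (x p.1) - Real.log (x p.2) - (- Real.log (y p.2)) := by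
          intro p hp
          rw [hz]
          simp only
          rw [Real.log_mul (hw0 p hp).ne' (hy0 _ (hP1 p hp).2).ne', hwlog p hp]
          ring
        have hd : |Real.log (z p) - Real.log (z p')| ≤ 3 * δ := by
          rw [hzl p hp, hzl p' hp']
          have e1 := cell_bounds hδ (Real.log (x p.1))
          have e2 := cell_bounds hδ (Real.log (x p.2))
          have e3 := cell_bounds hδ (Real.log (x p'.1))
          have e4 := cell_bounds hδ (Real.log (x p'.2))
          have e5 := cell_bounds hδ (-Real.log (y p.2))
          have e6 := cell_bounds hδ (-Real.log (y p'.2))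
          have he' : (cell δ (Real.log (x p.1)) : ℝ) - cell δ (Real.log (x p.2))
              - cell δ (-Real.log (y p.2)) =
            cell δ (Real.log (x p'.1)) - cell δ (Real.log (x p'.2))
              - cell δ (-Real.log (y p'.2)) := by exact_mod_cast he
          have he'' := congrArg (· * δ) he'
          simp only [sub_mul] at he''
          rw [abs_le]
          constructor <;> linarith
        have hzz : |z p - z p'| ≤ K ^ 3 * (3 * δ) :=
          (abs_sub_le_mul_abs_log_sub (hz0 p hp) (hz0 p' hp') (hzup p hp) (hzup p' hp')).trans
            (by gcongr)
        have hzapp : ∀ p ∈ P, |l * x p.1 + m * w p - z p| ≤ K ^ 3 * δ := by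
          intro p hp
          have e1 : l * x p.1 + m * w p - z p = - (w p * (y p.2 - (l * x p.2 + m))) := by
            have := (hx0 _ (hP1 p hp).2).ne'
            simp only [hz, hw]
            field_simp
            ring
          rw [e1, abs_neg, abs_mul, abs_of_pos (hw0 p hp)]
          calc w p * |y p.2 - (l * x p.2 + m)| ≤ K ^ 2 * (K * δ) := by
                gcongr
                · exact hwup p hp
                · exact hline _ (Finset.mem_product.1 hp).2
            _ = _ := by ring
        have h1 := abs_le.1 (hzapp p hp)
        have h2 := abs_le.1 (hzapp p' hp')
        have h3 := abs_le.1 hzz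
        have e1 := cell_bounds hδ (l * x p.1)
        have e2 := cell_bounds hδ (m * w p)
        have e3 := cell_bounds hδ (l * x p'.1)
        have e4 := cell_bounds hδ (m * w p')
        simp only [Function.comp_apply, hi, hj]
        push_cast
        rw [abs_le]
        constructor
        · refine le_of_mul_le_mul_right ?_ hδ
          linarith
        · refine le_of_mul_le_mul_right ?_ hδ
          linarith)
    have h2 : P.image (fun p => u p.1 - u p.2 - v p.2) ⊆ U - U - V := by
      intro z hz
      obtain ⟨p, hp, rfl⟩ := Finset.mem_image.1 hz
      obtain ⟨hp1, hp2⟩ := Finset.mem_product.1 hp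
      have h3 := (Finset.mem_filter.1 (hQtQ' hp2)).2
      exact Finset.sub_mem_sub (Finset.sub_mem_sub (Finset.mem_filter.1 hp1).2.1 h3.1) h3.2
    have h3 : ((P.image (fun p => u p.1 - u p.2 - v p.2)).card : ℝ) ≤ (K ^ 4) ^ 402 * N :=
      le_trans (by exact_mod_cast Finset.card_le_card h2) hUUV
    have h4 : 1 ≤ K ^ 3 := one_le_pow₀ hK1
    calc _ ≤ _ := h1
      _ ≤ (15 * K ^ 3) * ((K ^ 4) ^ 402 * N) :=
          mul_le_mul (by linarith) h3 (Nat.cast_nonneg _) (by positivity)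
      _ = 15 * K ^ 1611 * N := by ring
      _ ≤ _ := by gcongr; exact numeral_mul_pow_le (m := 1) hK (by norm_num) (by norm_num)
  have hK2 : 100 ≤ K ^ 1613 := hK.trans (le_self_pow₀ hK1 (by norm_num))
  obtain ⟨I, hI, J, -, -, hIge, hII, -, -⟩ :=
    exists_dense_subgraph_small_doubling _ _ G2 hG2sub hK2 hN
      (hIc.trans (by gcongr; norm_num))
      (hJc.trans (by gcongr; norm_num))
      (hG2c.trans (by gcongr; norm_num)) hSc
  -- A point of `R` has `i q ∈ I` and, being in `Q'`, also `u q ∈ U`. The bound on `I + I` controls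
  -- sums of abscissae and the bound on `U + U` controls products.
  set R := Q'.filter (fun q => i q ∈ I) with hR
  have hRQ' : R ⊆ Q' := Finset.filter_subset _ _
  have hRQ : R ⊆ Q := hRQ'.trans hQ'Q
  refine ⟨R.image x, Finset.image_subset_image hRQ, ?_, ?_, ?_⟩
  · have h1 := card_image_cell_le R (fun q => l * x q) (fun q => cell δ (x q)) (M := K) hδ
      hK0.le (fun q hq q' hq' he => by
        rw [← mul_sub, abs_mul]
        gcongr
        exact (abs_sub_lt_of_cell_eq hδ he).le)
    have h2 : I ⊆ R.image i := by
      intro z hz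
      obtain ⟨q, hq, rfl⟩ := Finset.mem_image.1 (hI hz)
      exact Finset.mem_image_of_mem _ (Finset.mem_filter.2 ⟨hq, hz⟩)
    have h3 : (I.card : ℝ) ≤ (R.image i).card := by exact_mod_cast Finset.card_le_card h2
    rw [← cov_image δ R x] at h1
    calc N ≤ (K ^ 1613) ^ 9 * I.card := hIge
      _ ≤ (K ^ 1613) ^ 9 * (3 * K * cov δ (R.image x)) := by
          refine mul_le_mul_of_nonneg_left (h3.trans (h1.trans ?_)) (by positivity)
          gcongr
          linarith
      _ = 3 * K ^ 14518 * cov δ (R.image x) := by ring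
      _ ≤ _ := by gcongr; exact numeral_mul_pow_le (m := 1) hK (by norm_num) (by norm_num)
  · have h0 : R.image x + R.image x = (R ×ˢ R).image (fun p => x p.1 + x p.2) := by
      ext z; simp [Finset.mem_add, and_assoc]
    rw [h0, cov_image]
    have h1 := card_image_cell_le (R ×ˢ R) (fun p => x p.1 + x p.2) (fun p => i p.1 + i p.2)
      (M := 2 * K) hδ (by positivity) (fun p hp p' hp' he => by
        have e1 := cell_bounds hδ (l * x p.1)
        have e2 := cell_bounds hδ (l * x p.2)
        have e3 := cell_bounds hδ (l * x p'.1)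
        have e4 := cell_bounds hδ (l * x p'.2)
        have he' : (cell δ (l * x p.1) : ℝ) + cell δ (l * x p.2) =
            cell δ (l * x p'.1) + cell δ (l * x p'.2) := by exact_mod_cast he
        have he'' := congrArg (· * δ) he'
        simp only [add_mul] at he''
        have e5 : |l * (x p.1 + x p.2 - (x p'.1 + x p'.2))| ≤ 2 * δ := by
          rw [abs_le]
          constructor <;> linarith
        rw [abs_mul] at e5
        set X := |x p.1 + x p.2 - (x p'.1 + x p'.2)|
        calc X = K * (K⁻¹ * X) := by field_simp
          _ ≤ K * (|l| * X) := by gcongr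
          _ ≤ K * (2 * δ) := by gcongr
          _ = _ := by ring)
    have h2 : (R ×ˢ R).image (fun p => i p.1 + i p.2) ⊆ I + I := by
      intro z hz
      obtain ⟨p, hp, rfl⟩ := Finset.mem_image.1 hz
      obtain ⟨hp1, hp2⟩ := Finset.mem_product.1 hp
      exact Finset.add_mem_add (Finset.mem_filter.1 hp1).2 (Finset.mem_filter.1 hp2).2
    have h3 : (((R ×ˢ R).image (fun p => i p.1 + i p.2)).card : ℝ) ≤ (K ^ 1613) ^ 53 * N :=
      le_trans (by exact_mod_cast Finset.card_le_card h2) hII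
    calc _ ≤ _ := h1
      _ ≤ (5 * K) * ((K ^ 1613) ^ 53 * N) :=
          mul_le_mul (by linarith) h3 (Nat.cast_nonneg _) (by positivity)
      _ = 5 * K ^ 85490 * N := by ring
      _ ≤ _ := by gcongr; exact numeral_mul_pow_le (m := 1) hK (by norm_num) (by norm_num)
  · have h0 : R.image x * R.image x = (R ×ˢ R).image (fun p => x p.1 * x p.2) := by
      ext z; simp [Finset.mem_mul, and_assoc]
    rw [h0, cov_image]
    have h1 := card_image_cell_le (R ×ˢ R) (fun p => x p.1 * x p.2) (fun p => u p.1 + u p.2)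
      (M := 2 * K ^ 2) hδ (by positivity) (fun p hp p' hp' he => by
        have hR2 : ∀ p ∈ R ×ˢ R, 0 < x p.1 * x p.2 ∧ x p.1 * x p.2 ≤ K ^ 2 ∧
            Real.log (x p.1 * x p.2) = Real.log (x p.1) + Real.log (x p.2) := by
          intro p hp
          obtain ⟨hp1, hp2⟩ := Finset.mem_product.1 hp
          have h1 := hx0 _ (hRQ hp1)
          have h2 := hx0 _ (hRQ hp2)
          refine ⟨mul_pos h1 h2, ?_, Real.log_mul h1.ne' h2.ne'⟩
          rw [pow_two]
          exact mul_le_mul (h.x_mem _ (hRQ hp1)).2 (h.x_mem _ (hRQ hp2)).2 h2.le hK0.le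
        have hd : |Real.log (x p.1 * x p.2) - Real.log (x p'.1 * x p'.2)| ≤ 2 * δ := by
          rw [(hR2 p hp).2.2, (hR2 p' hp').2.2]
          have e1 := cell_bounds hδ (Real.log (x p.1))
          have e2 := cell_bounds hδ (Real.log (x p.2))
          have e3 := cell_bounds hδ (Real.log (x p'.1))
          have e4 := cell_bounds hδ (Real.log (x p'.2))
          have he' : (cell δ (Real.log (x p.1)) : ℝ) + cell δ (Real.log (x p.2)) =
            cell δ (Real.log (x p'.1)) + cell δ (Real.log (x p'.2)) := by exact_mod_cast he
          have he'' := congrArg (· * δ) he'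
          simp only [add_mul] at he''
          rw [abs_le]
          constructor <;> linarith
        refine (abs_sub_le_mul_abs_log_sub (hR2 p hp).1 (hR2 p' hp').1 (hR2 p hp).2.1
          (hR2 p' hp').2.1).trans ?_
        calc _ ≤ K ^ 2 * (2 * δ) := by gcongr
          _ = _ := by ring)
    have h2 : (R ×ˢ R).image (fun p => u p.1 + u p.2) ⊆ U + U := by
      intro z hz
      obtain ⟨p, hp, rfl⟩ := Finset.mem_image.1 hz
      obtain ⟨hp1, hp2⟩ := Finset.mem_product.1 hp
      exact Finset.add_mem_add (Finset.mem_filter.1 (hRQ' hp1)).2.1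
        (Finset.mem_filter.1 (hRQ' hp2)).2.1
    have h3 : (((R ×ˢ R).image (fun p => u p.1 + u p.2)).card : ℝ) ≤ (K ^ 4) ^ 53 * N :=
      le_trans (by exact_mod_cast Finset.card_le_card h2) hUU
    have h4 : 1 ≤ K ^ 2 := one_le_pow₀ hK1
    calc _ ≤ _ := h1
      _ ≤ (7 * K ^ 2) * ((K ^ 4) ^ 53 * N) :=
          mul_le_mul (by linarith) h3 (Nat.cast_nonneg _) (by positivity)
      _ = 7 * K ^ 214 * N := by ring
      _ ≤ _ := by gcongr; exact numeral_mul_pow_le (m := 1) hK (by norm_num) (by norm_num)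

end Core

/-! ### Uniform power gains and the absence of bad configurations. -/

section Gap

/-- The configurations `a` that are bad at scale `δ` with constant `δ ^ (-η)` do not exist, for
some `η > 0` and all small `δ`. -/
def Gap {α : Type*} (Bad : ℝ → ℝ → α → Prop) : Prop :=
  ∃ η : ℝ, 0 < η ∧ η ≤ 1 ∧ ∃ δ₀ : ℝ, 0 < δ₀ ∧ ∀ δ : ℝ, 0 < δ → δ < δ₀ → ∀ a, ¬ Bad δ (δ ^ (-η)) a

theorem exists_forall_lt_le_rpow_neg {η : ℝ} (hη : 0 < η) (M : ℝ) :
    ∃ δ₀ : ℝ, 0 < δ₀ ∧ δ₀ ≤ 1 ∧ ∀ δ : ℝ, 0 < δ → δ < δ₀ → M ≤ δ ^ (-η) := by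
  set M' := max M 1 with hM'
  have hM1 : 1 ≤ M' := le_max_right _ _
  have hM0 : 0 < M' := by linarith
  refine ⟨M' ^ (-(1 / η)), Real.rpow_pos_of_pos hM0 _,
    Real.rpow_le_one_of_one_le_of_nonpos hM1 (by simp [hη.le]), ?_⟩
  intro δ hδ h
  refine (le_max_left M 1).trans ?_
  have h1 : (M' ^ (-(1 / η))) ^ (-η) ≤ δ ^ (-η) :=
    Real.rpow_le_rpow_of_nonpos hδ h.le (by linarith)
  rwa [← Real.rpow_mul hM0.le, show -(1 / η) * -η = 1 by field_simp, Real.rpow_one] at h1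

/-- If no second object is bad with constant `δ ^ (-η)`, then no first object is bad with constant
`δ ^ (-(η / c))`, since the latter raised to the power `c` is the former. The bound `η ≤ 1` in `Gap`
is what supplies `K ^ c * δ ≤ 1` to the construction. -/
theorem Gap.transfer {α β : Type*} {Bad₁ : ℝ → ℝ → α → Prop} {Bad₂ : ℝ → ℝ → β → Prop} {c : ℕ}
    (hc : 0 < c)
    (h : ∀ K δ : ℝ, 100 ≤ K → 0 < δ → K ^ c * δ ≤ 1 → ∀ a, Bad₁ δ K a → ∃ b, Bad₂ δ (K ^ c) b)
    (hg : Gap Bad₂) : Gap Bad₁ := by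
  obtain ⟨η, hη, hη1, δ₀, hδ₀, hb⟩ := hg
  have hc' : (0 : ℝ) < c := by exact_mod_cast hc
  have hηc : 0 < η / c := by positivity
  obtain ⟨δ₁, hδ₁, hδ₁1, hM⟩ := exists_forall_lt_le_rpow_neg hηc 100
  refine ⟨η / c, hηc, (div_le_self hη.le (by exact_mod_cast hc)).trans hη1, min δ₀ δ₁,
    lt_min hδ₀ hδ₁, ?_⟩
  intro δ hδ hlt a ha
  have hK := hM δ hδ (hlt.trans_le (min_le_right _ _))
  have hpow : (δ ^ (-(η / c))) ^ c = δ ^ (-η) := by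
    rw [← Real.rpow_natCast, ← Real.rpow_mul hδ.le]
    congr 1
    field_simp
  have hδ1 : δ ≤ 1 := (hlt.le.trans (min_le_right _ _)).trans hδ₁1
  obtain ⟨b, hb'⟩ := h _ δ hK hδ (by
    rw [hpow]
    nth_rewrite 2 [← Real.rpow_one δ]
    rw [← Real.rpow_add hδ]
    exact Real.rpow_le_one hδ.le hδ1 (by linarith)) a ha
  rw [hpow] at hb'
  exact hb δ hδ (hlt.trans_le (min_le_left _ _)) b hb'

/-- A statement with a uniform gain `δ ^ (-ε₀)` for all families of constants self-improves to a
statement in which the hypotheses may lose a small power of `δ`. -/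
theorem Gap.of_uniform {α : Type*} {Hyp Bad : ℝ → ℝ → α → Prop} {P : ℝ → ℝ → ℝ → α → Prop} {m : ℕ}
    (hmono : ∀ δ κ κ' a, 0 < δ → κ ≤ κ' → Hyp δ κ a → Hyp δ κ' a)
    (hbad : ∀ δ K a, 0 < δ → Bad δ K a → Hyp δ K a)
    (hstat : ∃ ε₀ : ℝ, 0 < ε₀ ∧ ∀ C : ℝ → ℝ, ∃ c : ℝ, 0 < c ∧ ∀ δ a, 0 < δ → δ < 1 →
      (∀ ε : ℝ, 0 < ε → Hyp δ (C ε * δ ^ (-ε)) a) → P ε₀ c δ a)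
    (hinc : ∀ ε₀ c δ K a, 0 < ε₀ → 0 < c → 0 < δ → δ < 1 → 1 ≤ K → Bad δ K a → P ε₀ c δ a →
      c * δ ^ (-ε₀) ≤ K ^ m) : Gap Bad := by
  -- If the gap fails, there is a bad configuration with exponent `1 / (n + 1)` at a scale below `1
  -- / (n + 2)` for every `n`. One function `C` is built that admits the whole sequence, and the
  -- single constant `c` obtained for it fails as `n → ∞`.
  by_contra hcon
  have key : ∀ n : ℕ, ∃ δ : ℝ, ∃ a, 0 < δ ∧ δ < 1 / (n + 2 : ℝ) ∧
      Bad δ (δ ^ (-(1 / (n + 1 : ℝ)))) a := by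
    intro n
    by_contra! hn
    refine hcon ⟨1 / (n + 1 : ℝ), by positivity, ?_, 1 / (n + 2 : ℝ), by positivity, ?_⟩
    · rw [div_le_one (by positivity)]; linarith [Nat.cast_nonneg (α := ℝ) n]
    · exact fun δ hδ hlt a => hn δ a hδ hlt
  choose d a hd0 hdlt hdbad using key
  have hd1 : ∀ n, d n < 1 := fun n => (hdlt n).trans_le (by
    rw [div_le_one (by positivity)]; linarith [Nat.cast_nonneg (α := ℝ) n])
  obtain ⟨ε₀, hε₀, hst⟩ := hstat
  -- For given `ε`, all `n` with `1 / (n + 1) ≤ ε` satisfy the hypothesis already with constant `1`.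
  -- The remaining `n` are below `⌈1 / ε⌉`, and the finite sum absorbs them through `δ ^ (-(1 / (n +
  -- 1))) ≤ δ⁻¹`.
  set C : ℝ → ℝ := fun ε => 1 + ∑ i ∈ Finset.range ⌈1 / ε⌉₊, (d i)⁻¹ with hC
  obtain ⟨c, hc, hst⟩ := hst C
  have hCge : ∀ ε, 1 ≤ C ε := fun ε => by
    have : 0 ≤ ∑ i ∈ Finset.range ⌈1 / ε⌉₊, (d i)⁻¹ :=
      Finset.sum_nonneg fun i _ => (inv_pos.2 (hd0 i)).le
    simp only [hC]; linarith
  have hP : ∀ n, P ε₀ c (d n) (a n) := by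
    intro n
    refine hst _ _ (hd0 n) (hd1 n) fun ε hε => ?_
    refine hmono _ _ _ _ (hd0 n) ?_ (hbad _ _ _ (hd0 n) (hdbad n))
    have hpos : 0 < (d n) ^ (-ε) := Real.rpow_pos_of_pos (hd0 n) _
    rcases le_total (1 / (n + 1 : ℝ)) ε with hle | hle
    · calc (d n) ^ (-(1 / (n + 1 : ℝ))) ≤ (d n) ^ (-ε) :=
          Real.rpow_le_rpow_of_exponent_ge (hd0 n) (hd1 n).le (by linarith)
        _ ≤ _ := le_mul_of_one_le_left hpos.le (hCge ε)
    · have hn : n ∈ Finset.range ⌈1 / ε⌉₊ := by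
        rw [Finset.mem_range, Nat.lt_ceil]
        have : (n + 1 : ℝ) ≤ 1 / ε := by
          rw [le_div_iff₀ hε]
          rw [le_div_iff₀ (by positivity)] at hle
          linarith
        linarith
      have h1 : (d n)⁻¹ ≤ C ε := by
        have := Finset.single_le_sum (f := fun i => (d i)⁻¹)
          (fun i _ => (inv_pos.2 (hd0 i)).le) hn
        simp only [hC]
        linarith
      have h2 : 1 ≤ (d n) ^ (-ε) :=
        Real.one_le_rpow_of_pos_of_le_one_of_nonpos (hd0 n) (hd1 n).le (by linarith)
      calc (d n) ^ (-(1 / (n + 1 : ℝ))) ≤ (d n) ^ (-1 : ℝ) := by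
            refine Real.rpow_le_rpow_of_exponent_ge (hd0 n) (hd1 n).le ?_
            rw [neg_le_neg_iff, div_le_one (by positivity)]
            linarith [Nat.cast_nonneg (α := ℝ) n]
        _ = (d n)⁻¹ := Real.rpow_neg_one _
        _ ≤ C ε := h1
        _ ≤ _ := le_mul_of_one_le_right (by linarith [hCge ε]) h2
  -- From this `n` on, the loss `K ^ m` is at most `δ ^ (-(ε₀ / 2))`, half of the gain in the
  -- exponent.
  have hfin : ∀ n : ℕ, 2 * m / ε₀ ≤ n → c ≤ (1 / (n + 2 : ℝ)) ^ (ε₀ / 2) := by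
    intro n hn
    have hK1 : 1 ≤ (d n) ^ (-(1 / (n + 1 : ℝ))) :=
      Real.one_le_rpow_of_pos_of_le_one_of_nonpos (hd0 n) (hd1 n).le
        (by rw [neg_nonpos]; positivity)
    have h1 := hinc _ _ _ _ _ hε₀ hc (hd0 n) (hd1 n) hK1 (hdbad n) (hP n)
    rw [← Real.rpow_natCast, ← Real.rpow_mul (hd0 n).le] at h1
    have h2 : (d n) ^ (-(1 / (n + 1 : ℝ)) * m) ≤ (d n) ^ (-(ε₀ / 2)) := by
      refine Real.rpow_le_rpow_of_exponent_ge (hd0 n) (hd1 n).le ?_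
      rw [neg_mul, neg_le_neg_iff, one_div_mul_eq_div, div_le_iff₀ (by positivity)]
      rw [div_le_iff₀ hε₀] at hn
      nlinarith
    have h3 : c * (d n) ^ (-ε₀) * (d n) ^ ε₀ ≤ (d n) ^ (-(ε₀ / 2)) * (d n) ^ ε₀ := by
      gcongr
      · exact (Real.rpow_pos_of_pos (hd0 n) _).le
      · exact h1.trans h2
    rw [mul_assoc, ← Real.rpow_add (hd0 n), ← Real.rpow_add (hd0 n)] at h3
    rw [show -ε₀ + ε₀ = 0 by ring, Real.rpow_zero, mul_one,
      show -(ε₀ / 2) + ε₀ = ε₀ / 2 by ring] at h3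
    exact h3.trans (Real.rpow_le_rpow (hd0 n).le (hdlt n).le (by positivity))
  have hlim : Filter.Tendsto (fun n : ℕ => (1 / (n + 2 : ℝ)) ^ (ε₀ / 2)) Filter.atTop (nhds 0) := by
    have h1 : Filter.Tendsto (fun n : ℕ => (1 / (n + 2 : ℝ))) Filter.atTop (nhds 0) := by
      have := (Filter.tendsto_add_atTop_iff_nat 1).2 (tendsto_one_div_add_atTop_nhds_zero_nat (𝕜 := ℝ))
      refine this.congr fun n => ?_
      push_cast; ring_nf
    have := h1.rpow_const (p := ε₀ / 2) (Or.inr (by positivity))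
    rwa [Real.zero_rpow (by positivity)] at this
  have hev := hlim.eventually (gt_mem_nhds hc)
  obtain ⟨n, hn1, hn2⟩ := (hev.and (Filter.eventually_ge_atTop ⌈2 * m / ε₀⌉₊)).exists
  exact absurd (hfin n ((Nat.le_ceil _).trans (by exact_mod_cast hn2))) (not_le.2 hn1)

/-- Only the hypothesis at `ε = η / 4` is needed for small `δ`: there `C (η / 4)` is itself at most
`δ ^ (-(η / 4))`, so the total loss is `δ ^ (-(η / 2))`. For `δ` bounded below, a trivial estimate
suffices and only affects `c`. -/
theorem Gap.uniform {α : Type*} {Hyp Bad : ℝ → ℝ → α → Prop} {P : ℝ → ℝ → ℝ → α → Prop}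
    (hmono : ∀ δ κ κ' a, 0 < δ → κ ≤ κ' → Hyp δ κ a → Hyp δ κ' a)
    (hPmono : ∀ ε₀ c c' δ a, 0 < δ → 0 < c' → c' ≤ c → P ε₀ c δ a → P ε₀ c' δ a)
    (h1 : ∀ η δ a, 0 < η → 0 < δ → δ < 1 → Hyp δ (δ ^ (-(η / 2))) a → ¬ P (η / 2) 1 δ a →
      Bad δ (δ ^ (-η)) a)
    (h2 : ∀ ε₀ δ₁ : ℝ, 0 < ε₀ → ε₀ ≤ 1 → 0 < δ₁ → ∃ c : ℝ, 0 < c ∧ ∀ δ κ a, δ₁ ≤ δ → δ < 1 →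
      Hyp δ κ a → P ε₀ c δ a)
    (hg : Gap Bad) : ∃ ε₀ : ℝ, 0 < ε₀ ∧ ∀ C : ℝ → ℝ, ∃ c : ℝ, 0 < c ∧ ∀ δ a, 0 < δ → δ < 1 →
      (∀ ε : ℝ, 0 < ε → Hyp δ (C ε * δ ^ (-ε)) a) → P ε₀ c δ a := by
  obtain ⟨η, hη, hη1, δ₀, hδ₀, hb⟩ := hg
  refine ⟨η / 2, by positivity, fun C => ?_⟩
  obtain ⟨δ₁, hδ₁, -, hM⟩ := exists_forall_lt_le_rpow_neg (show 0 < η / 4 by positivity) (C (η / 4))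
  obtain ⟨c, hc, hP⟩ := h2 (η / 2) (min δ₀ δ₁) (by positivity) (by linarith) (lt_min hδ₀ hδ₁)
  refine ⟨min c 1, lt_min hc one_pos, fun δ a hδ hδ1 hH => ?_⟩
  rcases le_or_gt (min δ₀ δ₁) δ with hle | hlt
  · exact hPmono _ _ _ _ _ hδ (lt_min hc one_pos) (min_le_left _ _)
      (hP δ _ a hle hδ1 (hH 1 one_pos))
  · refine hPmono _ _ _ _ _ hδ (lt_min hc one_pos) (min_le_right _ _) ?_
    by_contra hcon
    refine hb δ hδ (hlt.trans_le (min_le_left _ _)) a (h1 η δ a hη hδ hδ1 ?_ hcon)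
    refine hmono _ _ _ _ hδ ?_ (hH (η / 4) (by positivity))
    calc C (η / 4) * δ ^ (-(η / 4)) ≤ δ ^ (-(η / 4)) * δ ^ (-(η / 4)) := by
          gcongr
          exact hM δ hδ (hlt.trans_le (min_le_right _ _))
      _ = _ := by rw [← Real.rpow_add hδ]; congr 1; ring

end Gap

/-! ### Lebesgue measure and numbers of cells. -/

section Volume

theorem volume_real_le_of_subset_iUnion_ball {A : Set ℝ} {T : Finset ℝ} {δ M : ℝ} (hδ : 0 < δ)
    (hM : 0 ≤ M) (h : A ⊆ ⋃ t ∈ T, Metric.ball t (M * δ)) :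
    volume.real A ≤ (2 * M + 1) * δ * cov δ T := by
  have hsub : A ⊆ ⋃ i ∈ T.image (cell δ), Ioo (((i : ℝ) - M) * δ) (((i : ℝ) + 1 + M) * δ) := by
    intro y hy
    obtain ⟨t, ht, hyt⟩ := mem_iUnion₂.1 (h hy)
    refine mem_iUnion₂.2 ⟨cell δ t, Finset.mem_image_of_mem _ ht, ?_⟩
    have h1 := cell_bounds hδ t
    rw [Metric.mem_ball, Real.dist_eq, abs_lt] at hyt
    constructor <;> nlinarith
  calc volume.real A ≤ volume.real
        (⋃ i ∈ T.image (cell δ), Ioo (((i : ℝ) - M) * δ) (((i : ℝ) + 1 + M) * δ)) := by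
        refine measureReal_mono hsub ?_
        refine ((measure_biUnion_finset_le _ _).trans_lt ?_).ne
        refine ENNReal.sum_lt_top.2 fun i _ => ?_
        rw [Real.volume_Ioo]; exact ENNReal.ofReal_lt_top
    _ ≤ ∑ i ∈ T.image (cell δ), volume.real (Ioo (((i : ℝ) - M) * δ) (((i : ℝ) + 1 + M) * δ)) :=
        measureReal_biUnion_finset_le _ _
    _ = ∑ i ∈ T.image (cell δ), (2 * M + 1) * δ := by
        refine Finset.sum_congr rfl fun i _ => ?_
        rw [Real.volume_real_Ioo_of_le (by nlinarith)]
        ring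
    _ = _ := by rw [Finset.sum_const, nsmul_eq_mul, cov]; ring

theorem cov_le_volume_real {A : Set ℝ} {T : Finset ℝ} {δ : ℝ} (hδ : 0 < δ)
    (hA : volume A ≠ ⊤) (h : ∀ t ∈ T, Metric.ball t δ ⊆ A) :
    δ * cov δ T ≤ volume.real A := by
  -- A half-open cell of side `δ` lies in the open ball of radius `δ` about any of its points, so
  -- disjoint cells fit into `A`.
  have hsub : (⋃ i ∈ T.image (cell δ), Ico ((i : ℝ) * δ) (((i : ℝ) + 1) * δ)) ⊆ A := by
    refine iUnion₂_subset fun i hi => ?_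
    obtain ⟨t, ht, rfl⟩ := Finset.mem_image.1 hi
    refine Subset.trans (fun y hy => ?_) (h t ht)
    have h1 := cell_bounds hδ t
    rw [Metric.mem_ball, Real.dist_eq, abs_lt]
    constructor <;> nlinarith [hy.1, hy.2]
  have hdisj : Set.PairwiseDisjoint (↑(T.image (cell δ)) : Set ℤ)
      (fun i : ℤ => Ico ((i : ℝ) * δ) (((i : ℝ) + 1) * δ)) := by
    intro i _ j _ hij
    rw [Function.onFun, Set.disjoint_left]
    rintro y ⟨h1, h2⟩ ⟨h3, h4⟩
    apply hij
    have e1 : (i : ℝ) < j + 1 := lt_of_mul_lt_mul_right (h1.trans_lt h4) hδ.le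
    have e2 : (j : ℝ) < i + 1 := lt_of_mul_lt_mul_right (h3.trans_lt h2) hδ.le
    have e1' : i < j + 1 := by exact_mod_cast e1
    have e2' : j < i + 1 := by exact_mod_cast e2
    omega
  calc δ * cov δ T = ∑ i ∈ T.image (cell δ), volume.real (Ico ((i : ℝ) * δ) (((i : ℝ) + 1) * δ)) := by
        rw [cov, mul_comm, ← nsmul_eq_mul, ← Finset.sum_const]
        refine Finset.sum_congr rfl fun i _ => ?_
        rw [Real.volume_real_Ico_of_le (by nlinarith)]
        ring
    _ = volume.real (⋃ i ∈ T.image (cell δ), Ico ((i : ℝ) * δ) (((i : ℝ) + 1) * δ)) := by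
        rw [measureReal_biUnion_finset hdisj (fun _ _ => measurableSet_Ico)
          (fun i _ => by rw [Real.volume_Ico]; exact ENNReal.ofReal_ne_top)]
    _ ≤ _ := measureReal_mono hsub hA

theorem cov_image_le {S : Finset ℝ} {f : ℝ → ℝ} {δ δ' M : ℝ} (hδ : 0 < δ) (hδ' : 0 < δ') (hM : 0 ≤ M)
    (h : ∀ x ∈ S, ∀ y ∈ S, |x - y| ≤ δ' → |f x - f y| ≤ M * δ) :
    (cov δ (S.image f) : ℝ) ≤ (2 * M + 3) * cov δ' S := by
  rw [cov_image]
  exact card_image_cell_le S f (cell δ') hδ hM fun x hx y hy he =>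
    h x hx y hy (abs_sub_lt_of_cell_eq hδ' he).le

theorem cov_le_of_image {S : Finset ℝ} {f : ℝ → ℝ} {δ δ' M : ℝ} (hδ : 0 < δ) (hδ' : 0 < δ')
    (hM : 0 ≤ M) (h : ∀ x ∈ S, ∀ y ∈ S, |f x - f y| ≤ δ' → |x - y| ≤ M * δ) :
    (cov δ S : ℝ) ≤ (2 * M + 3) * cov δ' (S.image f) := by
  rw [cov_image]
  exact card_image_cell_le S (fun x => x) (fun x => cell δ' (f x)) hδ hM fun x hx y hy he =>
    h x hx y hy (abs_sub_lt_of_cell_eq hδ' he).le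

end Volume

/-! ### The expansion estimates as gap statements for finite sets. -/

section SetStatements

/-- The non-concentration condition in terms of numbers of cells. -/
def NonConc (σ δ K : ℝ) (S : Finset ℝ) : Prop :=
  ∀ a r : ℝ, δ ≤ r → (cov δ (S.filter (fun x => |x - a| ≤ r)) : ℝ) ≤ K * (r / δ) ^ σ

/-- The hypotheses on a `(δ, σ)`-set `A ⊆ I` of measure about `δ ^ (1 - σ)`, with constant `κ`. -/
structure DeltaSetHyp (I : Set ℝ) (σ δ κ : ℝ) (A : Set ℝ) : Prop where
  subset : A ⊆ I
  discretized : IsDiscretized δ A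
  nonconc : ∀ a r : ℝ, δ < r → r < 1 → volume.real (A ∩ Metric.ball a r) ≤ κ * (δ * (r / δ) ^ σ)
  le : volume.real A ≤ κ * δ ^ (1 - σ)
  ge : δ ^ (1 - σ) ≤ κ * volume.real A

/-- A counterexample with constant `K` to the expansion of the set function `f`. -/
structure DeltaSetBad (I : Set ℝ) (f : Set ℝ → ℝ) (σ δ K : ℝ) (A : Set ℝ) : Prop
    extends DeltaSetHyp I σ δ K A where
  small : f A ≤ K * δ ^ (1 - σ)

/-- The expansion estimate `f A ≳ δ ^ (-ε₀) |A|` for `(δ, σ)`-sets. -/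
def ExpansionEstimate (I : Set ℝ) (f : Set ℝ → ℝ) (σ : ℝ) : Prop :=
  ∃ ε₀ : ℝ, 0 < ε₀ ∧ ∀ C : ℝ → ℝ, ∃ c : ℝ, 0 < c ∧
    ∀ (δ : ℝ) (A : Set ℝ), 0 < δ → δ < 1 → A ⊆ I →
      IsDeltaSet C δ σ A → ApproxEq C δ (volume.real A) (δ ^ (1 - σ)) →
      c * (δ ^ (-ε₀) * volume.real A) ≤ f A

theorem deltaSetHyp_forall_iff {I : Set ℝ} {σ δ : ℝ} {C : ℝ → ℝ} {A : Set ℝ} :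
    (∀ ε : ℝ, 0 < ε → DeltaSetHyp I σ δ (C ε * δ ^ (-ε)) A) ↔
      A ⊆ I ∧ IsDeltaSet C δ σ A ∧ ApproxEq C δ (volume.real A) (δ ^ (1 - σ)) := by
  constructor
  · intro h
    exact ⟨(h 1 one_pos).subset, ⟨(h 1 one_pos).discretized,
      fun a r h1 h2 ε hε => (h ε hε).nonconc a r h1 h2⟩,
      fun ε hε => (h ε hε).le, fun ε hε => (h ε hε).ge⟩
  · rintro ⟨h1, ⟨h2, h3⟩, h4, h5⟩ ε hε
    exact ⟨h1, h2, fun a r h6 h7 => h3 a r h6 h7 ε hε, h4 ε hε, h5 ε hε⟩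

theorem expansionEstimate_iff {I : Set ℝ} {f : Set ℝ → ℝ} {σ : ℝ} :
    ExpansionEstimate I f σ ↔ ∃ ε₀ : ℝ, 0 < ε₀ ∧ ∀ C : ℝ → ℝ, ∃ c : ℝ, 0 < c ∧
      ∀ (δ : ℝ) (A : Set ℝ), 0 < δ → δ < 1 →
        (∀ ε : ℝ, 0 < ε → DeltaSetHyp I σ δ (C ε * δ ^ (-ε)) A) →
        c * (δ ^ (-ε₀) * volume.real A) ≤ f A := by
  simp only [deltaSetHyp_forall_iff, ExpansionEstimate, and_imp]

theorem DeltaSetHyp.mono {I : Set ℝ} {σ δ κ κ' : ℝ} {A : Set ℝ} (hδ : 0 < δ) (hκ : κ ≤ κ')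
    (h : DeltaSetHyp I σ δ κ A) : DeltaSetHyp I σ δ κ' A := by
  have := Real.rpow_pos_of_pos hδ (1 - σ)
  refine ⟨h.subset, h.discretized, fun a r h1 h2 => (h.nonconc a r h1 h2).trans ?_,
    h.le.trans (by gcongr), h.ge.trans (by gcongr)⟩
  have : 0 < (r / δ) ^ σ := Real.rpow_pos_of_pos (div_pos (hδ.trans h1) hδ) _
  gcongr

/-- For a bad set, `f A ≤ K δ ^ (1 - σ) ≤ K ^ 2 |A|`, which contradicts the gain as soon as `K ^ 2`
is smaller than it; hence `m = 2`. -/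
theorem gap_of_expansionEstimate {I : Set ℝ} {f : Set ℝ → ℝ} {σ : ℝ}
    (h : ExpansionEstimate I f σ) : Gap (DeltaSetBad I f σ) := by
  rw [expansionEstimate_iff] at h
  refine Gap.of_uniform (m := 2) (Hyp := DeltaSetHyp I σ)
    (P := fun ε₀ c δ A => c * (δ ^ (-ε₀) * volume.real A) ≤ f A)
    (fun δ κ κ' A hδ hκ hH => hH.mono hδ hκ) (fun δ K A _ hb => hb.toDeltaSetHyp) h ?_
  intro ε₀ c δ K A hε hc hδ hδ1 hK hb hP
  have h1 := Real.rpow_pos_of_pos hδ (1 - σ)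
  have hA : 0 < volume.real A :=
    pos_of_mul_pos_right (h1.trans_le hb.ge) (by linarith)
  refine le_of_mul_le_mul_right ?_ hA
  calc c * δ ^ (-ε₀) * volume.real A ≤ f A := by rw [mul_assoc]; exact hP
    _ ≤ K * δ ^ (1 - σ) := hb.small
    _ ≤ K * (K * volume.real A) := by gcongr; exact hb.ge
    _ = _ := by ring

/-- The trivial bound `hf` covers the scales bounded away from `0`. At small scales, failure of the
gain bounds `f A` by `δ ^ (-(η / 2)) |A|`, and the measure bound costs one more such factor. -/
theorem expansionEstimate_of_gap {I : Set ℝ} {f : Set ℝ → ℝ} {σ : ℝ}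
    (hf : ∃ c : ℝ, 0 < c ∧ ∀ A ⊆ I, c * volume.real A ≤ f A)
    (h : Gap (DeltaSetBad I f σ)) : ExpansionEstimate I f σ := by
  rw [expansionEstimate_iff]
  refine Gap.uniform (Hyp := DeltaSetHyp I σ) (Bad := DeltaSetBad I f σ)
    (P := fun ε₀ c δ A => c * (δ ^ (-ε₀) * volume.real A) ≤ f A)
    (fun δ κ κ' A hδ hκ hH => hH.mono hδ hκ) ?_ ?_ ?_ h
  · intro ε₀ c c' δ A hδ _ hcc hP
    have := Real.rpow_pos_of_pos hδ (-ε₀)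
    exact le_trans (by gcongr) hP
  · intro η δ A hη hδ hδ1 hH hP
    have h1 : δ ^ (-(η / 2)) ≤ δ ^ (-η) :=
      Real.rpow_le_rpow_of_exponent_ge hδ hδ1.le (by linarith)
    refine ⟨hH.mono hδ h1, ?_⟩
    rw [not_le, one_mul] at hP
    calc f A ≤ δ ^ (-(η / 2)) * volume.real A := hP.le
      _ ≤ δ ^ (-(η / 2)) * (δ ^ (-(η / 2)) * δ ^ (1 - σ)) := by
          have := Real.rpow_pos_of_pos hδ (-(η / 2))
          gcongr
          exact hH.le
      _ = _ := by
          rw [← mul_assoc, ← Real.rpow_add hδ]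
          congr 2
          ring
  · intro ε₀ δ₁ hε hε1 hδ₁
    obtain ⟨c, hc, hf⟩ := hf
    have hp := Real.rpow_pos_of_pos hδ₁ ε₀
    refine ⟨c * δ₁ ^ ε₀, by positivity, fun δ κ A h1 h2 hH => ?_⟩
    refine le_trans ?_ (hf A hH.subset)
    have h3 : δ₁ ^ ε₀ * δ ^ (-ε₀) ≤ 1 := by
      rw [Real.rpow_neg (hδ₁.le.trans h1), ← div_eq_mul_inv, div_le_one
        (Real.rpow_pos_of_pos (hδ₁.trans_le h1) _)]
      exact Real.rpow_le_rpow hδ₁.le h1 hε.le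
    calc _ = c * (δ₁ ^ ε₀ * δ ^ (-ε₀)) * volume.real A := by ring
      _ ≤ c * 1 * volume.real A := by gcongr
      _ = _ := by ring

/-- The set functions of the sum-product and of the shifted-product estimate. -/
noncomputable def sumProd (A : Set ℝ) : ℝ := max (volume.real (A + A)) (volume.real (A * A))

/-- See `sumProd`. -/
noncomputable def prodShift (A : Set ℝ) : ℝ :=
  max (volume.real (A * A)) (volume.real (({1} - A) * ({1} - A)))

theorem discretizedSumProduct_iff : DiscretizedSumProduct ↔
    ∀ σ : ℝ, 0 < σ → σ < 1 → ExpansionEstimate (Icc 0 1) sumProd σ := Iff.rfl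

theorem productShiftedProduct_iff : ProductShiftedProduct ↔
    ∀ σ : ℝ, 0 < σ → σ < 1 → ExpansionEstimate (Icc (1 / 4) (1 / 2)) prodShift σ := Iff.rfl

theorem volume_ne_top_of_subset_Icc {A : Set ℝ} {a b : ℝ} (h : A ⊆ Icc a b) : volume A ≠ ⊤ :=
  ((measure_mono h).trans_lt (by rw [Real.volume_Icc]; exact ENNReal.ofReal_lt_top)).ne

theorem add_subset_Icc {A B : Set ℝ} {a b c d : ℝ} (hA : A ⊆ Icc a b) (hB : B ⊆ Icc c d) :
    A + B ⊆ Icc (a + c) (b + d) := by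
  rintro _ ⟨x, hx, y, hy, rfl⟩
  exact ⟨add_le_add (hA hx).1 (hB hy).1, add_le_add (hA hx).2 (hB hy).2⟩

theorem mul_subset_Icc {A B : Set ℝ} (hA : A ⊆ Icc 0 1) (hB : B ⊆ Icc 0 1) :
    A * B ⊆ Icc 0 1 := by
  rintro _ ⟨x, hx, y, hy, rfl⟩
  exact ⟨mul_nonneg (hA hx).1 (hB hy).1, mul_le_one₀ (hA hx).2 (hB hy).1 (hB hy).2⟩

theorem volume_real_le_sumProd {A : Set ℝ} (hA : A ⊆ Icc 0 1) : 1 * volume.real A ≤ sumProd A := by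
  rw [one_mul]
  refine le_trans ?_ (le_max_left _ _)
  rcases A.eq_empty_or_nonempty with rfl | ⟨a, ha⟩
  · simp
  · have h1 : (fun x => a + x) '' A ⊆ A + A := by
      rintro _ ⟨x, hx, rfl⟩
      exact Set.add_mem_add ha hx
    calc volume.real A = volume.real ((fun x => a + x) '' A) := by
          simp [measureReal_def, image_add_left]
      _ ≤ _ := measureReal_mono h1 (volume_ne_top_of_subset_Icc (add_subset_Icc hA hA))

theorem volume_real_le_prodShift {A : Set ℝ} (hA : A ⊆ Icc (1 / 4) (1 / 2)) :
    1 / 4 * volume.real A ≤ prodShift A := by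
  refine le_trans ?_ (le_max_left _ _)
  rcases A.eq_empty_or_nonempty with rfl | ⟨a, ha⟩
  · simp
  · have h1 : a • A ⊆ A * A := by
      rintro _ ⟨x, hx, rfl⟩
      exact Set.mul_mem_mul ha hx
    have h0 : (0 : ℝ) < a := by linarith [(hA ha).1]
    have h01 : A ⊆ Icc 0 1 := fun x hx => ⟨by linarith [(hA hx).1], by linarith [(hA hx).2]⟩
    calc 1 / 4 * volume.real A ≤ a * volume.real A := by gcongr; exact (hA ha).1
      _ = volume.real (a • A) := by
          rw [measureReal_def, measureReal_def, Measure.addHaar_smul]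
          simp [abs_of_pos h0, ENNReal.toReal_ofReal h0.le]
      _ ≤ _ := measureReal_mono h1 (volume_ne_top_of_subset_Icc (mul_subset_Icc h01 h01))

/-- A finite set of real numbers that refutes the sum-product estimate at scale `δ`. -/
structure SumProductBad (I : ℝ → Set ℝ) (σ δ K : ℝ) (S : Finset ℝ) : Prop where
  mem : ∀ x ∈ S, x ∈ I K
  nonconc : NonConc σ δ K S
  card_ge : δ ^ (-σ) ≤ K * cov δ S
  card_add : (cov δ (S + S) : ℝ) ≤ K * δ ^ (-σ)
  card_mul : (cov δ (S * S) : ℝ) ≤ K * δ ^ (-σ)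

theorem rpow_one_sub_eq {δ σ : ℝ} (hδ : 0 < δ) : δ ^ (1 - σ) = δ * δ ^ (-σ) := by
  rw [sub_eq_add_neg, Real.rpow_add hδ, Real.rpow_one]

theorem mul_rpow_le {c t σ : ℝ} (hc : 1 ≤ c) (ht : 0 ≤ t) (hσ1 : σ ≤ 1) :
    (c * t) ^ σ ≤ c * t ^ σ := by
  rw [Real.mul_rpow (by linarith) ht]
  gcongr
  exact Real.rpow_le_self_of_one_le hc hσ1

/-- Dilating `S` into the unit interval and thickening by `δ` gives a bad measurable set; sums and
products of the balls stay within `O(δ)` of the dilated `S + S` and `S * S`. -/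
theorem gap_sumProductBad_of_gap {σ : ℝ} (hσ1 : σ < 1)
    (h : Gap (DeltaSetBad (Icc 0 1) sumProd σ)) :
    Gap (SumProductBad (fun K => Icc K⁻¹ K) σ) := by
  refine Gap.transfer (c := 10) (by norm_num) ?_ h
  intro K δ hK hδ hKδ S hS
  have hK0 : 0 < K := by linarith
  have hK1 : 1 ≤ K := by linarith
  have hδK : ∀ k : ℕ, k ≤ 10 → K ^ k * δ ≤ 1 := fun k hk =>
    le_trans (by gcongr) hKδ
  have hδ1 : δ ≤ 1 := by simpa using hδK 0 (by norm_num)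
  have hn := Real.rpow_pos_of_pos hδ (-σ)
  -- The factor `1 / (4K)` brings `S` into `[2δ, 1 / 4]`, which leaves room for the balls inside
  -- `[0, 1]`; the lower end uses that `K ^ 3 * δ ≤ 1`.
  set T := S.image (fun x => x / (4 * K)) with hT
  have hTmem : ∀ t ∈ T, 2 * δ ≤ t ∧ t ≤ 1 / 4 := by
    intro t ht
    obtain ⟨x, hx, rfl⟩ := Finset.mem_image.1 ht
    have h1 := hS.mem x hx
    have h2 := hδK 3 (by norm_num)
    constructor
    · rw [le_div_iff₀ (by positivity)]
      refine le_trans ?_ h1.1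
      rw [← one_div, le_div_iff₀ hK0]
      have : 0 ≤ K ^ 2 * δ := by positivity
      nlinarith
    · rw [div_le_iff₀ (by positivity)]
      linarith [h1.2]
  set A : Set ℝ := ⋃ t ∈ (T : Set ℝ), Metric.ball t δ with hA
  have hAsub : A ⊆ Icc 0 1 := by
    refine iUnion₂_subset fun t ht y hy => ?_
    have h1 := hTmem t ht
    rw [Metric.mem_ball, Real.dist_eq, abs_lt] at hy
    have h2 := hδK 1 (by norm_num)
    constructor <;> nlinarith
  have hcov : ∀ (R : Finset ℝ) (c : ℝ), 1 ≤ c →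
      (cov δ (R.image (fun x => x / c)) : ℝ) ≤ 5 * cov δ R := by
    intro R c hc
    have := cov_image_le (S := R) (f := fun x => x / c) (M := 1) hδ hδ zero_le_one (by
      intro x _ y _ hxy
      rw [← sub_div, abs_div, abs_of_pos (show 0 < c by linarith), one_mul]
      exact (div_le_self (abs_nonneg _) hc).trans hxy)
    linarith
  have h4K : 1 ≤ 4 * K := by linarith
  have hAvol : volume.real A ≤ 15 * δ * cov δ S := by
    have h1 := volume_real_le_of_subset_iUnion_ball (A := A) (T := T) (M := 1) hδ zero_le_one
      (by rw [one_mul]; exact subset_rfl)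
    have h2 := hcov S (4 * K) h4K
    calc volume.real A ≤ (2 * 1 + 1) * δ * cov δ T := h1
      _ ≤ (2 * 1 + 1) * δ * (5 * cov δ S) := by gcongr
      _ = _ := by ring
  have hcS : (cov δ S : ℝ) ≤ K ^ 2 * δ ^ (-σ) := by
    have h1 := hS.nonconc 0 K (by linarith)
    rw [Finset.filter_true_of_mem (fun x hx => by
      have := hS.mem x hx
      rw [sub_zero, abs_of_nonneg ((inv_pos.2 hK0).le.trans this.1)]
      exact this.2)] at h1
    rw [div_eq_mul_inv] at h1
    have h2 := mul_rpow_le hK1 (inv_pos.2 hδ).le hσ1.le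
    rw [Real.inv_rpow hδ.le, ← Real.rpow_neg hδ.le] at h2
    calc (cov δ S : ℝ) ≤ _ := h1
      _ ≤ K * (K * δ ^ (-σ)) := by gcongr
      _ = _ := by ring
  refine ⟨A, ⟨hAsub, ⟨T, rfl⟩, ?_, ?_, ?_⟩, ?_⟩
  · intro a r hr hr1
    have hr0 := hδ.trans hr
    set R := S.filter (fun x => |x - 4 * K * a| ≤ 8 * K * r) with hR
    have h1 : A ∩ Metric.ball a r ⊆ ⋃ t ∈ R.image (fun x => x / (4 * K)), Metric.ball t (1 * δ) := by
      rintro y ⟨hy, hya⟩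
      obtain ⟨t, ht, hyt⟩ := mem_iUnion₂.1 hy
      obtain ⟨x, hx, rfl⟩ := Finset.mem_image.1 (Finset.mem_coe.1 ht)
      rw [one_mul]
      refine mem_iUnion₂.2 ⟨_, Finset.mem_image_of_mem _ (Finset.mem_filter.2 ⟨hx, ?_⟩), hyt⟩
      rw [Metric.mem_ball, Real.dist_eq] at hyt hya
      have h2 : |x / (4 * K) - a| ≤ 2 * r := by
        rw [abs_lt] at hyt hya
        rw [abs_le]
        constructor <;> linarith
      calc |x - 4 * K * a| = |4 * K * (x / (4 * K) - a)| := by congr 1; field_simp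
        _ = 4 * K * |x / (4 * K) - a| := by rw [abs_mul, abs_of_pos (by positivity)]
        _ ≤ 4 * K * (2 * r) := by gcongr
        _ = _ := by ring
    have h2 := volume_real_le_of_subset_iUnion_ball hδ zero_le_one h1
    have h3 := hcov R (4 * K) h4K
    have h4 := hS.nonconc (4 * K * a) (8 * K * r) (by nlinarith)
    have h5 : (8 * K * r / δ) ^ σ ≤ 8 * K * (r / δ) ^ σ := by
      rw [mul_div_assoc]
      exact mul_rpow_le (by linarith) (by positivity) hσ1.le
    have h6 : 0 ≤ (r / δ) ^ σ := by positivity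
    calc _ ≤ (2 * 1 + 1) * δ * (5 * (K * (8 * K * (r / δ) ^ σ))) := by
          refine h2.trans ?_
          gcongr
          exact h3.trans (by gcongr; exact h4.trans (by gcongr))
      _ = 120 * K ^ 2 * (δ * (r / δ) ^ σ) := by ring
      _ ≤ _ := by gcongr; exact numeral_mul_pow_le (m := 2) hK (by norm_num) (by norm_num)
  · rw [rpow_one_sub_eq hδ]
    calc _ ≤ 15 * δ * (K ^ 2 * δ ^ (-σ)) := hAvol.trans (by gcongr)
      _ = 15 * K ^ 2 * (δ * δ ^ (-σ)) := by ring
      _ ≤ _ := by gcongr; exact numeral_mul_pow_le (m := 1) hK (by norm_num) (by norm_num)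
  · rw [rpow_one_sub_eq hδ]
    have h1 := cov_le_volume_real hδ (volume_ne_top_of_subset_Icc hAsub)
      (T := T) (fun t ht => subset_biUnion_of_mem (u := fun t => Metric.ball t δ)
        (Finset.mem_coe.2 ht))
    have h2 := cov_le_of_image (S := S) (f := fun x => x / (4 * K)) (M := 4 * K) hδ hδ
      (by positivity) (by
        intro x _ y _ hxy
        rw [← sub_div, abs_div, abs_of_pos (show 0 < 4 * K by positivity),
          div_le_iff₀ (by positivity)] at hxy
        linarith)
    calc δ * δ ^ (-σ) ≤ δ * (K * cov δ S) := by gcongr; exact hS.card_ge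
      _ ≤ δ * (K * ((9 * K) * cov δ T)) := by
          gcongr
          exact h2.trans (by gcongr; linarith)
      _ = 9 * K ^ 2 * (δ * cov δ T) := by ring
      _ ≤ K ^ 10 * (δ * cov δ T) := by
          gcongr; exact numeral_mul_pow_le (m := 1) hK (by norm_num) (by norm_num)
      _ ≤ _ := by gcongr
  · rw [rpow_one_sub_eq hδ]
    refine max_le ?_ ?_
    · have h1 : A + A ⊆ ⋃ t ∈ (S + S).image (fun x => x / (4 * K)), Metric.ball t (2 * δ) := by
        rintro _ ⟨y, hy, z, hz, rfl⟩
        obtain ⟨s, hs, hys⟩ := mem_iUnion₂.1 hy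
        obtain ⟨t, ht, hzt⟩ := mem_iUnion₂.1 hz
        obtain ⟨s, hs2, rfl⟩ := Finset.mem_image.1 (Finset.mem_coe.1 hs)
        obtain ⟨t, ht2, rfl⟩ := Finset.mem_image.1 (Finset.mem_coe.1 ht)
        refine mem_iUnion₂.2 ⟨_, Finset.mem_image_of_mem _ (Finset.add_mem_add hs2 ht2), ?_⟩
        rw [Metric.mem_ball, Real.dist_eq, abs_lt] at *
        rw [add_div]
        constructor <;> linarith
      have h2 := volume_real_le_of_subset_iUnion_ball hδ zero_le_two h1
      have h3 := hcov (S + S) (4 * K) h4K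
      calc _ ≤ (2 * 2 + 1) * δ * (5 * (K * δ ^ (-σ))) := by
            refine h2.trans ?_
            gcongr
            exact h3.trans (by gcongr; exact hS.card_add)
        _ = 25 * K ^ 1 * (δ * δ ^ (-σ)) := by ring
        _ ≤ _ := by gcongr; exact numeral_mul_pow_le (m := 1) hK (by norm_num) (by norm_num)
    · have h1 : A * A ⊆ ⋃ t ∈ (S * S).image (fun x => x / (16 * K ^ 2)), Metric.ball t (3 * δ) := by
        rintro _ ⟨y, hy, z, hz, rfl⟩
        have hz1 := hAsub hz
        obtain ⟨s, hs, hys⟩ := mem_iUnion₂.1 hy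
        obtain ⟨t, ht, hzt⟩ := mem_iUnion₂.1 hz
        have hs' := hTmem s hs
        obtain ⟨s, hs2, rfl⟩ := Finset.mem_image.1 (Finset.mem_coe.1 hs)
        obtain ⟨t, ht2, rfl⟩ := Finset.mem_image.1 (Finset.mem_coe.1 ht)
        refine mem_iUnion₂.2 ⟨_, Finset.mem_image_of_mem _ (Finset.mul_mem_mul hs2 ht2), ?_⟩
        rw [Metric.mem_ball, Real.dist_eq] at *
        rw [show s * t / (16 * K ^ 2) = (s / (4 * K)) * (t / (4 * K)) by field_simp; norm_num]
        set s' := s / (4 * K)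
        set t' := t / (4 * K)
        calc |y * z - s' * t'| = |(y - s') * z + s' * (z - t')| := by congr 1; ring
          _ ≤ |(y - s') * z| + |s' * (z - t')| := abs_add_le _ _
          _ = |y - s'| * z + s' * |z - t'| := by
              rw [abs_mul, abs_mul, abs_of_nonneg hz1.1, abs_of_nonneg (by linarith : 0 ≤ s')]
          _ ≤ δ * 1 + 1 * δ := by
              gcongr
              · exact hz1.1
              · exact hz1.2
              · linarith
          _ < 3 * δ := by linarith
      have h2 := volume_real_le_of_subset_iUnion_ball hδ (by norm_num) h1
      have h3 := hcov (S * S) (16 * K ^ 2) (by nlinarith)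
      calc _ ≤ (2 * 3 + 1) * δ * (5 * (K * δ ^ (-σ))) := by
            refine h2.trans ?_
            gcongr
            exact h3.trans (by gcongr; exact hS.card_mul)
        _ = 35 * K ^ 1 * (δ * δ ^ (-σ)) := by ring
        _ ≤ _ := by gcongr; exact numeral_mul_pow_le (m := 1) hK (by norm_num) (by norm_num)

end SetStatements

/-! ### Finite sets of centres, and localization away from the origin. -/

section Centers

/-- One centre is kept for each cell met by the centres of the balls of `A`. Enlarging the balls to
radius `2δ` recovers `A`, while the original balls remain inside it, so cell counts and measure are
comparable in both directions. -/
theorem DeltaSetHyp.exists_centers {I : Set ℝ} {σ δ κ : ℝ} {A : Set ℝ} (hδ : 0 < δ)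
    (hκ : 0 ≤ κ) (hσ : 0 ≤ σ) (hσ1 : σ ≤ 1) (hI : I ⊆ Icc 0 1) (h : DeltaSetHyp I σ δ κ A) :
    ∃ T : Finset ℝ, (∀ t ∈ T, Metric.ball t δ ⊆ A) ∧ NonConc σ δ (2 * κ) T ∧
      δ ^ (-σ) ≤ 5 * κ * cov δ T := by
  obtain ⟨S₀, hS₀⟩ := h.discretized
  have hA : A ⊆ Icc 0 1 := h.subset.trans hI
  have hS₀A : S₀ ⊆ A := fun x hx => by
    rw [hS₀]; exact mem_iUnion₂.2 ⟨x, hx, Metric.mem_ball_self hδ⟩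
  have hfin : (cell δ '' S₀).Finite := by
    refine (Set.finite_Icc (0 : ℤ) ⌊1 / δ⌋).subset ?_
    rintro _ ⟨x, hx, rfl⟩
    have := hA (hS₀A hx)
    refine ⟨Int.floor_nonneg.2 (div_nonneg this.1 hδ.le), Int.floor_le_floor ?_⟩
    gcongr
    exact this.2
  obtain ⟨T, hT1, hT2⟩ := Finset.subset_set_image_iff.1 (hfin.coe_toFinset.subset)
  have hball : ∀ t ∈ T, Metric.ball t δ ⊆ A := fun t ht => by
    rw [hS₀]
    exact subset_biUnion_of_mem (u := fun t => Metric.ball t δ) (hT1 ht)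
  have hAfin := volume_ne_top_of_subset_Icc hA
  refine ⟨T, hball, ?_, ?_⟩
  · intro a r hr
    have hr0 := hδ.trans_le hr
    have h2 : (2 * r / δ) ^ σ ≤ 2 * (r / δ) ^ σ := by
      rw [mul_div_assoc]
      exact mul_rpow_le one_le_two (by positivity) hσ1
    refine le_of_mul_le_mul_left ?_ hδ
    -- The non-concentration of `A` is only available for radii below `1`; beyond, the total measure
    -- gives the bound.
    rcases lt_or_ge (2 * r) 1 with hlt | hge
    · have h1 := cov_le_volume_real (A := A ∩ Metric.ball a (2 * r)) hδ
        (measure_ne_top_of_subset inter_subset_left hAfin)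
        (T := T.filter (fun x => |x - a| ≤ r)) (fun t ht => by
          rw [Finset.mem_filter] at ht
          refine subset_inter (hball t ht.1) (Metric.ball_subset_ball' ?_)
          rw [Real.dist_eq]
          linarith [ht.2])
      calc _ ≤ _ := h1
        _ ≤ κ * (δ * (2 * r / δ) ^ σ) := h.nonconc a _ (by linarith) hlt
        _ ≤ κ * (δ * (2 * (r / δ) ^ σ)) := by gcongr
        _ = _ := by ring
    · have h1 := cov_le_volume_real hδ hAfin
        (T := T.filter (fun x => |x - a| ≤ r)) (fun t ht => hball t (Finset.mem_filter.1 ht).1)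
      calc _ ≤ _ := h1
        _ ≤ κ * (δ * δ ^ (-σ)) := by rw [← rpow_one_sub_eq hδ]; exact h.le
        _ ≤ κ * (δ * (2 * r / δ) ^ σ) := by
            gcongr
            rw [Real.rpow_neg hδ.le, ← Real.inv_rpow hδ.le, ← one_div]
            gcongr
        _ ≤ κ * (δ * (2 * (r / δ) ^ σ)) := by gcongr
        _ = _ := by ring
  · have h1 : A ⊆ ⋃ t ∈ T, Metric.ball t (2 * δ) := by
      intro y hy
      rw [hS₀] at hy
      obtain ⟨x, hx, hyx⟩ := mem_iUnion₂.1 hy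
      have hc : cell δ x ∈ T.image (cell δ) := by
        rw [hT2, hfin.mem_toFinset]
        exact mem_image_of_mem _ hx
      obtain ⟨t, ht, htx⟩ := Finset.mem_image.1 hc
      refine mem_iUnion₂.2 ⟨t, ht, ?_⟩
      have h2 := abs_lt.1 (abs_sub_lt_of_cell_eq hδ htx)
      rw [Metric.mem_ball, Real.dist_eq, abs_lt] at *
      constructor <;> linarith
    have h2 := volume_real_le_of_subset_iUnion_ball hδ zero_le_two h1
    have h3 := h.ge
    rw [rpow_one_sub_eq hδ] at h3
    refine le_of_mul_le_mul_left ?_ hδ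
    calc _ ≤ κ * volume.real A := h3
      _ ≤ κ * ((2 * 2 + 1) * δ * cov δ T) := by gcongr
      _ = _ := by ring

theorem deltaSetHyp_iUnion_ball {I : Set ℝ} {σ δ K : ℝ} {T : Finset ℝ} (hδ : 0 < δ) (hK : 1 ≤ K)
    (hσ1 : σ ≤ 1) (hI : I ⊆ Icc 0 1) (hT : ∀ t ∈ T, Metric.ball t δ ⊆ I)
    (hnc : NonConc σ δ K T) (hle : (cov δ T : ℝ) ≤ K * δ ^ (-σ)) (hge : δ ^ (-σ) ≤ K * cov δ T) :
    DeltaSetHyp I σ δ (6 * K) (⋃ t ∈ (T : Set ℝ), Metric.ball t δ) := by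
  set A : Set ℝ := ⋃ t ∈ (T : Set ℝ), Metric.ball t δ with hA
  have hK0 : 0 < K := by linarith
  have hAI : A ⊆ I := iUnion₂_subset fun t ht => hT t ht
  have hn := Real.rpow_pos_of_pos hδ (-σ)
  refine ⟨hAI, ⟨T, rfl⟩, ?_, ?_, ?_⟩
  · intro a r hr hr1
    have hr0 := hδ.trans hr
    have h1 : A ∩ Metric.ball a r ⊆
        ⋃ t ∈ T.filter (fun x => |x - a| ≤ 2 * r), Metric.ball t (1 * δ) := by
      rintro y ⟨hy, hya⟩
      obtain ⟨t, ht, hyt⟩ := mem_iUnion₂.1 hy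
      rw [one_mul]
      refine mem_iUnion₂.2 ⟨t, Finset.mem_filter.2 ⟨Finset.mem_coe.1 ht, ?_⟩, hyt⟩
      rw [Metric.mem_ball, Real.dist_eq, abs_lt] at hyt hya
      rw [abs_le]
      constructor <;> linarith
    have h2 := volume_real_le_of_subset_iUnion_ball hδ zero_le_one h1
    have h4 := hnc a (2 * r) (by linarith)
    have h5 : (2 * r / δ) ^ σ ≤ 2 * (r / δ) ^ σ := by
      rw [mul_div_assoc]
      exact mul_rpow_le one_le_two (by positivity) hσ1
    calc _ ≤ (2 * 1 + 1) * δ * (K * (2 * (r / δ) ^ σ)) := by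
          refine h2.trans ?_
          gcongr
          exact h4.trans (by gcongr)
      _ = _ := by ring
  · have h1 := volume_real_le_of_subset_iUnion_ball (A := A) (T := T) (M := 1) hδ zero_le_one
      (by rw [one_mul]; exact subset_rfl)
    rw [rpow_one_sub_eq hδ]
    calc _ ≤ (2 * 1 + 1) * δ * (K * δ ^ (-σ)) := h1.trans (by gcongr)
      _ = 3 * (K * (δ * δ ^ (-σ))) := by ring
      _ ≤ 6 * (K * (δ * δ ^ (-σ))) := by gcongr; norm_num
      _ = _ := by ring
  · have h1 := cov_le_volume_real hδ (volume_ne_top_of_subset_Icc (hAI.trans hI))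
      (T := T) (fun t ht => subset_biUnion_of_mem (u := fun t => Metric.ball t δ)
        (Finset.mem_coe.2 ht))
    rw [rpow_one_sub_eq hδ]
    have h0 : 0 ≤ volume.real A := measureReal_nonneg
    calc _ ≤ δ * (K * cov δ T) := by gcongr
      _ = K * (δ * cov δ T) := by ring
      _ ≤ K * volume.real A := by gcongr
      _ ≤ 6 * (K * volume.real A) := by
          have : 0 ≤ K * volume.real A := by positivity
          linarith
      _ = _ := by ring

/-- The pieces of a finite set, labelled by `f`, cannot all be small. -/
theorem exists_cov_filter_ge {S : Finset ℝ} {β : Type*} [DecidableEq β] (f : ℝ → β) (δ : ℝ)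
    {J : Finset β} (hJ : J.Nonempty) (hf : ∀ x ∈ S, f x ∈ J) :
    ∃ b ∈ J, (cov δ S : ℝ) ≤ J.card * cov δ (S.filter (fun x => f x = b)) := by
  by_contra! hcon
  have hsub : S.image (cell δ) ⊆ J.biUnion fun b => (S.filter (fun x => f x = b)).image (cell δ) := by
    intro y hy
    obtain ⟨x, hx, rfl⟩ := Finset.mem_image.1 hy
    exact Finset.mem_biUnion.2 ⟨f x, hf x hx, Finset.mem_image_of_mem _
      (Finset.mem_filter.2 ⟨hx, rfl⟩)⟩
  have h1 : (cov δ S : ℝ) ≤ ∑ b ∈ J, (cov δ (S.filter (fun x => f x = b)) : ℝ) := by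
    exact_mod_cast (Finset.card_le_card hsub).trans Finset.card_biUnion_le
  have h2 : ∑ b ∈ J, (J.card * cov δ (S.filter (fun x => f x = b)) : ℝ) < ∑ b ∈ J, (cov δ S : ℝ) :=
    Finset.sum_lt_sum_of_nonempty hJ hcon
  rw [← Finset.mul_sum, Finset.sum_const, nsmul_eq_mul] at h2
  have hJ0 : (0 : ℝ) < J.card := by exact_mod_cast hJ.card_pos
  nlinarith

theorem cov_union_le (δ : ℝ) (S T : Finset ℝ) : cov δ (S ∪ T) ≤ cov δ S + cov δ T := by
  unfold cov
  rw [Finset.image_union]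
  exact Finset.card_union_le _ _

theorem cov_filter_add_le (δ : ℝ) (S : Finset ℝ) (p : ℝ → Prop) [DecidablePred p] :
    (cov δ S : ℝ) ≤ cov δ (S.filter p) + cov δ (S.filter (fun x => ¬ p x)) := by
  have := cov_union_le δ (S.filter p) (S.filter (fun x => ¬ p x))
  rw [Finset.filter_union_filter_not_eq] at this
  exact_mod_cast this

/-- The power of a small radius that beats a power of `K`. -/
theorem rpow_inv_pow_le {K σ : ℝ} {m k : ℕ} (hK : 1 ≤ K) (hm : 1 ≤ σ * m) :
    ((K⁻¹) ^ (m * k)) ^ σ ≤ (K⁻¹) ^ k := by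
  have hK0 : 0 < K := by linarith
  rw [← Real.rpow_natCast, ← Real.rpow_mul (by positivity), ← Real.rpow_natCast]
  refine Real.rpow_le_rpow_of_exponent_ge (by positivity) (inv_le_one_of_one_le₀ hK) ?_
  push_cast
  have : (0 : ℝ) ≤ k := Nat.cast_nonneg _
  nlinarith

/-- If `t ≥ b`, then `ball s δ * {t}` contains the ball of radius `b * δ` about `s * t`. Passing
from cells of side `b * δ` back to cells of side `δ` costs the factor `5`. -/
theorem cov_mul_le_volume_real {A : Set ℝ} {T : Finset ℝ} {δ b : ℝ} (hδ : 0 < δ) (hb0 : 0 < b)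
    (hb1 : b ≤ 1) (hA : A ⊆ Icc 0 1) (hT : ∀ t ∈ T, Metric.ball t δ ⊆ A) (hTb : ∀ t ∈ T, b ≤ t) :
    b * δ * cov δ (T * T) ≤ 5 * volume.real (A * A) := by
  have hbδ : 0 < b * δ := by positivity
  have h2 := cov_le_volume_real (A := A * A) (T := T * T) hbδ
    (volume_ne_top_of_subset_Icc (mul_subset_Icc hA hA)) (by
      intro z hz y hy
      obtain ⟨s, hs, t, ht, rfl⟩ := Finset.mem_mul.1 hz
      have ht0 : 0 < t := hb0.trans_le (hTb t ht)
      refine ⟨y / t, hT s hs ?_, t, hT t ht (Metric.mem_ball_self hδ), by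
        simp only; field_simp⟩
      rw [Metric.mem_ball, Real.dist_eq] at hy ⊢
      rw [show y / t - s = (y - s * t) / t by field_simp, abs_div, abs_of_pos ht0,
        div_lt_iff₀ ht0]
      refine hy.trans_le ?_
      rw [mul_comm]
      gcongr
      exact hTb t ht)
  have h3 := cov_le_of_image (S := T * T) (f := fun t => t) (δ := δ) (δ' := b * δ) (M := 1)
    hδ hbδ zero_le_one (by
      intro x _ y _ hxy
      refine hxy.trans ?_
      gcongr)
  rw [Finset.image_id'] at h3
  calc _ ≤ b * δ * ((2 * 1 + 3) * cov (b * δ) (T * T)) := by gcongr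
    _ = 5 * (b * δ * cov (b * δ) (T * T)) := by ring
    _ ≤ _ := by gcongr

/-- Non-concentration at `0` leaves most of the set above `ρ`. Among the intervals of length `ρ / 4`
one carries a `K ^ (-3m)` fraction up to constants, and dividing by its left endpoint `b ≥ ρ` moves
it into `[1, 5 / 4]`. -/
theorem gap_deltaSetBad_of_gap_local {σ : ℝ} (hσ : 0 < σ) (hσ1 : σ < 1)
    (h : Gap (SumProductBad (fun _ => Icc 1 (5 / 4)) σ)) :
    Gap (DeltaSetBad (Icc 0 1) sumProd σ) := by
  obtain ⟨m, hm⟩ := exists_nat_ge (1 / σ)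
  rw [div_le_iff₀ hσ, mul_comm] at hm
  have hm0 : 0 < m := by
    rcases Nat.eq_zero_or_pos m with rfl | h
    · norm_num at hm
    · exact h
  refine Gap.transfer (c := 10 * m + 10) (by omega) ?_ h
  intro K δ hK hδ hKδ A hA
  have hK0 : 0 < K := by linarith
  have hK1 : 1 ≤ K := by linarith
  have hn := Real.rpow_pos_of_pos hδ (-σ)
  obtain ⟨T, hT1, hT2, hT3⟩ := hA.toDeltaSetHyp.exists_centers hδ hK0.le hσ.le hσ1.le subset_rfl
  have hAsub := hA.subset
  have hAfin := volume_ne_top_of_subset_Icc hAsub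
  have hTA : ∀ t ∈ T, t ∈ A := fun t ht => hT1 t ht (Metric.mem_ball_self hδ)
  have hT01 : ∀ t ∈ T, 0 ≤ t ∧ t ≤ 1 := fun t ht => hAsub (hTA t ht)
  -- Since `σ * m ≥ 1`, `ρ ^ σ ≤ K ^ (-3)`: the part below `ρ` has at most `2 K ^ (-2) δ ^ (-σ)`
  -- cells, negligible against the lower bound `δ ^ (-σ) / (5K)`.
  set ρ := (K⁻¹) ^ (m * 3) with hρ
  have hρ0 : 0 < ρ := by positivity
  have hρ1 : ρ ≤ 1 := pow_le_one₀ (by positivity) (inv_le_one_of_one_le₀ hK1)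
  have hρinv : ρ⁻¹ = K ^ (m * 3) := by rw [hρ, inv_pow, inv_inv]
  have hδρ : δ ≤ ρ := by
    have h1 : K ^ (m * 3) * δ ≤ 1 :=
      le_trans (mul_le_mul_of_nonneg_right (pow_le_pow_right₀ hK1 (by omega)) hδ.le) hKδ
    rw [← hρinv, inv_mul_le_iff₀ hρ0, mul_one] at h1
    exact h1
  have hδ1 : δ ≤ 1 := hδρ.trans hρ1
  -- the part of the set away from the origin
  have hsmall : (cov δ (T.filter (fun t => ¬ ρ ≤ t)) : ℝ) ≤ 2 * K⁻¹ ^ 2 * δ ^ (-σ) := by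
    have h1 := hT2 0 ρ hδρ
    have h2 : cov δ (T.filter (fun t => ¬ ρ ≤ t)) ≤ cov δ (T.filter (fun x => |x - 0| ≤ ρ)) := by
      refine cov_mono fun x hx => ?_
      rw [Finset.mem_filter] at hx ⊢
      refine ⟨hx.1, ?_⟩
      rw [sub_zero, abs_of_nonneg (hT01 x hx.1).1]
      exact (not_le.1 hx.2).le
    have h3 : (ρ / δ) ^ σ ≤ K⁻¹ ^ 3 * δ ^ (-σ) := by
      rw [div_eq_mul_inv, Real.mul_rpow hρ0.le (by positivity), Real.inv_rpow hδ.le,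
        ← Real.rpow_neg hδ.le]
      gcongr
      exact rpow_inv_pow_le hK1 hm
    calc _ ≤ (cov δ (T.filter (fun x => |x - 0| ≤ ρ)) : ℝ) := by exact_mod_cast h2
      _ ≤ 2 * K * (K⁻¹ ^ 3 * δ ^ (-σ)) := h1.trans (by gcongr)
      _ = _ := by field_simp
  set T₁ := T.filter (fun t => ρ ≤ t) with hT₁
  have hbig : δ ^ (-σ) ≤ 10 * K * cov δ T₁ := by
    have h1 := cov_filter_add_le δ T (fun t => ρ ≤ t)
    have h2 : 5 * K * (cov δ T : ℝ) ≤ 5 * K * (cov δ T₁ + 2 * K⁻¹ ^ 2 * δ ^ (-σ)) := by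
      gcongr
      linarith
    have h3 : 5 * K * (2 * K⁻¹ ^ 2 * δ ^ (-σ)) ≤ δ ^ (-σ) / 2 := by
      have : 5 * K * (2 * K⁻¹ ^ 2 * δ ^ (-σ)) = 10 * K⁻¹ * δ ^ (-σ) := by field_simp; norm_num
      rw [this]
      have : K⁻¹ ≤ 100⁻¹ := by gcongr
      nlinarith
    nlinarith
  obtain ⟨k, hk, hkc⟩ := exists_cov_filter_ge (S := T₁) (fun t => ⌊t * 4 / ρ⌋) δ
    (J := Finset.Icc 0 ⌊4 / ρ⌋) ⟨0, Finset.mem_Icc.2 ⟨le_rfl, by positivity⟩⟩ (by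
      intro t ht
      have h1 := hT01 t (Finset.mem_filter.1 ht).1
      rw [Finset.mem_Icc]
      refine ⟨Int.floor_nonneg.2 (by have := h1.1; positivity), Int.floor_le_floor ?_⟩
      gcongr
      linarith [h1.2])
  set T₂ := T₁.filter (fun t => ⌊t * 4 / ρ⌋ = k) with hT₂
  have hT₂T : T₂ ⊆ T := (Finset.filter_subset _ _).trans (Finset.filter_subset _ _)
  have hJc : (((Finset.Icc 0 ⌊4 / ρ⌋).card : ℕ) : ℝ) ≤ 5 * K ^ (m * 3) := by
    have := card_le_of_abs_sub_le (S := Finset.Icc 0 ⌊4 / ρ⌋) (a := 2 / ρ) (M := 2 / ρ)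
      (by positivity) (by
        intro i hi
        rw [Finset.mem_Icc] at hi
        have h1 : (0 : ℝ) ≤ i := by exact_mod_cast hi.1
        have h2 : (i : ℝ) ≤ 4 / ρ := Int.le_floor.1 hi.2
        rw [abs_le]
        have : 4 / ρ = 2 * (2 / ρ) := by ring
        constructor <;> linarith)
    have h2 : 1 ≤ K ^ (m * 3) := one_le_pow₀ hK1
    calc _ ≤ _ := this
      _ = 4 * ρ⁻¹ + 1 := by rw [div_eq_mul_inv]; ring
      _ ≤ _ := by rw [hρinv]; linarith
  set b : ℝ := k * ρ / 4 with hb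
  have hT₂mem : ∀ t ∈ T₂, b ≤ t ∧ t < b + ρ / 4 ∧ ρ ≤ t := by
    intro t ht
    obtain ⟨h1, h2⟩ := Finset.mem_filter.1 ht
    have h3 := Int.floor_eq_iff.1 h2
    have h4 := (Finset.mem_filter.1 h1).2
    rw [le_div_iff₀ hρ0, div_lt_iff₀ hρ0] at h3
    refine ⟨?_, ?_, h4⟩
    · rw [hb]; linarith
    · rw [hb]; linarith
  have hT₂c : δ ^ (-σ) ≤ 50 * K ^ (m * 3 + 1) * cov δ T₂ := by
    calc δ ^ (-σ) ≤ 10 * K * cov δ T₁ := hbig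
      _ ≤ 10 * K * (5 * K ^ (m * 3) * cov δ T₂) := by
          gcongr
          exact hkc.trans (by gcongr)
      _ = _ := by ring
  have hT₂ne : T₂.Nonempty := by
    rw [Finset.nonempty_iff_ne_empty]
    intro h0
    rw [h0] at hT₂c
    simp [cov] at hT₂c
    linarith
  -- From `ρ ≤ t < b + ρ / 4` one only gets `b > 3ρ / 4`; integrality of `k = 4b / ρ` rounds this up
  -- to `b ≥ ρ`.
  have hbρ : ρ ≤ b := by
    obtain ⟨t, ht⟩ := hT₂ne
    have h1 := hT₂mem t ht
    have h2 : (3 : ℝ) < k := by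
      refine lt_of_mul_lt_mul_right ?_ hρ0.le
      have : b = k * ρ / 4 := rfl
      linarith
    have h3 : (4 : ℤ) ≤ k := by
      have : (3 : ℤ) < k := by exact_mod_cast h2
      omega
    have h4 : (4 : ℝ) ≤ k := by exact_mod_cast h3
    rw [hb]
    nlinarith
  have hb0 : 0 < b := hρ0.trans_le hbρ
  have hb1 : b ≤ 1 := by
    obtain ⟨t, ht⟩ := hT₂ne
    exact (hT₂mem t ht).1.trans (hT01 t (hT₂T ht)).2
  have hbinv : b⁻¹ ≤ K ^ (m * 3) := by
    rw [← hρinv]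
    gcongr
  have hKm1 : 1 ≤ K ^ (m * 3) := one_le_pow₀ hK1
  set S := T₂.image (fun t => t / b) with hS
  have hdil : ∀ (R : Finset ℝ) (c M : ℝ), 0 < c → 1 ≤ M → c⁻¹ ≤ M →
      (cov δ (R.image (fun x => x / c)) : ℝ) ≤ 5 * M * cov δ R := by
    intro R c M hc hM hcM
    refine (cov_image_le (S := R) (f := fun x => x / c) (M := M) hδ hδ (by linarith) (by
      intro x _ y _ hxy
      rw [← sub_div, abs_div, abs_of_pos hc, div_eq_mul_inv, mul_comm]
      gcongr)).trans ?_
    gcongr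
    linarith
  have hpw : ∀ (c : ℝ) (j k : ℕ), c ≤ 100 ^ j → j + k ≤ 10 * m + 10 → c * K ^ k ≤ K ^ (10 * m + 10) :=
    fun c j k h1 h2 => numeral_mul_pow_le hK h1 h2
  refine ⟨S, ?_, ?_, ?_, ?_, ?_⟩
  · intro x hx
    obtain ⟨t, ht, rfl⟩ := Finset.mem_image.1 hx
    have h1 := hT₂mem t ht
    constructor
    · rw [le_div_iff₀ hb0]; linarith
    · rw [div_le_iff₀ hb0]; linarith
  · intro a r hr
    have hr0 := hδ.trans_le hr
    have h1 : S.filter (fun x => |x - a| ≤ r) ⊆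
        (T.filter (fun t => |t - b * a| ≤ r)).image (fun t => t / b) := by
      intro x hx
      obtain ⟨hx, hxa⟩ := Finset.mem_filter.1 hx
      obtain ⟨t, ht, rfl⟩ := Finset.mem_image.1 hx
      refine Finset.mem_image_of_mem _ (Finset.mem_filter.2 ⟨hT₂T ht, ?_⟩)
      calc |t - b * a| = b * |t / b - a| := by
            rw [← abs_of_pos hb0, ← abs_mul, abs_of_pos hb0]
            congr 1; field_simp
        _ ≤ 1 * r := by gcongr
        _ = r := one_mul r
    have h2 : (cov δ (S.filter (fun x => |x - a| ≤ r)) : ℝ) ≤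
        cov δ ((T.filter (fun t => |t - b * a| ≤ r)).image (fun t => t / b)) := by
      exact_mod_cast cov_mono h1
    have h3 := hdil (T.filter (fun t => |t - b * a| ≤ r)) b _ hb0 hKm1 hbinv
    have h4 := hT2 (b * a) r hr
    have h5 : 0 ≤ (r / δ) ^ σ := by positivity
    calc _ ≤ 5 * K ^ (m * 3) * (2 * K * (r / δ) ^ σ) := h2.trans (h3.trans (by gcongr))
      _ = 10 * K ^ (m * 3 + 1) * (r / δ) ^ σ := by ring
      _ ≤ _ := by gcongr; exact hpw _ 1 _ (by norm_num) (by omega)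
  · have h1 := cov_le_of_image (S := T₂) (f := fun t => t / b) (M := 1) hδ hδ zero_le_one (by
      intro x _ y _ hxy
      rw [← sub_div, abs_div, abs_of_pos hb0, div_le_iff₀ hb0] at hxy
      nlinarith)
    calc δ ^ (-σ) ≤ 50 * K ^ (m * 3 + 1) * (5 * cov δ S) := by
          refine hT₂c.trans ?_
          gcongr
          exact h1.trans (by gcongr; norm_num)
      _ = 250 * K ^ (m * 3 + 1) * cov δ S := by ring
      _ ≤ _ := by gcongr; exact hpw _ 2 _ (by norm_num) (by omega)
  · have h0 : S + S = (T₂ + T₂).image (fun t => t / b) := by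
      rw [hS]
      ext z
      simp only [Finset.mem_add, Finset.mem_image]
      constructor
      · rintro ⟨_, ⟨s, hs, rfl⟩, _, ⟨t, ht, rfl⟩, rfl⟩
        exact ⟨s + t, ⟨s, hs, t, ht, rfl⟩, add_div _ _ _⟩
      · rintro ⟨_, ⟨s, hs, t, ht, rfl⟩, rfl⟩
        exact ⟨_, ⟨s, hs, rfl⟩, _, ⟨t, ht, rfl⟩, (add_div _ _ _).symm⟩
    rw [h0]
    have h1 := hdil (T₂ + T₂) b _ hb0 hKm1 hbinv
    have h2 := cov_le_volume_real (A := A + A) (T := T₂ + T₂) hδ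
      (volume_ne_top_of_subset_Icc (add_subset_Icc hAsub hAsub)) (by
        intro z hz y hy
        obtain ⟨s, hs, t, ht, rfl⟩ := Finset.mem_add.1 hz
        refine ⟨y - t, hT1 s (hT₂T hs) ?_, t, hTA t (hT₂T ht), by simp⟩
        rw [Metric.mem_ball, Real.dist_eq] at hy ⊢
        convert hy using 2; ring)
    have h3 : (cov δ (T₂ + T₂) : ℝ) ≤ K * δ ^ (-σ) := by
      refine le_of_mul_le_mul_left ?_ hδ
      calc _ ≤ K * δ ^ (1 - σ) := h2.trans ((le_max_left _ _).trans hA.small)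
        _ = _ := by rw [rpow_one_sub_eq hδ]; ring
    calc _ ≤ 5 * K ^ (m * 3) * (K * δ ^ (-σ)) := h1.trans (by gcongr)
      _ = 5 * K ^ (m * 3 + 1) * δ ^ (-σ) := by ring
      _ ≤ _ := by gcongr; exact hpw _ 1 _ (by norm_num) (by omega)
  · have h0 : S * S = (T₂ * T₂).image (fun t => t / b ^ 2) := by
      rw [hS]
      ext z
      simp only [Finset.mem_mul, Finset.mem_image]
      constructor
      · rintro ⟨_, ⟨s, hs, rfl⟩, _, ⟨t, ht, rfl⟩, rfl⟩
        exact ⟨s * t, ⟨s, hs, t, ht, rfl⟩, by field_simp⟩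
      · rintro ⟨_, ⟨s, hs, t, ht, rfl⟩, rfl⟩
        exact ⟨_, ⟨s, hs, rfl⟩, _, ⟨t, ht, rfl⟩, by field_simp⟩
    rw [h0]
    have h1 := hdil (T₂ * T₂) (b ^ 2) (K ^ (m * 3 * 2)) (by positivity) (one_le_pow₀ hK1)
      (by rw [← inv_pow, pow_mul]; gcongr)
    have h2 := cov_mul_le_volume_real hδ hb0 hb1 hAsub (fun t ht => hT1 t (hT₂T ht))
      (fun t ht => (hT₂mem t ht).1)
    have h4 : (cov δ (T₂ * T₂) : ℝ) ≤ 5 * (K ^ (m * 3 + 1) * δ ^ (-σ)) := by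
      refine le_of_mul_le_mul_left ?_ (show 0 < b * δ by positivity)
      calc _ ≤ 5 * (K * δ ^ (1 - σ)) :=
            h2.trans (by gcongr; exact (le_max_right _ _).trans hA.small)
        _ = 5 * (K * (b * b⁻¹) * (δ * δ ^ (-σ))) := by
            rw [rpow_one_sub_eq hδ, mul_inv_cancel₀ hb0.ne']; ring
        _ ≤ 5 * (K * (b * K ^ (m * 3)) * (δ * δ ^ (-σ))) := by gcongr
        _ = _ := by ring
    calc _ ≤ 5 * K ^ (m * 3 * 2) * (5 * (K ^ (m * 3 + 1) * δ ^ (-σ))) :=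
          h1.trans (by gcongr)
      _ = 25 * K ^ (m * 3 * 2 + (m * 3 + 1)) * δ ^ (-σ) := by rw [pow_add]; ring
      _ ≤ _ := by gcongr; exact hpw _ 1 _ (by norm_num) (by omega)

end Centers

/-! ### From sum-product to products and shifted products. -/

section ShiftedProduct

theorem NonConc.subset {σ δ K : ℝ} {S T : Finset ℝ} (h : NonConc σ δ K S) (hT : T ⊆ S) :
    NonConc σ δ K T := fun a r hr =>
  le_trans (by exact_mod_cast cov_mono (Finset.filter_subset_filter _ hT)) (h a r hr)

theorem NonConc.mono {σ δ K K' : ℝ} {S : Finset ℝ} (hδ : 0 < δ) (h : NonConc σ δ K S) (hK : K ≤ K') :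
    NonConc σ δ K' S := fun a r hr => (h a r hr).trans (by
  have : 0 ≤ r / δ := div_nonneg (hδ.le.trans hr) hδ.le
  gcongr)

theorem exists_subset_injOn_cell (δ : ℝ) (S : Finset ℝ) :
    ∃ T ⊆ S, Set.InjOn (cell δ) T ∧ cov δ T = cov δ S := by
  obtain ⟨T, h1, h2, h3⟩ := exists_injOn_image_eq S (cell δ)
  exact ⟨T, h1, h2, by unfold cov; rw [h3]⟩

theorem cov_eq_card {δ : ℝ} {S : Finset ℝ} (h : Set.InjOn (cell δ) S) : cov δ S = S.card :=
  Finset.card_image_of_injOn h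

/-- A set with few products has few differences of logarithms, up to cells. -/
theorem card_log_sub_log_le {δ M N : ℝ} {T : Finset ℝ} (hδ : 0 < δ) (hM : 100 ≤ M) (hN : 0 < N)
    (hT : ∀ t ∈ T, 1 / 4 ≤ t ∧ t ≤ 1) (hge : N ≤ M * cov δ T)
    (hmul : (cov δ (T * T) : ℝ) ≤ M * N) :
    ((T.image (fun t => cell δ (Real.log t)) - T.image (fun t => cell δ (Real.log t))).card : ℝ) ≤
      M ^ 5 * N := by
  set U := T.image (fun t => cell δ (Real.log t)) with hU
  have hM0 : 0 < M := by linarith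
  have h1 : ((U + U).card : ℝ) ≤ 37 * (M * N) := by
    have e1 : U + U = (T ×ˢ T).image (fun p => cell δ (Real.log p.1) + cell δ (Real.log p.2)) := by
      ext z; simp [hU, Finset.mem_add, and_assoc]
    have e2 : T * T = (T ×ˢ T).image (fun p => p.1 * p.2) := by
      ext z; simp [Finset.mem_mul, and_assoc]
    have h2 := card_image_int_le (T ×ˢ T)
      (fun p => cell δ (Real.log p.1) + cell δ (Real.log p.2))
      (fun p => cell δ (p.1 * p.2)) (M := 18) (by norm_num) (by
        intro p hp q hq he
        obtain ⟨hp1, hp2⟩ := Finset.mem_product.1 hp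
        obtain ⟨hq1, hq2⟩ := Finset.mem_product.1 hq
        have a1 := hT _ hp1
        have a2 := hT _ hp2
        have a3 := hT _ hq1
        have a4 := hT _ hq2
        have h3 := (abs_sub_lt_of_cell_eq hδ he).le
        have h4 := abs_log_sub_log_le (m := 1 / 16) (by norm_num)
          (show 1 / 16 ≤ p.1 * p.2 by nlinarith) (show 1 / 16 ≤ q.1 * q.2 by nlinarith)
        rw [Real.log_mul (by linarith) (by linarith), Real.log_mul (by linarith) (by linarith)] at h4
        have h5 : |p.1 * p.2 - q.1 * q.2| / (1 / 16) ≤ 16 * δ := by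
          rw [div_le_iff₀ (by norm_num)]; linarith
        have h6 := abs_le.1 (h4.trans h5)
        have b1 := cell_bounds hδ (Real.log p.1)
        have b2 := cell_bounds hδ (Real.log p.2)
        have b3 := cell_bounds hδ (Real.log q.1)
        have b4 := cell_bounds hδ (Real.log q.2)
        push_cast
        rw [abs_le]
        constructor
        · refine le_of_mul_le_mul_right ?_ hδ
          linarith
        · refine le_of_mul_le_mul_right ?_ hδ
          linarith)
    rw [e1]
    refine h2.trans ?_
    rw [e2, cov_image] at hmul
    norm_num
    exact hmul
  have h2 : N ≤ 5 * M * U.card := by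
    have h3 := card_image_cell_le T (fun t => t) (fun t => cell δ (Real.log t)) (M := 1) hδ
      zero_le_one (by
        intro p hp q hq he
        have a1 := hT _ hp
        have a2 := hT _ hq
        refine (abs_sub_le_mul_abs_log_sub (by linarith) (by linarith) a1.2 a2.2).trans ?_
        gcongr
        exact (abs_sub_lt_of_cell_eq hδ he).le)
    calc N ≤ M * cov δ T := hge
      _ ≤ M * ((2 * 1 + 3) * U.card) := by gcongr; exact h3
      _ = _ := by ring
  have h3 : ((U - U).card : ℝ) * U.card ≤ (U + U).card * (U + U).card := by
    exact_mod_cast Finset.ruzsa_triangle_inequality_sub_add_add U U U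
  refine le_of_mul_le_mul_right ?_ hN
  calc ((U - U).card : ℝ) * N ≤ (U - U).card * (5 * M * U.card) := by gcongr
    _ = 5 * M * ((U - U).card * U.card) := by ring
    _ ≤ 5 * M * ((37 * (M * N)) * (37 * (M * N))) := by
        refine mul_le_mul_of_nonneg_left (h3.trans ?_) (by positivity)
        gcongr
    _ = 6845 * M ^ 3 * N * N := by ring
    _ ≤ M ^ 5 * N * N := by
        gcongr; exact numeral_mul_pow_le (m := 2) hM (by norm_num) (by norm_num)

-- For centres `x, y` of `A`, few products give few `x / y`, and few products of `1 - A` give few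
-- slopes `(1 - y) / (1 - x)`. A point `(x, y)` lies on the line through `(1, 1)` with that slope,
-- so the pairs form a rich point set for four pencils.
set_option maxHeartbeats 2000000 in
theorem gap_prodShift_of_gap_sumProductBad {σ : ℝ} (hσ : 0 < σ) (hσ1 : σ < 1)
    (h : Gap (SumProductBad (fun K => Icc K⁻¹ K) σ)) :
    Gap (DeltaSetBad (Icc (1 / 4) (1 / 2)) prodShift σ) := by
  obtain ⟨m, hm⟩ := exists_nat_ge (1 / σ)
  rw [div_le_iff₀ hσ, mul_comm] at hm
  refine Gap.transfer (c := (3 * m + 20) * 200000) (by omega) ?_ h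
  intro K δ hK hδ hKδ A hA
  have hK0 : 0 < K := by linarith
  have hK1 : 1 ≤ K := by linarith
  set N := δ ^ (-σ) with hNdef
  have hN : 0 < N := Real.rpow_pos_of_pos hδ (-σ)
  have hI : Icc (1 / 4 : ℝ) (1 / 2) ⊆ Icc 0 1 := Icc_subset_Icc (by norm_num) (by norm_num)
  obtain ⟨T₀, hT01, hT02, hT03⟩ := hA.toDeltaSetHyp.exists_centers hδ hK0.le hσ.le hσ1.le hI
  obtain ⟨T, hTT₀, hTinj, hTcov⟩ := exists_subset_injOn_cell δ T₀
  have hAI := hA.subset.trans hI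
  have hball : ∀ t ∈ T, Metric.ball t δ ⊆ A := fun t ht => hT01 t (hTT₀ ht)
  have hTA : ∀ t ∈ T, t ∈ A := fun t ht => hball t ht (Metric.mem_ball_self hδ)
  have hTmem : ∀ t ∈ T, 1 / 4 ≤ t ∧ t ≤ 1 / 2 := fun t ht => hA.subset (hTA t ht)
  have hnc : NonConc σ δ (2 * K) T := hT02.subset hTT₀
  have hge : N ≤ 5 * K * cov δ T := by rw [hTcov]; exact hT03
  have hle : (cov δ T : ℝ) ≤ K * N := by
    refine le_of_mul_le_mul_left ?_ hδ
    calc _ ≤ volume.real A :=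
          cov_le_volume_real hδ (volume_ne_top_of_subset_Icc hAI) hball
      _ ≤ _ := hA.le
      _ = _ := by rw [rpow_one_sub_eq hδ]; ring
  set K' := K ^ (3 * m + 20) with hK'
  have hKK' : ∀ (c : ℝ) (j k : ℕ), c ≤ 100 ^ j → j + k ≤ 3 * m + 20 → c * K ^ k ≤ K' :=
    fun c j k h1 h2 => numeral_mul_pow_le hK h1 h2
  have hK'100 : 100 ≤ K' := by simpa using hKK' 100 1 0 (by norm_num) (by omega)
  have hK'0 : 0 < K' := by linarith
  have hδsmall : K' * δ ≤ 1 := by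
    refine le_trans (mul_le_mul_of_nonneg_right ?_ hδ.le) hKδ
    exact pow_le_pow_right₀ hK1 (by omega)
  have hδ100 : δ ≤ 1 / 100 := by
    rw [le_div_iff₀ (by norm_num)]; nlinarith
  -- few ratios
  have hU := card_log_sub_log_le (M := 20 * K) hδ (by linarith) hN
    (fun t ht => ⟨(hTmem t ht).1, by linarith [(hTmem t ht).2]⟩)
    (hge.trans (by gcongr; norm_num)) (by
      have h1 := cov_mul_le_volume_real (b := 1 / 4) hδ (by norm_num) (by norm_num) hAI hball
        (fun t ht => (hTmem t ht).1)
      have h2 := (le_max_left _ _).trans hA.small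
      rw [rpow_one_sub_eq hδ] at h2
      refine le_of_mul_le_mul_left ?_ hδ
      linarith)
  set T' := T.image (fun t => 1 - t) with hT'
  have hT'mem : ∀ t ∈ T', 1 / 2 ≤ t ∧ t ≤ 3 / 4 := by
    intro t ht
    obtain ⟨s, hs, rfl⟩ := Finset.mem_image.1 ht
    have := hTmem s hs
    constructor <;> linarith
  have hA'I : ({1} : Set ℝ) - A ⊆ Icc 0 1 := by
    rintro _ ⟨x, hx, y, hy, rfl⟩
    rw [mem_singleton_iff] at hx
    subst hx
    have := hAI hy
    exact ⟨by linarith [this.2], by linarith [this.1]⟩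
  have hV := card_log_sub_log_le (M := 25 * K) (T := T') hδ (by linarith) hN
    (fun t ht => ⟨by linarith [(hT'mem t ht).1], by linarith [(hT'mem t ht).2]⟩)
    (by
      have h1 := cov_le_of_image (S := T) (f := fun t => 1 - t) (M := 1) hδ hδ zero_le_one (by
        intro x _ y _ hxy
        rw [sub_sub_sub_cancel_left, abs_sub_comm] at hxy
        linarith)
      calc N ≤ 5 * K * ((2 * 1 + 3) * cov δ T') := hge.trans (by gcongr)
        _ = _ := by ring)
    (by
      have h1 := cov_mul_le_volume_real (T := T') (b := 1 / 2) hδ (by norm_num) (by norm_num) hA'I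
        (by
          intro t ht y hy
          obtain ⟨s, hs, rfl⟩ := Finset.mem_image.1 ht
          refine ⟨1, rfl, 1 - y, hball s hs ?_, by simp⟩
          rw [Metric.mem_ball, Real.dist_eq] at hy ⊢
          rw [abs_sub_comm]
          convert hy using 2; ring)
        (fun t ht => (hT'mem t ht).1)
      have h2 := (le_max_right _ _).trans hA.small
      rw [rpow_one_sub_eq hδ] at h2
      refine le_of_mul_le_mul_left ?_ hδ
      have : 0 ≤ K * (δ * N) := by positivity
      linarith)
  set u : ℝ → ℤ := fun t => cell δ (Real.log t) with hu
  set v : ℝ → ℤ := fun t => cell δ (Real.log (1 - t)) with hv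
  have hvT' : T'.image u = T.image v := by
    rw [hT', Finset.image_image]; rfl
  rw [hvT'] at hV
  set ρ := (K⁻¹) ^ (m * 3) with hρ
  have hρ0 : 0 < ρ := by positivity
  have hρinv : ρ⁻¹ = K ^ (m * 3) := by rw [hρ, inv_pow, inv_inv]
  have hδρ : 100 * δ ≤ ρ := by
    have h1 : 100 * K ^ (m * 3) ≤ K' := hKK' 100 1 _ (by norm_num) (by omega)
    have h2 : 100 * K ^ (m * 3) * δ ≤ 1 := le_trans (by gcongr) hδsmall
    have h3 := mul_le_mul_of_nonneg_left h2 hρ0.le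
    rw [← hρinv] at h3
    calc 100 * δ = ρ * (100 * ρ⁻¹ * δ) := by field_simp
      _ ≤ ρ * 1 := h3
      _ = ρ := mul_one ρ
  -- Pairs near the diagonal are removed because the intercept `μ = 1 - (1 - y) / (1 - x) = (y - x)
  -- / (1 - x)` must not be too small. Non-concentration at radius `ρ` shows that at least half of
  -- the pairs survive.
  set Q := (T ×ˢ T).filter (fun q => ρ ≤ |q.1 - q.2|) with hQ
  have hQmem : ∀ q ∈ Q, q.1 ∈ T ∧ q.2 ∈ T ∧ ρ ≤ |q.1 - q.2| := by
    intro q hq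
    obtain ⟨h1, h2⟩ := Finset.mem_filter.1 hq
    exact ⟨(Finset.mem_product.1 h1).1, (Finset.mem_product.1 h1).2, h2⟩
  have hcT : (cov δ T : ℝ) = T.card := by rw [cov_eq_card hTinj]
  rw [hcT] at hge hle
  have hQc : (T.card : ℝ) ^ 2 ≤ 2 * Q.card := by
    have h1 : ((T ×ˢ T).filter (fun q => ¬ ρ ≤ |q.1 - q.2|)).card ≤
        ∑ x ∈ T, cov δ (T.filter (fun y => |y - x| ≤ ρ)) := by
      rw [Finset.card_eq_sum_card_fiberwise (f := Prod.fst) (t := T) (by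
        intro q hq
        exact (Finset.mem_product.1 (Finset.mem_filter.1 hq).1).1)]
      refine Finset.sum_le_sum fun x hx => ?_
      rw [cov_eq_card (hTinj.mono (by exact_mod_cast Finset.filter_subset _ _))]
      refine Finset.card_le_card_of_injOn Prod.snd ?_ ?_
      · rintro ⟨a, b⟩ hq
        simp only [Finset.coe_filter, Finset.mem_filter, Finset.mem_product, mem_ofPred_eq] at hq ⊢
        obtain ⟨⟨⟨-, hb⟩, hab⟩, rfl⟩ := hq
        exact ⟨hb, by rw [abs_sub_comm]; exact (not_le.1 hab).le⟩
      · rintro ⟨a, b⟩ hq ⟨a', b'⟩ hq' hbb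
        simp only [Finset.coe_filter, mem_ofPred_eq] at hq hq'
        obtain ⟨-, rfl⟩ := hq
        obtain ⟨-, rfl⟩ := hq'
        simp only at hbb
        rw [hbb]
    have h2 : (ρ / δ) ^ σ ≤ K⁻¹ ^ 3 * N := by
      rw [div_eq_mul_inv, Real.mul_rpow hρ0.le (by positivity), Real.inv_rpow hδ.le,
        ← Real.rpow_neg hδ.le]
      gcongr
      exact rpow_inv_pow_le hK1 hm
    have h3 : (((T ×ˢ T).filter (fun q => ¬ ρ ≤ |q.1 - q.2|)).card : ℝ) ≤
        T.card * (2 * K * (K⁻¹ ^ 3 * N)) := by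
      calc _ ≤ ∑ x ∈ T, (cov δ (T.filter (fun y => |y - x| ≤ ρ)) : ℝ) := by exact_mod_cast h1
        _ ≤ ∑ x ∈ T, 2 * K * (K⁻¹ ^ 3 * N) := by
            refine Finset.sum_le_sum fun x _ => (hnc x ρ (by linarith)).trans ?_
            gcongr
        _ = _ := by rw [Finset.sum_const, nsmul_eq_mul]
    have h4 : (T.card : ℝ) * (2 * K * (K⁻¹ ^ 3 * N)) ≤ T.card ^ 2 / 2 := by
      have h5 : 2 * K * (K⁻¹ ^ 3 * N) ≤ T.card / 2 := by
        calc 2 * K * (K⁻¹ ^ 3 * N) ≤ 2 * K * (K⁻¹ ^ 3 * (5 * K * T.card)) := by gcongr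
          _ = 10 * K⁻¹ * T.card := by field_simp; ring
          _ ≤ 10 * 100⁻¹ * T.card := by gcongr
          _ ≤ _ := by linarith [Nat.cast_nonneg (α := ℝ) T.card]
      calc _ ≤ (T.card : ℝ) * (T.card / 2) := by gcongr
        _ = _ := by ring
    have h6 : (Q.card : ℝ) + ((T ×ˢ T).filter (fun q => ¬ ρ ≤ |q.1 - q.2|)).card =
        T.card ^ 2 := by
      have := Finset.card_filter_add_card_filter_not (s := T ×ˢ T) (fun q => ρ ≤ |q.1 - q.2|)
      rw [Finset.card_product] at this
      rw [pow_two]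
      exact_mod_cast this
    linarith
  -- The lines are labelled by integers `v x - v y`, which have to be few; the label `k` stands for
  -- the slope `exp (-δ k)`, correct up to `O(δ)`.
  have hvlog : ∀ q ∈ Q, |(-(δ * ((v q.1 - v q.2 : ℤ) : ℝ))) -
      Real.log ((1 - q.2) / (1 - q.1))| ≤ δ := by
    intro q hq
    obtain ⟨h1, h2, -⟩ := hQmem q hq
    have a1 := hTmem _ h1
    have a2 := hTmem _ h2
    rw [Real.log_div (by linarith) (by linarith)]
    have b1 := cell_bounds hδ (Real.log (1 - q.1))
    have b2 := cell_bounds hδ (Real.log (1 - q.2))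
    simp only [hv]
    push_cast
    rw [abs_le]
    constructor <;> linarith
  have hratio : ∀ q ∈ Q, 2 / 3 ≤ (1 - q.2) / (1 - q.1) ∧ (1 - q.2) / (1 - q.1) ≤ 3 / 2 := by
    intro q hq
    obtain ⟨h1, h2, -⟩ := hQmem q hq
    have a1 := hTmem _ h1
    have a2 := hTmem _ h2
    rw [le_div_iff₀ (by linarith), div_le_iff₀ (by linarith)]
    constructor <;> linarith
  have hlam : ∀ q ∈ Q, |Real.exp (-(δ * ((v q.1 - v q.2 : ℤ) : ℝ))) - (1 - q.2) / (1 - q.1)| ≤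
      5 * δ := by
    intro q hq
    have h1 := hvlog q hq
    have h2 := hratio q hq
    set e := -(δ * ((v q.1 - v q.2 : ℤ) : ℝ)) with he
    set d := (1 - q.2) / (1 - q.1) with hd
    have hd0 : 0 < d := by linarith
    have h3 : Real.exp e ≤ 5 := by
      have h4 : e ≤ Real.log d + 1 := by
        have := (abs_le.1 h1).2
        linarith
      calc Real.exp e ≤ Real.exp (Real.log d + 1) := Real.exp_le_exp.2 h4
        _ = d * Real.exp 1 := by rw [Real.exp_add, Real.exp_log hd0]
        _ ≤ (3 / 2) * 3 := by
            gcongr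
            · exact h2.2
            · linarith [Real.exp_one_lt_d9]
        _ ≤ 5 := by norm_num
    have h5 := abs_sub_le_mul_abs_log_sub (Real.exp_pos e) hd0 h3 (by linarith : d ≤ 5)
    rw [Real.log_exp] at h5
    exact h5.trans (by gcongr)
  have hrich : FourPencilRich K' δ N Q Prod.fst Prod.snd (fun q => v q.1 - v q.2)
      (fun k : ℤ => Real.exp (-(δ * (k : ℝ)))) (fun k : ℤ => 1 - Real.exp (-(δ * (k : ℝ)))) := by
    have hinv : K'⁻¹ ≤ 1 / 100 := by rw [← one_div]; gcongr
    refine ⟨?_, ?_, ?_, ?_, ?_, ?_, ?_, ?_, ?_, ?_, ?_⟩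
    · intro q hq
      have := hTmem _ (hQmem q hq).1
      constructor <;> linarith
    · intro q hq
      have := hTmem _ (hQmem q hq).2.1
      constructor <;> linarith
    · intro q hq
      have h1 := abs_le.1 (hlam q hq)
      have h2 := hratio q hq
      rw [abs_of_pos (Real.exp_pos _)]
      constructor <;> linarith
    · intro q hq
      have h1 := abs_le.1 (hlam q hq)
      obtain ⟨hq1, hq2, hq3⟩ := hQmem q hq
      have h2 : ρ ≤ |1 - (1 - q.2) / (1 - q.1)| := by
        have a1 := hTmem _ hq1
        rw [show 1 - (1 - q.2) / (1 - q.1) = (q.2 - q.1) / (1 - q.1) by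
          have : 1 - q.1 ≠ 0 := by linarith
          field_simp; ring, abs_div, abs_of_pos (by linarith : 0 < 1 - q.1), abs_sub_comm,
          le_div_iff₀ (by linarith)]
        nlinarith
      have hKρ : 2 * K'⁻¹ ≤ ρ := by
        have h3 : 2 * K ^ (m * 3) ≤ K' := hKK' 2 1 _ (by norm_num) (by omega)
        rw [← hρinv] at h3
        rw [← div_eq_mul_inv, div_le_iff₀ hK'0]
        calc (2 : ℝ) = ρ * (2 * ρ⁻¹) := by field_simp
          _ ≤ ρ * K' := by gcongr
      constructor
      · rcases le_abs.1 h2 with h3 | h3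
        · refine le_trans ?_ (le_abs_self _)
          linarith
        · refine le_trans ?_ (neg_le_abs _)
          linarith
      · have h2 := hratio q hq
        rw [abs_le]
        constructor <;> linarith
    · intro q hq
      have h1 := hlam q hq
      obtain ⟨hq1, hq2, -⟩ := hQmem q hq
      have a1 := hTmem _ hq1
      set l := Real.exp (-(δ * ((v q.1 - v q.2 : ℤ) : ℝ))) with hl
      have h2 : q.2 - (l * q.1 + (1 - l)) = (1 - q.1) * (l - (1 - q.2) / (1 - q.1)) := by
        have : 1 - q.1 ≠ 0 := by linarith
        field_simp; ring
      rw [h2, abs_mul, abs_of_pos (by linarith)]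
      calc (1 - q.1) * |l - (1 - q.2) / (1 - q.1)| ≤ 1 * (5 * δ) := by
            gcongr; linarith
        _ ≤ K' * δ := by nlinarith
    · rintro ⟨a, b⟩ hq ⟨a', b'⟩ hq' he
      obtain ⟨h1, h2, -⟩ := hQmem _ hq
      obtain ⟨h3, h4, -⟩ := hQmem _ hq'
      simp only [Prod.mk.injEq] at he
      exact Prod.ext (hTinj h1 h3 he.1) (hTinj h2 h4 he.2)
    · calc N ^ 2 ≤ (5 * K * T.card) ^ 2 := by gcongr
        _ = 25 * K ^ 2 * T.card ^ 2 := by ring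
        _ ≤ 25 * K ^ 2 * (2 * Q.card) := by gcongr
        _ = 50 * K ^ 2 * Q.card := by ring
        _ ≤ _ := by gcongr; exact hKK' _ 1 _ (by norm_num) (by omega)
    · have h1 : Q.image (fun q => cell δ q.1) ⊆ T.image (cell δ) := by
        intro z hz
        obtain ⟨q, hq, rfl⟩ := Finset.mem_image.1 hz
        exact Finset.mem_image_of_mem _ (hQmem q hq).1
      calc _ ≤ (T.card : ℝ) := by exact_mod_cast (Finset.card_le_card h1).trans Finset.card_image_le
        _ ≤ K * N := hle
        _ ≤ _ := by gcongr; simpa using hKK' 1 0 1 (by norm_num) (by omega)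
    · have h1 : Q.image (fun q => cell δ q.2) ⊆ T.image (cell δ) := by
        intro z hz
        obtain ⟨q, hq, rfl⟩ := Finset.mem_image.1 hz
        exact Finset.mem_image_of_mem _ (hQmem q hq).2.1
      calc _ ≤ (T.card : ℝ) := by exact_mod_cast (Finset.card_le_card h1).trans Finset.card_image_le
        _ ≤ K * N := hle
        _ ≤ _ := by gcongr; simpa using hKK' 1 0 1 (by norm_num) (by omega)
    · have h1 := card_image_cell_le Q (fun q => q.1 / q.2) (fun q => u q.1 - u q.2) (M := 4) hδ
        (by norm_num) (by
          intro q hq q' hq' he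
          obtain ⟨c1, c2, -⟩ := hQmem q hq
          obtain ⟨c3, c4, -⟩ := hQmem q' hq'
          have a1 := hTmem _ c1
          have a2 := hTmem _ c2
          have a3 := hTmem _ c3
          have a4 := hTmem _ c4
          have h3 := abs_sub_le_mul_abs_log_sub (a := q.1 / q.2) (b := q'.1 / q'.2) (M := 2)
            (div_pos (by linarith) (by linarith)) (div_pos (by linarith) (by linarith))
            (by rw [div_le_iff₀ (by linarith)]; linarith)
            (by rw [div_le_iff₀ (by linarith)]; linarith)
          rw [Real.log_div (by linarith) (by linarith),
            Real.log_div (by linarith) (by linarith)] at h3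
          refine h3.trans ?_
          have e1 := cell_bounds hδ (Real.log q.1)
          have e2 := cell_bounds hδ (Real.log q.2)
          have e3 := cell_bounds hδ (Real.log q'.1)
          have e4 := cell_bounds hδ (Real.log q'.2)
          have he' : (cell δ (Real.log q.1) : ℝ) - cell δ (Real.log q.2) =
            cell δ (Real.log q'.1) - cell δ (Real.log q'.2) := by exact_mod_cast he
          have he'' := congrArg (· * δ) he'
          simp only [sub_mul] at he''
          have : |Real.log q.1 - Real.log q.2 - (Real.log q'.1 - Real.log q'.2)| ≤ 2 * δ := by
            rw [abs_le]
            constructor <;> linarith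
          linarith)
      have h2 : Q.image (fun q => u q.1 - u q.2) ⊆ T.image u - T.image u := by
        intro z hz
        obtain ⟨q, hq, rfl⟩ := Finset.mem_image.1 hz
        exact Finset.sub_mem_sub (Finset.mem_image_of_mem _ (hQmem q hq).1)
          (Finset.mem_image_of_mem _ (hQmem q hq).2.1)
      calc _ ≤ _ := h1
        _ ≤ (2 * 4 + 3) * ((20 * K) ^ 5 * N) := by
            gcongr
            exact le_trans (by exact_mod_cast Finset.card_le_card h2) hU
        _ = (11 * 20 ^ 5) * K ^ 5 * N := by ring
        _ ≤ _ := by gcongr; exact hKK' _ 4 _ (by norm_num) (by omega)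
    · have h2 : Q.image (fun q => v q.1 - v q.2) ⊆ T.image v - T.image v := by
        intro z hz
        obtain ⟨q, hq, rfl⟩ := Finset.mem_image.1 hz
        exact Finset.sub_mem_sub (Finset.mem_image_of_mem _ (hQmem q hq).1)
          (Finset.mem_image_of_mem _ (hQmem q hq).2.1)
      calc _ ≤ (25 * K) ^ 5 * N := le_trans (by exact_mod_cast Finset.card_le_card h2) hV
        _ = 25 ^ 5 * K ^ 5 * N := by ring
        _ ≤ _ := by gcongr; exact hKK' _ 4 _ (by norm_num) (by omega)
  obtain ⟨S, hS1, hS2, hS3, hS4⟩ := hrich.exists_small_sum_and_product hK'100 hδ hN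
  have hST : S ⊆ T := by
    intro x hx
    obtain ⟨q, hq, rfl⟩ := Finset.mem_image.1 (hS1 hx)
    exact (hQmem q hq).1
  have hbig : K' ≤ K ^ ((3 * m + 20) * 200000) := by
    rw [pow_mul]
    exact le_self_pow₀ (by linarith) (by norm_num)
  refine ⟨S, ?_, ?_, ?_, ?_, ?_⟩
  · intro x hx
    have h1 := hTmem x (hST hx)
    have h2 : (K ^ ((3 * m + 20) * 200000))⁻¹ ≤ 1 / 100 := by
      rw [← one_div]; gcongr; linarith
    constructor <;> linarith
  · refine (hnc.subset hST).mono hδ (le_trans ?_ hbig)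
    simpa using hKK' 2 1 1 (by norm_num) (by omega)
  · rw [pow_mul]; exact hS2
  · rw [pow_mul]; exact hS3
  · rw [pow_mul]; exact hS4

end ShiftedProduct

/-! ### The Ruzsa triangle inequality and dilation for cell counts. -/

section RuzsaCells

theorem cov_sub_le_card {δ : ℝ} (hδ : 0 < δ) (Y Z : Finset ℝ) :
    (cov δ (Y - Z) : ℝ) ≤ 7 * (Y.image (cell δ) - Z.image (cell δ)).card := by
  have e1 : Y - Z = (Y ×ˢ Z).image (fun p => p.1 - p.2) := by
    ext z; simp [Finset.mem_sub, and_assoc]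
  have e2 : Y.image (cell δ) - Z.image (cell δ) =
      (Y ×ˢ Z).image (fun p => cell δ p.1 - cell δ p.2) := by
    ext z; simp [Finset.mem_sub, and_assoc]
  rw [e1, e2, cov_image]
  refine (card_image_cell_le (Y ×ˢ Z) _ (fun p => cell δ p.1 - cell δ p.2) (M := 2) hδ (by norm_num)
    ?_).trans_eq (by norm_num)
  intro p _ q _ he
  have he' : (cell δ p.1 : ℝ) - cell δ p.2 = cell δ q.1 - cell δ q.2 := by exact_mod_cast he
  have he2 : (cell δ p.1 : ℝ) * δ - cell δ p.2 * δ = cell δ q.1 * δ - cell δ q.2 * δ := by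
    rw [← sub_mul, he', sub_mul]
  have b1 := cell_bounds hδ p.1
  have b2 := cell_bounds hδ p.2
  have b3 := cell_bounds hδ q.1
  have b4 := cell_bounds hδ q.2
  rw [abs_le]
  constructor <;> linarith

theorem card_sub_le_cov {δ : ℝ} (hδ : 0 < δ) (Y Z : Finset ℝ) :
    ((Y.image (cell δ) - Z.image (cell δ)).card : ℝ) ≤ 7 * cov δ (Y - Z) := by
  have e1 : Y - Z = (Y ×ˢ Z).image (fun p => p.1 - p.2) := by
    ext z; simp [Finset.mem_sub, and_assoc]
  have e2 : Y.image (cell δ) - Z.image (cell δ) =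
      (Y ×ˢ Z).image (fun p => cell δ p.1 - cell δ p.2) := by
    ext z; simp [Finset.mem_sub, and_assoc]
  rw [e1, e2, cov_image]
  refine (card_image_int_le (Y ×ˢ Z) _ (fun p => cell δ (p.1 - p.2)) (M := 3) (by norm_num)
    ?_).trans_eq (by norm_num)
  intro p _ q _ he
  have h1 := abs_lt.1 (abs_sub_lt_of_cell_eq hδ he)
  have b1 := cell_bounds hδ p.1
  have b2 := cell_bounds hδ p.2
  have b3 := cell_bounds hδ q.1
  have b4 := cell_bounds hδ q.2
  push_cast
  rw [abs_le]
  constructor <;> refine le_of_mul_le_mul_right ?_ hδ <;> linarith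

/-- The Ruzsa triangle inequality for covering numbers. -/
theorem cov_sub_mul_cov_le {δ : ℝ} (hδ : 0 < δ) (X Y Z : Finset ℝ) :
    (cov δ (Y - Z) : ℝ) * cov δ X ≤ 343 * (cov δ (Y - X) * cov δ (X - Z)) := by
  have h1 : ((Y.image (cell δ) - Z.image (cell δ)).card * (X.image (cell δ)).card : ℝ) ≤
      (Y.image (cell δ) - X.image (cell δ)).card * (X.image (cell δ) - Z.image (cell δ)).card := by
    rw [← neg_sub (Z.image (cell δ)) (X.image (cell δ)), Finset.card_neg]
    exact_mod_cast Finset.ruzsa_triangle_inequality_sub_sub_sub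
      (Y.image (cell δ)) (X.image (cell δ)) (Z.image (cell δ))
  have h2 := cov_sub_le_card hδ Y Z
  have h3 := card_sub_le_cov hδ Y X
  have h4 := card_sub_le_cov hδ X Z
  calc (cov δ (Y - Z) : ℝ) * cov δ X
      ≤ 7 * (Y.image (cell δ) - Z.image (cell δ)).card * (X.image (cell δ)).card := by
        gcongr; exact le_rfl
    _ = 7 * ((Y.image (cell δ) - Z.image (cell δ)).card * (X.image (cell δ)).card) := by ring
    _ ≤ 7 * ((Y.image (cell δ) - X.image (cell δ)).card *
        (X.image (cell δ) - Z.image (cell δ)).card) := by gcongr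
    _ ≤ 7 * ((7 * cov δ (Y - X)) * (7 * cov δ (X - Z))) := by gcongr
    _ = _ := by ring

theorem cov_smul_le {δ M α : ℝ} (hδ : 0 < δ) (hα : |α| ≤ M) (T : Finset ℝ) :
    (cov δ (α • T) : ℝ) ≤ (2 * M + 3) * cov δ T := by
  have hM : 0 ≤ M := (abs_nonneg _).trans hα
  rw [← Finset.image_smul]
  refine cov_image_le hδ hδ hM fun x _ y _ hxy => ?_
  rw [smul_eq_mul, smul_eq_mul, ← mul_sub, abs_mul]
  gcongr

theorem card_filter_abs_sub_le {δ M a : ℝ} {T : Finset ℝ} (hδ : 0 < δ) (hM : 0 ≤ M)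
    (hT : Set.InjOn (cell δ) T) : ((T.filter (fun x => |x - a| ≤ M * δ)).card : ℝ) ≤ 2 * M + 3 := by
  rw [← Finset.card_image_of_injOn (f := cell δ)
    (hT.mono (by exact_mod_cast Finset.filter_subset _ _))]
  refine (card_le_of_abs_sub_le (a := a / δ) (M := M + 1) (by linarith) ?_).trans_eq (by ring)
  intro i hi
  obtain ⟨x, hx, rfl⟩ := Finset.mem_image.1 hi
  have h1 := abs_le.1 (Finset.mem_filter.1 hx).2
  have h2 := cell_bounds hδ x
  have h3 : a / δ * δ = a := div_mul_cancel₀ _ hδ.ne'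
  rw [abs_le]
  constructor <;> refine le_of_mul_le_mul_right ?_ hδ <;> linarith

/-- Cauchy–Schwarz for the number of collisions of a function. -/
theorem card_sq_le_card_image_mul {ι β : Type*} [DecidableEq β] [DecidableEq ι] (P : Finset ι)
    (f : ι → β) :
    (P.card : ℝ) ^ 2 ≤ (P.image f).card * ((P ×ˢ P).filter (fun q => f q.1 = f q.2)).card := by
  have h1 : P.card = ∑ b ∈ P.image f, (P.filter (fun p => f p = b)).card :=
    Finset.card_eq_sum_card_fiberwise (fun p hp => by simpa using ⟨p, hp, rfl⟩)
  have h2 : ((P ×ˢ P).filter (fun q => f q.1 = f q.2)).card =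
      ∑ b ∈ P.image f, (P.filter (fun p => f p = b)).card ^ 2 := by
    rw [Finset.card_eq_sum_card_fiberwise (f := fun q => f q.1) (t := P.image f)]
    · refine Finset.sum_congr rfl fun b _ => ?_
      rw [sq, ← Finset.card_product]
      congr 1
      ext q
      simp only [Finset.mem_filter, Finset.mem_product]
      constructor
      · rintro ⟨⟨⟨a, b⟩, c⟩, d⟩
        exact ⟨⟨a, d⟩, b, c ▸ d⟩
      · rintro ⟨⟨a, b⟩, c, d⟩
        exact ⟨⟨⟨a, c⟩, b.trans d.symm⟩, b⟩
    · intro q hq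
      have := (Finset.mem_product.1 (Finset.mem_filter.1 (Finset.mem_coe.1 hq)).1).1
      simpa using ⟨q.1, this, rfl⟩
  have h3 := sq_sum_le_card_mul_sum_sq (s := P.image f)
    (f := fun b => ((P.filter (fun p => f p = b)).card : ℝ))
  rw [h2, h1]
  push_cast
  exact h3

end RuzsaCells

/-! ### Dilates that keep a set nearly parallel to itself are few. -/

section GoodDilates

/-- A set of dilates for which `x S - S` is small is itself small when `S` is not concentrated. -/
theorem cov_dilates_le {δ L N κ ρ : ℝ} {S R : Finset ℝ} (hδ : 0 < δ) (hδρ : δ ≤ ρ) (hρ1 : ρ ≤ 1)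
    (hS : Set.InjOn (cell δ) S) (hN : 0 < N) (hNS : (S.card : ℝ) = N) (hL : 0 < L)
    (hnc : ∀ a, ((S.filter (fun x => |x - a| ≤ ρ)).card : ℝ) ≤ κ) (hκ : 10 * L * κ ≤ N)
    (hR : ∀ x ∈ R, (cov δ (x • S - S) : ℝ) ≤ L * N) : ρ * cov δ R ≤ 10 * L * N := by
  have hρ := hδ.trans_le hδρ
  obtain ⟨R', hR'R, hR'inj, hR'c⟩ := exists_subset_injOn_cell δ R
  rw [← hR'c, cov_eq_card hR'inj]
  set P := S ×ˢ S with hP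
  -- The collisions counted are quadruples with `x a - b` and `x c - d` in one cell and `|c - a| >
  -- ρ`. Such a quadruple determines `x` as `(d - b) / (c - a)` up to `δ / ρ`, which is the content
  -- of `hfew`.
  set far : ℝ → (ℝ × ℝ) × (ℝ × ℝ) → Prop := fun x q =>
    cell δ (x * q.1.1 - q.1.2) = cell δ (x * q.2.1 - q.2.2) ∧ ρ < |q.2.1 - q.1.1| with hfar
  classical
  have hmany : ∀ x ∈ R', N ^ 3 / (2 * L) ≤ (((P ×ˢ P).filter (far x)).card : ℝ) := by
    intro x hx
    have h1 := card_sq_le_card_image_mul P (fun p => cell δ (x * p.1 - p.2))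
    have h2 : ((P.image (fun p => cell δ (x * p.1 - p.2))).card : ℝ) ≤ L * N := by
      refine le_trans (le_of_eq ?_) (hR x (hR'R hx))
      have e1 : x • S - S = P.image (fun p => x * p.1 - p.2) := by
        ext z; simp [hP, Finset.mem_sub, Finset.mem_smul_finset, and_assoc]
      rw [e1, cov_image]
    set E := (P ×ˢ P).filter (fun q => cell δ (x * q.1.1 - q.1.2) = cell δ (x * q.2.1 - q.2.2))
      with hE
    have h3 : (P.card : ℝ) = N ^ 2 := by
      rw [hP, Finset.card_product]; push_cast; rw [hNS]; ring
    rw [h3] at h1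
    have h4 : N ^ 3 ≤ L * E.card := by
      refine le_of_mul_le_mul_right ?_ hN
      calc N ^ 3 * N = (N ^ 2) ^ 2 := by ring
        _ ≤ (L * N) * E.card := h1.trans (by gcongr)
        _ = _ := by ring
    have h5 : (((P ×ˢ P).filter (far x)).card : ℝ) + (E.filter (fun q => ¬ ρ < |q.2.1 - q.1.1|)).card
        = E.card := by
      have := Finset.card_filter_add_card_filter_not (s := E) (fun q => ρ < |q.2.1 - q.1.1|)
      rw [← this, Nat.cast_add]
      congr 2
      rw [hE, Finset.filter_filter]
    -- For given `(a, b)` there are at most `κ` choices of `c` within `ρ` of `a`, and then `d` is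
    -- confined to an interval that contains at most five points of `S`. The assumption on `κ` makes
    -- these collisions at most half of the total.
    have h6 : ((E.filter (fun q => ¬ ρ < |q.2.1 - q.1.1|)).card : ℝ) ≤ N ^ 2 * (5 * κ) := by
      rw [Finset.card_eq_sum_card_fiberwise (f := fun q => q.1) (t := P) (by
        intro q hq
        exact (Finset.mem_product.1 (Finset.mem_filter.1 (Finset.mem_filter.1
          (Finset.mem_coe.1 hq)).1).1).1)]
      push_cast
      rw [← h3, ← nsmul_eq_mul]
      refine Finset.sum_le_card_nsmul _ _ _ fun p hp => ?_
      set Ep := (E.filter (fun q => ¬ ρ < |q.2.1 - q.1.1|)).filter (fun q => q.1 = p) with hEp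
      rw [Finset.card_eq_sum_card_fiberwise (f := fun q => q.2.1)
        (t := S.filter (fun c => |c - p.1| ≤ ρ)) (by
          intro q hq
          simp only [hEp, hE, hP, Finset.coe_filter, Finset.mem_filter, Finset.mem_product, not_lt,
            mem_ofPred_eq] at hq ⊢
          obtain ⟨⟨⟨⟨_, h1, _⟩, _⟩, h2⟩, rfl⟩ := hq
          exact ⟨h1, h2⟩)]
      push_cast
      have h7 : ∀ c ∈ S.filter (fun c => |c - p.1| ≤ ρ),
          ((Ep.filter (fun q => q.2.1 = c)).card : ℝ) ≤ 5 := by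
        intro c _
        have h8 := card_filter_abs_sub_le (M := 1) (a := x * c - (x * p.1 - p.2)) hδ zero_le_one hS
        refine le_trans ?_ (h8.trans_eq (by norm_num))
        have : (Ep.filter (fun q => q.2.1 = c)).card ≤ (S.filter
            (fun y => |y - (x * c - (x * p.1 - p.2))| ≤ 1 * δ)).card := by
          refine Finset.card_le_card_of_injOn (fun q => q.2.2) ?_ ?_
          · intro q hq
            simp only [hEp, hE, hP, Finset.coe_filter, Finset.mem_filter, Finset.mem_product, not_lt,
              mem_ofPred_eq] at hq ⊢
            obtain ⟨⟨⟨⟨⟨_, _, h1⟩, h3⟩, h2⟩, rfl⟩, rfl⟩ := hq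
            refine ⟨h1, ?_⟩
            have := (abs_sub_lt_of_cell_eq hδ h3).le
            rw [one_mul]
            refine le_trans (le_of_eq ?_) this
            congr 1
            ring
          · intro q hq q' hq' he
            simp only [hEp, Finset.coe_filter, Finset.mem_filter, mem_ofPred_eq] at hq hq'
            refine Prod.ext (hq.1.2.trans hq'.1.2.symm) (Prod.ext (hq.2.trans hq'.2.symm) he)
        exact_mod_cast this
      calc _ ≤ ∑ c ∈ S.filter (fun c => |c - p.1| ≤ ρ), (5 : ℝ) := Finset.sum_le_sum h7
        _ = (S.filter (fun c => |c - p.1| ≤ ρ)).card * 5 := by rw [Finset.sum_const, nsmul_eq_mul]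
        _ ≤ κ * 5 := by gcongr; exact hnc p.1
        _ = _ := by ring
    rw [div_le_iff₀ (by positivity)]
    have h7 : L * (N ^ 2 * (5 * κ)) * 2 ≤ N ^ 3 := by
      calc _ = N ^ 2 * (10 * L * κ) := by ring
        _ ≤ N ^ 2 * N := by gcongr
        _ = _ := by ring
    nlinarith
  have hfew : ∀ q ∈ P ×ˢ P, ((R'.filter (fun x => far x q)).card : ℝ) ≤ 5 / ρ := by
    intro q _
    by_cases hq : ρ < |q.2.1 - q.1.1|
    · have h8 := card_filter_abs_sub_le (M := 1 / ρ)
        (a := (q.2.2 - q.1.2) / (q.2.1 - q.1.1)) hδ (by positivity) hR'inj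
      have h9 : R'.filter (fun x => far x q) ⊆ R'.filter (fun x =>
          |x - (q.2.2 - q.1.2) / (q.2.1 - q.1.1)| ≤ 1 / ρ * δ) := by
        intro x hx
        rw [Finset.mem_filter] at hx ⊢
        refine ⟨hx.1, ?_⟩
        have h10 := (abs_sub_lt_of_cell_eq hδ hx.2.1).le
        have h0 : q.2.1 - q.1.1 ≠ 0 := fun h0 => by rw [h0, abs_zero] at hq; linarith
        rw [show x - (q.2.2 - q.1.2) / (q.2.1 - q.1.1) =
          -(x * q.1.1 - q.1.2 - (x * q.2.1 - q.2.2)) / (q.2.1 - q.1.1) by field_simp; ring,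
          abs_div, abs_neg, one_div, inv_mul_eq_div]
        gcongr
      calc _ ≤ ((R'.filter (fun x =>
          |x - (q.2.2 - q.1.2) / (q.2.1 - q.1.1)| ≤ 1 / ρ * δ)).card : ℝ) := by
            exact_mod_cast Finset.card_le_card h9
        _ ≤ 2 * (1 / ρ) + 3 := h8
        _ ≤ 2 * (1 / ρ) + 3 * (1 / ρ) := by
            have : 1 ≤ 1 / ρ := by rw [le_div_iff₀ hρ]; linarith
            linarith
        _ = _ := by ring
    · rw [Finset.filter_false_of_mem (fun x _ h => hq h.2)]
      simp only [Finset.card_empty, Nat.cast_zero]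
      positivity
  have hsum : ∑ x ∈ R', (((P ×ˢ P).filter (far x)).card : ℝ) =
      ∑ q ∈ P ×ˢ P, ((R'.filter (fun x => far x q)).card : ℝ) := by
    exact_mod_cast Finset.sum_card_bipartiteAbove_eq_sum_card_bipartiteBelow far
  have hlow := Finset.card_nsmul_le_sum R' _ _ hmany
  have hup := Finset.sum_le_card_nsmul (P ×ˢ P) _ _ hfew
  rw [hsum] at hlow
  have hfin := hlow.trans hup
  rw [nsmul_eq_mul, nsmul_eq_mul, Finset.card_product, hP, Finset.card_product] at hfin
  push_cast at hfin
  rw [hNS, mul_div_assoc', mul_div_assoc', div_le_div_iff₀ (by positivity) hρ] at hfin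
  refine le_of_mul_le_mul_right ?_ (show 0 < N ^ 3 by positivity)
  nlinarith

end GoodDilates

/-! ### Popular dilates from small product sets. -/

section ShiftedDilates

theorem card_add_le_cov {δ : ℝ} (hδ : 0 < δ) (Y Z : Finset ℝ) :
    ((Y.image (cell δ) + Z.image (cell δ)).card : ℝ) ≤ 7 * cov δ (Y + Z) := by
  have e1 : Y + Z = (Y ×ˢ Z).image (fun p => p.1 + p.2) := by
    ext z; simp [Finset.mem_add, and_assoc]
  have e2 : Y.image (cell δ) + Z.image (cell δ) =
      (Y ×ˢ Z).image (fun p => cell δ p.1 + cell δ p.2) := by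
    ext z; simp [Finset.mem_add, and_assoc]
  rw [e1, e2, cov_image]
  refine (card_image_int_le (Y ×ˢ Z) _ (fun p => cell δ (p.1 + p.2)) (M := 3) (by norm_num)
    ?_).trans_eq (by norm_num)
  intro p _ q _ he
  have h1 := abs_lt.1 (abs_sub_lt_of_cell_eq hδ he)
  have b1 := cell_bounds hδ p.1
  have b2 := cell_bounds hδ p.2
  have b3 := cell_bounds hδ q.1
  have b4 := cell_bounds hδ q.2
  push_cast
  rw [abs_le]
  constructor <;> refine le_of_mul_le_mul_right ?_ hδ <;> linarith

theorem cov_le_of_close {δ M : ℝ} (hδ : 0 < δ) (hM : 0 ≤ M) {Y Z : Finset ℝ}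
    (h : ∀ y ∈ Y, ∃ z ∈ Z, |y - z| ≤ M * δ) : (cov δ Y : ℝ) ≤ (4 * M + 5) * cov δ Z := by
  choose! g hg hyg using h
  have h1 := card_image_cell_le Y (fun y => y) (fun y => cell δ (g y)) (M := 2 * M + 1) hδ
    (by linarith) (by
      intro y hy y' hy' he
      have h1 := abs_le.1 (hyg y hy)
      have h2 := abs_le.1 (hyg y' hy')
      have h3 := abs_lt.1 (abs_sub_lt_of_cell_eq hδ he)
      rw [abs_le]
      constructor <;> linarith)
  have h2 : (Y.image (fun y => cell δ (g y))).card ≤ cov δ Z := by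
    refine Finset.card_le_card fun i hi => ?_
    obtain ⟨y, hy, rfl⟩ := Finset.mem_image.1 hi
    exact Finset.mem_image_of_mem _ (hg y hy)
  calc (cov δ Y : ℝ) ≤ _ := h1
    _ ≤ (2 * (2 * M + 1) + 3) * cov δ Z := by gcongr
    _ = _ := by ring

/-- The dilate by `3` sits inside the threefold sumset, where Plünnecke applies. This is how the
shifts `3 - α` are reached from additive information. -/
theorem cov_three_smul_sub_sub_le {δ : ℝ} (hδ : 0 < δ) (S : Finset ℝ) :
    (cov δ ((3 : ℝ) • S - S - S) : ℝ) ≤ 13 * (3 • S.image (cell δ) - 2 • S.image (cell δ)).card := by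
  have e1 : (3 : ℝ) • S - S - S = (S ×ˢ S ×ˢ S).image (fun p => 3 * p.1 - p.2.1 - p.2.2) := by
    ext z; simp [Finset.mem_sub, Finset.mem_smul_finset, and_assoc]
  have e2 : (S ×ˢ S ×ˢ S).image (fun p => 3 * cell δ p.1 - (cell δ p.2.1 + cell δ p.2.2)) ⊆
      3 • S.image (cell δ) - 2 • S.image (cell δ) := by
    intro z hz
    obtain ⟨⟨a, b, c⟩, hp, rfl⟩ := Finset.mem_image.1 hz
    obtain ⟨ha, hb, hc⟩ : a ∈ S ∧ b ∈ S ∧ c ∈ S := by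
      simpa [Finset.mem_product] using hp
    have hm := fun x (hx : x ∈ S) => Finset.mem_image_of_mem (cell δ) hx
    refine Finset.sub_mem_sub ?_ ?_
    · rw [show 3 * cell δ a = cell δ a + cell δ a + cell δ a by ring,
        show 3 • S.image (cell δ) = S.image (cell δ) + S.image (cell δ) + S.image (cell δ) by
          simp [succ_nsmul]]
      exact Finset.add_mem_add (Finset.add_mem_add (hm a ha) (hm a ha)) (hm a ha)
    · rw [two_nsmul]
      exact Finset.add_mem_add (hm b hb) (hm c hc)
  rw [e1, cov_image]
  have h1 := card_image_cell_le (S ×ˢ S ×ˢ S) (fun p => 3 * p.1 - p.2.1 - p.2.2)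
    (fun p => 3 * cell δ p.1 - (cell δ p.2.1 + cell δ p.2.2)) (M := 5) hδ (by norm_num) (by
      intro p _ q _ he
      have he' : 3 * (cell δ p.1 : ℝ) - (cell δ p.2.1 + cell δ p.2.2) =
        3 * cell δ q.1 - (cell δ q.2.1 + cell δ q.2.2) := by exact_mod_cast he
      have he2 : 3 * (cell δ p.1 * δ) - (cell δ p.2.1 * δ + cell δ p.2.2 * δ) =
          3 * (cell δ q.1 * δ) - (cell δ q.2.1 * δ + cell δ q.2.2 * δ) := by
        linear_combination δ * he'
      have b1 := cell_bounds hδ p.1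
      have b2 := cell_bounds hδ p.2.1
      have b3 := cell_bounds hδ p.2.2
      have b4 := cell_bounds hδ q.1
      have b5 := cell_bounds hδ q.2.1
      have b6 := cell_bounds hδ q.2.2
      rw [abs_le]
      constructor <;> linarith)
  refine h1.trans ?_
  norm_num
  exact_mod_cast Finset.card_le_card e2

/-- A set with few products has many pairs of nearly parallel dilates. -/
theorem exists_popular_dilate {δ L N : ℝ} {S : Finset ℝ} (hδ : 0 < δ) (hS1 : ∀ x ∈ S, 1 ≤ x)
    (hS : Set.InjOn (cell δ) S) (hN : 0 < N) (hNS : (S.card : ℝ) = N) (hL : 0 < L)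
    (hmul : (cov δ (S * S) : ℝ) ≤ L * N) :
    ∃ b ∈ S, ∃ S₁ ⊆ S, N ≤ 10 * L * S₁.card ∧ ∀ a ∈ S₁, ∃ X ⊆ S, N ≤ 10 * L * X.card ∧
      ∀ c ∈ X, ∃ d ∈ S, cell δ (a * c) = cell δ (b * d) := by
  classical
  set P := S ×ˢ S with hP
  have hPc : (P.card : ℝ) = N ^ 2 := by
    rw [hP, Finset.card_product]; push_cast; rw [hNS]; ring
  set E := (P ×ˢ P).filter (fun q => cell δ (q.1.1 * q.1.2) = cell δ (q.2.1 * q.2.2)) with hE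
  have hEc : N ^ 3 ≤ L * E.card := by
    have h1 := card_sq_le_card_image_mul P (fun p => cell δ (p.1 * p.2))
    have h2 : ((P.image (fun p => cell δ (p.1 * p.2))).card : ℝ) ≤ L * N := by
      refine le_trans (le_of_eq ?_) hmul
      have e1 : S * S = P.image (fun p => p.1 * p.2) := by
        ext z; simp [hP, Finset.mem_mul, and_assoc]
      rw [e1, cov_image]
    rw [hPc] at h1
    refine le_of_mul_le_mul_right ?_ hN
    calc N ^ 3 * N = (N ^ 2) ^ 2 := by ring
      _ ≤ (L * N) * E.card := h1.trans (by gcongr)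
      _ = _ := by ring
  set X : ℝ → ℝ → Finset ℝ := fun b a =>
    S.filter (fun c => ∃ d ∈ S, cell δ (a * c) = cell δ (b * d)) with hX
  -- For fixed `a`, `b`, `c` the fourth member `d` lies within `δ` of `a c / b`, because `b ≥ 1`; at
  -- most five elements of `S` qualify.
  have hEX : (E.card : ℝ) ≤ 5 * ∑ b ∈ S, ∑ a ∈ S, ((X b a).card : ℝ) := by
    rw [Finset.card_eq_sum_card_fiberwise (f := fun q => (q.2.1, q.1)) (t := S ×ˢ P) (by
      intro q hq
      have := (Finset.mem_filter.1 (Finset.mem_coe.1 hq)).1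
      simp only [hP, Finset.mem_product, Finset.coe_product, Set.mem_prod, Finset.mem_coe] at this ⊢
      tauto), Finset.sum_product, Finset.mul_sum]
    push_cast
    refine Finset.sum_le_sum fun b hb => ?_
    rw [hP, Finset.sum_product, Finset.mul_sum]
    refine Finset.sum_le_sum fun a ha => ?_
    have h1 : ∀ c ∈ S, ((E.filter (fun q => (q.2.1, q.1) = (b, (a, c)))).card : ℝ) ≤
        if c ∈ X b a then 5 else 0 := by
      intro c hc
      split_ifs with hcX
      · have h8 := card_filter_abs_sub_le (M := 1) (a := a * c / b) hδ zero_le_one hS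
        refine le_trans ?_ (h8.trans_eq (by norm_num))
        have : (E.filter (fun q => (q.2.1, q.1) = (b, (a, c)))).card ≤
            (S.filter (fun y => |y - a * c / b| ≤ 1 * δ)).card := by
          refine Finset.card_le_card_of_injOn (fun q => q.2.2) ?_ ?_
          · rintro ⟨⟨a', c'⟩, b', d⟩ hq
            simp only [hE, hP, Finset.coe_filter, Finset.mem_filter, Finset.mem_product,
              mem_ofPred_eq, Prod.mk.injEq] at hq ⊢
            obtain ⟨⟨⟨_, _, hd⟩, he⟩, rfl, rfl, rfl⟩ := hq
            refine ⟨hd, ?_⟩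
            have h2 := (abs_sub_lt_of_cell_eq hδ he).le
            have hb1 := hS1 _ hb
            have hb0 : 0 < b' := by linarith
            rw [show d - a' * c' / b' = -(a' * c' - b' * d) / b' by field_simp; ring, abs_div,
              abs_neg, abs_of_pos hb0, one_mul, div_le_iff₀ hb0]
            nlinarith
          · rintro ⟨p, b', d⟩ hq ⟨p', b'', d'⟩ hq' he
            simp only [Finset.coe_filter, mem_ofPred_eq, Prod.mk.injEq] at hq hq' he
            obtain ⟨_, rfl, rfl⟩ := hq
            obtain ⟨_, rfl, rfl⟩ := hq'
            rw [he]
        exact_mod_cast this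
      · rw [Finset.filter_false_of_mem]
        · simp
        · rintro ⟨⟨a', c'⟩, b', d⟩ hq he
          simp only [hE, hP, Finset.mem_filter, Finset.mem_product, Prod.mk.injEq] at hq he
          obtain ⟨⟨_, _, hd⟩, he'⟩ := hq
          obtain ⟨rfl, rfl, rfl⟩ := he
          exact hcX (Finset.mem_filter.2 ⟨hc, d, hd, he'⟩)
    refine (Finset.sum_le_sum h1).trans_eq ?_
    rw [← Finset.sum_filter, Finset.sum_const, nsmul_eq_mul, mul_comm]
    congr 3
    ext c
    simp only [hX, Finset.mem_filter]
    tauto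
  obtain ⟨b, hb, hbX⟩ : ∃ b ∈ S, N ^ 2 ≤ 5 * L * ∑ a ∈ S, ((X b a).card : ℝ) := by
    by_contra! hcon
    have hne : S.Nonempty := by
      rw [← Finset.card_pos]
      have : (0 : ℝ) < S.card := by rw [hNS]; exact hN
      exact_mod_cast this
    have h1 := Finset.sum_lt_sum_of_nonempty hne hcon
    rw [Finset.sum_const, nsmul_eq_mul, hNS, ← Finset.mul_sum] at h1
    nlinarith
  refine ⟨b, hb, S.filter (fun a => N ≤ 10 * L * (X b a).card), Finset.filter_subset _ _, ?_,
    fun a ha => ⟨X b a, Finset.filter_subset _ _, (Finset.mem_filter.1 ha).2,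
      fun c hc => (Finset.mem_filter.1 hc).2⟩⟩
  have h1 : ∑ a ∈ S, 10 * L * ((X b a).card : ℝ) ≤
      ∑ a ∈ S, ((if N ≤ 10 * L * (X b a).card then 10 * L * N else 0) + N) := by
    refine Finset.sum_le_sum fun a _ => ?_
    have h2 : ((X b a).card : ℝ) ≤ N := by
      rw [← hNS]
      exact_mod_cast Finset.card_le_card (Finset.filter_subset _ _)
    split_ifs with h
    · have : 10 * L * ((X b a).card : ℝ) ≤ 10 * L * N := by gcongr
      linarith
    · linarith
  rw [Finset.sum_add_distrib, ← Finset.sum_filter, Finset.sum_const, Finset.sum_const,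
    nsmul_eq_mul, nsmul_eq_mul, hNS, ← Finset.mul_sum] at h1
  refine le_of_mul_le_mul_right ?_ hN
  nlinarith

end ShiftedDilates

/-! ### From products and shifted products to sum-product. -/

section ShiftedToSumProduct

theorem cov_sub_comm_le {δ : ℝ} (hδ : 0 < δ) (Y Z : Finset ℝ) :
    (cov δ (Y - Z) : ℝ) ≤ 5 * cov δ (Z - Y) := by
  have h := cov_image_le (S := Z - Y) (f := fun x => -x) (M := 1) hδ hδ zero_le_one
    (fun x _ y _ hxy => by
      rw [show -x - -y = -(x - y) by ring, abs_neg, one_mul]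
      exact hxy)
  rw [Finset.image_neg_eq_neg, neg_sub] at h
  linarith

theorem smul_finset_sub_distrib (x : ℝ) (Y Z : Finset ℝ) : x • (Y - Z) = x • Y - x • Z := by
  ext z
  simp only [Finset.mem_smul_finset, Finset.mem_sub, smul_eq_mul]
  constructor
  · rintro ⟨_, ⟨y, hy, z, hz, rfl⟩, rfl⟩
    exact ⟨_, ⟨y, hy, rfl⟩, _, ⟨z, hz, rfl⟩, (mul_sub _ _ _).symm⟩
  · rintro ⟨_, ⟨y, hy, rfl⟩, _, ⟨z, hz, rfl⟩, rfl⟩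
    exact ⟨_, ⟨y, hy, z, hz, rfl⟩, mul_sub _ _ _⟩

theorem cov_le_cov_smul {δ α M : ℝ} (hδ : 0 < δ) (hM : 0 ≤ M) (hα : 1 ≤ M * |α|) (T : Finset ℝ) :
    (cov δ T : ℝ) ≤ (2 * M + 3) * cov δ (α • T) := by
  rw [← Finset.image_smul]
  refine cov_le_of_image hδ hδ hM fun x _ y _ hxy => ?_
  rw [smul_eq_mul, smul_eq_mul, ← mul_sub, abs_mul] at hxy
  calc |x - y| ≤ (M * |α|) * |x - y| := le_mul_of_one_le_left (abs_nonneg _) hα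
    _ = M * (|α| * |x - y|) := by ring
    _ ≤ M * δ := by gcongr

/-- Few sums and products force many products `(3 - α) (3 - β)` for which the corresponding dilate
of the set is nearly parallel to the set. -/
theorem exists_shifted_dilates {δ K N : ℝ} {S : Finset ℝ} (hδ : 0 < δ) (hK : 100 ≤ K)
    (hS1 : ∀ x ∈ S, x ∈ Icc (1 : ℝ) (5 / 4))
    (hS : Set.InjOn (cell δ) S) (hN : 0 < N) (hNS : (S.card : ℝ) = N)
    (hadd : (cov δ (S + S) : ℝ) ≤ K ^ 2 * N) (hmul : (cov δ (S * S) : ℝ) ≤ K ^ 2 * N) :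
    ∃ b ∈ S, ∃ S₁ ⊆ S, N ≤ K ^ 3 * S₁.card ∧ ∀ a ∈ S₁, ∀ a' ∈ S₁,
      (cov δ (((3 - a / b) * (3 - a' / b)) • S - S) : ℝ) ≤ K ^ 235 * N := by
  have hK0 : 0 < K := by linarith
  have hK1 : 1 ≤ K := by linarith
  set I := S.image (cell δ) with hI
  have hIc : (I.card : ℝ) = N := by rw [← hNS, hI, Finset.card_image_of_injOn hS]
  have hcS : (cov δ S : ℝ) = N := by rw [cov_eq_card hS, hNS]
  have hplu : ∀ m k : ℕ, m + k ≤ 5 → ((m • I - k • I).card : ℝ) ≤ K ^ 33 * N := by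
    intro m k hmk
    have h1 := card_add_le_cov hδ S S
    have h2 := card_two_nsmul_sub_le (A := I) (K := K ^ 3) (N := N) (one_le_pow₀ hK1) hN
      (by rw [hIc]; exact le_mul_of_one_le_left hN.le (one_le_pow₀ hK1))
      (by rw [hIc]; exact le_mul_of_one_le_left hN.le (one_le_pow₀ hK1))
      (calc _ ≤ 7 * (K ^ 2 * N) := h1.trans (by gcongr)
        _ = 7 * K ^ 2 * N := by ring
        _ ≤ K ^ 3 * N := by
          gcongr; exact numeral_mul_pow_le (m := 1) hK (by norm_num) (by norm_num)) m k
    rw [← pow_mul] at h2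
    refine h2.trans ?_
    gcongr
    omega
  have h3 : (cov δ ((3 : ℝ) • S - S - S) : ℝ) ≤ K ^ 34 * N := by
    calc _ ≤ 13 * (K ^ 33 * N) := (cov_three_smul_sub_sub_le hδ S).trans (by
          gcongr; exact hplu 3 2 (by norm_num))
      _ = 13 * K ^ 33 * N := by ring
      _ ≤ _ := by gcongr; exact numeral_mul_pow_le (m := 1) hK (by norm_num) (by norm_num)
  have h1 : (cov δ (S - S) : ℝ) ≤ K ^ 34 * N := by
    have h4 := hplu 1 1 (by norm_num)
    rw [one_nsmul] at h4
    calc _ ≤ 7 * (K ^ 33 * N) := (cov_sub_le_card hδ S S).trans (by gcongr)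
      _ = 7 * K ^ 33 * N := by ring
      _ ≤ _ := by gcongr; exact numeral_mul_pow_le (m := 1) hK (by norm_num) (by norm_num)
  obtain ⟨b, hb, S₁, hS₁, hS₁c, hX⟩ := exists_popular_dilate hδ (fun x hx => (hS1 x hx).1) hS hN hNS
    (show 0 < K ^ 2 by positivity) hmul
  have hb1 := hS1 b hb
  have hb0 : 0 < b := by linarith [hb1.1]
  have hα : ∀ a ∈ S₁, 4 / 5 ≤ a / b ∧ a / b ≤ 5 / 4 := by
    intro a ha
    have ha1 := hS1 a (hS₁ ha)
    constructor
    · rw [le_div_iff₀ hb0]; linarith [ha1.1, hb1.2]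
    · rw [div_le_iff₀ hb0]; linarith [ha1.2, hb1.1]
  -- Triangle inequality through `α X`: it is nearly contained in `S`, and `α S - α X` is a dilate
  -- of part of `S - S`.
  have hgood1 : ∀ a ∈ S₁, (cov δ ((a / b) • S - S) : ℝ) ≤ K ^ 75 * N := by
    intro a ha
    obtain ⟨X, hXS, hXc, hXd⟩ := hX a ha
    obtain ⟨ha1, ha2⟩ := hα a ha
    set α := a / b
    have hαabs : |α| ≤ 5 / 4 := by rw [abs_of_nonneg (by linarith)]; exact ha2
    have e1 := cov_sub_mul_cov_le hδ (α • X) (α • S) S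
    have e2 : (cov δ (α • S - α • X) : ℝ) ≤ 6 * (K ^ 34 * N) := by
      rw [← smul_finset_sub_distrib]
      have := cov_smul_le hδ hαabs (S - X)
      have h5 : (cov δ (S - X) : ℝ) ≤ cov δ (S - S) := by
        exact_mod_cast cov_mono (Finset.sub_subset_sub subset_rfl hXS)
      calc _ ≤ (2 * (5 / 4) + 3) * (K ^ 34 * N) := this.trans (by gcongr; exact h5.trans h1)
        _ ≤ _ := by gcongr; norm_num
    have e3 : (cov δ (α • X - S) : ℝ) ≤ 9 * (K ^ 34 * N) := by
      have := cov_le_of_close (Y := α • X - S) (Z := S - S) (M := 1) hδ zero_le_one (by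
        intro y hy
        obtain ⟨_, hx, s, hs, rfl⟩ := Finset.mem_sub.1 hy
        obtain ⟨c, hc, rfl⟩ := Finset.mem_smul_finset.1 hx
        obtain ⟨d, hd, he⟩ := hXd c hc
        refine ⟨d - s, Finset.sub_mem_sub hd hs, ?_⟩
        have h2 := (abs_sub_lt_of_cell_eq hδ he).le
        rw [smul_eq_mul, show α * c - s - (d - s) = (a * c - b * d) / b by
          simp only [α]; field_simp; ring, abs_div, abs_of_pos hb0, div_le_iff₀ hb0]
        nlinarith [hb1.1])
      calc _ ≤ (4 * 1 + 5) * (K ^ 34 * N) := this.trans (by gcongr)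
        _ = _ := by norm_num
    have e4 : (X.card : ℝ) ≤ 6 * cov δ (α • X) := by
      have := cov_le_cov_smul (α := α) (M := 5 / 4) hδ (by norm_num)
        (by rw [abs_of_nonneg (by linarith)]; linarith) X
      rw [cov_eq_card (hS.mono (by exact_mod_cast hXS))] at this
      calc _ ≤ _ := this
        _ ≤ _ := by gcongr; norm_num
    refine le_of_mul_le_mul_right ?_ hN
    have h0 : (0 : ℝ) ≤ cov δ (α • S - S) := Nat.cast_nonneg _
    calc (cov δ (α • S - S) : ℝ) * N ≤ cov δ (α • S - S) * (10 * K ^ 2 * (6 * cov δ (α • X))) := by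
          refine mul_le_mul_of_nonneg_left (hXc.trans ?_) h0
          gcongr
      _ = 60 * K ^ 2 * (cov δ (α • S - S) * cov δ (α • X)) := by ring
      _ ≤ 60 * K ^ 2 * (343 * (6 * (K ^ 34 * N) * (9 * (K ^ 34 * N)))) := by
          refine mul_le_mul_of_nonneg_left (e1.trans ?_) (by positivity)
          gcongr
      _ = 1111320 * K ^ 70 * N * N := by ring
      _ ≤ _ := by gcongr; exact numeral_mul_pow_le (m := 4) hK (by norm_num) (by norm_num)
  -- Triangle inequality through `S`, after `(3 - α) S - S ⊆ 3 S - S - α S`; the two pieces are `3 S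
  -- - S - S` and `S - α S`.
  have hgood2 : ∀ a ∈ S₁, (cov δ ((3 - a / b) • S - S) : ℝ) ≤ K ^ 112 * N := by
    intro a ha
    set α := a / b
    have e1 := cov_sub_mul_cov_le hδ S ((3 : ℝ) • S - S) (α • S)
    rw [hcS] at e1
    have e2 : (cov δ ((3 - α) • S - S) : ℝ) ≤ cov δ ((3 : ℝ) • S - S - α • S) := by
      have : (3 - α) • S - S ⊆ (3 : ℝ) • S - S - α • S := by
        intro z hz
        obtain ⟨_, hx, t, ht, rfl⟩ := Finset.mem_sub.1 hz
        obtain ⟨s, hs, rfl⟩ := Finset.mem_smul_finset.1 hx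
        rw [show (3 - α) • s - t = (3 : ℝ) • s - t - α • s by
          simp only [smul_eq_mul]; ring]
        exact Finset.sub_mem_sub (Finset.sub_mem_sub (Finset.smul_mem_smul_finset hs) ht)
          (Finset.smul_mem_smul_finset hs)
      exact_mod_cast cov_mono this
    have e3 := (cov_sub_comm_le hδ S (α • S)).trans
      (mul_le_mul_of_nonneg_left (hgood1 a ha) (by norm_num))
    refine le_of_mul_le_mul_right ?_ hN
    calc _ ≤ cov δ ((3 : ℝ) • S - S - α • S) * N := by gcongr
      _ ≤ 343 * ((K ^ 34 * N) * (5 * (K ^ 75 * N))) := e1.trans (by gcongr)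
      _ = 1715 * K ^ 109 * N * N := by ring
      _ ≤ _ := by gcongr; exact numeral_mul_pow_le (m := 2) hK (by norm_num) (by norm_num)
  refine ⟨b, hb, S₁, hS₁, ?_, ?_⟩
  · refine hS₁c.trans ?_
    gcongr
    exact numeral_mul_pow_le (m := 1) hK (by norm_num) (by norm_num)
  · intro a ha a' ha'
    have hx := hα a ha
    set x := 3 - a / b with hxdef
    set y := 3 - a' / b with hydef
    have hx1 : 1 ≤ |x| := by rw [abs_of_nonneg (by linarith [hx.2])]; linarith [hx.2]
    have hx3 : |x| ≤ 3 := by rw [abs_of_nonneg (by linarith [hx.2])]; linarith [hx.1]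
    -- Dilates with this property compose: `x y S - x S` is `x` times `y S - S`, and `x S` serves as
    -- the intermediate set.
    have e1 := cov_sub_mul_cov_le hδ (x • S) ((x * y) • S) S
    have e2 : (cov δ ((x * y) • S - x • S) : ℝ) ≤ 9 * (K ^ 112 * N) := by
      rw [mul_smul, ← smul_finset_sub_distrib]
      calc _ ≤ (2 * 3 + 3) * (K ^ 112 * N) := (cov_smul_le hδ hx3 _).trans (by
            gcongr; exact hgood2 a' ha')
        _ = _ := by norm_num
    have e3 : N ≤ 5 * cov δ (x • S) := by
      have := cov_le_cov_smul (α := x) (M := 1) hδ zero_le_one (by linarith) S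
      rw [hcS] at this
      linarith
    refine le_of_mul_le_mul_right ?_ hN
    have h0 : (0 : ℝ) ≤ cov δ ((x * y) • S - S) := Nat.cast_nonneg _
    calc (cov δ ((x * y) • S - S) : ℝ) * N ≤ cov δ ((x * y) • S - S) * (5 * cov δ (x • S)) := by gcongr
      _ = 5 * (cov δ ((x * y) • S - S) * cov δ (x • S)) := by ring
      _ ≤ 5 * (343 * ((9 * (K ^ 112 * N)) * (K ^ 112 * N))) := by
          refine mul_le_mul_of_nonneg_left (e1.trans ?_) (by positivity)
          gcongr
          exact hgood2 a ha
      _ = 15435 * K ^ 224 * N * N := by ring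
      _ ≤ _ := by gcongr; exact numeral_mul_pow_le (m := 3) hK (by norm_num) (by norm_num)

theorem abs_mul_sub_mul_lt {y z s t δ : ℝ} (hys : |y - s| < δ) (hzt : |z - t| < δ)
    (hz0 : 0 ≤ z) (hz1 : z ≤ 1) (hs0 : 0 ≤ s) (hs1 : s ≤ 1) : |y * z - s * t| < 3 * δ := by
  have hδ : 0 < δ := (abs_nonneg _).trans_lt hys
  calc |y * z - s * t| = |(y - s) * z + s * (z - t)| := by congr 1; ring
    _ ≤ |(y - s) * z| + |s * (z - t)| := abs_add_le _ _
    _ = |y - s| * z + s * |z - t| := by rw [abs_mul, abs_mul, abs_of_nonneg hz0, abs_of_nonneg hs0]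
    _ ≤ δ * 1 + 1 * δ := by gcongr
    _ < 3 * δ := by linarith

-- The counterexample is `B = {a / (3b)}` for the popular dilates `a / b`. Its products lie in a
-- dilate of `S * S`. Its shifted products are `(3 - a / b)(3 - a' / b) / 9`, so they come from good
-- dilates, which non-concentration of `S` forces to be few.
set_option maxHeartbeats 1000000 in
theorem gap_sumProductBad_of_gap_prodShift {σ : ℝ} (hσ : 0 < σ) (hσ1 : σ < 1)
    (h : Gap (DeltaSetBad (Icc (1 / 4) (1 / 2)) prodShift σ)) :
    Gap (SumProductBad (fun _ => Icc 1 (5 / 4)) σ) := by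
  obtain ⟨m, hm⟩ := exists_nat_ge (1 / σ)
  rw [div_le_iff₀ hσ, mul_comm] at hm
  refine Gap.transfer (c := m * 238 + 300) (by omega) ?_ h
  intro K δ hK hδ hKδ S hS
  have hK0 : 0 < K := by linarith
  have hK1 : 1 ≤ K := by linarith
  have hn := Real.rpow_pos_of_pos hδ (-σ)
  set n := δ ^ (-σ) with hndef
  have hpw : ∀ (c : ℝ) (j k : ℕ), c ≤ 100 ^ j → j + k ≤ m * 238 + 300 →
      c * K ^ k ≤ K ^ (m * 238 + 300) := fun c j k h1 h2 => numeral_mul_pow_le hK h1 h2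
  -- The exponent `238 = 235 + 2 + 1` beats the loss `L = K ^ 235` of the good dilates and the
  -- factor `K ^ 2` in `κ`, with one power of `K` left for the constant `10`.
  set ρ := (K⁻¹) ^ (m * 238) with hρ
  have hρ0 : 0 < ρ := by positivity
  have hρ1 : ρ ≤ 1 := pow_le_one₀ (by positivity) (inv_le_one_of_one_le₀ hK1)
  have hρinv : ρ⁻¹ = K ^ (m * 238) := by rw [hρ, inv_pow, inv_inv]
  have hδρ : δ ≤ ρ := by
    have h1 : K ^ (m * 238) * δ ≤ 1 :=
      le_trans (mul_le_mul_of_nonneg_right (pow_le_pow_right₀ hK1 (by omega)) hδ.le) hKδ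
    rw [← hρinv, inv_mul_le_iff₀ hρ0, mul_one] at h1
    exact h1
  have hδ60 : 60 * δ ≤ 1 := by
    have h1 : K ^ 1 * δ ≤ 1 :=
      le_trans (mul_le_mul_of_nonneg_right (pow_le_pow_right₀ hK1 (by omega)) hδ.le) hKδ
    rw [pow_one] at h1
    nlinarith
  obtain ⟨S₀, hS₀S, hinj, hS₀c⟩ := exists_subset_injOn_cell δ S
  have hcard := cov_eq_card hinj
  set N : ℝ := (S₀.card : ℝ) with hNdef
  have hNcov : (cov δ S : ℝ) = N := by rw [← hS₀c, hcard]
  have hnN : n ≤ K * N := by rw [← hNcov]; exact hS.card_ge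
  have hN : 0 < N := pos_of_mul_pos_right (hn.trans_le hnN) hK0.le
  have hNn : N ≤ K * n := by
    have h1 := hS.nonconc 1 1 (by linarith)
    rw [Finset.filter_true_of_mem (fun x hx => by
      have := hS.mem x hx
      rw [abs_of_nonneg (by linarith [this.1])]
      linarith [this.2]), hNcov, one_div, Real.inv_rpow hδ.le, ← Real.rpow_neg hδ.le] at h1
    exact h1
  have hmem : ∀ x ∈ S₀, x ∈ Icc (1 : ℝ) (5 / 4) := fun x hx => hS.mem x (hS₀S hx)
  obtain ⟨b, hb, S₁, hS₁, hS₁c, hgood⟩ := exists_shifted_dilates hδ hK hmem hinj hN rfl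
    (calc (cov δ (S₀ + S₀) : ℝ) ≤ cov δ (S + S) := by
            exact_mod_cast cov_mono (Finset.add_subset_add hS₀S hS₀S)
      _ ≤ K * (K * N) := hS.card_add.trans (by gcongr)
      _ = _ := by ring)
    (calc (cov δ (S₀ * S₀) : ℝ) ≤ cov δ (S * S) := by
            exact_mod_cast cov_mono (Finset.mul_subset_mul hS₀S hS₀S)
      _ ≤ K * (K * N) := hS.card_mul.trans (by gcongr)
      _ = _ := by ring)
  have hb1 := hmem b hb
  have hb0 : 0 < b := by linarith [hb1.1]
  set R := (S₁ ×ˢ S₁).image (fun p => (3 - p.1 / b) * (3 - p.2 / b)) with hR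
  have hRc : (cov δ R : ℝ) ≤ K ^ (m * 238 + 237) * n := by
    have h1 := cov_dilates_le (S := S₀) (R := R) (L := K ^ 235) (N := N)
      (κ := K ^ 2 * (K⁻¹ ^ 238) * N) hδ hδρ hρ1 hinj hN rfl (by positivity) (by
        intro a
        have h2 := hS.nonconc a ρ hδρ
        have h3 : (S₀.filter (fun x => |x - a| ≤ ρ)).card ≤
            cov δ (S.filter (fun x => |x - a| ≤ ρ)) := by
          rw [← cov_eq_card (hinj.mono (by exact_mod_cast Finset.filter_subset _ _))]
          exact cov_mono (Finset.filter_subset_filter _ hS₀S)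
        have h4 : (ρ / δ) ^ σ ≤ K⁻¹ ^ 238 * n := by
          rw [div_eq_mul_inv, Real.mul_rpow hρ0.le (by positivity), Real.inv_rpow hδ.le,
            ← Real.rpow_neg hδ.le]
          gcongr
          exact rpow_inv_pow_le hK1 hm
        calc _ ≤ (cov δ (S.filter (fun x => |x - a| ≤ ρ)) : ℝ) := by exact_mod_cast h3
          _ ≤ K * (K⁻¹ ^ 238 * (K * N)) := h2.trans (by gcongr; exact h4.trans (by gcongr))
          _ = _ := by ring) (by
        have hpow : K ^ 235 * K ^ 2 * K⁻¹ ^ 238 = K⁻¹ := by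
          rw [← pow_add, show 238 = 237 + 1 from rfl, pow_succ K⁻¹, ← mul_assoc, ← mul_pow,
            mul_inv_cancel₀ hK0.ne', one_pow, one_mul]
        calc 10 * K ^ 235 * (K ^ 2 * K⁻¹ ^ 238 * N) = 10 * (K ^ 235 * K ^ 2 * K⁻¹ ^ 238) * N := by
              ring
          _ = 10 * K⁻¹ * N := by rw [hpow]
          _ ≤ 1 * N := by
              refine mul_le_mul_of_nonneg_right ?_ hN.le
              rw [← div_eq_mul_inv, div_le_one hK0]
              linarith
          _ = N := one_mul N) (by
        intro x hx
        obtain ⟨⟨a, a'⟩, hp, rfl⟩ := Finset.mem_image.1 hx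
        obtain ⟨ha, ha'⟩ := Finset.mem_product.1 hp
        exact hgood a ha a' ha')
    calc (cov δ R : ℝ) = ρ⁻¹ * (ρ * cov δ R) := by field_simp
      _ ≤ K ^ (m * 238) * (10 * K ^ 235 * (K * n)) := by
          rw [hρinv]
          refine mul_le_mul_of_nonneg_left (h1.trans ?_) (by positivity)
          gcongr
      _ = (10 * K ^ 236) * (K ^ (m * 238) * n) := by ring
      _ ≤ K ^ 237 * (K ^ (m * 238) * n) := by
          gcongr; exact numeral_mul_pow_le (m := 1) hK (by norm_num) (by norm_num)
      _ = _ := by rw [pow_add]; ring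
  -- As `a / b` lies in `[4 / 5, 5 / 4]`, division by `3` puts `B` strictly inside `[1 / 4, 1 / 2]`,
  -- with room for the balls of radius `δ`.
  set B := S₁.image (fun a => a / (3 * b)) with hB
  have hBmem : ∀ t ∈ B, 4 / 15 ≤ t ∧ t ≤ 5 / 12 := by
    intro t ht
    obtain ⟨a, ha, rfl⟩ := Finset.mem_image.1 ht
    have ha1 := hmem a (hS₁ ha)
    constructor
    · rw [le_div_iff₀ (by positivity)]; linarith [ha1.1, hb1.2]
    · rw [div_le_iff₀ (by positivity)]; linarith [ha1.2, hb1.1]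
  have hdil : ∀ (T : Finset ℝ) (c : ℝ), 1 ≤ c →
      (cov δ (T.image (fun x => x / c)) : ℝ) ≤ 5 * cov δ T := by
    intro T c hc
    have := cov_image_le (S := T) (f := fun x => x / c) (M := 1) hδ hδ zero_le_one (by
      intro x _ y _ hxy
      rw [← sub_div, abs_div, abs_of_pos (show 0 < c by linarith), one_mul]
      exact (div_le_self (abs_nonneg _) hc).trans hxy)
    linarith
  have h3b : 1 ≤ 3 * b := by linarith [hb1.1]
  have h3b0 : 0 < 3 * b := by linarith
  have hBball : ∀ t ∈ B, Metric.ball t δ ⊆ Icc (1 / 4) (1 / 2) := by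
    intro t ht y hy
    have h1 := hBmem t ht
    rw [Metric.mem_ball, Real.dist_eq, abs_lt] at hy
    constructor <;> linarith
  have h01 : Icc (1 / 4 : ℝ) (1 / 2) ⊆ Icc 0 1 := Icc_subset_Icc (by norm_num) (by norm_num)
  have hS₁N : (S₁.card : ℝ) ≤ N := Nat.cast_le.2 (Finset.card_le_card hS₁)
  have hS₁cov : (cov δ S₁ : ℝ) = S₁.card := by
    rw [cov_eq_card (hinj.mono (by exact_mod_cast hS₁))]
  have hBnc : NonConc σ δ (K ^ 6) B := by
    intro a r hr
    have hr0 := hδ.trans_le hr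
    have h1 : B.filter (fun x => |x - a| ≤ r) ⊆
        (S.filter (fun t => |t - 3 * b * a| ≤ 4 * r)).image (fun t => t / (3 * b)) := by
      intro x hx
      obtain ⟨hx, hxa⟩ := Finset.mem_filter.1 hx
      obtain ⟨t, ht, rfl⟩ := Finset.mem_image.1 hx
      refine Finset.mem_image_of_mem _ (Finset.mem_filter.2 ⟨hS₀S (hS₁ ht), ?_⟩)
      calc |t - 3 * b * a| = (3 * b) * |t / (3 * b) - a| := by
            nth_rewrite 2 [← abs_of_pos h3b0]
            rw [← abs_mul]
            congr 1; field_simp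
        _ ≤ 4 * r := by gcongr; linarith [hb1.2]
    have h2 : (cov δ (B.filter (fun x => |x - a| ≤ r)) : ℝ) ≤
        cov δ ((S.filter (fun t => |t - 3 * b * a| ≤ 4 * r)).image (fun t => t / (3 * b))) := by
      exact_mod_cast cov_mono h1
    have h4 := hS.nonconc (3 * b * a) (4 * r) (by linarith)
    have h5 : (4 * r / δ) ^ σ ≤ 4 * (r / δ) ^ σ := by
      rw [mul_div_assoc]
      exact mul_rpow_le (by norm_num) (by positivity) hσ1.le
    have h6 : 0 ≤ (r / δ) ^ σ := by positivity
    calc _ ≤ 5 * (K * (4 * (r / δ) ^ σ)) :=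
          h2.trans ((hdil _ _ h3b).trans (by gcongr; exact h4.trans (by gcongr)))
      _ = 20 * K ^ 1 * (r / δ) ^ σ := by ring
      _ ≤ _ := by gcongr; exact numeral_mul_pow_le (m := 1) hK (by norm_num) (by norm_num)
  have hBle : (cov δ B : ℝ) ≤ K ^ 6 * n := by
    calc (cov δ B : ℝ) ≤ 5 * (K * n) := (hdil _ _ h3b).trans (by
          gcongr; rw [hS₁cov]; exact hS₁N.trans hNn)
      _ = 5 * K ^ 1 * n := by ring
      _ ≤ _ := by gcongr; exact numeral_mul_pow_le (m := 1) hK (by norm_num) (by norm_num)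
  have hBge : n ≤ K ^ 6 * cov δ B := by
    have h1 := cov_le_of_image (S := S₁) (f := fun x => x / (3 * b)) (M := 4) hδ hδ (by norm_num) (by
      intro x _ y _ hxy
      rw [← sub_div, abs_div, abs_of_pos h3b0, div_le_iff₀ h3b0] at hxy
      nlinarith [hb1.2])
    rw [hS₁cov] at h1
    calc n ≤ K * (K ^ 3 * ((2 * 4 + 3) * cov δ B)) := hnN.trans (by
          gcongr; exact hS₁c.trans (by gcongr))
      _ = 11 * K ^ 4 * cov δ B := by ring
      _ ≤ _ := by gcongr; exact numeral_mul_pow_le (m := 1) hK (by norm_num) (by norm_num)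
  have hHyp := deltaSetHyp_iUnion_ball (I := Icc (1 / 4) (1 / 2)) hδ (one_le_pow₀ hK1 (n := 6))
    hσ1.le h01 hBball hBnc hBle hBge
  refine ⟨⋃ t ∈ (B : Set ℝ), Metric.ball t δ, hHyp.mono hδ (hpw _ 1 _ (by norm_num) (by omega)),
    max_le ?_ ?_⟩
  · have h1 : (⋃ t ∈ (B : Set ℝ), Metric.ball t δ) * (⋃ t ∈ (B : Set ℝ), Metric.ball t δ) ⊆
        ⋃ t ∈ (S * S).image (fun x => x / (3 * b) ^ 2), Metric.ball t (3 * δ) := by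
      rintro _ ⟨y, hy, z, hz, rfl⟩
      obtain ⟨s, hs, hys⟩ := mem_iUnion₂.1 hy
      obtain ⟨t, ht, hzt⟩ := mem_iUnion₂.1 hz
      have hs' := hBmem s hs
      have hz' := h01 (hBball t ht hzt)
      obtain ⟨s, hs2, rfl⟩ := Finset.mem_image.1 (Finset.mem_coe.1 hs)
      obtain ⟨t, ht2, rfl⟩ := Finset.mem_image.1 (Finset.mem_coe.1 ht)
      refine mem_iUnion₂.2 ⟨_, Finset.mem_image_of_mem _
        (Finset.mul_mem_mul (hS₀S (hS₁ hs2)) (hS₀S (hS₁ ht2))), ?_⟩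
      rw [Metric.mem_ball, Real.dist_eq] at *
      rw [show s * t / (3 * b) ^ 2 = (s / (3 * b)) * (t / (3 * b)) by field_simp]
      exact abs_mul_sub_mul_lt hys hzt hz'.1 hz'.2 (by linarith) (by linarith)
    have h2 := volume_real_le_of_subset_iUnion_ball hδ (by norm_num) h1
    calc _ ≤ (2 * 3 + 1) * δ * (5 * (K * n)) := h2.trans (by
          gcongr
          exact (hdil _ _ (one_le_pow₀ h3b)).trans (by gcongr; exact hS.card_mul))
      _ = 35 * K ^ 1 * (δ * n) := by ring
      _ ≤ _ := by
          rw [rpow_one_sub_eq hδ]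
          gcongr; exact hpw _ 1 _ (by norm_num) (by omega)
  · have h1 : ({1} - ⋃ t ∈ (B : Set ℝ), Metric.ball t δ) *
        ({1} - ⋃ t ∈ (B : Set ℝ), Metric.ball t δ) ⊆
        ⋃ t ∈ R.image (fun x => x / 9), Metric.ball t (3 * δ) := by
      rintro _ ⟨y, hy, z, hz, rfl⟩
      obtain ⟨_, rfl, y, hy, rfl⟩ := hy
      obtain ⟨_, rfl, z, hz, rfl⟩ := hz
      obtain ⟨s, hs, hys⟩ := mem_iUnion₂.1 hy
      obtain ⟨t, ht, hzt⟩ := mem_iUnion₂.1 hz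
      have hs' := hBmem s hs
      have hz' := h01 (hBball t ht hzt)
      obtain ⟨s, hs2, rfl⟩ := Finset.mem_image.1 (Finset.mem_coe.1 hs)
      obtain ⟨t, ht2, rfl⟩ := Finset.mem_image.1 (Finset.mem_coe.1 ht)
      refine mem_iUnion₂.2 ⟨_, Finset.mem_image_of_mem _ (Finset.mem_image_of_mem _
        (Finset.mk_mem_product hs2 ht2)), ?_⟩
      rw [Metric.mem_ball, Real.dist_eq] at *
      rw [show (3 - s / b) * (3 - t / b) / 9 = (1 - s / (3 * b)) * (1 - t / (3 * b)) by
        field_simp; ring]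
      refine abs_mul_sub_mul_lt ?_ ?_ (by linarith [hz'.2]) (by linarith [hz'.1]) (by linarith)
        (by linarith)
      · rw [abs_sub_comm]; convert hys using 2; ring
      · rw [abs_sub_comm]; convert hzt using 2; ring
    have h2 := volume_real_le_of_subset_iUnion_ball hδ (by norm_num) h1
    calc _ ≤ (2 * 3 + 1) * δ * (5 * (K ^ (m * 238 + 237) * n)) := h2.trans (by
          gcongr
          exact (hdil _ _ (by norm_num)).trans (by gcongr))
      _ = 35 * K ^ (m * 238 + 237) * (δ * n) := by ring
      _ ≤ _ := by
          rw [rpow_one_sub_eq hδ]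
          gcongr; exact hpw _ 1 _ (by norm_num) (by omega)

end ShiftedToSumProduct

/-! ### Planar measure and squares of side `δ`. -/

section PlaneBoxes

/-- The square of side `δ` of the plane with label `k`. -/
def planeBox (δ : ℝ) (k : ℤ × ℤ) : Set Plane := {q | (cell δ (q 0), cell δ (q 1)) = k}

theorem planeBox_eq {δ : ℝ} (hδ : 0 < δ) (k : ℤ × ℤ) :
    planeBox δ k = (MeasurableEquiv.toLp 2 (Fin 2 → ℝ)).symm ⁻¹' (Set.pi univ
      (fun i => Ico ((![k.1, k.2] i : ℤ) * δ) (((![k.1, k.2] i : ℤ) + 1) * δ))) := by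
  ext q
  simp only [planeBox, mem_ofPred_eq, mem_preimage, mem_pi, mem_univ, true_imp_iff,
    Fin.forall_fin_two, Prod.ext_iff, cell, Int.floor_eq_iff, le_div_iff₀ hδ, div_lt_iff₀ hδ]
  rfl

theorem measurableSet_planeBox {δ : ℝ} (hδ : 0 < δ) (k : ℤ × ℤ) : MeasurableSet (planeBox δ k) := by
  rw [planeBox_eq hδ]
  exact (MeasurableEquiv.toLp 2 (Fin 2 → ℝ)).symm.measurable
    (MeasurableSet.univ_pi fun _ => measurableSet_Ico)

theorem volume_planeBox {δ : ℝ} (hδ : 0 < δ) (k : ℤ × ℤ) :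
    volume (planeBox δ k) = ENNReal.ofReal (δ ^ 2) := by
  rw [planeBox_eq hδ, (EuclideanSpace.volume_preserving_symm_measurableEquiv_toLp (Fin 2)).measure_preimage
    (MeasurableSet.univ_pi fun _ => measurableSet_Ico).nullMeasurableSet, volume_pi_pi]
  simp only [Real.volume_Ico, Fin.prod_univ_two]
  rw [← ENNReal.ofReal_mul (by ring_nf; exact hδ.le)]
  congr 1
  ring

theorem volume_real_planeBox {δ : ℝ} (hδ : 0 < δ) (k : ℤ × ℤ) :
    volume.real (planeBox δ k) = δ ^ 2 := by
  rw [measureReal_def, volume_planeBox hδ, ENNReal.toReal_ofReal (by positivity)]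

theorem unitSquare_eq : unitSquare = (MeasurableEquiv.toLp 2 (Fin 2 → ℝ)).symm ⁻¹' (Set.pi univ
    (fun _ => Icc (0 : ℝ) 1)) := by
  ext q
  simp only [unitSquare, mem_ofPred_eq, mem_preimage, mem_pi, mem_univ, true_imp_iff]
  rfl

theorem volume_unitSquare : volume unitSquare = 1 := by
  rw [unitSquare_eq, (EuclideanSpace.volume_preserving_symm_measurableEquiv_toLp (Fin 2)).measure_preimage
    (MeasurableSet.univ_pi fun _ => measurableSet_Icc).nullMeasurableSet, volume_pi_pi]
  simp

/-- A bounded planar set is covered by the boxes of a finite separated subset. -/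
theorem exists_finset_volume_le {δ : ℝ} (hδ : 0 < δ) {E : Set Plane} (hE : E ⊆ unitSquare) :
    ∃ Q : Finset Plane, (Q : Set Plane) ⊆ E ∧
      Set.InjOn (fun q : Plane => (cell δ (q 0), cell δ (q 1))) Q ∧
      volume.real E ≤ δ ^ 2 * Q.card := by
  classical
  set f : Plane → ℤ × ℤ := fun q => (cell δ (q 0), cell δ (q 1)) with hf
  have hfin : (f '' E).Finite := by
    refine ((Set.finite_Icc (0 : ℤ) ⌊1 / δ⌋).prod (Set.finite_Icc (0 : ℤ) ⌊1 / δ⌋)).subset ?_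
    rintro _ ⟨q, hq, rfl⟩
    have h : ∀ i, cell δ (q i) ∈ Icc (0 : ℤ) ⌊1 / δ⌋ := fun i => by
      have := hE hq i
      refine ⟨Int.floor_nonneg.2 (div_nonneg this.1 hδ.le), Int.floor_le_floor ?_⟩
      gcongr
      exact this.2
    exact ⟨h 0, h 1⟩
  obtain ⟨T, hT1, hT2⟩ := Finset.subset_set_image_iff.1 (hfin.coe_toFinset.subset)
  obtain ⟨Q, hQT, hQi, hQ⟩ := exists_injOn_image_eq T f
  refine ⟨Q, Subset.trans (by exact_mod_cast hQT) hT1, hQi, ?_⟩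
  have hsub : E ⊆ ⋃ k ∈ Q.image f, planeBox δ k := by
    intro q hq
    refine mem_iUnion₂.2 ⟨f q, ?_, rfl⟩
    rw [hQ, hT2, hfin.mem_toFinset]
    exact mem_image_of_mem _ hq
  calc volume.real E ≤ volume.real (⋃ k ∈ Q.image f, planeBox δ k) := by
        refine measureReal_mono hsub ?_
        refine ((measure_biUnion_finset_le _ _).trans_lt ?_).ne
        exact ENNReal.sum_lt_top.2 fun i _ => by
          rw [volume_planeBox hδ]; exact ENNReal.ofReal_lt_top
    _ ≤ ∑ k ∈ Q.image f, volume.real (planeBox δ k) := measureReal_biUnion_finset_le _ _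
    _ = ∑ k ∈ Q.image f, δ ^ 2 := Finset.sum_congr rfl fun k _ => volume_real_planeBox hδ k
    _ = _ := by
        rw [Finset.sum_const, nsmul_eq_mul, Finset.card_image_of_injOn hQi]; ring

theorem card_mul_le_volume_real {δ : ℝ} (hδ : 0 < δ) {E : Set Plane} (hE : volume E ≠ ⊤)
    {T : Finset (ℤ × ℤ)} (h : ∀ k ∈ T, planeBox δ k ⊆ E) : δ ^ 2 * T.card ≤ volume.real E := by
  have hdisj : Set.PairwiseDisjoint (T : Set (ℤ × ℤ)) (planeBox δ) := by
    intro i _ j _ hij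
    rw [Function.onFun, Set.disjoint_left]
    intro q h1 h2
    exact hij (h1.symm.trans h2)
  calc δ ^ 2 * T.card = ∑ k ∈ T, volume.real (planeBox δ k) := by
        rw [Finset.sum_congr rfl fun k _ => volume_real_planeBox hδ k, Finset.sum_const,
          nsmul_eq_mul, mul_comm]
    _ = volume.real (⋃ k ∈ T, planeBox δ k) := by
        rw [measureReal_biUnion_finset hdisj (fun k _ => measurableSet_planeBox hδ k)
          (fun k _ => by rw [volume_planeBox hδ]; exact ENNReal.ofReal_ne_top)]
    _ ≤ _ := measureReal_mono (iUnion₂_subset h) hE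

end PlaneBoxes

/-! ### The four-pencil estimate as a gap statement. -/

section PencilGap

/-- The set of directions of a pencil at resolution `δ`. -/
def directionArcs (δ : ℝ) (Θ : Set ℝ) : Set ℝ := ⋃ θ ∈ Θ, Metric.ball θ δ

/-- The measure of the common part of four pencils in the unit square. -/
noncomputable def pencilVolume (δ : ℝ) (a : (Fin 4 → Plane) × (Fin 4 → Set ℝ)) : ℝ :=
  volume.real ((⋂ i, pencil δ (a.1 i) (a.2 i)) ∩ unitSquare)

/-- The hypotheses on four pencils with constant `κ`; the pencils are given by their tips and the
directions of their central lines. -/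
structure FourPencilHyp (σ δ κ : ℝ) (a : (Fin 4 → Plane) × (Fin 4 → Set ℝ)) : Prop where
  dir_subset : ∀ i, a.2 i ⊆ Ico 0 1
  nonconc : ∀ i b r, δ < r → r < 1 →
    volume.real (directionArcs δ (a.2 i) ∩ Metric.ball b r) ≤ κ * (δ * (r / δ) ^ σ)
  dist_le : ∀ i j, i ≠ j → dist (a.1 i) (a.1 j) ≤ κ * 1
  dist_ge : ∀ i j, i ≠ j → 1 ≤ κ * dist (a.1 i) (a.1 j)
  infDist_le : ∀ i j : Fin 4, i ≠ j → Metric.infDist (a.1 i) unitSquare ≤ κ * 1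
  infDist_ge : ∀ i j : Fin 4, i ≠ j → 1 ≤ κ * Metric.infDist (a.1 i) unitSquare
  setDist_le : ∀ i j, i ≠ j → setDist (lineAt (a.1 i) (a.1 j - a.1 i)) unitSquare ≤ κ * 1
  setDist_ge : ∀ i j, i ≠ j → 1 ≤ κ * setDist (lineAt (a.1 i) (a.1 j - a.1 i)) unitSquare
  tube_ge : ∀ (q v : Plane) (r : ℝ), v ≠ 0 → (∀ i, a.1 i ∈ tube (lineAt q v) r) → 1 ≤ κ * r

/-- Four pencils whose intersection is too large. -/
structure FourPencilBad (σ δ K : ℝ) (a : (Fin 4 → Plane) × (Fin 4 → Set ℝ)) : Prop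
    extends FourPencilHyp σ δ K a where
  large : δ ^ (2 - 2 * σ) ≤ K * pencilVolume δ a

theorem fourPencilHyp_forall_iff {σ δ : ℝ} {C : ℝ → ℝ} {a : (Fin 4 → Plane) × (Fin 4 → Set ℝ)} :
    (∀ ε : ℝ, 0 < ε → FourPencilHyp σ δ (C ε * δ ^ (-ε)) a) ↔
      (∀ i, a.2 i ⊆ Ico 0 1 ∧ IsDeltaSet C δ σ (directionArcs δ (a.2 i))) ∧
      TipsInGeneralPosition C δ a.1 := by
  constructor
  · intro h
    refine ⟨fun i => ⟨(h 1 one_pos).dir_subset i, ⟨_, rfl⟩,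
      fun b r h1 h2 ε hε => (h ε hε).nonconc i b r h1 h2⟩, fun i j hij => ⟨⟨?_, ?_⟩, ⟨?_, ?_⟩, ?_, ?_⟩,
      fun q v r hv hr ε hε => (h ε hε).tube_ge q v r hv hr⟩
    · exact fun ε hε => (h ε hε).dist_le i j hij
    · exact fun ε hε => (h ε hε).dist_ge i j hij
    · exact fun ε hε => (h ε hε).infDist_le i j hij
    · exact fun ε hε => (h ε hε).infDist_ge i j hij
    · exact fun ε hε => (h ε hε).setDist_le i j hij
    · exact fun ε hε => (h ε hε).setDist_ge i j hij
  · rintro ⟨h1, h2, h3⟩ ε hε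
    exact ⟨fun i => (h1 i).1, fun i b r ha hb => (h1 i).2.2 b r ha hb ε hε,
      fun i j hij => (h2 i j hij).1.1 ε hε, fun i j hij => (h2 i j hij).1.2 ε hε,
      fun i j hij => (h2 i j hij).2.1.1 ε hε, fun i j hij => (h2 i j hij).2.1.2 ε hε,
      fun i j hij => (h2 i j hij).2.2.1 ε hε, fun i j hij => (h2 i j hij).2.2.2 ε hε,
      fun q v r hv hr => h3 q v r hv hr ε hε⟩

theorem fourPencilEstimate_iff : FourPencilEstimate ↔
    ∀ σ : ℝ, 0 < σ → σ < 1 → ∃ ε₀ : ℝ, 0 < ε₀ ∧ ∀ C : ℝ → ℝ, ∃ c : ℝ, 0 < c ∧ ∀ δ a, 0 < δ → δ < 1 →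
      (∀ ε : ℝ, 0 < ε → FourPencilHyp σ δ (C ε * δ ^ (-ε)) a) →
      c * pencilVolume δ a ≤ δ ^ (2 - 2 * σ + ε₀) := by
  simp only [fourPencilHyp_forall_iff]
  refine forall_congr' fun σ => imp_congr_right fun _ => imp_congr_right fun _ =>
    exists_congr fun ε₀ => and_congr_right fun _ => forall_congr' fun C => ?_
  constructor
  · rintro ⟨K, hK, h⟩
    refine ⟨K⁻¹, inv_pos.2 hK, fun δ a hδ hδ1 ha => ?_⟩
    rw [inv_mul_le_iff₀ hK]
    exact h δ a.1 (fun i => pencil δ (a.1 i) (a.2 i)) hδ hδ1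
      (fun i => ⟨a.2 i, (ha.1 i).1, rfl, (ha.1 i).2⟩) ha.2
  · rintro ⟨c, hc, h⟩
    refine ⟨c⁻¹, inv_pos.2 hc, fun δ p P hδ hδ1 hP hp => ?_⟩
    choose Θ h1 h2 h3 using hP
    rw [le_inv_mul_iff₀ hc]
    have := h δ (p, Θ) hδ hδ1 ⟨fun i => ⟨h1 i, h3 i⟩, hp⟩
    rw [show P = fun i => pencil δ (p i) (Θ i) from funext h2]
    exact this

theorem FourPencilHyp.mono {σ δ κ κ' : ℝ} {a : (Fin 4 → Plane) × (Fin 4 → Set ℝ)} (hδ : 0 < δ)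
    (hκ : κ ≤ κ') (h : FourPencilHyp σ δ κ a) : FourPencilHyp σ δ κ' a := by
  have hs : ∀ S T : Set Plane, 0 ≤ setDist S T := fun S T => Real.iInf_nonneg fun _ => dist_nonneg
  refine ⟨h.dir_subset, fun i b r h1 h2 => (h.nonconc i b r h1 h2).trans ?_,
    fun i j hij => (h.dist_le i j hij).trans (by gcongr),
    fun i j hij => (h.dist_ge i j hij).trans (by gcongr),
    fun i j hij => (h.infDist_le i j hij).trans (by gcongr),
    fun i j hij => (h.infDist_ge i j hij).trans (by gcongr; exact Metric.infDist_nonneg),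
    fun i j hij => (h.setDist_le i j hij).trans (by gcongr),
    fun i j hij => (h.setDist_ge i j hij).trans (by gcongr; exact hs _ _),
    fun q v r hv hr => (h.tube_ge q v r hv hr).trans ?_⟩
  · have : 0 < (r / δ) ^ σ := Real.rpow_pos_of_pos (div_pos (hδ.trans h1) hδ) _
    gcongr
  · have : 0 < r := by
      by_contra hr0
      have := hr 0
      rw [tube, Metric.thickening_of_nonpos (not_lt.1 hr0)] at this
      exact this
    gcongr

theorem pencilVolume_le_one (δ : ℝ) (a : (Fin 4 → Plane) × (Fin 4 → Set ℝ)) :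
    pencilVolume δ a ≤ 1 := by
  have h : volume unitSquare ≠ ⊤ := by rw [volume_unitSquare]; exact ENNReal.one_ne_top
  refine (measureReal_mono inter_subset_right h).trans_eq ?_
  rw [measureReal_def, volume_unitSquare, ENNReal.toReal_one]

theorem gap_of_fourPencilEstimate {σ : ℝ}
    (h : ∃ ε₀ : ℝ, 0 < ε₀ ∧ ∀ C : ℝ → ℝ, ∃ c : ℝ, 0 < c ∧ ∀ δ a, 0 < δ → δ < 1 →
      (∀ ε : ℝ, 0 < ε → FourPencilHyp σ δ (C ε * δ ^ (-ε)) a) →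
      c * pencilVolume δ a ≤ δ ^ (2 - 2 * σ + ε₀)) : Gap (FourPencilBad σ) := by
  refine Gap.of_uniform (m := 1) (Hyp := FourPencilHyp σ)
    (P := fun ε₀ c δ a => c * pencilVolume δ a ≤ δ ^ (2 - 2 * σ + ε₀))
    (fun δ κ κ' a hδ hκ hH => hH.mono hδ hκ) (fun δ K a _ hb => hb.toFourPencilHyp) h ?_
  intro ε₀ c δ K a hε hc hδ hδ1 hK hb hP
  have h1 := Real.rpow_pos_of_pos hδ (2 - 2 * σ + ε₀)
  refine le_of_mul_le_mul_right ?_ h1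
  calc c * δ ^ (-ε₀) * δ ^ (2 - 2 * σ + ε₀) = c * δ ^ (2 - 2 * σ) := by
        rw [mul_assoc, ← Real.rpow_add hδ]; congr 2; ring
    _ ≤ c * (K * pencilVolume δ a) := by gcongr; exact hb.large
    _ = K * (c * pencilVolume δ a) := by ring
    _ ≤ K * δ ^ (2 - 2 * σ + ε₀) := by gcongr
    _ = _ := by rw [pow_one]

/-- At scales bounded below, the trivial bound by the measure of the square is enough; its constant
`δ₁ ^ (2 - 2 * σ + ε₀)` works for every `δ ≥ δ₁` because the exponent is positive. -/
theorem fourPencilEstimate_of_gap {σ : ℝ} (hσ1 : σ < 1) (h : Gap (FourPencilBad σ)) :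
    ∃ ε₀ : ℝ, 0 < ε₀ ∧ ∀ C : ℝ → ℝ, ∃ c : ℝ, 0 < c ∧ ∀ δ a, 0 < δ → δ < 1 →
      (∀ ε : ℝ, 0 < ε → FourPencilHyp σ δ (C ε * δ ^ (-ε)) a) →
      c * pencilVolume δ a ≤ δ ^ (2 - 2 * σ + ε₀) := by
  refine Gap.uniform (Hyp := FourPencilHyp σ) (Bad := FourPencilBad σ)
    (P := fun ε₀ c δ a => c * pencilVolume δ a ≤ δ ^ (2 - 2 * σ + ε₀))
    (fun δ κ κ' a hδ hκ hH => hH.mono hδ hκ) ?_ ?_ ?_ h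
  · intro ε₀ c c' δ a hδ _ hcc hP
    exact le_trans (mul_le_mul_of_nonneg_right hcc measureReal_nonneg) hP
  · intro η δ a hη hδ hδ1 hH hP
    have h1 : δ ^ (-(η / 2)) ≤ δ ^ (-η) :=
      Real.rpow_le_rpow_of_exponent_ge hδ hδ1.le (by linarith)
    refine ⟨hH.mono hδ h1, ?_⟩
    rw [not_le, one_mul] at hP
    have hV : 0 ≤ pencilVolume δ a := measureReal_nonneg
    calc δ ^ (2 - 2 * σ) = δ ^ (-(η / 2)) * δ ^ (2 - 2 * σ + η / 2) := by
          rw [← Real.rpow_add hδ]; congr 1; ring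
      _ ≤ δ ^ (-η) * pencilVolume δ a := by gcongr
  · intro ε₀ δ₁ hε hε1 hδ₁
    refine ⟨δ₁ ^ (2 - 2 * σ + ε₀), Real.rpow_pos_of_pos hδ₁ _, fun δ κ a h1 h2 hH => ?_⟩
    calc δ₁ ^ (2 - 2 * σ + ε₀) * pencilVolume δ a ≤ δ₁ ^ (2 - 2 * σ + ε₀) * 1 := by
          have := Real.rpow_pos_of_pos hδ₁ (2 - 2 * σ + ε₀)
          gcongr
          exact pencilVolume_le_one δ a
      _ ≤ _ := by
          rw [mul_one]
          exact Real.rpow_le_rpow hδ₁.le h1 (by linarith)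

end PencilGap

/-! ### Non-concentration of sumsets and difference sets. -/

section SumsetNonConc

/-- If `A` is not concentrated and `X + A` is small then the part of `X` in an interval is small. -/
theorem cov_mul_cov_le_of_abs_sub_le {δ r a₀ κ : ℝ} {X A : Finset ℝ} (hδ : 0 < δ) (hr : δ ≤ r)
    (hX : ∀ x ∈ X, |x - a₀| ≤ r)
    (hA : ∀ c, (cov δ (A.filter (fun a => |a - c| ≤ 2 * r)) : ℝ) ≤ κ) :
    (cov δ X : ℝ) * cov δ A ≤ 5 * κ * cov δ (X + A) := by
  classical
  obtain ⟨X', hX'X, hX'i, hX'c⟩ := exists_subset_injOn_cell δ X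
  obtain ⟨A', hA'A, hA'i, hA'c⟩ := exists_subset_injOn_cell δ A
  rw [← hX'c, ← hA'c, cov_eq_card hX'i, cov_eq_card hA'i]
  set f : ℝ × ℝ → ℤ := fun p => cell δ (p.1 + p.2) with hf
  -- If `x + a` lies in a given cell and `x` within `r` of `a₀`, then `a` lies within `2r` of a
  -- fixed point: at most `κ` choices, and then at most five for `x`.
  have h1 : ∀ v ∈ (X' ×ˢ A').image f, (((X' ×ˢ A').filter (fun p => f p = v)).card : ℝ) ≤ 5 * κ := by
    intro v _
    set G := (X' ×ˢ A').filter (fun p => f p = v) with hG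
    have hGm : ∀ p ∈ G, p.1 ∈ X' ∧ p.2 ∈ A' ∧ v * δ ≤ p.1 + p.2 ∧ p.1 + p.2 < v * δ + δ := by
      intro p hp
      obtain ⟨hp1, hp2⟩ := Finset.mem_filter.1 hp
      obtain ⟨hp3, hp4⟩ := Finset.mem_product.1 hp1
      have := cell_bounds hδ (p.1 + p.2)
      rw [show cell δ (p.1 + p.2) = v from hp2] at this
      exact ⟨hp3, hp4, this.1, by linarith [this.2]⟩
    have h2 : ∀ a ∈ A'.filter (fun a => |a - (v * δ - a₀)| ≤ 2 * r),
        ((G.filter (fun p => p.2 = a)).card : ℝ) ≤ 5 := by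
      intro a _
      have h8 := card_filter_abs_sub_le (M := 1) (a := v * δ - a) hδ zero_le_one hX'i
      refine le_trans ?_ (h8.trans_eq (by norm_num))
      have : (G.filter (fun p => p.2 = a)).card ≤
          (X'.filter (fun x => |x - (v * δ - a)| ≤ 1 * δ)).card := by
        refine Finset.card_le_card_of_injOn (fun p => p.1) ?_ ?_
        · intro p hp
          obtain ⟨hp1, rfl⟩ := Finset.mem_filter.1 (Finset.mem_coe.1 hp)
          obtain ⟨h3, h4, h5, h6⟩ := hGm p hp1
          refine Finset.mem_coe.2 (Finset.mem_filter.2 ⟨h3, ?_⟩)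
          rw [abs_le]
          constructor <;> linarith
        · intro p hp q hq he
          exact Prod.ext he ((Finset.mem_filter.1 (Finset.mem_coe.1 hp)).2.trans
            (Finset.mem_filter.1 (Finset.mem_coe.1 hq)).2.symm)
      exact_mod_cast this
    rw [Finset.card_eq_sum_card_fiberwise (f := fun p : ℝ × ℝ => p.2)
      (t := A'.filter (fun a => |a - (v * δ - a₀)| ≤ 2 * r)) (by
        intro p hp
        obtain ⟨h3, h4, h5, h6⟩ := hGm p (Finset.mem_coe.1 hp)
        refine Finset.mem_coe.2 (Finset.mem_filter.2 ⟨h4, ?_⟩)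
        have := abs_le.1 (hX _ (hX'X h3))
        rw [abs_le]
        constructor <;> linarith)]
    push_cast
    calc _ ≤ ∑ a ∈ A'.filter (fun a => |a - (v * δ - a₀)| ≤ 2 * r), (5 : ℝ) := Finset.sum_le_sum h2
      _ = (A'.filter (fun a => |a - (v * δ - a₀)| ≤ 2 * r)).card * 5 := by
          rw [Finset.sum_const, nsmul_eq_mul]
      _ ≤ κ * 5 := by
          gcongr
          refine le_trans ?_ (hA (v * δ - a₀))
          rw [← cov_eq_card (hA'i.mono (by exact_mod_cast Finset.filter_subset _ _))]
          exact_mod_cast cov_mono (Finset.filter_subset_filter _ hA'A)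
      _ = _ := by ring
  have h3 : ((X' ×ˢ A').card : ℝ) ≤ ((X' ×ˢ A').image f).card * (5 * κ) := by
    rw [Finset.card_eq_sum_card_fiberwise (f := f) (t := (X' ×ˢ A').image f)
      (fun p hp => Finset.mem_coe.2 (Finset.mem_image_of_mem _ hp)), ← nsmul_eq_mul]
    push_cast
    exact Finset.sum_le_card_nsmul _ _ _ h1
  have h4 : ((X' ×ˢ A').image f).card ≤ cov δ (X + A) := by
    refine Finset.card_le_card fun v hv => ?_
    obtain ⟨p, hp, rfl⟩ := Finset.mem_image.1 hv
    obtain ⟨hp1, hp2⟩ := Finset.mem_product.1 hp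
    exact Finset.mem_image_of_mem _ (Finset.add_mem_add (hX'X hp1) (hA'A hp2))
  have hκ : 0 ≤ κ := le_trans (Nat.cast_nonneg _) (hA 0)
  rw [Finset.card_product] at h3
  push_cast at h3
  calc _ ≤ _ := h3
    _ ≤ cov δ (X + A) * (5 * κ) := by gcongr
    _ = _ := by ring

theorem cov_triple_le {δ : ℝ} (hδ : 0 < δ) (A : Finset ℝ) :
    (cov δ (A + A + A) : ℝ) ≤ 9 * (3 • A.image (cell δ) - 0 • A.image (cell δ)).card ∧
    (cov δ (A - A + A) : ℝ) ≤ 9 * (2 • A.image (cell δ) - 1 • A.image (cell δ)).card := by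
  have hm := fun x (hx : x ∈ A) => Finset.mem_image_of_mem (cell δ) hx
  constructor
  · have e1 : A + A + A = (A ×ˢ A ×ˢ A).image (fun p => p.1 + p.2.1 + p.2.2) := by
      ext z; simp [Finset.mem_add, and_assoc]
    have e2 : (A ×ˢ A ×ˢ A).image (fun p => cell δ p.1 + cell δ p.2.1 + cell δ p.2.2) ⊆
        3 • A.image (cell δ) - 0 • A.image (cell δ) := by
      intro z hz
      obtain ⟨⟨a, b, c⟩, hp, rfl⟩ := Finset.mem_image.1 hz
      obtain ⟨ha, hb, hc⟩ : a ∈ A ∧ b ∈ A ∧ c ∈ A := by simpa [Finset.mem_product] using hp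
      rw [zero_nsmul, sub_zero,
        show 3 • A.image (cell δ) = A.image (cell δ) + A.image (cell δ) + A.image (cell δ) by
          simp [succ_nsmul]]
      exact Finset.add_mem_add (Finset.add_mem_add (hm a ha) (hm b hb)) (hm c hc)
    rw [e1, cov_image]
    refine (card_image_cell_le (A ×ˢ A ×ˢ A) (fun p => p.1 + p.2.1 + p.2.2)
      (fun p => cell δ p.1 + cell δ p.2.1 + cell δ p.2.2) (M := 3) hδ (by norm_num) (by
        intro p _ q _ he
        have he' : (cell δ p.1 : ℝ) + cell δ p.2.1 + cell δ p.2.2 =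
          cell δ q.1 + cell δ q.2.1 + cell δ q.2.2 := by exact_mod_cast he
        have he2 : cell δ p.1 * δ + cell δ p.2.1 * δ + cell δ p.2.2 * δ =
            cell δ q.1 * δ + cell δ q.2.1 * δ + cell δ q.2.2 * δ := by
          linear_combination δ * he'
        have b1 := cell_bounds hδ p.1
        have b2 := cell_bounds hδ p.2.1
        have b3 := cell_bounds hδ p.2.2
        have b4 := cell_bounds hδ q.1
        have b5 := cell_bounds hδ q.2.1
        have b6 := cell_bounds hδ q.2.2
        rw [abs_le]
        constructor <;> linarith)).trans ?_
    rw [show (2 : ℝ) * 3 + 3 = 9 by norm_num]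
    exact mul_le_mul_of_nonneg_left (Nat.cast_le.2 (Finset.card_le_card e2)) (by norm_num)
  · have e1 : A - A + A = (A ×ˢ A ×ˢ A).image (fun p => p.1 - p.2.1 + p.2.2) := by
      ext z; simp [Finset.mem_add, Finset.mem_sub, and_assoc]
    have e2 : (A ×ˢ A ×ˢ A).image (fun p => cell δ p.1 - cell δ p.2.1 + cell δ p.2.2) ⊆
        2 • A.image (cell δ) - 1 • A.image (cell δ) := by
      intro z hz
      obtain ⟨⟨a, b, c⟩, hp, rfl⟩ := Finset.mem_image.1 hz
      obtain ⟨ha, hb, hc⟩ : a ∈ A ∧ b ∈ A ∧ c ∈ A := by simpa [Finset.mem_product] using hp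
      rw [one_nsmul, two_nsmul, show cell δ a - cell δ b + cell δ c =
        cell δ a + cell δ c - cell δ b by ring]
      exact Finset.sub_mem_sub (Finset.add_mem_add (hm a ha) (hm c hc)) (hm b hb)
    rw [e1, cov_image]
    refine (card_image_cell_le (A ×ˢ A ×ˢ A) (fun p => p.1 - p.2.1 + p.2.2)
      (fun p => cell δ p.1 - cell δ p.2.1 + cell δ p.2.2) (M := 3) hδ (by norm_num) (by
        intro p _ q _ he
        have he' : (cell δ p.1 : ℝ) - cell δ p.2.1 + cell δ p.2.2 =
          cell δ q.1 - cell δ q.2.1 + cell δ q.2.2 := by exact_mod_cast he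
        have he2 : cell δ p.1 * δ - cell δ p.2.1 * δ + cell δ p.2.2 * δ =
            cell δ q.1 * δ - cell δ q.2.1 * δ + cell δ q.2.2 * δ := by
          linear_combination δ * he'
        have b1 := cell_bounds hδ p.1
        have b2 := cell_bounds hδ p.2.1
        have b3 := cell_bounds hδ p.2.2
        have b4 := cell_bounds hδ q.1
        have b5 := cell_bounds hδ q.2.1
        have b6 := cell_bounds hδ q.2.2
        rw [abs_le]
        constructor <;> linarith)).trans ?_
    rw [show (2 : ℝ) * 3 + 3 = 9 by norm_num]
    exact mul_le_mul_of_nonneg_left (Nat.cast_le.2 (Finset.card_le_card e2)) (by norm_num)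

/-- Sums and differences of a set with small doubling inherit non-concentration. -/
theorem NonConc.add_self_and_sub_self {σ δ K n : ℝ} {A : Finset ℝ} (hδ : 0 < δ) (hK : 100 ≤ K)
    (hσ1 : σ ≤ 1) (hn : 0 < n) (hA : NonConc σ δ K A) (hge : n ≤ K * cov δ A)
    (hle : (cov δ A : ℝ) ≤ K * n) (hadd : (cov δ (A + A) : ℝ) ≤ K * n) :
    NonConc σ δ (K ^ 20) (A + A) ∧ NonConc σ δ (K ^ 20) (A - A) := by
  have hK0 : 0 < K := by linarith
  have hK1 : 1 ≤ K := by linarith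
  set I := A.image (cell δ) with hI
  have hplu : ∀ m k : ℕ, m + k ≤ 3 → ((m • I - k • I).card : ℝ) ≤ K ^ 14 * n := by
    intro m k hmk
    have h1 := card_add_le_cov hδ A A
    have h2 := card_two_nsmul_sub_le (A := I) (K := K ^ 2) (N := n) (one_le_pow₀ hK1) hn
      (by
        refine hge.trans ?_
        gcongr
        · exact le_self_pow₀ hK1 (by norm_num)
        · exact le_rfl)
      (by
        refine le_trans ?_ (hle.trans ?_)
        · exact le_rfl
        · gcongr; exact le_self_pow₀ hK1 (by norm_num))
      (calc _ ≤ 7 * (K * n) := h1.trans (by gcongr)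
        _ = 7 * K ^ 1 * n := by ring
        _ ≤ K ^ 2 * n := by
          gcongr; exact numeral_mul_pow_le (m := 1) hK (by norm_num) (by norm_num)) m k
    rw [← pow_mul] at h2
    refine h2.trans ?_
    gcongr
    omega
  -- Apply the interval bound to the part of `Y` in an interval. It only requires `Y + A` to be
  -- small, which Plünnecke provides for `A + A + A` and `A - A + A`.
  have key : ∀ Y : Finset ℝ, (cov δ (Y + A) : ℝ) ≤ 9 * (K ^ 14 * n) → NonConc σ δ (K ^ 20) Y := by
    intro Y hY a r hr
    have hr0 := hδ.trans_le hr
    set X := Y.filter (fun x => |x - a| ≤ r) with hX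
    have h1 := cov_mul_cov_le_of_abs_sub_le (X := X) (A := A) (a₀ := a) (κ := 2 * K * (r / δ) ^ σ)
      hδ hr (fun x hx => (Finset.mem_filter.1 hx).2) (by
        intro c
        have h5 : (2 * r / δ) ^ σ ≤ 2 * (r / δ) ^ σ := by
          rw [mul_div_assoc]
          exact mul_rpow_le one_le_two (by positivity) hσ1
        calc _ ≤ K * (2 * (r / δ) ^ σ) := (hA c (2 * r) (by linarith)).trans (by gcongr)
          _ = _ := by ring)
    have h2 : (cov δ (X + A) : ℝ) ≤ 9 * (K ^ 14 * n) := by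
      refine le_trans ?_ hY
      exact_mod_cast cov_mono (Finset.add_subset_add (Finset.filter_subset _ _) subset_rfl)
    have hp : 0 ≤ (r / δ) ^ σ := by positivity
    refine le_of_mul_le_mul_right ?_ hn
    calc (cov δ X : ℝ) * n ≤ cov δ X * (K * cov δ A) := by gcongr
      _ = K * (cov δ X * cov δ A) := by ring
      _ ≤ K * (5 * (2 * K * (r / δ) ^ σ) * (9 * (K ^ 14 * n))) := by
          refine mul_le_mul_of_nonneg_left (h1.trans ?_) hK0.le
          gcongr
      _ = 90 * K ^ 16 * (r / δ) ^ σ * n := by ring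
      _ ≤ _ := by gcongr; exact numeral_mul_pow_le (m := 1) hK (by norm_num) (by norm_num)
  obtain ⟨h1, h2⟩ := cov_triple_le hδ A
  exact ⟨key _ (h1.trans (by gcongr; exact hplu 3 0 (by norm_num))),
    key _ (h2.trans (by gcongr; exact hplu 2 1 (by norm_num)))⟩

end SumsetNonConc

/-! ### Distances, tubes and lines in coordinates. -/

section PlaneGeometry

theorem abs_sub_apply_le_dist (x y : Plane) (i : Fin 2) : |x i - y i| ≤ dist x y := by
  rw [dist_eq_norm, ← Real.norm_eq_abs, ← PiLp.sub_apply]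
  exact PiLp.norm_apply_le _ _

theorem dist_le_abs_add_abs (x y : Plane) : dist x y ≤ |x 0 - y 0| + |x 1 - y 1| := by
  rw [EuclideanSpace.dist_eq, Fin.sum_univ_two, Real.dist_eq, Real.dist_eq]
  refine Real.sqrt_le_iff.2 ⟨by positivity, ?_⟩
  nlinarith [abs_nonneg (x 0 - y 0), abs_nonneg (x 1 - y 1)]

theorem norm_le_abs_add_abs (v : Plane) : ‖v‖ ≤ |v 0| + |v 1| := by
  have := dist_le_abs_add_abs v 0
  simpa [dist_eq_norm] using this

theorem planeBox_subset_ball {δ : ℝ} (hδ : 0 < δ) (q : Plane) :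
    planeBox (δ / 2) (cell (δ / 2) (q 0), cell (δ / 2) (q 1)) ⊆ Metric.ball q δ := by
  intro z hz
  have h1 : cell (δ / 2) (z 0) = cell (δ / 2) (q 0) := congrArg Prod.fst hz
  have h2 : cell (δ / 2) (z 1) = cell (δ / 2) (q 1) := congrArg Prod.snd hz
  have h3 := abs_sub_lt_of_cell_eq (half_pos hδ) h1
  have h4 := abs_sub_lt_of_cell_eq (half_pos hδ) h2
  rw [Metric.mem_ball]
  linarith [dist_le_abs_add_abs z q]

theorem abs_det_le (v w : Plane) : |v 0 * w 1 - v 1 * w 0| ≤ ‖v‖ * ‖w‖ := by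
  rw [EuclideanSpace.norm_eq, EuclideanSpace.norm_eq, ← Real.sqrt_mul (by positivity),
    Fin.sum_univ_two, Fin.sum_univ_two]
  refine Real.abs_le_sqrt ?_
  simp only [Real.norm_eq_abs, sq_abs]
  nlinarith [sq_nonneg (v 0 * w 0 + v 1 * w 1)]

theorem abs_det_lt_of_mem_tube {p v q : Plane} {r : ℝ} (hv : v ≠ 0) (h : q ∈ tube (lineAt p v) r) :
    |v 0 * (q 1 - p 1) - v 1 * (q 0 - p 0)| < ‖v‖ * r := by
  obtain ⟨z, ⟨t, rfl⟩, hz⟩ := Metric.mem_thickening_iff.1 h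
  have h1 := abs_det_le v (q - (p + t • v))
  rw [← dist_eq_norm] at h1
  calc |v 0 * (q 1 - p 1) - v 1 * (q 0 - p 0)|
      = |v 0 * (q - (p + t • v)) 1 - v 1 * (q - (p + t • v)) 0| := by
        congr 1
        simp only [PiLp.sub_apply, PiLp.add_apply, PiLp.smul_apply, smul_eq_mul]
        ring
    _ ≤ _ := h1
    _ < _ := by
        have := norm_pos_iff.2 hv
        gcongr

/-- On `S` the affine form `a x + b y - c` vanishes, and it is Lipschitz with constant `|a| + |b|`;
so a lower bound for it on `T` separates the two sets. -/
theorem le_mul_setDist_of_forall {S T : Set Plane} {a b c d : ℝ} (hS : S.Nonempty)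
    (hT : T.Nonempty) (hl : ∀ z ∈ S, a * z 0 + b * z 1 = c)
    (hd : ∀ q ∈ T, d ≤ |a * q 0 + b * q 1 - c|) (hab : 0 < |a| + |b|) :
    d ≤ (|a| + |b|) * setDist S T := by
  have : Nonempty (S × T) := ⟨⟨⟨_, hS.some_mem⟩, ⟨_, hT.some_mem⟩⟩⟩
  rw [← div_le_iff₀' hab]
  refine le_ciInf fun z => ?_
  rw [div_le_iff₀' hab]
  obtain ⟨⟨z, hz⟩, ⟨q, hq⟩⟩ := z
  have h0 := abs_sub_apply_le_dist z q 0
  have h1 := abs_sub_apply_le_dist z q 1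
  calc d ≤ |a * q 0 + b * q 1 - c| := hd q hq
    _ = |a * (z 0 - q 0) + b * (z 1 - q 1)| := by
        rw [← hl z hz, abs_sub_comm]; congr 1; ring
    _ ≤ |a * (z 0 - q 0)| + |b * (z 1 - q 1)| := abs_add_le _ _
    _ = |a| * |z 0 - q 0| + |b| * |z 1 - q 1| := by rw [abs_mul, abs_mul]
    _ ≤ |a| * dist z q + |b| * dist z q := by gcongr
    _ = _ := by ring

theorem setDist_le_dist {S T : Set Plane} {z q : Plane} (hz : z ∈ S) (hq : q ∈ T) :
    setDist S T ≤ dist z q :=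
  ciInf_le (f := fun w : S × T => dist (w.1 : Plane) (w.2 : Plane))
    ⟨0, by rintro _ ⟨w, rfl⟩; exact dist_nonneg⟩ (⟨z, hz⟩, ⟨q, hq⟩)

end PlaneGeometry

/-! ### Slopes as direction parameters. -/

section SlopeAngle

/-- The direction parameter of the lines of slope `m`. -/
noncomputable def slopeAngle (m : ℝ) : ℝ := 1 / 2 + Real.arctan m / (2 * Real.pi)

theorem slopeAngle_mem (m : ℝ) : slopeAngle m ∈ Ico (0 : ℝ) 1 := by
  have h1 := Real.neg_pi_div_two_lt_arctan m
  have h2 := Real.arctan_lt_pi_div_two m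
  have hp := Real.pi_pos
  have h3 : -(1 / 4) < Real.arctan m / (2 * Real.pi) := by
    rw [lt_div_iff₀ (by positivity)]; linarith
  have h4 : Real.arctan m / (2 * Real.pi) < 1 / 4 := by
    rw [div_lt_iff₀ (by positivity)]; linarith
  constructor <;> unfold slopeAngle <;> linarith

theorem abs_arctan_sub_arctan_le (x y : ℝ) : |Real.arctan x - Real.arctan y| ≤ |x - y| := by
  have h := Convex.norm_image_sub_le_of_norm_deriv_le (f := Real.arctan) (C := 1) (s := univ)
    (x := y) (y := x) (fun x _ => Real.differentiable_arctan x) (fun x _ => by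
      rw [Real.deriv_arctan, Real.norm_eq_abs, abs_of_nonneg (by positivity),
        div_le_one (by positivity)]
      nlinarith [sq_nonneg x]) convex_univ (mem_univ _) (mem_univ _)
  simpa using h

theorem abs_sub_le_mul_abs_arctan_sub {x y M : ℝ} (hx : |x| ≤ M) (hy : |y| ≤ M) :
    |x - y| ≤ (1 + M ^ 2) * |Real.arctan x - Real.arctan y| := by
  wlog hxy : x ≤ y generalizing x y
  · rw [abs_sub_comm, abs_sub_comm (Real.arctan x)]
    exact this hy hx (le_of_not_ge hxy)
  have hM : 0 < 1 + M ^ 2 := by positivity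
  have h := Convex.mul_sub_le_image_sub_of_le_deriv (convex_Icc (-M) M) (f := Real.arctan)
    (C := (1 + M ^ 2)⁻¹) Real.continuous_arctan.continuousOn
    Real.differentiable_arctan.differentiableOn (fun z hz => by
      have hz' := interior_subset hz
      rw [Real.deriv_arctan]
      change _ ≤ 1 / (1 + z ^ 2)
      rw [← one_div]
      gcongr 1 / (1 + ?_)
      exact sq_le_sq' hz'.1 hz'.2) x (abs_le.1 hx) y (abs_le.1 hy) hxy
  have h0 := Real.arctan_strictMono.monotone hxy
  rw [abs_sub_comm, abs_of_nonneg (by linarith), abs_sub_comm, abs_of_nonneg (by linarith)]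
  rw [inv_mul_le_iff₀ hM] at h
  exact h

/-- The shift by `1 / 2` in `slopeAngle` replaces the direction vector by its negative. The line is
the same, and the parameter stays in `(1 / 4, 3 / 4)`, away from the point where the circle is cut
open. -/
theorem mem_lineAt_slopeAngle {p q : Plane} {m : ℝ} (h : q 1 - p 1 = m * (q 0 - p 0)) :
    q ∈ lineAt p (direction (slopeAngle m)) := by
  have hc := Real.cos_arctan_pos m
  have ha : 2 * Real.pi * slopeAngle m = Real.arctan m + Real.pi := by
    unfold slopeAngle
    have := Real.pi_ne_zero
    field_simp
    ring
  have hs : Real.sin (Real.arctan m) = m * Real.cos (Real.arctan m) := by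
    rw [Real.sin_arctan, Real.cos_arctan]; ring
  refine ⟨-(q 0 - p 0) / Real.cos (Real.arctan m), ?_⟩
  ext i
  fin_cases i
  · simp only [direction, ha, Real.cos_add_pi, Real.sin_add_pi]
    simp
    field_simp
    ring
  · simp only [direction, ha, Real.cos_add_pi, Real.sin_add_pi, hs]
    simp
    field_simp
    linear_combination h

end SlopeAngle

/-! ### Non-concentration under bi-Lipschitz maps and for sets of directions. -/

section Arcs

theorem NonConc.image {σ δ κ B B' : ℝ} {Z : Finset ℝ} {f : ℝ → ℝ} (hδ : 0 < δ) (hB : 0 ≤ B)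
    (hB' : 1 ≤ B') (hσ1 : σ ≤ 1) (hZ : NonConc σ δ κ Z)
    (h1 : ∀ z ∈ Z, ∀ w ∈ Z, |f z - f w| ≤ B * |z - w|)
    (h2 : ∀ z ∈ Z, ∀ w ∈ Z, |z - w| ≤ B' * |f z - f w|) :
    NonConc σ δ ((2 * B + 3) * (2 * B') * κ) (Z.image f) := by
  have hκ : 0 ≤ κ := by
    have := hZ 0 δ le_rfl
    rw [div_self hδ.ne', Real.one_rpow, mul_one] at this
    exact le_trans (Nat.cast_nonneg _) this
  intro a r hr
  have hr0 := hδ.trans_le hr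
  have hp : 0 ≤ (r / δ) ^ σ := by positivity
  rcases ((Z.image f).filter (fun x => |x - a| ≤ r)).eq_empty_or_nonempty with h0 | ⟨x, hx⟩
  · rw [h0]
    simp only [cov, Finset.image_empty, Finset.card_empty, Nat.cast_zero]
    positivity
  obtain ⟨hx1, hxa⟩ := Finset.mem_filter.1 hx
  obtain ⟨z₀, hz₀, rfl⟩ := Finset.mem_image.1 hx1
  have h3 : (Z.image f).filter (fun x => |x - a| ≤ r) ⊆
      (Z.filter (fun z => |z - z₀| ≤ 2 * B' * r)).image f := by
    intro y hy
    obtain ⟨hy1, hya⟩ := Finset.mem_filter.1 hy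
    obtain ⟨z, hz, rfl⟩ := Finset.mem_image.1 hy1
    refine Finset.mem_image_of_mem _ (Finset.mem_filter.2 ⟨hz, ?_⟩)
    have h4 : |f z - f z₀| ≤ 2 * r := by
      rw [abs_le] at *
      constructor <;> linarith
    calc |z - z₀| ≤ B' * |f z - f z₀| := h2 z hz z₀ hz₀
      _ ≤ B' * (2 * r) := by gcongr
      _ = _ := by ring
  have h4 := cov_image_le (S := Z.filter (fun z => |z - z₀| ≤ 2 * B' * r)) (f := f) (M := B) hδ hδ hB
    (fun z hz w hw hzw => (h1 z (Finset.mem_filter.1 hz).1 w (Finset.mem_filter.1 hw).1).trans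
      (by gcongr))
  have h5 : (2 * B' * r / δ) ^ σ ≤ 2 * B' * (r / δ) ^ σ := by
    rw [mul_div_assoc]
    exact mul_rpow_le (by linarith) (by positivity) hσ1
  calc _ ≤ (cov δ ((Z.filter (fun z => |z - z₀| ≤ 2 * B' * r)).image f) : ℝ) := by
        exact_mod_cast cov_mono h3
    _ ≤ (2 * B + 3) * (κ * (2 * B' * (r / δ) ^ σ)) := by
        refine h4.trans ?_
        gcongr
        exact (hZ z₀ _ (by nlinarith)).trans (by gcongr)
    _ = _ := by ring

/-- The slope is bi-Lipschitz in the label and, since slopes are at most `60`, the angle is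
bi-Lipschitz in the slope: the constant `30000` exceeds `7 * (1 + 60 ^ 2)`, with `7` bounding `2π`.
-/
theorem volume_directionArcs_le {σ δ κ : ℝ} {Z : Finset ℝ} {m : ℝ → ℝ} (hδ : 0 < δ) (hσ1 : σ ≤ 1)
    (hZ : NonConc σ δ κ Z) (hm : ∀ z ∈ Z, |m z| ≤ 60)
    (h1 : ∀ z ∈ Z, ∀ w ∈ Z, |m z - m w| ≤ 200 * |z - w|)
    (h2 : ∀ z ∈ Z, ∀ w ∈ Z, |z - w| ≤ 200 * |m z - m w|) (b r : ℝ) (hr : δ < r) :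
    volume.real (directionArcs δ (Z.image (fun z => slopeAngle (m z)) : Finset ℝ) ∩ Metric.ball b r) ≤
      100 ^ 6 * κ * (δ * (r / δ) ^ σ) := by
  have hr0 := hδ.trans hr
  have hpi : 0 < 2 * Real.pi := by positivity
  have hpi1 : 1 ≤ 2 * Real.pi := by linarith [Real.pi_gt_three]
  have hpi7 : 2 * Real.pi ≤ 7 := by linarith [Real.pi_lt_d2]
  have hsub : ∀ z w, |slopeAngle (m z) - slopeAngle (m w)| =
      |Real.arctan (m z) - Real.arctan (m w)| / (2 * Real.pi) := by
    intro z w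
    rw [show slopeAngle (m z) - slopeAngle (m w) =
      (Real.arctan (m z) - Real.arctan (m w)) / (2 * Real.pi) by unfold slopeAngle; ring,
      abs_div, abs_of_pos hpi]
  have hκ : 0 ≤ κ := by
    have := hZ 0 δ le_rfl
    rw [div_self hδ.ne', Real.one_rpow, mul_one] at this
    exact le_trans (Nat.cast_nonneg _) this
  have hnc := hZ.image (f := fun z => slopeAngle (m z)) (B := 200) (B' := 200 * 30000) hδ (by norm_num)
    (by norm_num) hσ1 (by
      intro z hz w hw
      rw [hsub]
      calc _ ≤ |Real.arctan (m z) - Real.arctan (m w)| := div_le_self (abs_nonneg _) hpi1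
        _ ≤ _ := (abs_arctan_sub_arctan_le _ _).trans (h1 z hz w hw)) (by
      intro z hz w hw
      rw [hsub]
      have h3 := abs_sub_le_mul_abs_arctan_sub (hm z hz) (hm w hw)
      calc |z - w| ≤ 200 * ((1 + 60 ^ 2) * |Real.arctan (m z) - Real.arctan (m w)|) :=
            (h2 z hz w hw).trans (by gcongr)
        _ = 200 * ((1 + 60 ^ 2) * (2 * Real.pi *
            (|Real.arctan (m z) - Real.arctan (m w)| / (2 * Real.pi)))) := by
              rw [mul_div_cancel₀ _ hpi.ne']
        _ ≤ 200 * ((1 + 60 ^ 2) * (7 *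
            (|Real.arctan (m z) - Real.arctan (m w)| / (2 * Real.pi)))) := by gcongr
        _ = 200 * 25207 * (|Real.arctan (m z) - Real.arctan (m w)| / (2 * Real.pi)) := by ring
        _ ≤ _ := by gcongr; norm_num)
  set Θ := Z.image (fun z => slopeAngle (m z)) with hΘ
  have h3 : directionArcs δ (Θ : Set ℝ) ∩ Metric.ball b r ⊆
      ⋃ t ∈ Θ.filter (fun x => |x - b| ≤ 2 * r), Metric.ball t (1 * δ) := by
    rintro y ⟨hy, hyb⟩
    obtain ⟨t, ht, hyt⟩ := mem_iUnion₂.1 hy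
    rw [one_mul]
    refine mem_iUnion₂.2 ⟨t, Finset.mem_filter.2 ⟨Finset.mem_coe.1 ht, ?_⟩, hyt⟩
    rw [Metric.mem_ball, Real.dist_eq, abs_lt] at hyt hyb
    rw [abs_le]
    constructor <;> linarith
  have h4 := volume_real_le_of_subset_iUnion_ball hδ zero_le_one h3
  have h5 : (2 * r / δ) ^ σ ≤ 2 * (r / δ) ^ σ := by
    rw [mul_div_assoc]
    exact mul_rpow_le one_le_two (by positivity) hσ1
  have hp : 0 ≤ (r / δ) ^ σ := by positivity
  calc _ ≤ (2 * 1 + 1) * δ * ((2 * 200 + 3) * (2 * (200 * 30000)) * κ * (2 * (r / δ) ^ σ)) := by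
        refine h4.trans ?_
        gcongr
        exact (hnc b _ (by linarith)).trans (by gcongr)
    _ = (2 * 1 + 1) * ((2 * 200 + 3) * (2 * (200 * 30000)) * 2) * (κ * (δ * (r / δ) ^ σ)) := by ring
    _ ≤ 100 ^ 6 * (κ * (δ * (r / δ) ^ σ)) := by gcongr; norm_num
    _ = _ := by ring

end Arcs

/-! ### Four explicit tips in general position. -/

section Tips

/-- The tips of the four pencils that encode `y / x`, `y`, `x`, `x + y`. -/
noncomputable def projTips : Fin 4 → Plane :=
  ![!₂[-1 / 4, -1 / 4], !₂[199 / 4, -1 / 4], !₂[-1 / 4, 99 / 4], !₂[-201 / 4, 199 / 4]]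

/-- The projective transformation that sends the four tips to the directions of the lines
`y / x = t`, `y = t`, `x = t`, `x + y = t`. -/
noncomputable def projMap (x y : ℝ) : Plane :=
  !₂[50 * x / (x + 2 * y + 100) - 1 / 4, 50 * y / (x + 2 * y + 100) - 1 / 4]

theorem zero_mem_unitSquare : (0 : Plane) ∈ unitSquare := fun i => by simp

theorem projTips_infDist (i : Fin 4) : Metric.infDist (projTips i) unitSquare ≤ 1000 ∧
    1 ≤ 1000 * Metric.infDist (projTips i) unitSquare := by
  constructor
  · refine (Metric.infDist_le_dist_of_mem zero_mem_unitSquare).trans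
      ((dist_le_abs_add_abs _ _).trans ?_)
    fin_cases i <;> simp [projTips] <;> norm_num [abs_of_pos, abs_of_neg]
  · have h : (1 / 4 : ℝ) ≤ Metric.infDist (projTips i) unitSquare := by
      rw [Metric.le_infDist ⟨0, zero_mem_unitSquare⟩]
      intro q hq
      have h0 := hq 0
      have h1 := hq 1
      obtain ⟨d0, d0'⟩ := abs_le.1 (abs_sub_apply_le_dist (projTips i) q 0)
      obtain ⟨d1, d1'⟩ := abs_le.1 (abs_sub_apply_le_dist (projTips i) q 1)
      fin_cases i <;> simp [projTips] at d0 d1 d0' d1' h0 h1 ⊢ <;>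
        linarith [h0.1, h0.2, h1.1, h1.2]
    linarith

theorem projTips_dist (i j : Fin 4) (hij : i ≠ j) : dist (projTips i) (projTips j) ≤ 1000 ∧
    1 ≤ 1000 * dist (projTips i) (projTips j) := by
  obtain ⟨d0, d0'⟩ := abs_le.1 (abs_sub_apply_le_dist (projTips i) (projTips j) 0)
  obtain ⟨d1, d1'⟩ := abs_le.1 (abs_sub_apply_le_dist (projTips i) (projTips j) 1)
  have h := dist_le_abs_add_abs (projTips i) (projTips j)
  constructor
  · refine h.trans ?_
    clear h d0 d1 d0' d1'
    fin_cases i <;> fin_cases j <;> simp [projTips] <;> norm_num [abs_of_pos, abs_of_neg]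
  · clear h
    fin_cases i <;> fin_cases j <;> simp [projTips] at hij d0 d1 d0' d1' ⊢ <;>
      linarith

theorem lineAt_subset_of_apply {p p' : Plane} {a b c : ℝ} (h : a * p 0 + b * p 1 = c)
    (h' : a * p' 0 + b * p' 1 = c) : ∀ z ∈ lineAt p (p' - p), a * z 0 + b * z 1 = c := by
  rintro _ ⟨t, rfl⟩
  simp only [PiLp.add_apply, PiLp.smul_apply, PiLp.sub_apply, smul_eq_mul]
  linear_combination (1 - t) * h + t * h'

theorem mem_lineAt_self (p v : Plane) : p ∈ lineAt p v := ⟨0, by simp⟩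

/-- Only four lines occur: the image `x + 2y = 197 / 4` of the line at infinity, which contains the
last three tips, and the lines joining the first tip, the image of the origin, to each of them. Each
avoids the square by an explicit margin. -/
theorem projTips_setDist (i j : Fin 4) (hij : i ≠ j) :
    setDist (lineAt (projTips i) (projTips j - projTips i)) unitSquare ≤ 1000 ∧
    1 ≤ 1000 * setDist (lineAt (projTips i) (projTips j - projTips i)) unitSquare := by
  constructor
  · refine (setDist_le_dist (mem_lineAt_self _ _) zero_mem_unitSquare).trans
      ((dist_le_abs_add_abs _ _).trans ?_)
    clear hij
    fin_cases i <;> simp [projTips] <;> norm_num [abs_of_pos, abs_of_neg]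
  · have key : ∀ a b c : ℝ, |a| + |b| ≤ 4 → 0 < |a| + |b| →
        a * projTips i 0 + b * projTips i 1 = c → a * projTips j 0 + b * projTips j 1 = c →
        (∀ q ∈ unitSquare, 1 / 4 ≤ |a * q 0 + b * q 1 - c|) →
        1 ≤ 1000 * setDist (lineAt (projTips i) (projTips j - projTips i)) unitSquare := by
      intro a b c h4 h0 h1 h2 h3
      have := le_mul_setDist_of_forall ⟨_, mem_lineAt_self _ _⟩ ⟨0, zero_mem_unitSquare⟩
        (lineAt_subset_of_apply h1 h2) h3 h0
      have hn : 0 ≤ setDist (lineAt (projTips i) (projTips j - projTips i)) unitSquare :=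
        Real.iInf_nonneg fun _ => dist_nonneg
      nlinarith
    have hsq1 : ∀ q ∈ unitSquare, 1 / 4 ≤ |(1 : ℝ) * q 0 + 2 * q 1 - 197 / 4| := fun q hq => by
      rw [abs_of_neg (by linarith [(hq 0).2, (hq 1).2])]; linarith [(hq 0).2, (hq 1).2]
    have hsq2 : ∀ q ∈ unitSquare, 1 / 4 ≤ |(0 : ℝ) * q 0 + 1 * q 1 - -1 / 4| := fun q hq => by
      rw [abs_of_pos (by linarith [(hq 0).1, (hq 1).1])]; linarith [(hq 0).1, (hq 1).1]
    have hsq3 : ∀ q ∈ unitSquare, 1 / 4 ≤ |(1 : ℝ) * q 0 + 0 * q 1 - -1 / 4| := fun q hq => by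
      rw [abs_of_pos (by linarith [(hq 0).1, (hq 1).1])]; linarith [(hq 0).1, (hq 1).1]
    have hsq4 : ∀ q ∈ unitSquare, 1 / 4 ≤ |(1 : ℝ) * q 0 + 1 * q 1 - -1 / 2| := fun q hq => by
      rw [abs_of_pos (by linarith [(hq 0).1, (hq 1).1])]; linarith [(hq 0).1, (hq 1).1]
    fin_cases i <;> fin_cases j <;> first
      | exact absurd rfl hij
      | (refine key _ _ _ (by norm_num) (by norm_num) ?_ ?_ hsq1 <;> norm_num [projTips] <;> done)
      | (refine key _ _ _ (by norm_num) (by norm_num) ?_ ?_ hsq2 <;> norm_num [projTips] <;> done)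
      | (refine key _ _ _ (by norm_num) (by norm_num) ?_ ?_ hsq3 <;> norm_num [projTips] <;> done)
      | (refine key _ _ _ (by norm_num) (by norm_num) ?_ ?_ hsq4 <;> norm_num [projTips])

/-- The first three tips are the corners of a right triangle with legs `50` and `25` parallel to the
axes; a tube of radius `r` containing them bounds both coordinates of its unit direction by `r`. -/
theorem projTips_tube (q v : Plane) (r : ℝ) (hv : v ≠ 0) (h : ∀ i, projTips i ∈ tube (lineAt q v) r) :
    1 ≤ 1000 * r := by
  have h0 := abs_lt.1 (abs_det_lt_of_mem_tube hv (h 0))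
  have h1 := abs_lt.1 (abs_det_lt_of_mem_tube hv (h 1))
  have h2 := abs_lt.1 (abs_det_lt_of_mem_tube hv (h 2))
  simp [projTips] at h0 h1 h2
  have hn := norm_le_abs_add_abs v
  have hv0 := norm_pos_iff.2 hv
  have e1 : |v 0| ≤ ‖v‖ * r := by
    rw [abs_le]; constructor <;> linarith [h0.1, h0.2, h2.1, h2.2]
  have e2 : |v 1| ≤ ‖v‖ * r := by
    rw [abs_le]; constructor <;> linarith [h0.1, h0.2, h1.1, h1.2]
  have : ‖v‖ * 1 ≤ ‖v‖ * (2 * r) := by linarith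
  have := le_of_mul_le_mul_left this hv0
  linarith

end Tips

/-! ### From the four-pencil estimate to sum-product. -/

section PencilsToSumProduct

/-- The directions of the four pencils through the points `projMap x y`, `x, y ∈ S`. -/
noncomputable def projDirs (S : Finset ℝ) : Fin 4 → Finset ℝ :=
  ![(S.image Real.log - S.image Real.log).image (fun w => slopeAngle (Real.exp w)),
    S.image (fun y => slopeAngle (-y / (2 * y + 100))),
    S.image (fun x => slopeAngle (-(x + 100) / (2 * x))),
    (S + S).image (fun z => slopeAngle (-(z + 100) / (2 * z + 100)))]

/-- A projective map takes concurrent lines to concurrent lines: the slope seen from each tip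
depends on one of `y / x`, `y`, `x`, `x + y` alone. -/
theorem projMap_mem_lineAt {S : Finset ℝ} (hS : ∀ x ∈ S, x ∈ Icc (1 : ℝ) (5 / 4)) {x y : ℝ}
    (hx : x ∈ S) (hy : y ∈ S) (i : Fin 4) :
    ∃ θ ∈ projDirs S i, projMap x y ∈ lineAt (projTips i) (direction θ) := by
  have hx1 := hS x hx
  have hy1 := hS y hy
  have hs : 0 < x + 2 * y + 100 := by linarith [hx1.1, hy1.1]
  have hx0 : 0 < x := by linarith [hx1.1]
  have hy0 : 0 < y := by linarith [hy1.1]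
  fin_cases i
  · refine ⟨_, Finset.mem_image_of_mem _ (Finset.sub_mem_sub (Finset.mem_image_of_mem _ hy)
      (Finset.mem_image_of_mem _ hx)), mem_lineAt_slopeAngle ?_⟩
    rw [Real.exp_sub, Real.exp_log hy0, Real.exp_log hx0]
    simp [projMap, projTips]
    field_simp
    try ring
  · refine ⟨_, Finset.mem_image_of_mem _ hy, mem_lineAt_slopeAngle ?_⟩
    simp [projMap, projTips]
    field_simp
    ring
  · refine ⟨_, Finset.mem_image_of_mem _ hx, mem_lineAt_slopeAngle ?_⟩
    simp [projMap, projTips]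
    field_simp
    ring
  · refine ⟨_, Finset.mem_image_of_mem _ (Finset.add_mem_add hx hy), mem_lineAt_slopeAngle ?_⟩
    have : 0 < 2 * (x + y) + 100 := by linarith
    simp [projMap, projTips]
    field_simp
    ring

theorem ball_projMap_subset {S : Finset ℝ} (hS : ∀ x ∈ S, x ∈ Icc (1 : ℝ) (5 / 4)) {x y δ : ℝ}
    (hδ : δ ≤ 1 / 10) (hx : x ∈ S) (hy : y ∈ S) : Metric.ball (projMap x y) δ ⊆
      (⋂ i, pencil δ (projTips i) (projDirs S i)) ∩ unitSquare := by
  intro q hq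
  rw [Metric.mem_ball] at hq
  have hx1 := hS x hx
  have hy1 := hS y hy
  have hs : 0 < x + 2 * y + 100 := by linarith [hx1.1, hy1.1]
  constructor
  · refine mem_iInter.2 fun i => ?_
    obtain ⟨θ, hθ, hl⟩ := projMap_mem_lineAt hS hx hy i
    exact mem_iUnion₂.2 ⟨θ, hθ, Metric.mem_thickening_iff.2 ⟨_, hl, hq⟩⟩
  · have h0 := abs_le.1 ((abs_sub_apply_le_dist q (projMap x y) 0).trans hq.le)
    have h1 := abs_le.1 ((abs_sub_apply_le_dist q (projMap x y) 1).trans hq.le)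
    have hb : ∀ t ∈ Icc (1 : ℝ) (5 / 4), 2 / 5 ≤ 50 * t / (x + 2 * y + 100) ∧
        50 * t / (x + 2 * y + 100) ≤ 7 / 10 := by
      intro t ht
      rw [le_div_iff₀ hs, div_le_iff₀ hs]
      constructor <;> linarith [ht.1, ht.2, hx1.1, hx1.2, hy1.1, hy1.2]
    have hbx := hb x hx1
    have hby := hb y hy1
    simp only [projMap] at h0 h1
    simp at h0 h1
    intro i
    fin_cases i
    · constructor <;> simp <;> linarith [h0.1, h0.2]
    · constructor <;> simp <;> linarith [h1.1, h1.2]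

/-- The denominator `s = x + 2y + 100` can be recovered first, because `50 s - 5000` is `s` times a
fixed combination of the image coordinates, which is far below `50`; then `x` and `y` follow. -/
theorem abs_sub_le_of_projMap {x y x' y' ε : ℝ} (hx : x ∈ Icc (1 : ℝ) (5 / 4))
    (hy : y ∈ Icc (1 : ℝ) (5 / 4)) (hx' : x' ∈ Icc (1 : ℝ) (5 / 4)) (hy' : y' ∈ Icc (1 : ℝ) (5 / 4))
    (h0 : |projMap x y 0 - projMap x' y' 0| ≤ ε) (h1 : |projMap x y 1 - projMap x' y' 1| ≤ ε) :
    |x - x'| ≤ 3 * ε ∧ |y - y'| ≤ 3 * ε := by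
  obtain ⟨hx1, hx2⟩ := hx
  obtain ⟨hy1, hy2⟩ := hy
  obtain ⟨hx1', hx2'⟩ := hx'
  obtain ⟨hy1', hy2'⟩ := hy'
  set s := x + 2 * y + 100 with hs
  set s' := x' + 2 * y' + 100 with hs'
  have hs0 : 0 < s := by linarith
  have hs0' : 0 < s' := by linarith
  have e0 : projMap x y 0 - projMap x' y' 0 = 50 * x / s - 50 * x' / s' := by simp [projMap, s, s']
  have e1 : projMap x y 1 - projMap x' y' 1 = 50 * y / s - 50 * y' / s' := by simp [projMap, s, s']
  rw [e0] at h0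
  rw [e1] at h1
  set u := 50 * x / s with hu
  set v := 50 * y / s with hv
  set u' := 50 * x' / s' with hu'
  set v' := 50 * y' / s' with hv'
  have hxu : 50 * x = s * u := by rw [hu]; field_simp
  have hyv : 50 * y = s * v := by rw [hv]; field_simp
  have hxu' : 50 * x' = s' * u' := by rw [hu']; field_simp
  have hyv' : 50 * y' = s' * v' := by rw [hv']; field_simp
  have hu0 : 0 ≤ u' ∧ u' ≤ 7 / 10 := by
    rw [hu', le_div_iff₀ hs0', div_le_iff₀ hs0']; constructor <;> linarith
  have hv0 : 0 ≤ v' ∧ v' ≤ 7 / 10 := by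
    rw [hv', le_div_iff₀ hs0', div_le_iff₀ hs0']; constructor <;> linarith
  have hε : 0 ≤ ε := (abs_nonneg _).trans h0
  have k0 : |s * (u - u')| ≤ 104 * ε := by
    rw [abs_mul, abs_of_pos hs0]
    gcongr
    linarith
  have k1 : |s * (v - v')| ≤ 104 * ε := by
    rw [abs_mul, abs_of_pos hs0]
    gcongr
    linarith
  have hd : 50 * (s - s') = s * (u - u') + 2 * (s * (v - v')) + (u' + 2 * v') * (s - s') := by
    have : 50 * (s - s') = s * u + 2 * (s * v) - (s' * u' + 2 * (s' * v')) := by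
      rw [← hxu, ← hyv, ← hxu', ← hyv']; simp only [s, s']; ring
    rw [this]; ring
  have hds : |s - s'| ≤ 7 * ε := by
    have h3 : |(50 - (u' + 2 * v')) * (s - s')| ≤ 312 * ε := by
      rw [show (50 - (u' + 2 * v')) * (s - s') = s * (u - u') + 2 * (s * (v - v')) by
        linear_combination hd]
      rw [abs_le] at *
      constructor <;> linarith
    rw [abs_mul, abs_of_pos (by linarith)] at h3
    nlinarith [abs_nonneg (s - s')]
  have m0 : |u' * (s - s')| ≤ 7 / 10 * (7 * ε) := by
    rw [abs_mul, abs_of_nonneg hu0.1]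
    gcongr
    exact hu0.2
  have m1 : |v' * (s - s')| ≤ 7 / 10 * (7 * ε) := by
    rw [abs_mul, abs_of_nonneg hv0.1]
    gcongr
    exact hv0.2
  have f0 : 50 * (x - x') = s * (u - u') + u' * (s - s') := by linear_combination hxu - hxu'
  have f1 : 50 * (y - y') = s * (v - v') + v' * (s - s') := by linear_combination hyv - hyv'
  rw [abs_le] at k0 k1 m0 m1
  constructor <;> rw [abs_le] <;> constructor <;> linarith

/-- For fractional linear functions the difference of two values is the difference of the arguments
times `c / d` (up to sign), `d` a product of denominators. Comparability of `c` and `d` is therefore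
all that bi-Lipschitz bounds need. -/
theorem abs_le_and_abs_le_of_mul_eq {a b c d : ℝ} (hc : 0 < c) (hd0 : 0 < d) (hd : d ≤ 200 * c)
    (hc2 : c ≤ 200 * d) (h : a * d = c * b) : |a| ≤ 200 * |b| ∧ |b| ≤ 200 * |a| := by
  have h1 : |a| * d = c * |b| := by
    have := congrArg abs h
    rwa [abs_mul, abs_mul, abs_of_pos hd0, abs_of_pos hc] at this
  constructor
  · refine le_of_mul_le_mul_right ?_ hd0
    nlinarith [abs_nonneg b]
  · refine le_of_mul_le_mul_right ?_ hc
    nlinarith [abs_nonneg a]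

theorem volume_projDirs_le {σ δ κ : ℝ} {S : Finset ℝ} (hδ : 0 < δ) (hσ1 : σ ≤ 1)
    (hS : ∀ x ∈ S, x ∈ Icc (1 : ℝ) (5 / 4)) (h0 : NonConc σ δ κ S) (h1 : NonConc σ δ κ (S + S))
    (h2 : NonConc σ δ κ (S.image Real.log - S.image Real.log)) (i : Fin 4) (b r : ℝ) (hr : δ < r) :
    volume.real (directionArcs δ (projDirs S i) ∩ Metric.ball b r) ≤
      100 ^ 6 * κ * (δ * (r / δ) ^ σ) := by
  have hSS : ∀ z ∈ S + S, 2 ≤ z ∧ z ≤ 5 / 2 := by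
    intro z hz
    obtain ⟨x, hx, y, hy, rfl⟩ := Finset.mem_add.1 hz
    constructor <;> linarith [(hS x hx).1, (hS x hx).2, (hS y hy).1, (hS y hy).2]
  have hSD : ∀ w ∈ S.image Real.log - S.image Real.log, 4 / 5 ≤ Real.exp w ∧ Real.exp w ≤ 5 / 4 := by
    intro w hw
    obtain ⟨_, hx', _, hy', rfl⟩ := Finset.mem_sub.1 hw
    obtain ⟨x, hx, rfl⟩ := Finset.mem_image.1 hx'
    obtain ⟨y, hy, rfl⟩ := Finset.mem_image.1 hy'
    have hx1 := hS x hx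
    have hy1 := hS y hy
    have hx0 : 0 < x := by linarith [hx1.1]
    have hy0 : 0 < y := by linarith [hy1.1]
    rw [Real.exp_sub, Real.exp_log hx0, Real.exp_log hy0, le_div_iff₀ hy0, div_le_iff₀ hy0]
    constructor <;> linarith [hx1.1, hx1.2, hy1.1, hy1.2]
  fin_cases i
  · refine volume_directionArcs_le hδ hσ1 h2 (fun w hw => ?_) (fun z hz w hw => ?_)
      (fun z hz w hw => ?_) b r hr
    · rw [abs_of_pos (Real.exp_pos w)]; linarith [(hSD w hw).2]
    · have := abs_sub_le_mul_abs_log_sub (M := 5 / 4) (Real.exp_pos z) (Real.exp_pos w)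
        (hSD z hz).2 (hSD w hw).2
      rw [Real.log_exp, Real.log_exp] at this
      linarith [abs_nonneg (z - w)]
    · have := abs_log_sub_log_le (m := 4 / 5) (by norm_num) (hSD z hz).1 (hSD w hw).1
      rw [Real.log_exp, Real.log_exp] at this
      refine this.trans ?_
      rw [div_le_iff₀ (by norm_num)]
      linarith [abs_nonneg (Real.exp z - Real.exp w)]
  · have key : ∀ z ∈ S, ∀ w ∈ S,
        |-z / (2 * z + 100) - -w / (2 * w + 100)| ≤ 200 * |z - w| ∧
        |z - w| ≤ 200 * |-z / (2 * z + 100) - -w / (2 * w + 100)| := by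
      intro z hz w hw
      obtain ⟨hz1, hz2⟩ := hS z hz
      obtain ⟨hw1, hw2⟩ := hS w hw
      rw [abs_sub_comm (-z / (2 * z + 100))]
      have d1 : 0 < 2 * z + 100 := by linarith
      have d2 : 0 < 2 * w + 100 := by linarith
      refine abs_le_and_abs_le_of_mul_eq (c := 100) (d := (2 * z + 100) * (2 * w + 100))
        (by norm_num) (by positivity) (by nlinarith) (by nlinarith) ?_
      field_simp
      ring
    refine volume_directionArcs_le hδ hσ1 h0 (fun z hz => ?_) (fun z hz w hw => (key z hz w hw).1)
      (fun z hz w hw => (key z hz w hw).2) b r hr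
    obtain ⟨hz1, hz2⟩ := hS z hz
    rw [abs_le, le_div_iff₀ (by linarith), div_le_iff₀ (by linarith)]
    constructor <;> linarith
  · have key : ∀ z ∈ S, ∀ w ∈ S,
        |-(z + 100) / (2 * z) - -(w + 100) / (2 * w)| ≤ 200 * |z - w| ∧
        |z - w| ≤ 200 * |-(z + 100) / (2 * z) - -(w + 100) / (2 * w)| := by
      intro z hz w hw
      obtain ⟨hz1, hz2⟩ := hS z hz
      obtain ⟨hw1, hw2⟩ := hS w hw
      have d1 : 0 < z := by linarith
      have d2 : 0 < w := by linarith
      refine abs_le_and_abs_le_of_mul_eq (c := 50) (d := z * w)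
        (by norm_num) (by positivity) (by nlinarith) (by nlinarith) ?_
      field_simp
      ring
    refine volume_directionArcs_le hδ hσ1 h0 (fun z hz => ?_) (fun z hz w hw => (key z hz w hw).1)
      (fun z hz w hw => (key z hz w hw).2) b r hr
    obtain ⟨hz1, hz2⟩ := hS z hz
    rw [abs_le, le_div_iff₀ (by linarith), div_le_iff₀ (by linarith)]
    constructor <;> linarith
  · have key : ∀ z ∈ S + S, ∀ w ∈ S + S,
        |-(z + 100) / (2 * z + 100) - -(w + 100) / (2 * w + 100)| ≤ 200 * |z - w| ∧
        |z - w| ≤ 200 * |-(z + 100) / (2 * z + 100) - -(w + 100) / (2 * w + 100)| := by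
      intro z hz w hw
      obtain ⟨hz1, hz2⟩ := hSS z hz
      obtain ⟨hw1, hw2⟩ := hSS w hw
      have d1 : 0 < 2 * z + 100 := by linarith
      have d2 : 0 < 2 * w + 100 := by linarith
      refine abs_le_and_abs_le_of_mul_eq (c := 100) (d := (2 * z + 100) * (2 * w + 100))
        (by norm_num) (by positivity) (by nlinarith) (by nlinarith) ?_
      field_simp
      ring
    refine volume_directionArcs_le hδ hσ1 h1 (fun z hz => ?_) (fun z hz w hw => (key z hz w hw).1)
      (fun z hz w hw => (key z hz w hw).2) b r hr
    obtain ⟨hz1, hz2⟩ := hSS z hz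
    rw [abs_le, le_div_iff₀ (by linarith), div_le_iff₀ (by linarith)]
    constructor <;> linarith

theorem cov_sq_le_pencilVolume {δ : ℝ} {S : Finset ℝ} (hδ : 0 < δ) (hδ1 : δ ≤ 1 / 10)
    (hS : ∀ x ∈ S, x ∈ Icc (1 : ℝ) (5 / 4)) :
    δ ^ 2 * (cov δ S : ℝ) ^ 2 ≤ 144 * pencilVolume δ (projTips, fun i => (projDirs S i : Set ℝ)) := by
  set g : ℝ × ℝ → ℤ × ℤ := fun p =>
    (cell (δ / 2) (projMap p.1 p.2 0), cell (δ / 2) (projMap p.1 p.2 1)) with hg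
  have h1 : (cov δ S : ℝ) ^ 2 ≤ (2 * (3 / 2) + 3) ^ 2 * ((S ×ˢ S).image g).card := by
    have hcl : ∀ p ∈ S ×ˢ S, ∀ q ∈ S ×ˢ S, g p = g q →
        |p.1 - q.1| ≤ 3 / 2 * δ ∧ |p.2 - q.2| ≤ 3 / 2 * δ := by
      intro p hp q hq he
      obtain ⟨hp1, hp2⟩ := Finset.mem_product.1 hp
      obtain ⟨hq1, hq2⟩ := Finset.mem_product.1 hq
      have := abs_sub_le_of_projMap (hS _ hp1) (hS _ hp2) (hS _ hq1) (hS _ hq2)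
        (abs_sub_lt_of_cell_eq (half_pos hδ) (congrArg Prod.fst he)).le
        (abs_sub_lt_of_cell_eq (half_pos hδ) (congrArg Prod.snd he)).le
      constructor <;> linarith [this.1, this.2]
    have h2 := card_image_cell_prod_le (S ×ˢ S) (fun p => p.1) (fun p => p.2) g (M := 3 / 2) hδ
      (by norm_num) (fun p hp q hq he => (hcl p hp q hq he).1)
      (fun p hp q hq he => (hcl p hp q hq he).2)
    have h3 : (S ×ˢ S).image (fun p => (cell δ p.1, cell δ p.2)) =
        S.image (cell δ) ×ˢ S.image (cell δ) := by
      ext ⟨i, j⟩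
      simp only [Finset.mem_image, Finset.mem_product, Prod.mk.injEq, Prod.exists]
      constructor
      · rintro ⟨x, y, ⟨hx, hy⟩, rfl, rfl⟩
        exact ⟨⟨x, hx, rfl⟩, y, hy, rfl⟩
      · rintro ⟨⟨x, hx, rfl⟩, y, hy, rfl⟩
        exact ⟨x, y, ⟨hx, hy⟩, rfl, rfl⟩
    rw [h3, Finset.card_product] at h2
    push_cast at h2
    rw [sq]
    exact h2
  have h2 := card_mul_le_volume_real (half_pos hδ)
    (E := (⋂ i, pencil δ (projTips i) (projDirs S i)) ∩ unitSquare)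
    (measure_ne_top_of_subset inter_subset_right
      (by rw [volume_unitSquare]; exact ENNReal.one_ne_top))
    (T := (S ×ˢ S).image g) (by
      intro k hk
      obtain ⟨p, hp, rfl⟩ := Finset.mem_image.1 hk
      obtain ⟨hp1, hp2⟩ := Finset.mem_product.1 hp
      exact (planeBox_subset_ball hδ _).trans (ball_projMap_subset hS hδ1 hp1 hp2))
  unfold pencilVolume
  calc δ ^ 2 * (cov δ S : ℝ) ^ 2 ≤ δ ^ 2 * ((2 * (3 / 2) + 3) ^ 2 * ((S ×ˢ S).image g).card) := by
        gcongr
    _ = 144 * ((δ / 2) ^ 2 * ((S ×ˢ S).image g).card) := by ring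
    _ ≤ _ := by gcongr

/-- The pencils are admissible because `S`, `S + S` and `log S - log S` are not concentrated. The
intersection is large because it contains `δ`-balls about the points `projMap x y`, which occupy
about `|S| ^ 2` cells. -/
theorem gap_sumProductBad_of_gap_fourPencilBad {σ : ℝ} (hσ1 : σ < 1)
    (h : Gap (FourPencilBad σ)) : Gap (SumProductBad (fun _ => Icc 1 (5 / 4)) σ) := by
  refine Gap.transfer (c := 50) (by norm_num) ?_ h
  intro K δ hK hδ hKδ S hS
  have hK0 : 0 < K := by linarith
  have hK1 : 1 ≤ K := by linarith
  have hn := Real.rpow_pos_of_pos hδ (-σ)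
  set n := δ ^ (-σ) with hndef
  have hδ1 : δ ≤ 1 / 10 := by
    have h1 : K ^ 1 * δ ≤ 1 :=
      le_trans (mul_le_mul_of_nonneg_right (pow_le_pow_right₀ hK1 (by norm_num)) hδ.le) hKδ
    rw [pow_one] at h1
    nlinarith
  have hmem : ∀ x ∈ S, x ∈ Icc (1 : ℝ) (5 / 4) := hS.mem
  have hle : (cov δ S : ℝ) ≤ K * n := by
    have h1 := hS.nonconc 1 1 (by linarith)
    rwa [Finset.filter_true_of_mem (fun x hx => by
      have := hmem x hx
      rw [abs_of_nonneg (by linarith [this.1])]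
      linarith [this.2]), one_div, Real.inv_rpow hδ.le, ← Real.rpow_neg hδ.le] at h1
  have hlog1 : ∀ x, 1 ≤ x → ∀ y, 1 ≤ y → |Real.log x - Real.log y| ≤ 1 * |x - y| := by
    intro x hx y hy
    have := abs_log_sub_log_le one_pos hx hy
    rwa [div_one, ← one_mul |x - y|] at this
  have hlog2 : ∀ x ∈ S, ∀ y ∈ S, |x - y| ≤ 5 / 4 * |Real.log x - Real.log y| := fun x hx y hy =>
    abs_sub_le_mul_abs_log_sub (by linarith [(hmem x hx).1]) (by linarith [(hmem y hy).1])
      (hmem x hx).2 (hmem y hy).2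
  set A := S.image Real.log with hA
  have hAnc : NonConc σ δ (K ^ 2) A := by
    refine (hS.nonconc.image (f := Real.log) (B := 1) (B' := 5 / 4) hδ zero_le_one (by norm_num)
      hσ1.le (fun x hx y hy => hlog1 x (hmem x hx).1 y (hmem y hy).1) hlog2).mono hδ ?_
    calc (2 * 1 + 3) * (2 * (5 / 4)) * K = 25 / 2 * K ^ 1 := by ring
      _ ≤ K ^ 2 := numeral_mul_pow_le (m := 1) hK (by norm_num) (by norm_num)
  have hdil : ∀ T : Finset ℝ, (∀ x ∈ T, 1 ≤ x) → (cov δ (T.image Real.log) : ℝ) ≤ 5 * cov δ T := by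
    intro T hT
    refine (cov_image_le (M := 1) hδ hδ zero_le_one fun x hx y hy hxy => ?_).trans_eq (by norm_num)
    exact (hlog1 x (hT x hx) y (hT y hy)).trans (by gcongr)
  have hAadd : A + A = (S * S).image Real.log := by
    ext z
    simp only [hA, Finset.mem_add, Finset.mem_mul, Finset.mem_image]
    constructor
    · rintro ⟨_, ⟨x, hx, rfl⟩, _, ⟨y, hy, rfl⟩, rfl⟩
      exact ⟨x * y, ⟨x, hx, y, hy, rfl⟩, Real.log_mul (by linarith [(hmem x hx).1])
        (by linarith [(hmem y hy).1])⟩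
    · rintro ⟨_, ⟨x, hx, y, hy, rfl⟩, rfl⟩
      exact ⟨_, ⟨x, hx, rfl⟩, _, ⟨y, hy, rfl⟩, (Real.log_mul (by linarith [(hmem x hx).1])
        (by linarith [(hmem y hy).1])).symm⟩
  have hK2 : ∀ c : ℝ, c ≤ 100 → c * K ≤ K ^ 2 := fun c hc => by nlinarith
  have hle2 : K ≤ K ^ 2 := le_self_pow₀ hK1 (by norm_num)
  have hp1 := (NonConc.add_self_and_sub_self hδ hK hσ1.le hn hS.nonconc hS.card_ge hle hS.card_add).1
  -- Applied to `log S`, whose doubling is controlled by `S * S`; the difference set then labels the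
  -- quotients `y / x`.
  have hp2 := (NonConc.add_self_and_sub_self (K := K ^ 2) hδ (by nlinarith) hσ1.le hn hAnc (by
      have h1 := cov_le_of_image (M := 5 / 4) hδ hδ (by norm_num) (fun x hx y hy hxy =>
        (hlog2 x hx y hy).trans (by gcongr))
      calc n ≤ K * ((2 * (5 / 4) + 3) * cov δ A) := hS.card_ge.trans (by gcongr)
        _ = ((2 * (5 / 4) + 3) * K) * cov δ A := by ring
        _ ≤ K ^ 2 * cov δ A := by gcongr; exact hK2 _ (by norm_num)) (by
      calc (cov δ A : ℝ) ≤ 5 * (K * n) := (hdil S fun x hx => (hmem x hx).1).trans (by gcongr)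
        _ = (5 * K) * n := by ring
        _ ≤ K ^ 2 * n := by gcongr; exact hK2 _ (by norm_num)) (by
      rw [hAadd]
      calc _ ≤ 5 * (K * n) := (hdil (S * S) fun x hx => by
            obtain ⟨y, hy, z, hz, rfl⟩ := Finset.mem_mul.1 hx
            nlinarith [(hmem y hy).1, (hmem z hz).1]).trans (by gcongr; exact hS.card_mul)
        _ = (5 * K) * n := by ring
        _ ≤ K ^ 2 * n := by gcongr; exact hK2 _ (by norm_num))).2
  have hpw : ∀ (c : ℝ) (j k : ℕ), c ≤ 100 ^ j → j + k ≤ 50 → c * K ^ k ≤ K ^ 50 :=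
    fun c j k h1 h2 => numeral_mul_pow_le hK h1 h2
  have h1000 : 1000 ≤ K ^ 50 := by
    have := hpw 1000 2 0 (by norm_num) (by norm_num)
    linarith
  have hnn : ∀ U V : Set Plane, 0 ≤ setDist U V := fun U V => Real.iInf_nonneg fun _ => dist_nonneg
  refine ⟨(projTips, fun i => (projDirs S i : Set ℝ)), ⟨?_, ?_, ?_, ?_, ?_, ?_, ?_, ?_, ?_⟩, ?_⟩
  · intro i θ hθ
    have : ∃ m, slopeAngle m = θ := by
      fin_cases i <;> obtain ⟨z, _, hz⟩ := Finset.mem_image.1 (Finset.mem_coe.1 hθ) <;>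
        exact ⟨_, hz⟩
    obtain ⟨m, rfl⟩ := this
    exact slopeAngle_mem m
  · intro i b r hr _
    have hr0 := hδ.trans hr
    have h1 := volume_projDirs_le (κ := K ^ 40) hδ hσ1.le hmem
      (hS.nonconc.mono hδ (le_self_pow₀ hK1 (by norm_num)))
      (hp1.mono hδ (pow_le_pow_right₀ hK1 (by norm_num)))
      (hp2.mono hδ (by rw [← pow_mul])) i b r hr
    refine h1.trans ?_
    have : 0 ≤ (r / δ) ^ σ := by positivity
    gcongr
    exact hpw _ 6 _ le_rfl (by norm_num)
  · intro i j hij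
    rw [mul_one]
    exact (projTips_dist i j hij).1.trans h1000
  · intro i j hij
    exact (projTips_dist i j hij).2.trans (by gcongr)
  · intro i j hij
    rw [mul_one]
    exact (projTips_infDist i).1.trans h1000
  · intro i j hij
    exact (projTips_infDist i).2.trans (by gcongr; exact Metric.infDist_nonneg)
  · intro i j hij
    rw [mul_one]
    exact (projTips_setDist i j hij).1.trans h1000
  · intro i j hij
    exact (projTips_setDist i j hij).2.trans (by gcongr; exact hnn _ _)
  · intro q v r hv hr
    have h1 := projTips_tube q v r hv hr
    have : 0 < r := by linarith
    exact h1.trans (by gcongr)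
  · have h1 := cov_sq_le_pencilVolume hδ hδ1 hmem
    have h2 : δ ^ (2 - 2 * σ) = δ ^ 2 * n ^ 2 := by
      rw [hndef, ← Real.rpow_natCast, ← Real.rpow_natCast, ← Real.rpow_mul hδ.le,
        ← Real.rpow_add hδ]
      congr 1
      push_cast
      ring
    have hV : 0 ≤ pencilVolume δ (projTips, fun i => (projDirs S i : Set ℝ)) := measureReal_nonneg
    rw [h2]
    calc δ ^ 2 * n ^ 2 ≤ δ ^ 2 * (K * cov δ S) ^ 2 := by gcongr; exact hS.card_ge
      _ = K ^ 2 * (δ ^ 2 * (cov δ S : ℝ) ^ 2) := by ring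
      _ ≤ K ^ 2 * (144 * pencilVolume δ (projTips, fun i => (projDirs S i : Set ℝ))) := by gcongr
      _ = 144 * K ^ 2 * pencilVolume δ (projTips, fun i => (projDirs S i : Set ℝ)) := by ring
      _ ≤ _ := by gcongr; exact hpw _ 2 _ (by norm_num) (by norm_num)

end PencilsToSumProduct

/-! ### Determinants, and angles between directions. -/

section CrossProduct

/-- The determinant of two vectors of the plane. -/
def cross (v w : Plane) : ℝ := v 0 * w 1 - v 1 * w 0

/-- The scalar product of two vectors of the plane, in coordinates. -/
def scal (v w : Plane) : ℝ := v 0 * w 0 + v 1 * w 1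

theorem norm_sq_plane (v : Plane) : ‖v‖ ^ 2 = v 0 ^ 2 + v 1 ^ 2 := by
  rw [EuclideanSpace.real_norm_sq_eq, Fin.sum_univ_two]

theorem abs_cross_le (v w : Plane) : |cross v w| ≤ ‖v‖ * ‖w‖ := abs_det_le v w

theorem abs_scal_le (v w : Plane) : |scal v w| ≤ ‖v‖ * ‖w‖ := by
  refine abs_le_of_sq_le_sq ?_ (by positivity)
  rw [mul_pow, norm_sq_plane, norm_sq_plane]
  unfold scal
  nlinarith [sq_nonneg (v 0 * w 1 - v 1 * w 0)]

theorem norm_direction (θ : ℝ) : ‖direction θ‖ = 1 := by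
  have h := norm_sq_plane (direction θ)
  simp only [direction, PiLp.toLp_apply, Matrix.cons_val_zero, Matrix.cons_val_one,
    Real.cos_sq_add_sin_sq] at h
  exact (pow_eq_one_iff_of_nonneg (norm_nonneg _) two_ne_zero).1 h

theorem norm_le_scal_add_cross {d : Plane} (hd : ‖d‖ = 1) (w : Plane) :
    ‖w‖ ≤ |scal w d| + |cross d w| := by
  have h1 : ‖w‖ ^ 2 = scal w d ^ 2 + cross d w ^ 2 := by
    have h2 := norm_sq_plane d
    rw [hd] at h2
    rw [norm_sq_plane]
    unfold scal cross
    linear_combination (w 0 ^ 2 + w 1 ^ 2) * h2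
  refine le_of_sq_le_sq ?_ (by positivity)
  rw [h1, ← sq_abs (scal w d), ← sq_abs (cross d w)]
  nlinarith [abs_nonneg (scal w d), abs_nonneg (cross d w)]

/-- The determinant written in the orthonormal frame given by `d` and its rotation by a right angle.
It shows that vectors nearly parallel to `d` have small determinant. -/
theorem cross_eq_of_unit {d : Plane} (hd : ‖d‖ = 1) (v w : Plane) :
    cross v w = scal v d * cross d w - cross d v * scal w d := by
  have h2 := norm_sq_plane d
  rw [hd] at h2
  unfold scal cross
  linear_combination (v 0 * w 1 - v 1 * w 0) * h2

theorem exists_mem_lineAt_dist_mul_eq {p v q : Plane} (hv : v ≠ 0) :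
    ∃ z ∈ lineAt p v, dist z q * ‖v‖ = |cross v (q - p)| := by
  have hn := norm_sq_plane v
  have hv0 : 0 < ‖v‖ := norm_pos_iff.2 hv
  have hs : 0 < v 0 ^ 2 + v 1 ^ 2 := by rw [← hn]; positivity
  refine ⟨p + (scal v (q - p) / (v 0 ^ 2 + v 1 ^ 2)) • v, ⟨_, rfl⟩, ?_⟩
  rw [← abs_of_nonneg (show 0 ≤ dist (p + (scal v (q - p) / (v 0 ^ 2 + v 1 ^ 2)) • v) q * ‖v‖ by
    positivity), ← sq_eq_sq_iff_abs_eq_abs, mul_pow, dist_eq_norm, norm_sq_plane, hn]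
  simp only [scal, cross, PiLp.sub_apply, PiLp.add_apply, PiLp.smul_apply, smul_eq_mul]
  field_simp
  ring

theorem abs_cross_direction_sub_le (θ θ' : ℝ) (w : Plane) :
    |cross (direction θ) w - cross (direction θ') w| ≤ 14 * |θ - θ'| * ‖w‖ := by
  have h0 := abs_sub_apply_le_dist w 0 0
  have h1 := abs_sub_apply_le_dist w 0 1
  rw [dist_zero_right] at h0 h1
  simp only [PiLp.zero_apply, sub_zero] at h0 h1
  have hpi : 2 * Real.pi ≤ 7 := by linarith [Real.pi_lt_d2]
  have hang : |2 * Real.pi * θ - 2 * Real.pi * θ'| ≤ 7 * |θ - θ'| := by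
    rw [← mul_sub, abs_mul, abs_of_pos (by positivity)]
    gcongr
  have hc := (Real.abs_cos_sub_cos_le (2 * Real.pi * θ) (2 * Real.pi * θ')).trans hang
  have hs := (Real.abs_sin_sub_sin_le (2 * Real.pi * θ) (2 * Real.pi * θ')).trans hang
  have e : cross (direction θ) w - cross (direction θ') w =
      (Real.cos (2 * Real.pi * θ) - Real.cos (2 * Real.pi * θ')) * w 1 -
      (Real.sin (2 * Real.pi * θ) - Real.sin (2 * Real.pi * θ')) * w 0 := by
    simp [cross, direction]; ring
  rw [e]
  refine (abs_sub _ _).trans ?_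
  rw [abs_mul, abs_mul]
  calc _ ≤ 7 * |θ - θ'| * ‖w‖ + 7 * |θ - θ'| * ‖w‖ := by gcongr
    _ = _ := by ring

theorem cross_direction (θ θ' : ℝ) :
    cross (direction θ) (direction θ') = Real.sin (Real.pi * (2 * (θ' - θ))) := by
  rw [show Real.pi * (2 * (θ' - θ)) = 2 * Real.pi * θ' - 2 * Real.pi * θ by ring, Real.sin_sub]
  simp [cross, direction]
  ring

theorem abs_sub_round_le_abs_sin (u : ℝ) : |u - round u| ≤ |Real.sin (Real.pi * u)| := by
  have h1 := abs_sub_round u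
  have h2 : |Real.sin (Real.pi * u)| = |Real.sin (Real.pi * (u - round u))| := by
    rw [mul_sub, mul_comm Real.pi (round u : ℝ), Real.sin_sub_int_mul_pi, abs_mul]
    simp
  rw [h2]
  have h3 := Real.mul_abs_le_abs_sin (x := Real.pi * (u - round u)) (by
    rw [abs_mul, abs_of_pos Real.pi_pos]
    nlinarith [Real.pi_pos])
  rw [abs_mul, abs_of_pos Real.pi_pos] at h3
  have h4 : 2 / Real.pi * (Real.pi * |u - round u|) = 2 * |u - round u| := by
    have := Real.pi_ne_zero
    field_simp
  rw [h4] at h3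
  linarith [abs_nonneg (u - round u)]

end CrossProduct

/-! ### Quantitative position of the tips relative to the square. -/

section TipGeometry

variable {σ δ K : ℝ} {a : (Fin 4 → Plane) × (Fin 4 → Set ℝ)}

theorem FourPencilHyp.norm_bounds (h : FourPencilHyp σ δ K a) (hK : 0 < K) {i j : Fin 4} (hij : i ≠ j) :
    K⁻¹ ≤ ‖a.1 j - a.1 i‖ ∧ ‖a.1 j - a.1 i‖ ≤ K := by
  have h1 := h.dist_le i j hij
  have h2 := h.dist_ge i j hij
  rw [dist_comm, dist_eq_norm] at h1 h2
  rw [mul_one] at h1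
  exact ⟨(inv_le_iff_one_le_mul₀' hK).2 h2, h1⟩

theorem dist_le_two_of_mem_unitSquare {q z : Plane} (hq : q ∈ unitSquare) (hz : z ∈ unitSquare) :
    dist q z ≤ 2 := by
  refine (dist_le_abs_add_abs q z).trans ?_
  have h : ∀ i, |q i - z i| ≤ 1 := fun i => by
    rw [abs_le]; constructor <;> linarith [(hq i).1, (hq i).2, (hz i).1, (hz i).2]
  linarith [h 0, h 1]

theorem FourPencilHyp.norm_sub_bounds (h : FourPencilHyp σ δ K a) (hK : 100 ≤ K) (i : Fin 4) {q : Plane}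
    (hq : q ∈ unitSquare) : K⁻¹ ≤ ‖q - a.1 i‖ ∧ ‖q - a.1 i‖ ≤ 2 * K := by
  have hK0 : 0 < K := by linarith
  obtain ⟨j, hij⟩ : ∃ j : Fin 4, i ≠ j := ⟨i + 1, by fin_cases i <;> decide⟩
  have h1 := h.infDist_le i j hij
  have h2 := h.infDist_ge i j hij
  rw [← dist_eq_norm, dist_comm]
  constructor
  · refine ((inv_le_iff_one_le_mul₀' hK0).2 h2).trans (Metric.infDist_le_dist_of_mem hq)
  · obtain ⟨z, hz, hd⟩ := (Metric.infDist_lt_iff ⟨0, zero_mem_unitSquare⟩).1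
      (show Metric.infDist (a.1 i) unitSquare < K + 1 by linarith)
    linarith [dist_triangle (a.1 i) z q, dist_le_two_of_mem_unitSquare hz hq]

/-- The determinant is the distance from `q` to the line through the two tips times the distance of
the tips; both factors are at least `K⁻¹`. -/
theorem FourPencilHyp.cross_bounds (h : FourPencilHyp σ δ K a) (hK : 100 ≤ K) {i j : Fin 4}
    (hij : i ≠ j) {q : Plane} (hq : q ∈ unitSquare) :
    K⁻¹ ^ 2 ≤ |cross (a.1 j - a.1 i) (q - a.1 i)| ∧
      |cross (a.1 j - a.1 i) (q - a.1 i)| ≤ 2 * K ^ 2 := by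
  have hK0 : 0 < K := by linarith
  have h1 := h.norm_bounds hK0 hij
  have h2 := h.norm_sub_bounds hK i hq
  constructor
  · have hv : a.1 j - a.1 i ≠ 0 := norm_pos_iff.1 ((inv_pos.2 hK0).trans_le h1.1)
    obtain ⟨z, hz, hzd⟩ := exists_mem_lineAt_dist_mul_eq (p := a.1 i) (q := q) hv
    have h3 := (inv_le_iff_one_le_mul₀' hK0).2 (h.setDist_ge i j hij)
    rw [← hzd, sq]
    gcongr
    · exact h3.trans (setDist_le_dist hz hq)
    · exact h1.1
  · calc _ ≤ _ := abs_cross_le _ _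
      _ ≤ K * (2 * K) := by gcongr; exacts [h1.2, h2.2]
      _ = _ := by ring

/-- The determinant is an affine function without zeros on the square, which is convex; hence it has
constant sign there. -/
theorem FourPencilHyp.cross_mul_cross_pos (h : FourPencilHyp σ δ K a) (hK : 100 ≤ K) {i j : Fin 4}
    (hij : i ≠ j) {q q' : Plane} (hq : q ∈ unitSquare) (hq' : q' ∈ unitSquare) :
    0 < cross (a.1 j - a.1 i) (q - a.1 i) * cross (a.1 j - a.1 i) (q' - a.1 i) := by
  have hK0 : 0 < K := by linarith
  set f : Plane → ℝ := fun q => cross (a.1 j - a.1 i) (q - a.1 i) with hf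
  change 0 < f q * f q'
  by_contra hcon
  rw [not_lt] at hcon
  have hne : ∀ z ∈ unitSquare, f z ≠ 0 := by
    intro z hz h0
    have := (h.cross_bounds hK hij hz).1
    rw [show cross (a.1 j - a.1 i) (z - a.1 i) = f z from rfl, h0, abs_zero] at this
    have : 0 < K⁻¹ ^ 2 := by positivity
    linarith
  have hlt : f q * f q' < 0 := lt_of_le_of_ne hcon (mul_ne_zero (hne q hq) (hne q' hq'))
  have hd : f q - f q' ≠ 0 := by
    intro h0
    rw [sub_eq_zero] at h0
    rw [← h0] at hlt
    nlinarith [sq_nonneg (f q)]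
  set t := f q / (f q - f q') with ht
  have ht01 : 0 ≤ t ∧ t ≤ 1 := by
    rcases lt_or_gt_of_ne (hne q hq) with h1 | h1
    · have h2 : 0 < f q' := by nlinarith
      rw [ht, div_nonneg_iff, div_le_one_of_neg (by linarith)]
      exact ⟨Or.inr ⟨h1.le, by linarith⟩, by linarith⟩
    · have h2 : f q' < 0 := by nlinarith
      rw [ht, div_nonneg_iff, div_le_one (by linarith)]
      exact ⟨Or.inl ⟨h1.le, by linarith⟩, by linarith⟩
  set z : Plane := q + t • (q' - q) with hz
  have hzs : z ∈ unitSquare := by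
    intro k
    have e : z k = (1 - t) * q k + t * q' k := by
      simp [hz]; ring
    rw [e]
    have h1 := hq k
    have h2 := hq' k
    constructor <;> nlinarith [h1.1, h1.2, h2.1, h2.2, ht01.1, ht01.2]
  refine hne z hzs ?_
  have e : f z = f q - t * (f q - f q') := by
    simp [hf, hz, cross]; ring
  rw [e, ht, div_mul_cancel₀ _ hd, sub_self]

/-- The central lines of a pencil that meet the square stay away from the other tips. -/
theorem FourPencilHyp.cross_direction_bounds (h : FourPencilHyp σ δ K a) (hK : 100 ≤ K) {i j : Fin 4}
    (hij : i ≠ j) {q d : Plane} {e : ℝ} (hq : q ∈ unitSquare) (hd : ‖d‖ = 1)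
    (hqd : |cross d (q - a.1 i)| ≤ e) (he : 2 * K ^ 3 * e ≤ 1) :
    K⁻¹ ^ 4 ≤ |cross d (a.1 j - a.1 i)| ∧ |cross d (a.1 j - a.1 i)| ≤ K := by
  have hK0 : 0 < K := by linarith
  have h1 := h.norm_bounds hK0 hij
  have h2 := h.norm_sub_bounds hK i hq
  constructor
  · have h3 := (h.cross_bounds hK hij hq).1
    rw [cross_eq_of_unit hd] at h3
    have h4 := abs_scal_le (a.1 j - a.1 i) d
    have h5 := abs_scal_le (q - a.1 i) d
    rw [hd, mul_one] at h4 h5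
    set m := |cross d (a.1 j - a.1 i)| with hm
    -- In the frame of `d`, the determinant of `p j - p i` and `q - p i` has one term that is tiny
    -- because `q` lies nearly on the line, so the other one carries the lower bound.
    have h6 : K⁻¹ ^ 2 ≤ K * e + m * (2 * K) := by
      refine h3.trans ((abs_sub _ _).trans ?_)
      rw [abs_mul, abs_mul]
      gcongr
      · exact h4.trans h1.2
      · exact h5.trans h2.2
    have h7 : K * e ≤ K⁻¹ ^ 2 / 2 := by
      rw [inv_pow, le_div_iff₀ two_pos, ← one_div, le_div_iff₀ (by positivity)]
      linarith
    have h8 : K⁻¹ ^ 4 * (4 * K) ≤ K⁻¹ ^ 2 := by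
      rw [inv_pow, inv_pow, inv_mul_le_iff₀ (by positivity), show K ^ 4 * (K ^ 2)⁻¹ = K ^ 2 by
        field_simp]
      nlinarith
    refine le_of_mul_le_mul_right ?_ (show 0 < 4 * K by positivity)
    linarith
  · calc _ ≤ _ := abs_cross_le _ _
      _ ≤ 1 * K := by rw [hd]; gcongr; exact h1.2
      _ = K := one_mul K

end TipGeometry

/-! ### Finite sets of directions of a pencil. -/

section Directions

theorem exists_finset_cell_eq {δ : ℝ} (hδ : 0 < δ) {Θ : Set ℝ} (hΘ : Θ ⊆ Ico 0 1) :
    ∃ T : Finset ℝ, (T : Set ℝ) ⊆ Θ ∧ Set.InjOn (cell δ) T ∧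
      ∀ θ ∈ Θ, ∃ t ∈ T, cell δ t = cell δ θ := by
  have hfin : (cell δ '' Θ).Finite := by
    refine (Set.finite_Icc (0 : ℤ) ⌊1 / δ⌋).subset ?_
    rintro _ ⟨x, hx, rfl⟩
    have := hΘ hx
    refine ⟨Int.floor_nonneg.2 (div_nonneg this.1 hδ.le), Int.floor_le_floor ?_⟩
    gcongr
    exact this.2.le
  obtain ⟨T₀, hT1, hT2⟩ := Finset.subset_set_image_iff.1 (hfin.coe_toFinset.subset)
  obtain ⟨T, hT, hTi, hTe⟩ := exists_injOn_image_eq T₀ (cell δ)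
  refine ⟨T, Subset.trans (by exact_mod_cast hT) hT1, hTi, fun θ hθ => ?_⟩
  have : cell δ θ ∈ T.image (cell δ) := by
    rw [hTe, hT2, hfin.mem_toFinset]
    exact mem_image_of_mem _ hθ
  exact Finset.mem_image.1 this

variable {σ δ K : ℝ} {a : (Fin 4 → Plane) × (Fin 4 → Set ℝ)}

theorem FourPencilHyp.exists_directions (h : FourPencilHyp σ δ K a) (hK : 100 ≤ K) (hδ : 0 < δ)
    (hδ4 : 4 * δ < 1) (hσ : 0 ≤ σ) (hσ1 : σ ≤ 1) (i : Fin 4) :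
    ∃ T : Finset ℝ, (T : Set ℝ) ⊆ Ico 0 1 ∧ Set.InjOn (cell δ) T ∧ NonConc σ δ (4 * K) T ∧
      (T.card : ℝ) ≤ 2 * K * δ ^ (-σ) ∧ ∀ q ∈ pencil δ (a.1 i) (a.2 i), q ∈ unitSquare →
        ∃ θ ∈ T, |cross (direction θ) (q - a.1 i)| ≤ K ^ 2 * δ := by
  have hK0 : 0 < K := by linarith
  obtain ⟨T, hTΘ, hTi, hT⟩ := exists_finset_cell_eq hδ (h.dir_subset i)
  have hball : ∀ b r, δ ≤ r → 2 * r < 1 →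
      (cov δ (T.filter (fun x => |x - b| ≤ r)) : ℝ) ≤ K * (2 * r / δ) ^ σ := by
    intro b r hr hr1
    refine le_of_mul_le_mul_left ?_ hδ
    have h1 := cov_le_volume_real (A := directionArcs δ (a.2 i) ∩ Metric.ball b (2 * r)) hδ
      (measure_ne_top_of_subset inter_subset_right (measure_ball_lt_top).ne)
      (T := T.filter (fun x => |x - b| ≤ r)) (fun t ht => by
        rw [Finset.mem_filter] at ht
        refine subset_inter (subset_biUnion_of_mem (u := fun t => Metric.ball t δ)
          (hTΘ (Finset.mem_coe.2 ht.1))) (Metric.ball_subset_ball' ?_)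
        rw [Real.dist_eq]
        linarith [ht.2])
    have h2 := h.nonconc i b (2 * r) (by linarith) hr1
    calc _ ≤ _ := h1.trans h2
      _ = _ := by ring
  -- Non-concentration says nothing about radius `1`, so the circle `[0, 1)` is covered by two
  -- intervals of radius `1 / 4`.
  have hall : (cov δ T : ℝ) ≤ 2 * K * (1 / δ) ^ σ := by
    have h1 := cov_filter_add_le δ T (fun x => |x - 1 / 4| ≤ 1 / 4)
    have h2 : cov δ (T.filter (fun x => ¬ |x - 1 / 4| ≤ 1 / 4)) ≤
        cov δ (T.filter (fun x => |x - 3 / 4| ≤ 1 / 4)) := by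
      refine cov_mono fun x hx => ?_
      rw [Finset.mem_filter] at hx ⊢
      refine ⟨hx.1, ?_⟩
      have h3 := h.dir_subset i (hTΘ (Finset.mem_coe.2 hx.1))
      by_contra hcon
      refine hx.2 ?_
      rw [abs_le] at *
      constructor
      · linarith [h3.1]
      · by_contra h4
        exact hcon ⟨by linarith, by linarith [h3.2]⟩
    have h3 := hball (1 / 4) (1 / 4) (by linarith) (by norm_num)
    have h4 := hball (3 / 4) (1 / 4) (by linarith) (by norm_num)
    have h5 : (2 * (1 / 4) / δ) ^ σ ≤ (1 / δ) ^ σ := by gcongr; norm_num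
    have h6 : (cov δ (T.filter (fun x => ¬ |x - 1 / 4| ≤ 1 / 4)) : ℝ) ≤
        cov δ (T.filter (fun x => |x - 3 / 4| ≤ 1 / 4)) := by exact_mod_cast h2
    have h7 : K * (2 * (1 / 4) / δ) ^ σ ≤ K * (1 / δ) ^ σ := by gcongr
    linarith
  refine ⟨T, hTΘ.trans (h.dir_subset i), hTi, ?_, ?_, ?_⟩
  · intro b r hr
    have hr0 := hδ.trans_le hr
    have h5 : (2 * r / δ) ^ σ ≤ 2 * (r / δ) ^ σ := by
      rw [mul_div_assoc]
      exact mul_rpow_le one_le_two (by positivity) hσ1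
    have hp : 0 ≤ (r / δ) ^ σ := by positivity
    rcases lt_or_ge (2 * r) 1 with h1 | h1
    · calc _ ≤ K * (2 * (r / δ) ^ σ) := (hball b r hr h1).trans (by gcongr)
        _ ≤ _ := by nlinarith
    · have h2 : (cov δ (T.filter (fun x => |x - b| ≤ r)) : ℝ) ≤ cov δ T := by
        exact_mod_cast cov_mono (Finset.filter_subset _ _)
      calc _ ≤ 2 * K * (1 / δ) ^ σ := h2.trans hall
        _ ≤ 2 * K * (2 * r / δ) ^ σ := by gcongr
        _ ≤ 2 * K * (2 * (r / δ) ^ σ) := by gcongr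
        _ = _ := by ring
  · rw [← cov_eq_card hTi, Real.rpow_neg hδ.le, ← Real.inv_rpow hδ.le, ← one_div]
    exact hall
  · intro q hq hqs
    obtain ⟨θ, hθ, hqθ⟩ := mem_iUnion₂.1 hq
    obtain ⟨t, ht, hc⟩ := hT θ hθ
    refine ⟨t, ht, ?_⟩
    have h1 := (abs_sub_lt_of_cell_eq hδ hc).le
    have hd : direction θ ≠ 0 := norm_pos_iff.1 (by rw [norm_direction]; norm_num)
    have h2 : |cross (direction θ) (q - a.1 i)| < 1 * δ := by
      rw [← norm_direction θ]
      exact abs_det_lt_of_mem_tube hd hqθ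
    have h3 := abs_cross_direction_sub_le t θ (q - a.1 i)
    have h4 := (h.norm_sub_bounds hK i hqs).2
    have h5 : 14 * |t - θ| * ‖q - a.1 i‖ ≤ 14 * δ * (2 * K) := by gcongr
    have h6 : |cross (direction t) (q - a.1 i)| ≤ |cross (direction θ) (q - a.1 i)| +
        |cross (direction t) (q - a.1 i) - cross (direction θ) (q - a.1 i)| := by
      have := abs_add_le (cross (direction θ) (q - a.1 i))
        (cross (direction t) (q - a.1 i) - cross (direction θ) (q - a.1 i))
      rwa [add_sub_cancel] at this
    have h7 : δ + 28 * (K * δ) ≤ K ^ 2 * δ := by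
      have : 0 ≤ δ * (K - 100) := by nlinarith
      nlinarith
    linarith

/-- The determinant of two directions is `sin (2π (θ - θ₀))`, small only when `θ - θ₀` is near a
multiple of `1 / 2`. For parameters in `[0, 1)` the multiples `k / 2` with `|k| ≤ 2` suffice. -/
theorem card_filter_cross_direction_le {κ θ₀ s : ℝ} {T : Finset ℝ} (hδ : 0 < δ) (hs : δ ≤ s)
    (hT01 : (T : Set ℝ) ⊆ Ico 0 1) (hTi : Set.InjOn (cell δ) T) (hT : NonConc σ δ κ T)
    (hθ₀ : θ₀ ∈ Ico (0 : ℝ) 1) :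
    ((T.filter (fun θ => |cross (direction θ₀) (direction θ)| ≤ s)).card : ℝ) ≤
      5 * (κ * (s / δ) ^ σ) := by
  classical
  have hs0 := hδ.trans_le hs
  have hsub : T.filter (fun θ => |cross (direction θ₀) (direction θ)| ≤ s) ⊆
      (Finset.Icc (-2 : ℤ) 2).biUnion (fun k => T.filter (fun θ => |θ - (θ₀ + k / 2)| ≤ s)) := by
    intro θ hθ
    obtain ⟨hθT, hθs⟩ := Finset.mem_filter.1 hθ
    have h1 := hT01 (Finset.mem_coe.2 hθT)
    rw [cross_direction] at hθs
    have h2 := (abs_sub_round_le_abs_sin (2 * (θ - θ₀))).trans hθs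
    have h3 := abs_le.1 (abs_sub_round (2 * (θ - θ₀)))
    set k := round (2 * (θ - θ₀)) with hk
    have h4 : -2 ≤ k ∧ k ≤ 2 := by
      have e1 : (-3 : ℝ) < k := by linarith [h1.1, h1.2, hθ₀.1, hθ₀.2]
      have e2 : (k : ℝ) < 3 := by linarith [h1.1, h1.2, hθ₀.1, hθ₀.2]
      have e1' : (-3 : ℤ) < k := by exact_mod_cast e1
      have e2' : k < 3 := by exact_mod_cast e2
      omega
    refine Finset.mem_biUnion.2 ⟨k, Finset.mem_Icc.2 h4, Finset.mem_filter.2 ⟨hθT, ?_⟩⟩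
    rw [abs_le] at h2 ⊢
    constructor <;> linarith
  calc _ ≤ (((Finset.Icc (-2 : ℤ) 2).biUnion
        (fun k => T.filter (fun θ => |θ - (θ₀ + k / 2)| ≤ s))).card : ℝ) := by
        exact_mod_cast Finset.card_le_card hsub
    _ ≤ ∑ k ∈ Finset.Icc (-2 : ℤ) 2, ((T.filter (fun θ => |θ - (θ₀ + k / 2)| ≤ s)).card : ℝ) := by
        exact_mod_cast Finset.card_biUnion_le
    _ ≤ ∑ k ∈ Finset.Icc (-2 : ℤ) 2, (κ * (s / δ) ^ σ) := by
        refine Finset.sum_le_sum fun k _ => ?_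
        rw [← cov_eq_card (hTi.mono (by exact_mod_cast Finset.filter_subset _ _))]
        exact hT _ s hs
    _ = _ := by
        rw [Finset.sum_const, nsmul_eq_mul, show (Finset.Icc (-2 : ℤ) 2).card = 5 from rfl]
        norm_num

end Directions

/-! ### Projective coordinates attached to three tips. -/

section Sides

variable {σ δ K : ℝ} {a : (Fin 4 → Plane) × (Fin 4 → Set ℝ)}

/-- The signed distance, up to normalization, from the line through two of the tips. -/
def side (p : Fin 4 → Plane) (i j : Fin 4) (q : Plane) : ℝ := cross (p j - p i) (q - p i)

theorem side_comm (p : Fin 4 → Plane) (i j : Fin 4) (q : Plane) : side p i j q = -side p j i q := by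
  simp only [side, cross, PiLp.sub_apply]
  ring

theorem side_mul_sub (p : Fin 4 → Plane) (i j k : Fin 4) (q q' : Plane) :
    side p i k q * side p i j q' - side p i k q' * side p i j q =
      cross (p k - p i) (p j - p i) * cross (q - p i) (q' - p i) := by
  simp only [side, cross, PiLp.sub_apply]
  ring

theorem side_eq_det (p : Fin 4 → Plane) (i j k : Fin 4) (q : Plane) :
    side p j k q - side p i k q + side p i j q = cross (p j - p i) (p k - p i) := by
  simp only [side, cross, PiLp.sub_apply]
  ring

/-- The affine form `cross d (q - z)` expanded in barycentric coordinates of `q` with respect to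
three tips. Dividing by one side makes a line through the fourth tip into a linear equation between
two projective coordinates. -/
theorem side_barycentric (p : Fin 4 → Plane) (i j k : Fin 4) (d z q : Plane) :
    cross (p j - p i) (p k - p i) * cross d (q - z) =
      side p j k q * cross d (p i - z) - side p i k q * cross d (p j - z) +
        side p i j q * cross d (p k - z) := by
  simp only [side, cross, PiLp.sub_apply]
  ring

theorem side_sub_side (p : Fin 4 → Plane) (i j k : Fin 4) (q q' : Plane) (l : Fin 2) :
    cross (p j - p i) (p k - p i) * (q l - q' l) =
      (side p i j q - side p i j q') * (p k - p i) l -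
        (side p i k q - side p i k q') * (p j - p i) l := by
  simp only [side, cross, PiLp.sub_apply]
  fin_cases l <;> simp only [Fin.zero_eta, Fin.mk_one] <;> ring

/-- The projective coordinate with respect to the pencil of lines through the tip `p i`. -/
noncomputable def sideRatio (p : Fin 4 → Plane) (i j k : Fin 4) (q : Plane) : ℝ :=
  |side p i k q / side p i j q|

theorem abs_abs_sub_abs_of_mul_pos {x y : ℝ} (h : 0 < x * y) : |(|x| - |y|)| = |x - y| := by
  rcases pos_and_pos_or_neg_and_neg_of_mul_pos h with ⟨h1, h2⟩ | ⟨h1, h2⟩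
  · rw [abs_of_pos h1, abs_of_pos h2]
  · rw [abs_of_neg h1, abs_of_neg h2, ← abs_neg]
    congr 1
    ring

theorem FourPencilHyp.abs_side_pos (h : FourPencilHyp σ δ K a) (hK : 100 ≤ K) {i j : Fin 4}
    (hij : i ≠ j) {q : Plane} (hq : q ∈ unitSquare) : 0 < |side a.1 i j q| := by
  refine lt_of_lt_of_le ?_ (h.cross_bounds hK hij hq).1
  have : 0 < K := by linarith
  positivity

theorem FourPencilHyp.sideRatio_bounds (h : FourPencilHyp σ δ K a) (hK : 100 ≤ K) {i j k : Fin 4}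
    (hij : i ≠ j) (hik : i ≠ k) {q : Plane} (hq : q ∈ unitSquare) :
    K⁻¹ ^ 5 ≤ sideRatio a.1 i j k q ∧ sideRatio a.1 i j k q ≤ K ^ 5 := by
  have hK0 : 0 < K := by linarith
  have h1 := h.cross_bounds hK hij hq
  have h2 := h.cross_bounds hK hik hq
  have h3 := h.abs_side_pos hK hij hq
  unfold sideRatio
  rw [abs_div, le_div_iff₀ h3, div_le_iff₀ h3]
  have hk3 : 2 * K ^ 2 ≤ K ^ 3 := by nlinarith [sq_nonneg K]
  constructor
  · calc K⁻¹ ^ 5 * |side a.1 i j q| ≤ K⁻¹ ^ 5 * (2 * K ^ 2) := by gcongr; exact h1.2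
      _ ≤ K⁻¹ ^ 5 * K ^ 3 := by gcongr
      _ = K⁻¹ ^ 2 := by field_simp
      _ ≤ _ := h2.1
  · calc _ ≤ 2 * K ^ 2 := h2.2
      _ ≤ K ^ 3 := hk3
      _ = K ^ 5 * K⁻¹ ^ 2 := by field_simp
      _ ≤ _ := by gcongr; exact h1.1

theorem FourPencilHyp.ratio_mul_ratio_pos (h : FourPencilHyp σ δ K a) (hK : 100 ≤ K) {i j k l : Fin 4}
    (hij : i ≠ j) (hkl : k ≠ l) {q q' : Plane} (hq : q ∈ unitSquare) (hq' : q' ∈ unitSquare) :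
    0 < (side a.1 k l q / side a.1 i j q) * (side a.1 k l q' / side a.1 i j q') := by
  rw [div_mul_div_comm]
  exact div_pos (h.cross_mul_cross_pos hK hkl hq hq') (h.cross_mul_cross_pos hK hij hq hq')

theorem abs_cross_le_of_unit {d u v : Plane} {e M : ℝ} (hd : ‖d‖ = 1) (hu : |cross d u| ≤ e)
    (hv : |cross d v| ≤ e) (hu' : ‖u‖ ≤ M) (hv' : ‖v‖ ≤ M) : |cross u v| ≤ 2 * M * e := by
  rw [cross_eq_of_unit hd]
  have h1 := abs_scal_le u d
  have h2 := abs_scal_le v d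
  rw [hd, mul_one] at h1 h2
  have hM : 0 ≤ M := (norm_nonneg _).trans hu'
  have he : 0 ≤ e := (abs_nonneg _).trans hu
  refine (abs_sub _ _).trans ?_
  rw [abs_mul, abs_mul]
  calc _ ≤ M * e + e * M := by
        gcongr
        · exact h1.trans hu'
        · exact h2.trans hv'
    _ = _ := by ring

/-- By `side_mul_sub` the difference is a multiple of the determinant of `q - p i` and `q' - p i`.
This vanishes when the two points lie on one line through `p i`, so the ratio is nearly constant
along a tube of the pencil. -/
theorem FourPencilHyp.abs_sideRatio_sub_le (h : FourPencilHyp σ δ K a) (hK : 100 ≤ K) {i j k : Fin 4}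
    (hij : i ≠ j) (hik : i ≠ k) {q q' d : Plane} {e : ℝ} (hq : q ∈ unitSquare)
    (hq' : q' ∈ unitSquare) (hd : ‖d‖ = 1) (hqd : |cross d (q - a.1 i)| ≤ e)
    (hqd' : |cross d (q' - a.1 i)| ≤ e) :
    |sideRatio a.1 i j k q - sideRatio a.1 i j k q'| ≤ 4 * K ^ 7 * e := by
  have hK0 : 0 < K := by linarith
  have he : 0 ≤ e := (abs_nonneg _).trans hqd
  have hW := h.abs_side_pos hK hij hq
  have hW' := h.abs_side_pos hK hij hq'
  have hW0 := abs_pos.1 hW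
  have hW0' := abs_pos.1 hW'
  unfold sideRatio
  rw [abs_abs_sub_abs_of_mul_pos (h.ratio_mul_ratio_pos hK hij hik hq hq'),
    div_sub_div _ _ hW0 hW0', mul_comm (side a.1 i j q), side_mul_sub, abs_div, abs_mul, abs_mul,
    div_le_iff₀ (by positivity)]
  have h1 := abs_cross_le_of_unit hd hqd hqd' (h.norm_sub_bounds hK i hq).2
    (h.norm_sub_bounds hK i hq').2
  have h2 : |cross (a.1 k - a.1 i) (a.1 j - a.1 i)| ≤ K * K := by
    refine (abs_cross_le _ _).trans ?_
    gcongr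
    exacts [(h.norm_bounds hK0 hik).2, (h.norm_bounds hK0 hij).2]
  calc _ ≤ K * K * (2 * (2 * K) * e) := by gcongr
    _ = 4 * K ^ 7 * e * (K⁻¹ ^ 2 * K⁻¹ ^ 2) := by field_simp; ring
    _ ≤ _ := by
        gcongr
        exacts [(h.cross_bounds hK hij hq).1, (h.cross_bounds hK hij hq').1]

/-- The converse: close ratios force the two vectors from the tip to be nearly parallel, provided
that the three tips are not nearly collinear. -/
theorem FourPencilHyp.abs_cross_direction_le (h : FourPencilHyp σ δ K a) (hK : 100 ≤ K)
    {i j k : Fin 4} (hij : i ≠ j) (hik : i ≠ k) {q q' d d' : Plane} {e r : ℝ} (hq : q ∈ unitSquare)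
    (hq' : q' ∈ unitSquare) (hd : ‖d‖ = 1) (hd' : ‖d'‖ = 1) (hqd : |cross d (q - a.1 i)| ≤ e)
    (hqd' : |cross d' (q' - a.1 i)| ≤ e) (he : 2 * K * e ≤ 1)
    (hdet : K⁻¹ ^ 3 ≤ |cross (a.1 k - a.1 i) (a.1 j - a.1 i)|)
    (hr : |sideRatio a.1 i j k q - sideRatio a.1 i j k q'| ≤ r) :
    |cross d d'| ≤ 4 * K ^ 2 * (4 * K ^ 7 * r + 4 * K * e) := by
  have hK0 : 0 < K := by linarith
  have he0 : 0 ≤ e := (abs_nonneg _).trans hqd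
  have hr0 : 0 ≤ r := (abs_nonneg _).trans hr
  have hW := h.abs_side_pos hK hij hq
  have hW' := h.abs_side_pos hK hij hq'
  have hW0 := abs_pos.1 hW
  have hW0' := abs_pos.1 hW'
  set u := q - a.1 i with hu
  set v := q' - a.1 i with hv
  have hub := h.norm_sub_bounds hK i hq
  have hvb := h.norm_sub_bounds hK i hq'
  have huv : |cross u v| ≤ 4 * K ^ 7 * r := by
    unfold sideRatio at hr
    rw [abs_abs_sub_abs_of_mul_pos (h.ratio_mul_ratio_pos hK hij hik hq hq'),
      div_sub_div _ _ hW0 hW0', mul_comm (side a.1 i j q), side_mul_sub, abs_div, abs_mul, abs_mul,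
      div_le_iff₀ (by positivity)] at hr
    refine le_of_mul_le_mul_left ?_ (show 0 < K⁻¹ ^ 3 by positivity)
    calc K⁻¹ ^ 3 * |cross u v| ≤ |cross (a.1 k - a.1 i) (a.1 j - a.1 i)| * |cross u v| := by gcongr
      _ ≤ _ := hr
      _ ≤ r * (2 * K ^ 2 * (2 * K ^ 2)) := by
          gcongr
          exacts [(h.cross_bounds hK hij hq).2, (h.cross_bounds hK hij hq').2]
      _ = _ := by field_simp; ring
  have hs : ∀ w f : Plane, ‖f‖ = 1 → |cross f w| ≤ e → K⁻¹ ≤ ‖w‖ → (2 * K)⁻¹ ≤ |scal w f| := by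
    intro w f hf hw hwn
    have h1 := norm_le_scal_add_cross hf w
    have h2 : e ≤ (2 * K)⁻¹ := by
      rw [← one_div, le_div_iff₀ (by positivity)]; linarith
    have h3 : K⁻¹ = (2 * K)⁻¹ + (2 * K)⁻¹ := by field_simp; norm_num
    linarith
  have hs1 := hs u d hd hqd hub.1
  have hs2 := hs v d' hd' hqd' hvb.1
  -- Up to terms with `cross d u` or `cross d' v`, which are at most `e`, the determinant of `u` and
  -- `v` is that of `d` and `d'` times their lengths along these directions.
  have hkey : scal u d * scal v d' * cross d d' =
      cross u v + cross d u * scal v d - scal u d * (scal d d' * cross d' v) := by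
    have e1 := cross_eq_of_unit hd u v
    have e2 := cross_eq_of_unit hd' d v
    have e3 : cross d' d = -cross d d' := by unfold cross; ring
    rw [e3] at e2
    rw [e1, e2]
    ring
  have b1 := abs_scal_le u d
  have b2 := abs_scal_le v d
  have b3 := abs_scal_le d d'
  rw [hd, mul_one] at b1 b2
  rw [hd, hd', mul_one] at b3
  have hbound : |scal u d| * |scal v d'| * |cross d d'| ≤ 4 * K ^ 7 * r + 4 * K * e := by
    rw [← abs_mul, ← abs_mul, hkey]
    calc _ ≤ |cross u v| + |cross d u * scal v d| + |scal u d * (scal d d' * cross d' v)| := by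
          refine (abs_sub _ _).trans ?_
          gcongr
          exact abs_add_le _ _
      _ = |cross u v| + |cross d u| * |scal v d| + |scal u d| * (|scal d d'| * |cross d' v|) := by
          rw [abs_mul, abs_mul, abs_mul]
      _ ≤ 4 * K ^ 7 * r + e * (2 * K) + 2 * K * (1 * e) := by
          gcongr
          · exact b2.trans hvb.2
          · exact b1.trans hub.2
      _ = _ := by ring
  have hfin : (2 * K)⁻¹ * (2 * K)⁻¹ * |cross d d'| ≤ 4 * K ^ 7 * r + 4 * K * e :=
    le_trans (by gcongr) hbound
  rw [← mul_inv, inv_mul_le_iff₀ (by positivity)] at hfin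
  calc _ ≤ _ := hfin
    _ = _ := by ring

end Sides

/-! ### The four pencils in projective coordinates. -/

section SumProductToPencils

variable {σ δ K : ℝ} {a : (Fin 4 → Plane) × (Fin 4 → Set ℝ)}

theorem sideRatio_swap (p : Fin 4 → Plane) (i j k : Fin 4) (q : Plane) :
    sideRatio p j i k q = |side p j k q / side p i j q| := by
  rw [sideRatio, side_comm p j i, div_neg, abs_neg]

/-- Two of the projective coordinates determine the point. -/
theorem FourPencilHyp.abs_sub_apply_le (h : FourPencilHyp σ δ K a) (hK : 100 ≤ K) {i j k : Fin 4}
    (hij : i ≠ j) (hik : i ≠ k) (hjk : j ≠ k) {q q' : Plane} {e : ℝ} (hq : q ∈ unitSquare)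
    (hq' : q' ∈ unitSquare) (hdet : K⁻¹ ^ 3 ≤ |cross (a.1 j - a.1 i) (a.1 k - a.1 i)|)
    (hx : |sideRatio a.1 i j k q - sideRatio a.1 i j k q'| ≤ e)
    (hy : |sideRatio a.1 j i k q - sideRatio a.1 j i k q'| ≤ e) (l : Fin 2) :
    |q l - q' l| ≤ K ^ 18 * e := by
  have hK0 : 0 < K := by linarith
  have he : 0 ≤ e := (abs_nonneg _).trans hx
  have hW0 := abs_pos.1 (h.abs_side_pos hK hij hq)
  have hW0' := abs_pos.1 (h.abs_side_pos hK hij hq')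
  have hxb := (h.sideRatio_bounds hK hij hik hq).2
  rw [sideRatio_swap, sideRatio_swap,
    abs_abs_sub_abs_of_mul_pos (h.ratio_mul_ratio_pos hK hij hjk hq hq')] at hy
  unfold sideRatio at hx hxb
  rw [abs_abs_sub_abs_of_mul_pos (h.ratio_mul_ratio_pos hK hij hik hq hq')] at hx
  have hW := (h.cross_bounds hK hij hq).2
  have hW' := (h.cross_bounds hK hij hq').2
  change |side a.1 i j q| ≤ _ at hW
  change |side a.1 i j q'| ≤ _ at hW'
  have e1 := side_eq_det a.1 i j k q
  have e2 := side_eq_det a.1 i j k q'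
  have e3 := side_sub_side a.1 i j k q q' l
  set W := side a.1 i j q
  set W' := side a.1 i j q'
  set X := side a.1 i k q
  set X' := side a.1 i k q'
  set Y := side a.1 j k q
  set Y' := side a.1 j k q'
  set D := cross (a.1 j - a.1 i) (a.1 k - a.1 i)
  -- By `side_eq_det`, `D = Y - X + W`, so the ratios `X / W` and `Y / W` determine `W`, then `X`,
  -- and finally the point.
  have h1 : D * (W - W') = W * W' * ((Y' / W' - Y / W) + (X / W - X' / W')) := by
    field_simp
    linear_combination W' * e1 - W * e2
  have cancel : ∀ u B : ℝ, |D| * |u| ≤ B → |u| ≤ K ^ 3 * B := by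
    intro u B hB
    have : K⁻¹ ^ 3 * |u| ≤ B := le_trans (by gcongr) hB
    rwa [inv_pow, inv_mul_le_iff₀ (by positivity)] at this
  have h2 : |W - W'| ≤ K ^ 3 * (8 * K ^ 4 * e) := by
    refine cancel _ _ ?_
    rw [← abs_mul, h1, abs_mul, abs_mul]
    rw [abs_sub_comm] at hy
    calc _ ≤ 2 * K ^ 2 * (2 * K ^ 2) * (e + e) := by
          gcongr
          exact (abs_add_le _ _).trans (add_le_add hy hx)
      _ = _ := by ring
  have h3 : |X - X'| ≤ K ^ 13 * e := by
    have : X - X' = X / W * (W - W') + W' * (X / W - X' / W') := by field_simp; ring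
    rw [this]
    calc _ ≤ |X / W| * |W - W'| + |W'| * |X / W - X' / W'| := by
          refine (abs_add_le _ _).trans_eq ?_
          rw [abs_mul, abs_mul]
      _ ≤ K ^ 5 * (K ^ 3 * (8 * K ^ 4 * e)) + 2 * K ^ 2 * e := by gcongr
      _ ≤ K ^ 5 * (K ^ 3 * (8 * K ^ 4 * e)) + 2 * K ^ 12 * e := by
          gcongr
          · linarith
          · norm_num
      _ = 10 * (K ^ 12 * e) := by ring
      _ ≤ K * (K ^ 12 * e) := by gcongr; linarith
      _ = _ := by ring
  have hcoord : ∀ m, i ≠ m → |(a.1 m - a.1 i) l| ≤ K := by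
    intro m hm
    have h4 := abs_sub_apply_le_dist (a.1 m - a.1 i) 0 l
    rw [dist_zero_right] at h4
    simp only [PiLp.zero_apply, sub_zero] at h4
    exact h4.trans (h.norm_bounds hK0 hm).2
  refine (cancel _ (2 * K ^ 14 * e) ?_).trans ?_
  · rw [← abs_mul, e3]
    refine (abs_sub _ _).trans ?_
    rw [abs_mul, abs_mul]
    calc _ ≤ K ^ 3 * (8 * K ^ 4 * e) * K + K ^ 13 * e * K := by
          gcongr
          exacts [hcoord k hik, hcoord j hij]
      _ = 8 * (K ^ 8 * e) + K ^ 14 * e := by ring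
      _ ≤ K * (K ^ 8 * e) + K ^ 14 * e := by gcongr; linarith
      _ = K ^ 9 * e + K ^ 14 * e := by ring
      _ ≤ K ^ 14 * e + K ^ 14 * e := by
          gcongr
          · linarith
          · norm_num
      _ = _ := by ring
  · calc K ^ 3 * (2 * K ^ 14 * e) = 2 * K ^ 17 * e := by ring
      _ ≤ _ := by
          gcongr
          exact numeral_mul_pow_le hK (m := 1) (by norm_num) (by norm_num)

theorem eq_sign_mul_abs {b c : ℝ} (h : 0 < b * c) : b = c / |c| * |b| := by
  rcases pos_and_pos_or_neg_and_neg_of_mul_pos h with ⟨h1, h2⟩ | ⟨h1, h2⟩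
  · rw [abs_of_pos h1, abs_of_pos h2, div_self h2.ne', one_mul]
  · rw [abs_of_neg h1, abs_of_neg h2, div_neg, div_self h2.ne]
    ring

/-- The tubes through a fourth tip are lines in the projective coordinates. -/
theorem FourPencilHyp.exists_slope_intercept (h : FourPencilHyp σ δ K a) (hK : 100 ≤ K)
    {i j k l : Fin 4} (hij : i ≠ j) (hik : i ≠ k) (hjk : j ≠ k) (hil : l ≠ i) (hjl : l ≠ j)
    (hkl : l ≠ k) {e : ℝ} (he : 2 * K ^ 3 * e ≤ 1) :
    ∃ lam mu : ℝ → ℝ, ∀ q ∈ unitSquare, ∀ θ, |cross (direction θ) (q - a.1 l)| ≤ e →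
      (K⁻¹ ^ 5 ≤ |lam θ| ∧ |lam θ| ≤ K ^ 5) ∧ (K⁻¹ ^ 5 ≤ |mu θ| ∧ |mu θ| ≤ K ^ 5) ∧
      |sideRatio a.1 j i k q - (lam θ * sideRatio a.1 i j k q + mu θ)| ≤ K ^ 8 * e := by
  have hK0 : 0 < K := by linarith
  set f : Plane → ℝ := fun q => side a.1 i k q / side a.1 i j q with hf
  set g : Plane → ℝ := fun q => side a.1 j k q / side a.1 i j q with hg
  have h0 := zero_mem_unitSquare
  have hsf : ∀ q ∈ unitSquare, 0 < f q * f 0 := fun q hq => h.ratio_mul_ratio_pos hK hij hik hq h0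
  have hsg : ∀ q ∈ unitSquare, 0 < g q * g 0 := fun q hq => h.ratio_mul_ratio_pos hK hij hjk hq h0
  have hsgn : ∀ c : ℝ, 0 < c * c → |(c / |c|)| = 1 := fun c hc => by
    rw [abs_div, abs_abs, div_self (abs_ne_zero.2 (left_ne_zero_of_mul hc.ne'))]
  -- The coordinates are absolute values; the signs `s` and `t` of the underlying ratios are
  -- constant on the square and enter the slope and the intercept.
  set s := f 0 / |f 0| with hs
  set t := g 0 / |g 0| with ht
  have hs1 : |s| = 1 := hsgn _ (hsf 0 h0)
  have ht1 : |t| = 1 := hsgn _ (hsg 0 h0)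
  set m : Fin 4 → ℝ → ℝ := fun n θ => cross (direction θ) (a.1 n - a.1 l) with hm
  refine ⟨fun θ => t * s * (m j θ / m i θ), fun θ => -t * (m k θ / m i θ), fun q hq θ hqθ => ?_⟩
  have hd := norm_direction θ
  have bi := h.cross_direction_bounds hK hil hq hd hqθ he
  have bj := h.cross_direction_bounds hK hjl hq hd hqθ he
  have bk := h.cross_direction_bounds hK hkl hq hd hqθ he
  have hmi : 0 < |m i θ| := lt_of_lt_of_le (by positivity) bi.1
  have hrat : ∀ u : ℝ, K⁻¹ ^ 4 ≤ |u| ∧ |u| ≤ K → K⁻¹ ^ 5 ≤ |u / m i θ| ∧ |u / m i θ| ≤ K ^ 5 := by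
    intro u hu
    rw [abs_div, le_div_iff₀ hmi, div_le_iff₀ hmi]
    constructor
    · calc K⁻¹ ^ 5 * |m i θ| ≤ K⁻¹ ^ 5 * K := by gcongr; exact bi.2
        _ = K⁻¹ ^ 4 := by field_simp
        _ ≤ _ := hu.1
    · calc |u| ≤ K := hu.2
        _ = K ^ 5 * K⁻¹ ^ 4 := by field_simp
        _ ≤ _ := by gcongr; exact bi.1
  refine ⟨?_, ?_, ?_⟩
  · rw [abs_mul, abs_mul, hs1, ht1, one_mul, one_mul]
    exact hrat _ bj
  · rw [abs_mul, abs_neg, ht1, one_mul]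
    exact hrat _ bk
  · have e1 : f q = s * sideRatio a.1 i j k q := eq_sign_mul_abs (hsf q hq)
    have e2 : g q = t * sideRatio a.1 j i k q := by
      rw [sideRatio_swap]; exact eq_sign_mul_abs (hsg q hq)
    have htt : t * t = 1 := by rw [← abs_mul_abs_self, ht1, one_mul]
    have hW := h.abs_side_pos hK hij hq
    have hW0 := abs_pos.1 hW
    have hmi0 := abs_pos.1 hmi
    have e3 : sideRatio a.1 j i k q - (t * s * (m j θ / m i θ) * sideRatio a.1 i j k q +
        -t * (m k θ / m i θ)) = t * (cross (a.1 j - a.1 i) (a.1 k - a.1 i) *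
          cross (direction θ) (q - a.1 l) / (side a.1 i j q * m i θ)) := by
      have e4 : cross (a.1 j - a.1 i) (a.1 k - a.1 i) * cross (direction θ) (q - a.1 l) /
          (side a.1 i j q * m i θ) = g q - m j θ / m i θ * f q + m k θ / m i θ := by
        rw [side_barycentric, hf, hg]
        field_simp
        ring
      rw [e4, e1, e2]
      linear_combination -sideRatio a.1 j i k q * htt
    rw [e3, abs_mul, ht1, one_mul, abs_div, abs_mul, abs_mul, div_le_iff₀ (by positivity)]
    have h2 : |cross (a.1 j - a.1 i) (a.1 k - a.1 i)| ≤ K * K := by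
      refine (abs_cross_le _ _).trans ?_
      gcongr
      exacts [(h.norm_bounds hK0 hij).2, (h.norm_bounds hK0 hik).2]
    have he0 : 0 ≤ e := (abs_nonneg _).trans hqθ
    calc _ ≤ K * K * e := by gcongr
      _ = K ^ 8 * e * (K⁻¹ ^ 2 * K⁻¹ ^ 4) := by field_simp
      _ ≤ _ := by
          gcongr
          exacts [(h.cross_bounds hK hij hq).1, bi.1]

/-- A projective coordinate takes nonconcentrated values on the pencil with the same tip. -/
theorem FourPencilHyp.nonConc_sideRatio (h : FourPencilHyp σ δ K a) (hK : 100 ≤ K) (hδ : 0 < δ)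
    (hσ1 : σ ≤ 1) {i j k : Fin 4} (hij : i ≠ j) (hik : i ≠ k)
    (hdet : K⁻¹ ^ 3 ≤ |cross (a.1 k - a.1 i) (a.1 j - a.1 i)|) (he : 2 * K * (K ^ 2 * δ) ≤ 1)
    {T : Finset ℝ} (hT01 : (T : Set ℝ) ⊆ Ico 0 1) (hTi : Set.InjOn (cell δ) T)
    (hT : NonConc σ δ (4 * K) T) {Q : Finset Plane} (hQ : ∀ q ∈ Q, q ∈ unitSquare) {ω : Plane → ℝ}
    (hω : ∀ q ∈ Q, ω q ∈ T ∧ |cross (direction (ω q)) (q - a.1 i)| ≤ K ^ 2 * δ) :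
    NonConc σ δ (K ^ 30) (Q.image (sideRatio a.1 i j k)) := by
  classical
  have hK0 : 0 < K := by linarith
  intro b r hr
  have hr0 := hδ.trans_le hr
  set x := sideRatio a.1 i j k with hx
  set R := Q.filter (fun q => |x q - b| ≤ r) with hR
  have hSR : (Q.image x).filter (fun t => |t - b| ≤ r) = R.image x := by
    rw [hR, Finset.filter_image]
  rw [hSR]
  have hpos : 0 ≤ (r / δ) ^ σ := by positivity
  rcases R.eq_empty_or_nonempty with hRe | ⟨q₀, hq₀⟩
  · rw [hRe]
    simp only [Finset.image_empty, cov, Finset.card_empty, Nat.cast_zero]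
    positivity
  have hRQ : ∀ q ∈ R, q ∈ Q ∧ |x q - b| ≤ r := fun q hq => Finset.mem_filter.1 hq
  -- Points of `Q` whose coordinates lie in one interval of radius `r` have directions within `K ^
  -- 12 * r` of that of one fixed point, so the non-concentration of `T` applies.
  have h1 : R.image ω ⊆ T.filter (fun θ => |cross (direction (ω q₀)) (direction θ)| ≤ K ^ 12 * r) := by
    intro θ hθ
    obtain ⟨q, hq, rfl⟩ := Finset.mem_image.1 hθ
    have hqQ := hRQ q hq
    have hqQ₀ := hRQ q₀ hq₀
    refine Finset.mem_filter.2 ⟨(hω q hqQ.1).1, ?_⟩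
    have h2 := h.abs_cross_direction_le hK hij hik (hQ _ hqQ₀.1) (hQ _ hqQ.1) (norm_direction _)
      (norm_direction _) (hω _ hqQ₀.1).2 (hω _ hqQ.1).2 he hdet (r := 2 * r) (by
        have h3 := hqQ.2
        have h4 := hqQ₀.2
        rw [abs_le] at h3 h4 ⊢
        constructor <;> linarith)
    refine h2.trans ?_
    calc 4 * K ^ 2 * (4 * K ^ 7 * (2 * r) + 4 * K * (K ^ 2 * δ))
        ≤ 4 * K ^ 2 * (4 * K ^ 7 * (2 * r) + 4 * K * (K ^ 2 * r)) := by gcongr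
      _ = 32 * K ^ 9 * r + 16 * K ^ 5 * r := by ring
      _ ≤ 32 * K ^ 9 * r + 16 * K ^ 9 * r := by
          gcongr
          · linarith
          · norm_num
      _ = 48 * K ^ 9 * r := by ring
      _ ≤ _ := by
          gcongr
          exact numeral_mul_pow_le hK (m := 1) (by norm_num) (by norm_num)
  have h2 := card_filter_cross_direction_le hδ (s := K ^ 12 * r) (hr.trans
    (le_mul_of_one_le_left hr0.le (one_le_pow₀ (by linarith)))) hT01 hTi hT
    (hT01 (Finset.mem_coe.2 (hω q₀ (hRQ q₀ hq₀).1).1))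
  have h3 : ((R.image ω).card : ℝ) ≤ 5 * (4 * K * (K ^ 12 * (r / δ) ^ σ)) := by
    refine le_trans (by exact_mod_cast Finset.card_le_card h1) (h2.trans ?_)
    gcongr
    rw [mul_div_assoc]
    exact mul_rpow_le (one_le_pow₀ (by linarith)) (by positivity) hσ1
  have h4 := card_image_cell_le R x ω hδ (M := 4 * K ^ 9) (by positivity) (fun q hq q' hq' hqq => by
    have h5 := h.abs_sideRatio_sub_le hK hij hik (hQ q (hRQ q hq).1) (hQ q' (hRQ q' hq').1)
      (norm_direction (ω q)) (hω q (hRQ q hq).1).2 (by rw [hqq]; exact (hω q' (hRQ q' hq').1).2)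
    refine h5.trans_eq ?_
    ring)
  rw [cov_image]
  calc _ ≤ _ := h4
    _ ≤ (K ^ 10 + K ^ 10) * (5 * (4 * K * (K ^ 12 * (r / δ) ^ σ))) := by
        gcongr
        · rw [← mul_assoc]
          exact numeral_mul_pow_le hK (m := 1) (by norm_num) (by norm_num)
        · exact le_trans (by linarith) (le_self_pow₀ (by linarith) (by norm_num))
    _ = 40 * K ^ 23 * (r / δ) ^ σ := by ring
    _ ≤ _ := by
        gcongr
        exact numeral_mul_pow_le hK (m := 1) (by norm_num) (by norm_num)

end SumProductToPencils

/-! ### From sum-product to the four-pencil estimate. -/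

section FourPencilsFromSumProduct

variable {σ δ K : ℝ} {a : (Fin 4 → Plane) × (Fin 4 → Set ℝ)}

/-- The third pencil becomes the pencil through the origin: the quotient of the two coordinates is
the coordinate belonging to the third tip. -/
theorem FourPencilHyp.sideRatio_div (h : FourPencilHyp σ δ K a) (hK : 100 ≤ K) {i j k : Fin 4}
    (hij : i ≠ j) {q : Plane} (hq : q ∈ unitSquare) :
    sideRatio a.1 i j k q / sideRatio a.1 j i k q = sideRatio a.1 k j i q := by
  have hW := abs_pos.1 (h.abs_side_pos hK hij.symm hq)
  rw [sideRatio_swap, sideRatio, sideRatio, side_comm a.1 k i, side_comm a.1 k j, ← abs_div,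
    neg_div_neg_eq]
  congr 1
  field_simp

theorem FourPencilHyp.card_image_sideRatio_le (h : FourPencilHyp σ δ K a) (hK : 100 ≤ K)
    (hδ : 0 < δ) {i j k : Fin 4} (hij : i ≠ j) (hik : i ≠ k) {T : Finset ℝ} {N : ℝ}
    (hT : (T.card : ℝ) ≤ 2 * K * N) {Q : Finset Plane} (hQ : ∀ q ∈ Q, q ∈ unitSquare) {ω : Plane → ℝ}
    (hω : ∀ q ∈ Q, ω q ∈ T ∧ |cross (direction (ω q)) (q - a.1 i)| ≤ K ^ 2 * δ) :
    ((Q.image (fun q => cell δ (sideRatio a.1 i j k q))).card : ℝ) ≤ K ^ 12 * N := by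
  classical
  have hK0 : 0 < K := by linarith
  have hT0 : (0 : ℝ) ≤ 2 * K * N := (Nat.cast_nonneg _).trans hT
  have h1 := card_image_cell_le Q (sideRatio a.1 i j k) ω hδ (M := 4 * K ^ 9) (by positivity)
    (fun q hq q' hq' hqq => by
      have h5 := h.abs_sideRatio_sub_le hK hij hik (hQ q hq) (hQ q' hq') (norm_direction (ω q))
        (hω q hq).2 (by rw [hqq]; exact (hω q' hq').2)
      exact h5.trans_eq (by ring))
  have h2 : ((Q.image ω).card : ℝ) ≤ 2 * K * N := by
    refine le_trans ?_ hT
    exact_mod_cast Finset.card_le_card (Finset.image_subset_iff.2 fun q hq => (hω q hq).1)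
  calc _ ≤ _ := h1
    _ ≤ (8 * K ^ 9 + 3 * K ^ 9) * (2 * K * N) := by
        have : 1 ≤ K ^ 9 := one_le_pow₀ (by linarith)
        refine mul_le_mul (by linarith) h2 (Nat.cast_nonneg _) (by positivity)
    _ = 22 * K ^ 10 * N := by ring
    _ ≤ _ := by
        have : 0 ≤ N := by
          by_contra hN
          nlinarith
        gcongr
        exact numeral_mul_pow_le hK (m := 1) (by norm_num) (by norm_num)

/-- Tips `0` and `1` go to infinity and tip `3` to the origin, which requires these three to be far
from collinear; the directions at tip `2` label the lines. -/
theorem FourPencilBad.exists_fourPencilRich (h : FourPencilBad σ δ K a) (hK : 100 ≤ K)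
    (hδ : 0 < δ) (hKδ : K ^ 100 * δ ≤ 1) (hσ : 0 < σ) (hσ1 : σ < 1)
    (hdet : K⁻¹ ^ 3 ≤ |cross (a.1 1 - a.1 0) (a.1 3 - a.1 0)|) :
    ∃ (Q : Finset Plane) (τ : Plane → ℝ) (lam mu : ℝ → ℝ),
      FourPencilRich (K ^ 40) δ (δ ^ (-σ)) Q (sideRatio a.1 0 1 3) (sideRatio a.1 1 0 3) τ lam mu ∧
      NonConc σ δ (K ^ 30) (Q.image (sideRatio a.1 0 1 3)) := by
  classical
  have hH := h.toFourPencilHyp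
  have hK0 : 0 < K := by linarith
  have hK1 : 1 ≤ K := by linarith
  have hsmall : ∀ (c : ℝ) (m k : ℕ), c ≤ 100 ^ m → m + k ≤ 100 → c * K ^ k * δ ≤ 1 :=
    fun c m k hc hl => le_trans (by gcongr; exact numeral_mul_pow_le hK hc hl) hKδ
  have hδ4 : 4 * δ < 1 := by
    have := hsmall 5 1 0 (by norm_num) (by norm_num)
    linarith
  have he1 : 2 * K * (K ^ 2 * δ) ≤ 1 := by
    have := hsmall 2 1 3 (by norm_num) (by norm_num)
    calc _ = 2 * K ^ 3 * δ := by ring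
      _ ≤ _ := this
  have he3 : 2 * K ^ 3 * (K ^ 2 * δ) ≤ 1 := by
    have := hsmall 2 1 5 (by norm_num) (by norm_num)
    calc _ = 2 * K ^ 5 * δ := by ring
      _ ≤ _ := this
  set n := δ ^ (-σ) with hn
  have hn0 : 0 < n := Real.rpow_pos_of_pos hδ _
  choose T hT01 hTi hT hTc hTω using fun i => hH.exists_directions hK hδ hδ4 hσ.le hσ1.le i
  obtain ⟨Q₀, hQ₀E, hQ₀i, hQ₀V⟩ := exists_finset_volume_le hδ
    (E := (⋂ i, pencil δ (a.1 i) (a.2 i)) ∩ unitSquare) inter_subset_right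
  have hω' : ∀ (i : Fin 4) (q : Plane), ∃ θ, q ∈ Q₀ →
      θ ∈ T i ∧ |cross (direction θ) (q - a.1 i)| ≤ K ^ 2 * δ := by
    intro i q
    by_cases hq : q ∈ Q₀
    · have h1 := hQ₀E (Finset.mem_coe.2 hq)
      obtain ⟨θ, h2, h3⟩ := hTω i q (mem_iInter.1 h1.1 i) h1.2
      exact ⟨θ, fun _ => ⟨h2, h3⟩⟩
    · exact ⟨0, fun hq' => absurd hq' hq⟩
  choose ω hω using hω'
  set x := sideRatio a.1 0 1 3 with hx
  set y := sideRatio a.1 1 0 3 with hy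
  -- `Q₀` has one point per cell of the plane; it is thinned to one point per cell in the new
  -- coordinates. As these determine the point up to `K ^ 18 * δ`, only a power of `K` is lost.
  obtain ⟨Q, hQQ₀, hQi, hQe⟩ := exists_injOn_image_eq Q₀ (fun q => (cell δ (x q), cell δ (y q)))
  have hQ₀s : ∀ q ∈ Q₀, q ∈ unitSquare := fun q hq => (hQ₀E (Finset.mem_coe.2 hq)).2
  have hQs : ∀ q ∈ Q, q ∈ unitSquare := fun q hq => hQ₀s q (hQQ₀ hq)
  have hωQ : ∀ i, ∀ q ∈ Q, ω i q ∈ T i ∧ |cross (direction (ω i q)) (q - a.1 i)| ≤ K ^ 2 * δ :=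
    fun i q hq => hω i q (hQQ₀ hq)
  have h01 : (0 : Fin 4) ≠ 1 := by decide
  have h03 : (0 : Fin 4) ≠ 3 := by decide
  have h13 : (1 : Fin 4) ≠ 3 := by decide
  obtain ⟨lam, mu, hline⟩ := hH.exists_slope_intercept hK h01 h03 h13 (l := 2) (by decide)
    (by decide) (by decide) he3
  have hKK : ∀ m, m ≤ 40 → K ^ m ≤ K ^ 40 := fun m hm => pow_le_pow_right₀ hK1 hm
  have hKKi : (K ^ 40)⁻¹ ≤ K⁻¹ ^ 5 := by
    rw [inv_pow]
    exact inv_anti₀ (by positivity) (hKK 5 (by norm_num))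
  have hb : ∀ {u : ℝ}, K⁻¹ ^ 5 ≤ u ∧ u ≤ K ^ 5 → (K ^ 40)⁻¹ ≤ u ∧ u ≤ K ^ 40 := fun hu =>
    ⟨hKKi.trans hu.1, hu.2.trans (hKK 5 (by norm_num))⟩
  refine ⟨Q, ω 2, lam, mu, ⟨?_, ?_, ?_, ?_, ?_, hQi, ?_, ?_, ?_, ?_, ?_⟩, ?_⟩
  · exact fun q hq => hb (hH.sideRatio_bounds hK h01 h03 (hQs q hq))
  · exact fun q hq => hb (hH.sideRatio_bounds hK h01.symm h13 (hQs q hq))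
  · exact fun q hq => hb (hline q (hQs q hq) _ (hωQ 2 q hq).2).1
  · exact fun q hq => hb (hline q (hQs q hq) _ (hωQ 2 q hq).2).2.1
  · intro q hq
    refine (hline q (hQs q hq) _ (hωQ 2 q hq).2).2.2.trans ?_
    rw [← mul_assoc, ← pow_add]
    gcongr
    norm_num
  · have h1 : δ ^ 2 * n ^ 2 ≤ δ ^ 2 * (K * Q₀.card) := by
      calc δ ^ 2 * n ^ 2 = δ ^ (2 - 2 * σ) := by
            rw [hn, ← Real.rpow_natCast, ← Real.rpow_natCast, ← Real.rpow_mul hδ.le,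
              ← Real.rpow_add hδ]
            congr 1
            push_cast
            ring
        _ ≤ K * pencilVolume δ a := h.large
        _ ≤ K * (δ ^ 2 * Q₀.card) := by gcongr; exact hQ₀V
        _ = _ := by ring
    have h2 : n ^ 2 ≤ K * Q₀.card := le_of_mul_le_mul_left h1 (by positivity)
    have hcell : ∀ l : Fin 2, ∀ q ∈ Q₀, ∀ q' ∈ Q₀,
        (cell δ (x q), cell δ (y q)) = (cell δ (x q'), cell δ (y q')) →
        |q l - q' l| ≤ K ^ 18 * δ := by
      intro l q hq q' hq' hqq
      obtain ⟨e1, e2⟩ := Prod.ext_iff.1 hqq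
      exact hH.abs_sub_apply_le hK h01 h03 h13 (hQ₀s q hq) (hQ₀s q' hq') hdet
        (abs_sub_lt_of_cell_eq hδ e1).le (abs_sub_lt_of_cell_eq hδ e2).le l
    have h3 := card_image_cell_prod_le Q₀ (fun q => q 0) (fun q => q 1)
      (fun q => (cell δ (x q), cell δ (y q))) hδ (M := K ^ 18) (by positivity) (hcell 0) (hcell 1)
    rw [Finset.card_image_of_injOn hQ₀i, ← hQe, Finset.card_image_of_injOn hQi] at h3
    calc n ^ 2 ≤ K * Q₀.card := h2
      _ ≤ K * ((2 * K ^ 18 + 3 * K ^ 18) ^ 2 * Q.card) := by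
          gcongr
          refine h3.trans ?_
          gcongr
          have : 1 ≤ K ^ 18 := one_le_pow₀ hK1
          linarith
      _ = 25 * K ^ 37 * Q.card := by ring
      _ ≤ _ := by
          gcongr
          exact numeral_mul_pow_le hK (m := 1) (by norm_num) (by norm_num)
  · refine (hH.card_image_sideRatio_le hK hδ h01 h03 (hTc 0) hQs (hωQ 0)).trans ?_
    gcongr
    norm_num
  · refine (hH.card_image_sideRatio_le hK hδ h01.symm h13 (hTc 1) hQs (hωQ 1)).trans ?_
    gcongr
    norm_num
  · have h1 : Q.image (fun q => cell δ (x q / y q)) =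
        Q.image (fun q => cell δ (sideRatio a.1 3 1 0 q)) :=
      Finset.image_congr fun q hq => by
        simp only [hx, hy, hH.sideRatio_div hK h01 (hQs q (Finset.mem_coe.1 hq))]
    rw [h1]
    refine (hH.card_image_sideRatio_le hK hδ h13.symm h03.symm (hTc 3) hQs (hωQ 3)).trans ?_
    gcongr
    norm_num
  · have h1 : ((Q.image (ω 2)).card : ℝ) ≤ (T 2).card := by
      exact_mod_cast Finset.card_le_card (Finset.image_subset_iff.2 fun q hq => (hωQ 2 q hq).1)
    refine h1.trans ((hTc 2).trans ?_)
    gcongr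
    calc 2 * K = 2 * K ^ 1 := by ring
      _ ≤ _ := numeral_mul_pow_le hK (m := 1) (by norm_num) (by norm_num)
  · refine hH.nonConc_sideRatio hK hδ hσ1.le h01 h03 ?_ he1 (hT01 0) (hTi 0) (hT 0) hQs (hωQ 0)
    refine hdet.trans_eq ?_
    rw [← abs_neg]
    congr 1
    simp only [cross]
    ring

/-- Four pencils with large intersection yield a set with few sums and products. -/
theorem FourPencilBad.exists_sumProductBad (h : FourPencilBad σ δ K a) (hK : 100 ≤ K)
    (hδ : 0 < δ) (hKδ : K ^ 100 * δ ≤ 1) (hσ : 0 < σ) (hσ1 : σ < 1)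
    (hdet : K⁻¹ ^ 3 ≤ |cross (a.1 1 - a.1 0) (a.1 3 - a.1 0)|) {E : ℕ} (hE : E = 200000) :
    ∃ S, SumProductBad (fun K => Icc K⁻¹ K) σ δ (K ^ (40 * E)) S := by
  classical
  have hK1 : 1 ≤ K := by linarith
  obtain ⟨Q, τ, lam, mu, hR, hN⟩ := h.exists_fourPencilRich hK hδ hKδ hσ hσ1 hdet
  obtain ⟨S, hS, h1, h2, h3⟩ := hR.exists_small_sum_and_product
    (hK.trans (le_self_pow₀ hK1 (by norm_num))) hδ (Real.rpow_pos_of_pos hδ _)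
  -- The large exponent is kept as the symbol `E`, so the powers of `K` stay symbolic.
  rw [← hE, ← pow_mul] at h1 h2 h3
  have hle : ∀ m : ℕ, m ≤ 40 → K ^ m ≤ K ^ (40 * E) := fun m hm =>
    pow_le_pow_right₀ hK1 (by omega)
  refine ⟨S, fun z hz => ?_, (hN.subset hS).mono hδ (hle 30 (by norm_num)), h1, h2, h3⟩
  obtain ⟨q, hq, rfl⟩ := Finset.mem_image.1 (hS hz)
  have hx := hR.x_mem q hq
  have hKp : 0 < K ^ 40 := by positivity
  exact ⟨(inv_anti₀ hKp (hle 40 le_rfl)).trans hx.1, hx.2.trans (hle 40 le_rfl)⟩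

theorem FourPencilBad.perm (h : FourPencilBad σ δ K a) (e : Equiv.Perm (Fin 4)) :
    FourPencilBad σ δ K (a.1 ∘ e, a.2 ∘ e) := by
  have he : ∀ {i j}, i ≠ j → e i ≠ e j := fun hij => e.injective.ne hij
  refine ⟨⟨fun i => h.dir_subset _, fun i => h.nonconc _, fun i j hij => h.dist_le _ _ (he hij),
    fun i j hij => h.dist_ge _ _ (he hij), fun i j hij => h.infDist_le _ _ (he hij),
    fun i j hij => h.infDist_ge _ _ (he hij), fun i j hij => h.setDist_le _ _ (he hij),
    fun i j hij => h.setDist_ge _ _ (he hij), fun q v r hv hr => h.tube_ge q v r hv fun i => ?_⟩, ?_⟩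
  · have := hr (e.symm i)
    simpa using this
  · have h1 : pencilVolume δ (a.1 ∘ e, a.2 ∘ e) = pencilVolume δ a := by
      unfold pencilVolume
      rw [← e.surjective.iInter_comp (fun i => pencil δ (a.1 i) (a.2 i))]
      rfl
    rw [h1]
    exact h.large

/-- Otherwise all four tips lie in the tube of radius `K⁻¹ ^ 2` about the line through the first
two, while any such tube has radius at least `K⁻¹`. -/
theorem FourPencilHyp.exists_le_abs_cross (h : FourPencilHyp σ δ K a) (hK : 100 ≤ K) :
    K⁻¹ ^ 3 ≤ |cross (a.1 1 - a.1 0) (a.1 3 - a.1 0)| ∨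
      K⁻¹ ^ 3 ≤ |cross (a.1 1 - a.1 0) (a.1 2 - a.1 0)| := by
  have hK0 : 0 < K := by linarith
  by_contra! hcon
  have hb := h.norm_bounds hK0 (show (0 : Fin 4) ≠ 1 by decide)
  have hv : a.1 1 - a.1 0 ≠ 0 := norm_pos_iff.1 (lt_of_lt_of_le (by positivity) hb.1)
  have h1 : ∀ i, |cross (a.1 1 - a.1 0) (a.1 i - a.1 0)| < K⁻¹ ^ 3 := by
    intro i
    fin_cases i
    · simp [cross, hK0]
    · refine lt_of_eq_of_lt ?_ (show 0 < K⁻¹ ^ 3 by positivity)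
      rw [abs_eq_zero]
      simp only [cross, Fin.mk_one]
      ring
    · exact hcon.2
    · exact hcon.1
  have h2 := h.tube_ge (a.1 0) (a.1 1 - a.1 0) (K⁻¹ ^ 2) hv fun i => by
    obtain ⟨z, hz, hzd⟩ := exists_mem_lineAt_dist_mul_eq (p := a.1 0) (q := a.1 i) hv
    refine Metric.mem_thickening_iff.2 ⟨z, hz, ?_⟩
    rw [dist_comm]
    refine lt_of_mul_lt_mul_right (a := ‖a.1 1 - a.1 0‖) ?_ (norm_nonneg _)
    rw [hzd]
    calc _ < K⁻¹ ^ 3 := h1 i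
      _ = K⁻¹ ^ 2 * K⁻¹ := by ring
      _ ≤ _ := by gcongr; exact hb.1
  have h3 : K * K⁻¹ ^ 2 = K⁻¹ := by field_simp
  rw [h3] at h2
  have h4 : K⁻¹ ≤ 100⁻¹ := inv_anti₀ (by norm_num) hK
  norm_num at h4
  linarith

theorem gap_fourPencilBad_of_gap_sumProductBad (hσ : 0 < σ) (hσ1 : σ < 1)
    (hg : Gap (SumProductBad (fun K => Icc K⁻¹ K) σ)) : Gap (FourPencilBad σ) := by
  obtain ⟨E, hE⟩ : ∃ E : ℕ, E = 200000 := ⟨_, rfl⟩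
  refine Gap.transfer (c := 40 * E) (by omega) (fun K δ hK hδ hKδ a ha => ?_) hg
  have hKδ' : K ^ 100 * δ ≤ 1 := by
    refine le_trans ?_ hKδ
    gcongr
    · linarith
    · omega
  rcases ha.exists_le_abs_cross hK with h1 | h1
  · exact ha.exists_sumProductBad hK hδ hKδ' hσ hσ1 h1 hE
  -- If tip `2` rather than tip `3` is far from the line through the first two tips, the two
  -- exchange roles.
  · refine (ha.perm (Equiv.swap 2 3)).exists_sumProductBad hK hδ hKδ' hσ hσ1 ?_ hE
    exact h1

end FourPencilsFromSumProduct


/-! ### The equivalence. -/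

theorem expansionEstimate_sumProd_of_gap {σ : ℝ} (hσ : 0 < σ) (hσ1 : σ < 1)
    (h : Gap (SumProductBad (fun _ => Icc 1 (5 / 4)) σ)) : ExpansionEstimate (Icc 0 1) sumProd σ :=
  expansionEstimate_of_gap ⟨1, one_pos, fun _ hA => volume_real_le_sumProd hA⟩
    (gap_deltaSetBad_of_gap_local hσ hσ1 h)

theorem mainTheorem2 :
    List.TFAE [DiscretizedSumProduct, FourPencilEstimate, ProductShiftedProduct] := by
  rw [discretizedSumProduct_iff, fourPencilEstimate_iff, productShiftedProduct_iff]
  -- Sum-product is the hub. Leaving it, counterexamples arrive as finite sets in `[K⁻¹, K]`, the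
  -- form produced by the four-pencil argument; returning to it, one may start from sets localized
  -- to `[1, 5 / 4]`.
  have h12 : ∀ σ : ℝ, σ < 1 → ExpansionEstimate (Icc 0 1) sumProd σ →
      Gap (SumProductBad (fun K => Icc K⁻¹ K) σ) := fun σ hσ1 h =>
    gap_sumProductBad_of_gap hσ1 (gap_of_expansionEstimate h)
  tfae_have 1 → 2 := fun h σ hσ hσ1 =>
    fourPencilEstimate_of_gap hσ1
      (gap_fourPencilBad_of_gap_sumProductBad hσ hσ1 (h12 σ hσ1 (h σ hσ hσ1)))
  tfae_have 1 → 3 := fun h σ hσ hσ1 =>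
    expansionEstimate_of_gap ⟨1 / 4, by norm_num, fun _ hA => volume_real_le_prodShift hA⟩
      (gap_prodShift_of_gap_sumProductBad hσ hσ1 (h12 σ hσ1 (h σ hσ hσ1)))
  tfae_have 2 → 1 := fun h σ hσ hσ1 =>
    expansionEstimate_sumProd_of_gap hσ hσ1
      (gap_sumProductBad_of_gap_fourPencilBad hσ1 (gap_of_fourPencilEstimate (h σ hσ hσ1)))
  tfae_have 3 → 1 := fun h σ hσ hσ1 =>
    expansionEstimate_sumProd_of_gap hσ hσ1
      (gap_sumProductBad_of_gap_prodShift hσ hσ1 (gap_of_expansionEstimate (h σ hσ hσ1)))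
  tfae_finish
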